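/- **Lemma.** Let $G$ be a finite group. *Notation.* Let $\mathcal O_G$ be the orbit category of $G$ (objects $G/H$, morphisms the $G$-maps) and let $\mathscr B_G$ be the Burnside category: its objects are the finite $G$-sets, $\mathscr B_G(S,T)$ is the Grothendieck group of the commutative monoid of isomorphism classes of spans $S\leftarrow U\to T$ of finite $G$-sets under disjoint union, and composition is given by fibre products. A coefficient system is a functor $\mathcal O_G^{op}\to Ab$, and a Mackey functor is an additive functor $\mathscr B_G\to Ab$. Let $L$ be the left Kan extension from coefficient systems to Mackey functors along $\mathcal O_G^{op}\to\mathscr B_G$ (the left adjoint of restriction). For Mackey functors $M,N$, the box product $M\,\Box\,N$ is the (additive) left Kan extension of the biadditive functor $(S,T)\mapsto M(S)\otimes N(T)$ along the Cartesian product $\mathscr B_G\times\mathscr B_G\to\mathscr B_G$. The box product of two chain complexes of Mackey functors in non-negative degrees is the total complex of the double complex of box products. For a $G$-CW complex $X$ with skeleta $X_n$, let $C_G(X)$ be the chain complex of coefficient systems whose value at $G/H$ is the cellular chain complex of the CW complex $X^H$, that is, $C_{G,n}(X)(G/H)=H_n(X_n^H,X_{n-1}^H;\mathbb Z)$ with the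 boundary maps of the triples, and let $C_M(X)=L\,C_G(X)$, where $L$ is applied degreewise. For a based $G$-CW complex $X$, whose base point $x_0$ is a $G$-fixed $0$-cell, let $\widetilde C_M(X)=L\,\widetilde C_G(X)$, where $\widetilde C_G(X)(G/H)$ is the cellular chain complex of the pair $(X^H,\{x_0\})$. *Statement.* (1) Let $X$ and $Y$ be $G$-CW complexes. Their product $X\times Y$, with the compactly generated product topology and the diagonal action of $G$, has a $G$-CW structure whose $n$-skeleton is $\bigcup_{p+q=n}X_p\times Y_q$ for all $n\ge 0$, and for every such structure there is an isomorphism of chain complexes of Mackey functors $$C_M(X\times Y)\cong C_M(X)\,\Box\,C_M(Y).$$ (2) Let $X$ and $Y$ be based $G$-CW complexes with base points $x_0$ and $y_0$. The smash product $X\wedge Y=(X\times Y)/(X\times\{y_0\}\cup\{x_0\}\times Y)$, where the product carries the compactly generated topology, has a based $G$-CW structure whose $n$-skeleton is the image of $\bigcup_{p+q=n}X_p\times Y_q$ for all $n\ge 0$, and for every such structure there is an isomorphism of chain complexes of Mackey functors $$\widetilde C_M(X\wedge Y)\cong\widetilde C_M(X)\,\Box\,\widetilde C_M(Y).$$ 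-/

import Mathlib

open CategoryTheory Limits Topology TensorProduct

universe u w₁ w₂ w₃ w₄

noncomputable section

namespace MackeyChains

/-! ## Finite `G`-sets and spans -/

/-- A finite `G`-set. -/
structure FinGSet (G : Type u) [Group G] : Type (u + 1) where
  carrier : Type u
  [action : MulAction G carrier]
  [finite : Finite carrier]

attribute [instance] FinGSet.action FinGSet.finite

instance (G : Type u) [Group G] : CoeSort (FinGSet G) (Type u) := ⟨FinGSet.carrier⟩

/-- The empty `G`-set. -/
instance emptyAction (G : Type u) [Group G] : MulAction G PEmpty.{u + 1} where
  smul _ x := x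
  one_smul x := x.elim
  mul_smul _ _ x := x.elim

/-- The product of two finite `G`-sets, with the diagonal action. -/
abbrev FinGSet.prod {G : Type u} [Group G] (S T : FinGSet G) : FinGSet G := ⟨S × T⟩

/-- The fibre product of two maps of `G`-sets, with the diagonal action. -/
abbrev FibreProd {G : Type u} [Group G] {A B C : FinGSet G} (p : A →[G] C) (q : B →[G] C) :
    Type u :=
  {x : A × B // p x.1 = q x.2}

instance fibreProdAction {G : Type u} [Group G] {A B C : FinGSet G} (p : A →[G] C)
    (q : B →[G] C) : MulAction G (FibreProd p q) where
  smul g x := ⟨g • x.1, by simp [map_smul, x.2]⟩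
  one_smul x := Subtype.ext (one_smul G x.1)
  mul_smul g h x := Subtype.ext (mul_smul g h x.1)

/-- A span `S ← apex → T` of finite `G`-sets. -/
structure GSpan {G : Type u} [Group G] (S T : FinGSet G) : Type (u + 1) where
  apex : FinGSet G
  left : apex →[G] S
  right : apex →[G] T

variable {G : Type u} [Group G]

/-- Isomorphism of spans: a `G`-isomorphism of the apices over `S` and `T`. -/
def GSpan.Iso {S T : FinGSet G} (A B : GSpan S T) : Prop :=
  ∃ e : A.apex ≃ B.apex, (∀ (g : G) (x : A.apex), e (g • x) = g • e x) ∧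
    (∀ x, B.left (e x) = A.left x) ∧ ∀ x, B.right (e x) = A.right x

instance spanSetoid (S T : FinGSet G) : Setoid (GSpan S T) where
  r := GSpan.Iso
  iseqv :=
    { refl := fun A => ⟨Equiv.refl _, fun _ _ => rfl, fun _ => rfl, fun _ => rfl⟩
      symm := by
        rintro A B ⟨e, h1, h2, h3⟩
        refine ⟨e.symm, fun g x => ?_, fun x => ?_, fun x => ?_⟩
        · rw [Equiv.symm_apply_eq, h1, Equiv.apply_symm_apply]
        · rw [← h2, Equiv.apply_symm_apply]
        · rw [← h3, Equiv.apply_symm_apply]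
      trans := by
        rintro A B C ⟨e, h1, h2, h3⟩ ⟨f, k1, k2, k3⟩
        exact ⟨e.trans f, fun g x => by simp [h1, k1], fun x => by simp [h2, k2],
          fun x => by simp [h3, k3]⟩ }

/-- The disjoint union of two spans. -/
abbrev GSpan.sum {S T : FinGSet G} (A B : GSpan S T) : GSpan S T where
  apex := ⟨A.apex ⊕ B.apex⟩
  left := { toFun := Sum.elim A.left B.left
            map_smul' := by rintro g (x | x) <;> simp [map_smul] }
  right := { toFun := Sum.elim A.right B.right
             map_smul' := by rintro g (x | x) <;> simp [map_smul] }

/-- The empty span. -/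
abbrev GSpan.empty (S T : FinGSet G) : GSpan S T where
  apex := ⟨PEmpty⟩
  left := { toFun := PEmpty.elim, map_smul' := fun _ x => x.elim }
  right := { toFun := PEmpty.elim, map_smul' := fun _ x => x.elim }

/-- The composite of two spans, formed with the fibre product. -/
abbrev GSpan.comp {S T U : FinGSet G} (A : GSpan S T) (B : GSpan T U) : GSpan S U where
  apex := ⟨FibreProd A.right B.left⟩
  left := { toFun := fun x => A.left x.1.1, map_smul' := fun g x => map_smul A.left g x.1.1 }
  right := { toFun := fun x => B.right x.1.2, map_smul' := fun g x => map_smul B.right g x.1.2 }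

/-- The identity span. -/
abbrev GSpan.id (S : FinGSet G) : GSpan S S where
  apex := S
  left := MulActionHom.id G
  right := MulActionHom.id G

/-- The product of two spans. -/
abbrev GSpan.prod {S T S' T' : FinGSet G} (A : GSpan S T) (B : GSpan S' T') :
    GSpan (S.prod S') (T.prod T') where
  apex := A.apex.prod B.apex
  left := { toFun := fun x => (A.left x.1, B.left x.2)
            map_smul' := fun g x => Prod.ext (map_smul A.left g x.1) (map_smul B.left g x.2) }
  right := { toFun := fun x => (A.right x.1, B.right x.2)
             map_smul' := fun g x => Prod.ext (map_smul A.right g x.1) (map_smul B.right g x.2) }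

/-- Isomorphism classes of spans from `S` to `T`. -/
abbrev SpanClass (S T : FinGSet G) : Type (u + 1) := Quotient (spanSetoid S T)

instance (S T : FinGSet G) : Zero (SpanClass S T) := ⟨⟦GSpan.empty S T⟧⟩

instance (S T : FinGSet G) : Add (SpanClass S T) where
  add := Quotient.map₂ GSpan.sum (by
    rintro A A' ⟨e, h1, h2, h3⟩ B B' ⟨f, k1, k2, k3⟩
    refine ⟨Equiv.sumCongr e f, ?_, ?_, ?_⟩
    · rintro g (x | x) <;> simp [h1, k1]
    · rintro (x | x)
      · exact h2 x
      · exact k2 x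
    · rintro (x | x)
      · exact h3 x
      · exact k3 x)

/-- Isomorphism classes of spans form a commutative monoid under disjoint union. -/
instance (S T : FinGSet G) : AddCommMonoid (SpanClass S T) where
  nsmul := nsmulRec
  add_assoc := by
    rintro ⟨A⟩ ⟨B⟩ ⟨C⟩
    refine Quotient.sound ⟨Equiv.sumAssoc _ _ _, ?_, ?_, ?_⟩
    · rintro g ((x | x) | x) <;> rfl
    · rintro ((x | x) | x) <;> rfl
    · rintro ((x | x) | x) <;> rfl
  zero_add := by
    rintro ⟨A⟩
    refine Quotient.sound ⟨Equiv.emptySum _ _, ?_, ?_, ?_⟩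
    · rintro g (x | x)
      · exact x.elim
      · rfl
    · rintro (x | x)
      · exact x.elim
      · rfl
    · rintro (x | x)
      · exact x.elim
      · rfl
  add_zero := by
    rintro ⟨A⟩
    refine Quotient.sound ⟨Equiv.sumEmpty _ _, ?_, ?_, ?_⟩
    · rintro g (x | x)
      · rfl
      · exact x.elim
    · rintro (x | x)
      · rfl
      · exact x.elim
    · rintro (x | x)
      · rfl
      · exact x.elim
  add_comm := by
    rintro ⟨A⟩ ⟨B⟩
    refine Quotient.sound ⟨Equiv.sumComm _ _, ?_, ?_, ?_⟩
    · rintro g (x | x) <;> rfl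
    · rintro (x | x) <;> rfl
    · rintro (x | x) <;> rfl

/-- Composition of isomorphism classes of spans; it is biadditive. -/
def SpanClass.comp (S T U : FinGSet G) : SpanClass S T →+ SpanClass T U →+ SpanClass S U where
  toFun a :=
    { toFun := fun b => Quotient.map₂ GSpan.comp (by
        rintro A A' ⟨e, h1, h2, h3⟩ B B' ⟨f, k1, k2, k3⟩
        refine ⟨(Equiv.prodCongr e f).subtypeEquiv fun x => ?_, ?_, ?_, ?_⟩
        · simp [h3, k2]
        · rintro g ⟨⟨x, y⟩, h⟩
          exact Subtype.ext (Prod.ext (h1 g x) (k1 g y))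
        · rintro ⟨⟨x, y⟩, h⟩
          exact h2 x
        · rintro ⟨⟨x, y⟩, h⟩
          exact k3 y) a b
      map_zero' := by
        induction a using Quotient.inductionOn with | _ A
        refine Quotient.sound ⟨⟨fun x => x.1.2.elim, fun x => x.elim, fun x => x.1.2.elim,
          fun x => x.elim⟩, fun _ x => x.1.2.elim, fun x => x.1.2.elim, fun x => x.1.2.elim⟩
      map_add' := by
        rintro ⟨B⟩ ⟨B'⟩
        induction a using Quotient.inductionOn with | _ A
        refine Quotient.sound ⟨⟨fun x => match x with
            | ⟨(x, Sum.inl y), h⟩ => Sum.inl ⟨(x, y), h⟩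
            | ⟨(x, Sum.inr y), h⟩ => Sum.inr ⟨(x, y), h⟩,
          fun x => match x with
            | Sum.inl ⟨(x, y), h⟩ => ⟨(x, Sum.inl y), h⟩
            | Sum.inr ⟨(x, y), h⟩ => ⟨(x, Sum.inr y), h⟩, ?_, ?_⟩, ?_, ?_, ?_⟩
        · rintro ⟨⟨x, y | y⟩, h⟩ <;> rfl
        · rintro (⟨⟨x, y⟩, h⟩ | ⟨⟨x, y⟩, h⟩) <;> rfl
        · rintro g ⟨⟨x, y | y⟩, h⟩ <;> rfl
        · rintro ⟨⟨x, y | y⟩, h⟩ <;> rfl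
        · rintro ⟨⟨x, y | y⟩, h⟩ <;> rfl }
  map_zero' := by
    ext ⟨B⟩
    refine Quotient.sound ⟨⟨fun x => x.1.1.elim, fun x => x.elim, fun x => x.1.1.elim,
      fun x => x.elim⟩, fun _ x => x.1.1.elim, fun x => x.1.1.elim, fun x => x.1.1.elim⟩
  map_add' := by
    rintro ⟨A⟩ ⟨A'⟩
    ext ⟨B⟩
    refine Quotient.sound ⟨⟨fun x => match x with
        | ⟨(Sum.inl x, y), h⟩ => Sum.inl ⟨(x, y), h⟩
        | ⟨(Sum.inr x, y), h⟩ => Sum.inr ⟨(x, y), h⟩,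
      fun x => match x with
        | Sum.inl ⟨(x, y), h⟩ => ⟨(Sum.inl x, y), h⟩
        | Sum.inr ⟨(x, y), h⟩ => ⟨(Sum.inr x, y), h⟩, ?_, ?_⟩, ?_, ?_, ?_⟩
    · rintro ⟨⟨x | x, y⟩, h⟩ <;> rfl
    · rintro (⟨⟨x, y⟩, h⟩ | ⟨⟨x, y⟩, h⟩) <;> rfl
    · rintro g ⟨⟨x | x, y⟩, h⟩ <;> rfl
    · rintro ⟨⟨x | x, y⟩, h⟩ <;> rfl
    · rintro ⟨⟨x | x, y⟩, h⟩ <;> rfl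

/-- The product of isomorphism classes of spans; it is biadditive. -/
def SpanClass.prod (S T S' T' : FinGSet G) :
    SpanClass S T →+ SpanClass S' T' →+ SpanClass (S.prod S') (T.prod T') where
  toFun a :=
    { toFun := fun b => Quotient.map₂ GSpan.prod (by
        rintro A A' ⟨e, h1, h2, h3⟩ B B' ⟨f, k1, k2, k3⟩
        refine ⟨Equiv.prodCongr e f, ?_, ?_, ?_⟩
        · rintro g ⟨x, y⟩
          exact Prod.ext (h1 g x) (k1 g y)
        · rintro ⟨x, y⟩
          exact Prod.ext (h2 x) (k2 y)
        · rintro ⟨x, y⟩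
          exact Prod.ext (h3 x) (k3 y)) a b
      map_zero' := by
        induction a using Quotient.inductionOn with | _ A
        refine Quotient.sound ⟨⟨fun x => x.2.elim, fun x => x.elim, fun x => x.2.elim,
          fun x => x.elim⟩, fun _ x => x.2.elim, fun x => x.2.elim, fun x => x.2.elim⟩
      map_add' := by
        rintro ⟨B⟩ ⟨B'⟩
        induction a using Quotient.inductionOn with | _ A
        refine Quotient.sound ⟨Equiv.prodSumDistrib _ _ _, ?_, ?_, ?_⟩
        · rintro g ⟨x, y | y⟩ <;> rfl
        · rintro ⟨x, y | y⟩ <;> rfl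
        · rintro ⟨x, y | y⟩ <;> rfl }
  map_zero' := by
    ext ⟨B⟩
    refine Quotient.sound ⟨⟨fun x => x.1.elim, fun x => x.elim, fun x => x.1.elim,
      fun x => x.elim⟩, fun _ x => x.1.elim, fun x => x.1.elim, fun x => x.1.elim⟩
  map_add' := by
    rintro ⟨A⟩ ⟨A'⟩
    ext ⟨B⟩
    refine Quotient.sound ⟨Equiv.sumProdDistrib _ _ _, ?_, ?_, ?_⟩
    · rintro g ⟨x | x, y⟩ <;> rfl
    · rintro ⟨x | x, y⟩ <;> rfl
    · rintro ⟨x | x, y⟩ <;> rfl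

lemma SpanClass.id_comp {S T : FinGSet G} (a : SpanClass S T) :
    SpanClass.comp S S T ⟦GSpan.id S⟧ a = a := by
  induction a using Quotient.inductionOn with | _ A
  refine Quotient.sound ⟨⟨fun x => x.1.2, fun y => ⟨(A.left y, y), rfl⟩, ?_, fun _ => rfl⟩,
    fun _ _ => rfl, ?_, fun _ => rfl⟩
  · rintro ⟨⟨x, y⟩, h⟩
    exact Subtype.ext (Prod.ext h.symm rfl)
  · rintro ⟨⟨x, y⟩, h⟩
    exact h.symm

lemma SpanClass.comp_id {S T : FinGSet G} (a : SpanClass S T) :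
    SpanClass.comp S T T a ⟦GSpan.id T⟧ = a := by
  induction a using Quotient.inductionOn with | _ A
  refine Quotient.sound ⟨⟨fun x => x.1.1, fun y => ⟨(y, A.right y), rfl⟩, ?_, fun _ => rfl⟩,
    fun _ _ => rfl, fun _ => rfl, ?_⟩
  · rintro ⟨⟨x, y⟩, h⟩
    exact Subtype.ext (Prod.ext rfl h)
  · rintro ⟨⟨x, y⟩, h⟩
    exact h

lemma SpanClass.comp_assoc {S T U V : FinGSet G} (a : SpanClass S T) (b : SpanClass T U)
    (c : SpanClass U V) :
    SpanClass.comp S U V (SpanClass.comp S T U a b) c =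
      SpanClass.comp S T V a (SpanClass.comp T U V b c) := by
  induction a using Quotient.inductionOn with | _ A
  induction b using Quotient.inductionOn with | _ B
  induction c using Quotient.inductionOn with | _ C
  exact Quotient.sound ⟨⟨fun x => ⟨(x.1.1.1.1, ⟨(x.1.1.1.2, x.1.2), x.2⟩), x.1.1.2⟩,
    fun x => ⟨(⟨(x.1.1, x.1.2.1.1), x.2⟩, x.1.2.1.2), x.1.2.2⟩, fun _ => rfl, fun _ => rfl⟩,
    fun _ _ => rfl, fun _ => rfl, fun _ => rfl⟩

lemma SpanClass.prod_id (S T : FinGSet G) :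
    SpanClass.prod S S T T ⟦GSpan.id S⟧ ⟦GSpan.id T⟧ = ⟦GSpan.id (S.prod T)⟧ :=
  rfl

lemma SpanClass.prod_comp {S T U S' T' U' : FinGSet G} (a : SpanClass S T) (b : SpanClass T U)
    (a' : SpanClass S' T') (b' : SpanClass T' U') :
    SpanClass.prod S U S' U' (SpanClass.comp S T U a b) (SpanClass.comp S' T' U' a' b') =
      SpanClass.comp (S.prod S') (T.prod T') (U.prod U')
        (SpanClass.prod S T S' T' a a') (SpanClass.prod T U T' U' b b') := by
  induction a using Quotient.inductionOn with | _ A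
  induction b using Quotient.inductionOn with | _ B
  induction a' using Quotient.inductionOn with | _ A'
  induction b' using Quotient.inductionOn with | _ B'
  exact Quotient.sound ⟨⟨fun x => ⟨((x.1.1.1, x.2.1.1), (x.1.1.2, x.2.1.2)),
      Prod.ext x.1.2 x.2.2⟩,
    fun x => (⟨(x.1.1.1, x.1.2.1), congrArg Prod.fst x.2⟩,
      ⟨(x.1.1.2, x.1.2.2), congrArg Prod.snd x.2⟩), fun _ => rfl, fun _ => rfl⟩,
    fun _ _ => rfl, fun _ => rfl, fun _ => rfl⟩

/-! ## Group completion and the Burnside category -/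

open Algebra (GrothendieckAddGroup)

lemma groth_lift_of {M A : Type*} [AddCommMonoid M] [AddCommGroup A] (f : M →+ A) (m : M) :
    GrothendieckAddGroup.lift f (GrothendieckAddGroup.of m) = f m :=
  DFunLike.congr_fun (GrothendieckAddGroup.lift.symm_apply_apply f) m

lemma groth_hom_ext {M A : Type*} [AddCommMonoid M] [AddCommGroup A]
    {f g : GrothendieckAddGroup M →+ A}
    (h : ∀ m, f (GrothendieckAddGroup.of m) = g (GrothendieckAddGroup.of m)) : f = g :=
  GrothendieckAddGroup.lift.symm.injective (AddMonoidHom.ext h)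

lemma groth_induction {M : Type*} [AddCommMonoid M] {p : GrothendieckAddGroup M → Prop}
    (x : GrothendieckAddGroup M) (of : ∀ m, p (GrothendieckAddGroup.of m))
    (add : ∀ x y, p x → p y → p (x + y)) (neg : ∀ x, p x → p (-x)) : p x := by
  have hx : x ∈ AddSubgroup.closure
      (Set.range fun m : M => (GrothendieckAddGroup.of m : GrothendieckAddGroup M)) := by
    have key : (AddSubgroup.closure (Set.range
        fun m : M => (GrothendieckAddGroup.of m : GrothendieckAddGroup M))).subtype.comp
        (GrothendieckAddGroup.lift
          (GrothendieckAddGroup.of.codRestrict _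
            fun m => AddSubgroup.subset_closure ⟨m, rfl⟩)) = AddMonoidHom.id _ := by
      apply groth_hom_ext
      intro m
      rw [AddMonoidHom.comp_apply, groth_lift_of]
      rfl
    have := DFunLike.congr_fun key x
    rw [AddMonoidHom.id_apply] at this
    rw [← this]
    exact Subtype.prop _
  induction hx using AddSubgroup.closure_induction with
  | mem x hx => obtain ⟨m, rfl⟩ := hx; exact of m
  | zero => simpa using of 0
  | add x y _ _ hx hy => exact add x y hx hy
  | neg x _ hx => exact neg x hx

/-- The extension of a biadditive map to group completions. -/
def grothLift₂ {M N P : Type*} [AddCommMonoid M] [AddCommMonoid N] [AddCommMonoid P]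
    (f : M →+ N →+ P) :
    GrothendieckAddGroup M →+ GrothendieckAddGroup N →+ GrothendieckAddGroup P :=
  GrothendieckAddGroup.lift
    { toFun := fun m => GrothendieckAddGroup.lift (GrothendieckAddGroup.of.comp (f m))
      map_zero' := by
        apply groth_hom_ext
        intro n
        rw [groth_lift_of, map_zero, AddMonoidHom.comp_zero]
        rfl
      map_add' := fun m m' => by
        apply groth_hom_ext
        intro n
        rw [AddMonoidHom.add_apply, groth_lift_of, groth_lift_of, groth_lift_of, map_add]
        exact map_add GrothendieckAddGroup.of _ _ }

lemma grothLift₂_of {M N P : Type*} [AddCommMonoid M] [AddCommMonoid N] [AddCommMonoid P]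
    (f : M →+ N →+ P) (m : M) (n : N) :
    grothLift₂ f (GrothendieckAddGroup.of m) (GrothendieckAddGroup.of n) =
      GrothendieckAddGroup.of (f m n) := by
  rw [grothLift₂, groth_lift_of]
  exact groth_lift_of _ n

/-- The Burnside category of `G`: its objects are the finite `G`-sets. -/
structure Burnside (G : Type u) [Group G] : Type (u + 1) where
  of ::
  toFinGSet : FinGSet G

/-- Morphisms of the Burnside category: the group completion of the monoid of isomorphism
classes of spans. -/
abbrev BurnsideHom (S T : FinGSet G) : Type (u + 1) := GrothendieckAddGroup (SpanClass S T)

/-- The class of a span in the Burnside category. -/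
abbrev GSpan.toHom {S T : FinGSet G} (A : GSpan S T) : BurnsideHom S T :=
  GrothendieckAddGroup.of ⟦A⟧

/-- Composition is the biadditive extension of the composition of spans by fibre products. -/
instance : Category.{u + 1} (Burnside G) where
  Hom S T := BurnsideHom S.toFinGSet T.toFinGSet
  id S := (GSpan.id S.toFinGSet).toHom
  comp {S T U} f g :=
    grothLift₂ (SpanClass.comp S.toFinGSet T.toFinGSet U.toFinGSet) f g
  id_comp {S T} f := by
    induction f using groth_induction with
    | of a => rw [grothLift₂_of, SpanClass.id_comp]
    | add x y hx hy => rw [map_add, hx, hy]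
    | neg x hx => rw [map_neg, hx]
  comp_id {S T} f := by
    induction f using groth_induction with
    | of a => rw [grothLift₂_of, SpanClass.comp_id]
    | add x y hx hy => rw [map_add, AddMonoidHom.add_apply, hx, hy]
    | neg x hx => rw [map_neg, AddMonoidHom.neg_apply, hx]
  assoc {S T U V} f g h := by
    induction f using groth_induction with
    | of a =>
      induction g using groth_induction with
      | of b =>
        induction h using groth_induction with
        | of c => simp only [grothLift₂_of, SpanClass.comp_assoc]
        | add x y hx hy => simp only [map_add, hx, hy]
        | neg x hx => simp only [map_neg, hx]
      | add x y hx hy => simp only [map_add, AddMonoidHom.add_apply, hx, hy]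
      | neg x hx => simp only [map_neg, AddMonoidHom.neg_apply, hx]
    | add x y hx hy => simp only [map_add, AddMonoidHom.add_apply, hx, hy]
    | neg x hx => simp only [map_neg, AddMonoidHom.neg_apply, hx]

instance (S T : Burnside G) : AddCommGroup (S ⟶ T) :=
  inferInstanceAs (AddCommGroup (BurnsideHom S.toFinGSet T.toFinGSet))

lemma Burnside.comp_def {S T U : Burnside G} (f : S ⟶ T) (g : T ⟶ U) :
    f ≫ g = grothLift₂ (SpanClass.comp S.toFinGSet T.toFinGSet U.toFinGSet) f g :=
  rfl

instance : Preadditive (Burnside G) where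
  add_comp S T U f f' g := by
    simp only [Burnside.comp_def]
    refine Eq.trans ?_ (AddMonoidHom.add_apply _ _ _)
    exact congrArg (fun h : BurnsideHom T.toFinGSet U.toFinGSet →+ _ => h g) (map_add _ _ _)
  comp_add S T U f g g' := by
    simp only [Burnside.comp_def]
    exact map_add _ _ _

/-- The Cartesian product functor of the Burnside category, the biadditive extension of the
product of spans. -/
def burnsideProd (G : Type u) [Group G] : Burnside G × Burnside G ⥤ Burnside G where
  obj S := Burnside.of (S.1.toFinGSet.prod S.2.toFinGSet)
  map {S T} f := grothLift₂
    (SpanClass.prod S.1.toFinGSet T.1.toFinGSet S.2.toFinGSet T.2.toFinGSet) f.1 f.2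
  map_id S := grothLift₂_of _ _ _
  map_comp {S T U} f g := by
    obtain ⟨f, f'⟩ := f
    obtain ⟨g, g'⟩ := g
    change grothLift₂ (SpanClass.prod _ _ _ _) (grothLift₂ (SpanClass.comp _ _ _) f g)
        (grothLift₂ (SpanClass.comp _ _ _) f' g') =
      grothLift₂ (SpanClass.comp _ _ _) (grothLift₂ (SpanClass.prod _ _ _ _) f f')
        (grothLift₂ (SpanClass.prod _ _ _ _) g g')
    induction f using groth_induction with
    | of a =>
      induction g using groth_induction with
      | of b =>
        induction f' using groth_induction with
        | of a' =>
          induction g' using groth_induction with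
          | of b' => simp only [grothLift₂_of, SpanClass.prod_comp]
          | add x y hx hy => simp only [map_add, hx, hy]
          | neg x hx => simp only [map_neg, hx]
        | add x y hx hy => simp only [map_add, AddMonoidHom.add_apply, hx, hy]
        | neg x hx => simp only [map_neg, AddMonoidHom.neg_apply, hx]
      | add x y hx hy => simp only [map_add, AddMonoidHom.add_apply, hx, hy]
      | neg x hx => simp only [map_neg, AddMonoidHom.neg_apply, hx]
    | add x y hx hy => simp only [map_add, AddMonoidHom.add_apply, hx, hy]
    | neg x hx => simp only [map_neg, AddMonoidHom.neg_apply, hx]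

/-! ## Coefficient systems and Mackey functors -/

/-- The orbit category of `G`: its objects are the orbits `G ⧸ H`, and its morphisms are the
`G`-maps. -/
structure OrbitCat (G : Type u) [Group G] : Type u where
  of ::
  subgroup : Subgroup G

instance : Category.{u} (OrbitCat G) where
  Hom H K := (G ⧸ H.subgroup) →[G] (G ⧸ K.subgroup)
  id H := MulActionHom.id G
  comp f g := MulActionHom.comp g f

/-- A coefficient system is a contravariant functor from the orbit category to abelian groups. -/
abbrev CoeffSystem (G : Type u) [Group G] := (OrbitCat G)ᵒᵖ ⥤ AddCommGrpCat.{u + 1}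

/-- A Mackey functor is an additive functor from the Burnside category to abelian groups. -/
abbrev MackeyFunctor (G : Type u) [Group G] := Burnside G ⥤+ AddCommGrpCat.{u + 1}

/-- The orbit `G ⧸ H` as a finite `G`-set. -/
abbrev orbit [Finite G] (H : OrbitCat G) : FinGSet G := ⟨G ⧸ H.subgroup⟩

/-- The functor from the opposite of the orbit category to the Burnside category, the identity on
objects; it sends a `G`-map `f : G ⧸ H → G ⧸ K` to the span `G ⧸ K ← G ⧸ H = G ⧸ H` whose left leg
is `f`. -/
def orbitToBurnside (G : Type u) [Group G] [Finite G] : (OrbitCat G)ᵒᵖ ⥤ Burnside G where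
  obj H := Burnside.of (orbit H.unop)
  map {K H} f := GSpan.toHom
    { apex := orbit H.unop
      left := f.unop
      right := MulActionHom.id G }
  map_id H := rfl
  map_comp {K H I} f g := by
    let g' : orbit I.unop →[G] orbit H.unop := g.unop
    refine Eq.trans ?_ (grothLift₂_of _ _ _).symm
    refine congrArg GrothendieckAddGroup.of (Quotient.sound ⟨⟨fun x => ⟨(g' x, x), rfl⟩,
      fun x => x.1.2, fun _ => rfl, ?_⟩, fun r x => ?_, fun _ => rfl, fun _ => rfl⟩)
    · rintro ⟨⟨x, y⟩, h⟩
      exact Subtype.ext (Prod.ext h.symm rfl)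
    · exact Subtype.ext (Prod.ext (map_smul g' r x) rfl)

/-! ## Additive left Kan extension -/

section AddLan

variable {𝒜 : Type w₁} [Category.{w₂} 𝒜] {ℬ : Type w₃} [Category.{w₄} ℬ] [Preadditive ℬ]
  (J : 𝒜 ⥤ ℬ)

/-- Restriction of additive functors along `J`. -/
def addRestrict : (ℬ ⥤+ AddCommGrpCat.{max w₁ w₄}) ⥤ (𝒜 ⥤ AddCommGrpCat.{max w₁ w₄}) :=
  AdditiveFunctor.forget _ _ ⋙ (Functor.whiskeringLeft _ _ _).obj J

variable (F F' : 𝒜 ⥤ AddCommGrpCat.{max w₁ w₄})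

/-- The group `⨁ a, ℬ(J a, b) ⊗ F a`. -/
abbrev LanSum (b : ℬ) : Type (max w₁ w₄) :=
  DirectSum 𝒜 fun a => (J.obj a ⟶ b) ⊗[ℤ] (F.obj a)

open Classical in
/-- The element `f ⊗ x` of the summand of index `a`. -/
def lanSumOf {b : ℬ} (a : 𝒜) : ((J.obj a ⟶ b) ⊗[ℤ] (F.obj a)) →+ LanSum J F b :=
  DirectSum.of (fun a => (J.obj a ⟶ b) ⊗[ℤ] (F.obj a)) a

/-- The subgroup generated by the differences `f ⊗ F(v) x - (f ∘ J(v)) ⊗ x`. -/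
def lanRel (b : ℬ) : AddSubgroup (LanSum J F b) :=
  AddSubgroup.closure {z | ∃ (a a' : 𝒜) (v : a ⟶ a') (f : J.obj a' ⟶ b) (x : F.obj a),
    z = lanSumOf J F a' (f ⊗ₜ F.map v x) - lanSumOf J F a ((J.map v ≫ f) ⊗ₜ x)}

/-- The coend `∫^a ℬ(J a, b) ⊗ F a`. -/
def LanGroup (b : ℬ) : Type (max w₁ w₄) := LanSum J F b ⧸ lanRel J F b

instance (b : ℬ) : AddCommGroup (LanGroup J F b) :=
  inferInstanceAs (AddCommGroup (LanSum J F b ⧸ lanRel J F b))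

/-- The quotient map to the coend. -/
def lanQuot (b : ℬ) : LanSum J F b →+ LanGroup J F b := QuotientAddGroup.mk' _

/-- The class of `f ⊗ x` in the coend. -/
def lanMk {b : ℬ} {a : 𝒜} (f : J.obj a ⟶ b) (x : F.obj a) : LanGroup J F b :=
  lanQuot J F b (lanSumOf J F a (f ⊗ₜ x))

variable {J F F'}

lemma lanMk_add_left {b : ℬ} {a : 𝒜} (f f' : J.obj a ⟶ b) (x : F.obj a) :
    lanMk J F (f + f') x = lanMk J F f x + lanMk J F f' x := by
  simp only [lanMk, TensorProduct.add_tmul, map_add]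

lemma lanMk_add_right {b : ℬ} {a : 𝒜} (f : J.obj a ⟶ b) (x x' : F.obj a) :
    lanMk J F f (x + x') = lanMk J F f x + lanMk J F f x' := by
  simp only [lanMk, TensorProduct.tmul_add, map_add]

lemma lanMk_map {b : ℬ} {a a' : 𝒜} (v : a ⟶ a') (f : J.obj a' ⟶ b) (x : F.obj a) :
    lanMk J F f (F.map v x) = lanMk J F (J.map v ≫ f) x := by
  rw [← sub_eq_zero, lanMk, lanMk, ← map_sub]
  exact (QuotientAddGroup.eq_zero_iff _).2 (AddSubgroup.subset_closure ⟨a, a', v, f, x, rfl⟩)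

lemma lan_hom_ext {b : ℬ} {A : Type*} [AddCommGroup A] {p q : LanGroup J F b →+ A}
    (h : ∀ (a : 𝒜) (f : J.obj a ⟶ b) (x : F.obj a), p (lanMk J F f x) = q (lanMk J F f x)) :
    p = q := by
  classical
  apply QuotientAddGroup.addMonoidHom_ext
  apply DirectSum.addHom_ext'
  intro a
  apply AddMonoidHom.toIntLinearMap_injective
  apply TensorProduct.ext'
  intro f x
  exact h a f x

open Classical in
/-- The map out of the direct sum induced by biadditive maps. -/
def lanSumDesc {b : ℬ} {A : Type*} [AddCommGroup A]
    (φ : ∀ a, (J.obj a ⟶ b) →+ F.obj a →+ A) : LanSum J F b →+ A :=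
  DirectSum.toAddMonoid fun a => TensorProduct.liftAddHom (φ a) fun r f x => by simp

lemma lanSumDesc_of {b : ℬ} {A : Type*} [AddCommGroup A]
    (φ : ∀ a, (J.obj a ⟶ b) →+ F.obj a →+ A) (a : 𝒜) (f : J.obj a ⟶ b) (x : F.obj a) :
    lanSumDesc φ (lanSumOf J F a (f ⊗ₜ x)) = φ a f x := by
  classical
  simp only [lanSumDesc, lanSumOf]
  exact DirectSum.toAddMonoid_of _ _ _

/-- The universal property of the coend. -/
def lanDesc {b : ℬ} {A : Type*} [AddCommGroup A] (φ : ∀ a, (J.obj a ⟶ b) →+ F.obj a →+ A)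
    (hφ : ∀ (a a' : 𝒜) (v : a ⟶ a') (f : J.obj a' ⟶ b) (x : F.obj a),
      φ a' f (F.map v x) = φ a (J.map v ≫ f) x) : LanGroup J F b →+ A :=
  QuotientAddGroup.lift _ (lanSumDesc φ) (by
    rw [lanRel, AddSubgroup.closure_le]
    rintro z ⟨a, a', v, f, x, rfl⟩
    change _ = _
    rw [map_sub, sub_eq_zero, lanSumDesc_of, lanSumDesc_of, hφ])

lemma lanDesc_mk {b : ℬ} {A : Type*} [AddCommGroup A] (φ : ∀ a, (J.obj a ⟶ b) →+ F.obj a →+ A)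
    (hφ : ∀ (a a' : 𝒜) (v : a ⟶ a') (f : J.obj a' ⟶ b) (x : F.obj a),
      φ a' f (F.map v x) = φ a (J.map v ≫ f) x) (a : 𝒜) (f : J.obj a ⟶ b) (x : F.obj a) :
    lanDesc φ hφ (lanMk J F f x) = φ a f x :=
  lanSumDesc_of φ a f x

variable (F) in
/-- The map `f ⊗ x ↦ (g ∘ f) ⊗ x` of coends. -/
def lanPost {b b' : ℬ} (g : b ⟶ b') : LanGroup J F b →+ LanGroup J F b' :=
  lanDesc (fun _ => AddMonoidHom.mk' (fun f => AddMonoidHom.mk' (fun x => lanMk J F (f ≫ g) x)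
      fun x x' => lanMk_add_right _ x x')
      fun f f' => AddMonoidHom.ext fun x =>
        (congrArg (fun k => lanMk J F k x) (Preadditive.add_comp _ _ _ f f' g)).trans
          (lanMk_add_left _ _ x))
    fun _ _ v f x => (lanMk_map v (f ≫ g) x).trans
      (congrArg (fun k => lanMk J F k x) (Category.assoc _ _ _).symm)

lemma lanPost_mk {b b' : ℬ} (g : b ⟶ b') {a : 𝒜} (f : J.obj a ⟶ b) (x : F.obj a) :
    lanPost F g (lanMk J F f x) = lanMk J F (f ≫ g) x :=
  lanDesc_mk _ _ a f x

variable (J) in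
/-- The map `f ⊗ x ↦ f ⊗ α(x)` of coends. -/
def lanNat (α : F ⟶ F') (b : ℬ) : LanGroup J F b →+ LanGroup J F' b :=
  lanDesc (fun a => AddMonoidHom.mk' (fun f => AddMonoidHom.mk'
      (fun x => lanMk J F' f (α.app a x))
      fun x x' => by rw [map_add, lanMk_add_right])
      fun f f' => AddMonoidHom.ext fun x => lanMk_add_left f f' _)
    fun _ _ v f x => (congrArg (lanMk J F' f) (NatTrans.naturality_apply α v x)).trans
      (lanMk_map v f _)

lemma lanNat_mk (α : F ⟶ F') {b : ℬ} {a : 𝒜} (f : J.obj a ⟶ b) (x : F.obj a) :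
    lanNat J α b (lanMk J F f x) = lanMk J F' f (α.app a x) :=
  lanDesc_mk _ _ a f x

variable (J F) in
/-- The functor `b ↦ ∫^a ℬ(J a, b) ⊗ F a`. -/
def lanFunctor : ℬ ⥤ AddCommGrpCat.{max w₁ w₄} where
  obj b := AddCommGrpCat.of (LanGroup J F b)
  map g := AddCommGrpCat.ofHom (lanPost F g)
  map_id b := by
    ext : 1
    refine lan_hom_ext fun a f x => (lanPost_mk _ f x).trans ?_
    exact congrArg (fun f => lanMk J F f x) (Category.comp_id f)
  map_comp g g' := by
    ext : 1
    refine lan_hom_ext fun a f x => (lanPost_mk _ f x).trans ?_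
    refine Eq.trans ?_ (congrArg (lanPost F g') (lanPost_mk g f x)).symm
    refine Eq.trans ?_ (lanPost_mk g' _ x).symm
    exact congrArg (fun f => lanMk J F f x) (Category.assoc f g g').symm

instance : (lanFunctor J F).Additive where
  map_add {b b' g g'} := by
    ext : 1
    refine lan_hom_ext fun a f x => (lanPost_mk _ f x).trans ?_
    refine (congrArg (fun f => lanMk J F f x) (Preadditive.comp_add _ _ _ f g g')).trans ?_
    refine (lanMk_add_left _ _ x).trans ?_
    exact congrArg₂ (· + ·) (lanPost_mk g f x).symm (lanPost_mk g' f x).symm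

variable (J) in
/-- The natural transformation of coends induced by a natural transformation. -/
def lanMap (α : F ⟶ F') : lanFunctor J F ⟶ lanFunctor J F' where
  app b := AddCommGrpCat.ofHom (lanNat J α b)
  naturality b b' g := by
    ext : 1
    refine lan_hom_ext fun a f x => ?_
    refine (congrArg (lanNat J α b') (lanPost_mk g f x)).trans ?_
    refine (lanNat_mk α _ x).trans ?_
    refine Eq.trans ?_ (congrArg (lanPost F' g) (lanNat_mk α f x)).symm
    exact (lanPost_mk g f _).symm

variable (J) in
/-- Left Kan extension along `J` with values in additive functors, given by the coend
`∫^a ℬ(J a, -) ⊗ F a`. -/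
def addLan : (𝒜 ⥤ AddCommGrpCat.{max w₁ w₄}) ⥤ (ℬ ⥤+ AddCommGrpCat.{max w₁ w₄}) where
  obj F := AdditiveFunctor.of (lanFunctor J F)
  map α := ObjectProperty.homMk (lanMap J α)
  map_id F := by
    ext b : 4
    exact lan_hom_ext fun a f x => lanNat_mk _ f x
  map_comp {F F' F''} α β := by
    ext b : 4
    refine lan_hom_ext fun a f x => (lanNat_mk _ f x).trans ?_
    exact ((congrArg (lanNat J β b) (lanNat_mk α f x)).trans (lanNat_mk β f _)).symm

instance : (addLan J).Additive where
  map_add {F F' α β} := by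
    ext b : 4
    refine lan_hom_ext fun a f x => (lanNat_mk _ f x).trans ?_
    refine (lanMk_add_right f _ _).trans ?_
    exact congrArg₂ (· + ·) (lanNat_mk α f x).symm (lanNat_mk β f x).symm

/-- The unit `x ↦ id ⊗ x` of the Kan extension. -/
def lanUnit (F : 𝒜 ⥤ AddCommGrpCat.{max w₁ w₄}) :
    F ⟶ (addRestrict J).obj ((addLan J).obj F) where
  app a := AddCommGrpCat.ofHom (AddMonoidHom.mk' (fun x => lanMk J F (𝟙 (J.obj a)) x)
    fun x x' => lanMk_add_right _ x x')
  naturality a a' v := by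
    ext x
    refine (lanMk_map v (𝟙 (J.obj a')) x).trans ?_
    refine Eq.trans ?_ (lanPost_mk (J.map v) (𝟙 (J.obj a)) x).symm
    exact congrArg (fun f => lanMk J F f x) (by rw [Category.comp_id, Category.id_comp])

/-- The counit `f ⊗ x ↦ P(f)(x)` of the Kan extension at one object. -/
def lanEval (P : ℬ ⥤+ AddCommGrpCat.{max w₁ w₄}) (b : ℬ) :
    LanGroup J ((addRestrict J).obj P) b →+ P.obj.obj b :=
  lanDesc (fun a => AddMonoidHom.mk' (fun f => (P.obj.map f).hom) fun f f' => by
      rw [P.obj.map_add]; rfl)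
    fun a a' v f x => (ConcreteCategory.congr_hom (P.obj.map_comp (J.map v) f) x).symm

lemma lanEval_mk (P : ℬ ⥤+ AddCommGrpCat.{max w₁ w₄}) {b : ℬ} {a : 𝒜} (f : J.obj a ⟶ b)
    (x : P.obj.obj (J.obj a)) :
    lanEval P b (lanMk J ((addRestrict J).obj P) f x) = P.obj.map f x := by
  rw [lanEval]
  exact lanDesc_mk (F := (addRestrict J).obj P) _ _ a f x

/-- The counit `f ⊗ x ↦ P(f)(x)` of the Kan extension. -/
def lanCounit (P : ℬ ⥤+ AddCommGrpCat.{max w₁ w₄}) :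
    (addLan J).obj ((addRestrict J).obj P) ⟶ P :=
  ObjectProperty.homMk
    { app := fun b => AddCommGrpCat.ofHom (lanEval P b)
      naturality := fun b b' g => by
        ext : 1
        refine lan_hom_ext fun a f x => ?_
        refine (congrArg (lanEval P b') (lanPost_mk g f x)).trans ?_
        refine (lanEval_mk P (f ≫ g) x).trans ?_
        refine Eq.trans ?_ (congrArg (P.obj.map g) (lanEval_mk P f x)).symm
        exact ConcreteCategory.congr_hom (P.obj.map_comp f g) x }

variable (J) in
/-- `addLan J` is left adjoint to the restriction of additive functors along `J`. -/
def addLanAdjunction : addLan J ⊣ addRestrict J :=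
  Adjunction.mkOfUnitCounit
    { unit :=
        { app := lanUnit
          naturality := fun F F' α => by
            ext a x
            exact (lanNat_mk α (𝟙 (J.obj a)) x).symm }
      counit :=
        { app := lanCounit
          naturality := fun P Q α => by
            ext b : 4
            refine lan_hom_ext fun a f x => ?_
            refine (congrArg (lanEval Q b) (lanNat_mk _ f x)).trans ?_
            refine (lanEval_mk Q f _).trans ?_
            refine Eq.trans ?_ (congrArg (α.hom.app b) (lanEval_mk P f x)).symm
            exact (NatTrans.naturality_apply α.hom f x).symm }
      left_triangle := by
        ext F b : 6
        refine lan_hom_ext fun a f x => ?_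
        refine (congrArg (lanEval ((addLan J).obj F) b)
          (lanNat_mk (F' := (addRestrict J).obj ((addLan J).obj F)) (lanUnit F) f x)).trans ?_
        refine (lanEval_mk ((addLan J).obj F) f _).trans ?_
        refine (lanPost_mk f (𝟙 (J.obj a)) x).trans ?_
        exact congrArg (fun f => lanMk J F f x) (Category.id_comp f)
      right_triangle := by
        ext P a x
        refine (lanEval_mk P (𝟙 (J.obj a)) x).trans ?_
        exact ConcreteCategory.congr_hom (P.obj.map_id (J.obj a)) x }

end AddLan

/-! ## Mackey functors: coproducts, the left Kan extension `L` and the box product -/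

instance {𝒦 : Type*} [Category* 𝒦] {ℬ : Type*} [Category* ℬ] [Preadditive ℬ]
    {𝒟 : Type*} [Category* 𝒟] [Preadditive 𝒟] [HasColimitsOfShape 𝒦 𝒟] :
    (additiveFunctor ℬ 𝒟).IsClosedUnderColimitsOfShape 𝒦 where
  colimitsOfShape_le := by
    rintro F ⟨p⟩
    refine ⟨fun {b b' f g} => ?_⟩
    have hc := isColimitOfPreserves ((evaluation ℬ 𝒟).obj b) p.isColimit
    refine hc.hom_ext fun k => ?_
    have := p.prop_diag_obj k
    have hk : (p.diag.obj k).Additive := this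
    have nat (h : b ⟶ b') := (p.ι.app k).naturality h
    dsimp at nat ⊢
    rw [Preadditive.comp_add, ← nat, ← nat, ← nat, hk.map_add, Preadditive.add_comp]


instance : HasFiniteCoproducts (MackeyFunctor G) where
  out n := by
    have h : HasColimitsOfSize.{0, 0} AddCommGrpCat.{u + 1} := inferInstance
    have h' : HasColimitsOfShape (Discrete (Fin n)) AddCommGrpCat.{u + 1} :=
      h.has_colimits_of_shape _
    exact hasColimitsOfShape_of_closedUnderColimits _ _

/-- The left Kan extension from coefficient systems to Mackey functors. -/
def coeffToMackey (G : Type u) [Group G] [Finite G] : CoeffSystem G ⥤ MackeyFunctor G :=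
  addLan (orbitToBurnside G)

instance [Finite G] : (coeffToMackey G).Additive :=
  inferInstanceAs (addLan (orbitToBurnside G)).Additive

/-- The tensor product of two homomorphisms of abelian groups. -/
def tensorHom {A A' B B' : Type*} [AddCommGroup A] [AddCommGroup A'] [AddCommGroup B]
    [AddCommGroup B'] (f : A →+ A') (g : B →+ B') : A ⊗[ℤ] B →+ A' ⊗[ℤ] B' :=
  (TensorProduct.map f.toIntLinearMap g.toIntLinearMap).toAddMonoidHom

lemma tensorHom_tmul {A A' B B' : Type*} [AddCommGroup A] [AddCommGroup A'] [AddCommGroup B]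
    [AddCommGroup B'] (f : A →+ A') (g : B →+ B') (x : A) (y : B) :
    tensorHom f g (x ⊗ₜ y) = f x ⊗ₜ g y :=
  rfl

lemma tensor_hom_ext {A B C : Type*} [AddCommGroup A] [AddCommGroup B] [AddCommGroup C]
    {f g : A ⊗[ℤ] B →+ C} (h : ∀ x y, f (x ⊗ₜ y) = g (x ⊗ₜ y)) : f = g :=
  AddMonoidHom.toIntLinearMap_injective (TensorProduct.ext' h)

/-- The external product `(S, T) ↦ M(S) ⊗ N(T)` of Mackey functors. -/
def externalTensor (M N : MackeyFunctor G) : Burnside G × Burnside G ⥤ AddCommGrpCat.{u + 1} where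
  obj S := AddCommGrpCat.of (M.obj.obj S.1 ⊗[ℤ] N.obj.obj S.2)
  map f := AddCommGrpCat.ofHom (tensorHom (M.obj.map f.1).hom (N.obj.map f.2).hom)
  map_id S := by
    ext : 1
    exact tensor_hom_ext fun x y => congrArg₂ (fun a b => a ⊗ₜ[ℤ] b)
      (ConcreteCategory.congr_hom (M.obj.map_id S.1) x)
      (ConcreteCategory.congr_hom (N.obj.map_id S.2) y)
  map_comp f g := by
    ext : 1
    exact tensor_hom_ext fun x y => congrArg₂ (fun a b => a ⊗ₜ[ℤ] b)
      (ConcreteCategory.congr_hom (M.obj.map_comp f.1 g.1) x)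
      (ConcreteCategory.congr_hom (N.obj.map_comp f.2 g.2) y)

/-- The map of external products induced by maps of Mackey functors. -/
def externalTensorMap {M M' N N' : MackeyFunctor G} (α : M ⟶ M') (β : N ⟶ N') :
    externalTensor M N ⟶ externalTensor M' N' where
  app S := AddCommGrpCat.ofHom (tensorHom (α.hom.app S.1).hom (β.hom.app S.2).hom)
  naturality S T f := by
    ext : 1
    exact tensor_hom_ext fun x y => congrArg₂ (fun a b => a ⊗ₜ[ℤ] b)
      (NatTrans.naturality_apply α.hom f.1 x) (NatTrans.naturality_apply β.hom f.2 y)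

lemma externalTensorMap_id (M N : MackeyFunctor G) :
    externalTensorMap (𝟙 M) (𝟙 N) = 𝟙 (externalTensor M N) := by
  ext S : 3
  exact tensor_hom_ext fun x y => rfl

lemma externalTensorMap_comp {M M' M'' N N' N'' : MackeyFunctor G} (α : M ⟶ M') (α' : M' ⟶ M'')
    (β : N ⟶ N') (β' : N' ⟶ N'') :
    externalTensorMap (α ≫ α') (β ≫ β') = externalTensorMap α β ≫ externalTensorMap α' β' := by
  ext S : 3
  exact tensor_hom_ext fun x y => rfl

lemma externalTensorMap_add_left {M M' N N' : MackeyFunctor G} (α α' : M ⟶ M') (β : N ⟶ N') :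
    externalTensorMap (α + α') β = externalTensorMap α β + externalTensorMap α' β := by
  ext S : 3
  exact tensor_hom_ext fun x y => TensorProduct.add_tmul _ _ _

lemma externalTensorMap_add_right {M M' N N' : MackeyFunctor G} (α : M ⟶ M') (β β' : N ⟶ N') :
    externalTensorMap α (β + β') = externalTensorMap α β + externalTensorMap α β' := by
  ext S : 3
  exact tensor_hom_ext fun x y => TensorProduct.tmul_add _ _ _

/-- The box product of Mackey functors: the left Kan extension of the external product along the
Cartesian product of the Burnside category. By `addLanAdjunction`, maps from `M □ N` to a Mackey
functor `P` are natural maps `M(S) ⊗ N(T) → P(S × T)`; both sides are biadditive in `(S, T)`. -/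
def box (G : Type u) [Group G] : MackeyFunctor G ⥤ MackeyFunctor G ⥤ MackeyFunctor G where
  obj M :=
    { obj := fun N => (addLan (burnsideProd G)).obj (externalTensor M N)
      map := fun β => (addLan (burnsideProd G)).map (externalTensorMap (𝟙 M) β)
      map_id := fun N => by rw [externalTensorMap_id, CategoryTheory.Functor.map_id]
      map_comp := fun β β' => by
        rw [← Functor.map_comp, ← externalTensorMap_comp, Category.comp_id] }
  map α :=
    { app := fun N => (addLan (burnsideProd G)).map (externalTensorMap α (𝟙 N))
      naturality := fun N N' β => by
        simp only [← Functor.map_comp, ← externalTensorMap_comp, Category.comp_id,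
          Category.id_comp] }
  map_id M := by
    ext N : 2
    exact (congrArg (addLan (burnsideProd G)).map (externalTensorMap_id M N)).trans
      (CategoryTheory.Functor.map_id _ _)
  map_comp α α' := by
    ext N : 2
    simp only [NatTrans.comp_app, ← Functor.map_comp, ← externalTensorMap_comp, Category.comp_id]

instance (M : MackeyFunctor G) : ((box G).obj M).Additive where
  map_add {_ _ β β'} :=
    (congrArg (addLan (burnsideProd G)).map (externalTensorMap_add_right (𝟙 M) β β')).trans
      (Functor.map_add _)

instance : (box G).Additive where
  map_add {M M' α α'} := by
    ext N : 2
    exact (congrArg (addLan (burnsideProd G)).map (externalTensorMap_add_left α α' (𝟙 N))).trans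
      (Functor.map_add _)

instance (K L : ChainComplex (MackeyFunctor G) ℕ) :
    HomologicalComplex.HasMapBifunctor K L (box G) (ComplexShape.down ℕ) := fun n => by
  have : Finite (ComplexShape.π (ComplexShape.down ℕ) (ComplexShape.down ℕ)
      (ComplexShape.down ℕ) ⁻¹' {n}) :=
    Set.Finite.subset ((Set.finite_Iic n).prod (Set.finite_Iic n)) (by
      rintro ⟨p, q⟩ (h : p + q = n)
      exact ⟨show p ≤ n by omega, show q ≤ n by omega⟩)
  have := hasColimitsOfShape_discrete (MackeyFunctor G)
    (ComplexShape.π (ComplexShape.down ℕ) (ComplexShape.down ℕ) (ComplexShape.down ℕ) ⁻¹' {n})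
  exact HasColimitsOfShape.has_colimit _

/-- The box product of chain complexes of Mackey functors: the total complex of the bicomplex of
the box products `K_p □ L_q`. -/
def boxComplex (K L : ChainComplex (MackeyFunctor G) ℕ) : ChainComplex (MackeyFunctor G) ℕ :=
  HomologicalComplex.mapBifunctor K L (box G) (ComplexShape.down ℕ)

/-! ## The cellular chain complex of a filtered space -/

/-- The sequences of spaces `A 0 → A 1 → ...` all of whose maps are injective. -/
def monoSequence : ObjectProperty (ℕ ⥤ TopCat.{u}) :=
  fun A => ∀ n, Mono (A.map (homOfLE (Nat.le_succ n)))

/-- Filtered spaces, as sequences of injective continuous maps `A 0 → A 1 → ...`. -/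
abbrev FilteredSpace : Type (u + 1) := monoSequence.{u}.FullSubcategory

/-- The integral singular chain complex functor. -/
abbrev singularChains : TopCat.{u} ⥤ ChainComplex AddCommGrpCat.{u + 1} ℕ :=
  (AlgebraicTopology.singularChainComplexFunctor AddCommGrpCat.{u + 1}).obj
    (AddCommGrpCat.of (ULift.{u + 1} ℤ))

/-- The short exact sequence `0 → S(A n) → S(A (n + 1)) → S(A (n + 1)) / S(A n) → 0`. -/
def pairSequence (A : FilteredSpace.{u}) (n : ℕ) :
    ShortComplex (ChainComplex AddCommGrpCat.{u + 1} ℕ) :=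
  ShortComplex.mk (singularChains.map (A.obj.map (homOfLE (Nat.le_succ n))))
    (cokernel.π (singularChains.map (A.obj.map (homOfLE (Nat.le_succ n)))))
    (cokernel.condition _)

lemma pairSequence_shortExact (A : FilteredSpace.{u}) (n : ℕ) :
    (pairSequence A n).ShortExact where
  exact := ShortComplex.exact_cokernel
    (singularChains.map (A.obj.map (homOfLE (Nat.le_succ n))))
  mono_f := by
    have := A.property n
    exact inferInstanceAs (Mono (singularChains.map (A.obj.map (homOfLE (Nat.le_succ n)))))
  epi_g := inferInstanceAs (Epi (cokernel.π
    (singularChains.map (A.obj.map (homOfLE (Nat.le_succ n))))))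

/-- The morphism of short exact sequences induced by a map of filtered spaces. -/
def pairMap {A B : FilteredSpace.{u}} (φ : A ⟶ B) (n : ℕ) :
    pairSequence A n ⟶ pairSequence B n where
  τ₁ := singularChains.map (φ.hom.app n)
  τ₂ := singularChains.map (φ.hom.app (n + 1))
  τ₃ := cokernel.map _ _ (singularChains.map (φ.hom.app n)) (singularChains.map (φ.hom.app (n + 1)))
    (by rw [← Functor.map_comp, ← Functor.map_comp, φ.hom.naturality])
  comm₁₂ := by
    dsimp [pairSequence]
    rw [← Functor.map_comp, ← Functor.map_comp, φ.hom.naturality]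
  comm₂₃ := by
    dsimp [pairSequence]
    simp

/-- The relative homology group `H_n(A (n + 1), A n)`. -/
def cellGroup (A : FilteredSpace.{u}) (n : ℕ) : AddCommGrpCat.{u + 1} :=
  (pairSequence A n).X₃.homology n

/-- The homology group `H_n(A (n + 1))`. -/
def skelGroup (A : FilteredSpace.{u}) (n : ℕ) : AddCommGrpCat.{u + 1} :=
  (pairSequence A n).X₂.homology n

/-- The connecting homomorphism `H_{n+1}(A (n + 2), A (n + 1)) → H_n(A (n + 1))`. -/
def connecting (A : FilteredSpace.{u}) (n : ℕ) : cellGroup A (n + 1) ⟶ skelGroup A n :=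
  (pairSequence_shortExact A (n + 1)).δ (n + 1) n (ComplexShape.down_mk (n + 1) n rfl)

/-- The map `H_n(A (n + 1)) → H_n(A (n + 1), A n)`. -/
def toRelative (A : FilteredSpace.{u}) (n : ℕ) : skelGroup A n ⟶ cellGroup A n :=
  HomologicalComplex.homologyMap (pairSequence A n).g n

lemma toRelative_connecting (A : FilteredSpace.{u}) (n : ℕ) :
    toRelative A (n + 1) ≫ connecting A n = 0 :=
  (pairSequence_shortExact A (n + 1)).comp_δ _ _ _

/-- The boundary `H_{n+1}(A (n + 2), A (n + 1)) → H_n(A (n + 1)) → H_n(A (n + 1), A n)` of the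
triple. -/
def cellBoundary (A : FilteredSpace.{u}) (n : ℕ) : cellGroup A (n + 1) ⟶ cellGroup A n :=
  connecting A n ≫ toRelative A n

lemma cellBoundary_comp (A : FilteredSpace.{u}) (n : ℕ) :
    cellBoundary A (n + 1) ≫ cellBoundary A n = 0 := by
  simp only [cellBoundary, Category.assoc]
  rw [← Category.assoc (toRelative A (n + 1)), toRelative_connecting, zero_comp, comp_zero]

/-- The map of relative homology groups induced by a map of filtered spaces. -/
def cellGroupMap {A B : FilteredSpace.{u}} (φ : A ⟶ B) (n : ℕ) : cellGroup A n ⟶ cellGroup B n :=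
  HomologicalComplex.homologyMap (pairMap φ n).τ₃ n

lemma cellBoundary_naturality {A B : FilteredSpace.{u}} (φ : A ⟶ B) (n : ℕ) :
    cellGroupMap φ (n + 1) ≫ cellBoundary B n = cellBoundary A n ≫ cellGroupMap φ n := by
  have h1 : connecting A n ≫ HomologicalComplex.homologyMap (pairMap φ n).τ₂ n =
      cellGroupMap φ (n + 1) ≫ connecting B n :=
    HomologicalComplex.HomologySequence.δ_naturality (pairMap φ (n + 1))
      (pairSequence_shortExact A (n + 1)) (pairSequence_shortExact B (n + 1)) (n + 1) n
      (ComplexShape.down_mk (n + 1) n rfl)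
  have h2 : toRelative A n ≫ cellGroupMap φ n =
      HomologicalComplex.homologyMap (pairMap φ n).τ₂ n ≫ toRelative B n := by
    refine (HomologicalComplex.homologyMap_comp _ _ n).symm.trans ?_
    rw [← (pairMap φ n).comm₂₃]
    exact HomologicalComplex.homologyMap_comp _ _ n
  rw [cellBoundary, cellBoundary, Category.assoc, h2, ← Category.assoc, ← h1]
  exact Category.assoc _ _ _

lemma cellGroupMap_id (A : FilteredSpace.{u}) (n : ℕ) :
    cellGroupMap (𝟙 A) n = 𝟙 (cellGroup A n) := by
  have h : (pairMap (𝟙 A) n).τ₃ = 𝟙 _ := by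
    refine coequalizer.hom_ext ?_
    refine (cokernel.π_desc _ _ _).trans ?_
    refine Eq.trans ?_ (Category.comp_id _).symm
    refine Eq.trans ?_ (Category.id_comp _)
    exact congrArg (fun k => k ≫ _) (singularChains.map_id _)
  rw [cellGroupMap, h]
  exact HomologicalComplex.homologyMap_id _ _

lemma cellGroupMap_comp {A B C : FilteredSpace.{u}} (φ : A ⟶ B) (ψ : B ⟶ C) (n : ℕ) :
    cellGroupMap (φ ≫ ψ) n = cellGroupMap φ n ≫ cellGroupMap ψ n := by
  have h : (pairMap (φ ≫ ψ) n).τ₃ = (pairMap φ n).τ₃ ≫ (pairMap ψ n).τ₃ := by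
    have h1 := (pairMap φ n).comm₂₃
    have h2 := (pairMap ψ n).comm₂₃
    have h3 := (pairMap (φ ≫ ψ) n).comm₂₃
    have h4 : (pairMap (φ ≫ ψ) n).τ₂ = (pairMap φ n).τ₂ ≫ (pairMap ψ n).τ₂ :=
      singularChains.map_comp _ _
    have := (pairSequence_shortExact A n).epi_g
    rw [← cancel_epi (pairSequence A n).g, ← h3, h4, Category.assoc, h2, ← Category.assoc, h1,
      Category.assoc]
  rw [cellGroupMap, h]
  exact HomologicalComplex.homologyMap_comp _ _ _

/-- The cellular chain complex: in degree `n` the group `H_n(A (n + 1), A n)`, with the boundary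
maps of the triples. -/
def cellularComplex : FilteredSpace.{u} ⥤ ChainComplex AddCommGrpCat.{u + 1} ℕ where
  obj A := ChainComplex.of (cellGroup A) (cellBoundary A) (cellBoundary_comp A)
  map {A B} φ := ChainComplex.ofHom (cellGroupMap φ) fun n => by
    simp only [ChainComplex.of_d]
    exact cellBoundary_naturality φ n
  map_id A := by
    ext n : 1
    exact cellGroupMap_id A n
  map_comp φ ψ := by
    ext n : 1
    exact cellGroupMap_comp φ ψ n

/-! ## `G`-CW complexes and their Mackey functor valued chain complexes -/

/-- A relative `G`-CW structure on `(X, D)`, for a discrete group `G`: a relative CW structure with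
an action of `G` on the set `I_n` of `n`-cells, for each `n`, for which the characteristic map
`I_n × Dⁿ → X` is equivariant. Decomposing `I_n` into orbits, these are the structures in which `X`
is obtained from `D` by attaching the `G`-cells `G ⧸ H × Dⁿ`. -/
structure RelGCWComplex (G : Type u) [Group G] (X : Type u) [TopologicalSpace X] [MulAction G X]
    (D : Set X) where
  [t2Space : T2Space X]
  continuous_smul : ∀ g : G, Continuous fun x : X => g • x
  smul_base : ∀ (g : G) (x : X), x ∈ D → g • x ∈ D
  cw : RelCWComplex (Set.univ : Set X) D
  cellAction : ∀ n, MulAction G (cw.cell n)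
  map_smul : ∀ (g : G) (n : ℕ) (i : cw.cell n) (t : Fin n → ℝ), t ∈ Metric.closedBall 0 1 →
    cw.map n (g • i) t = g • cw.map n i t

/-- A `G`-CW structure on `X`. -/
abbrev GCWComplex (G : Type u) [Group G] (X : Type u) [TopologicalSpace X] [MulAction G X] :
    Type (u + 1) :=
  RelGCWComplex G X ∅

/-- A based `G`-CW structure on `X`, with a `G`-fixed vertex `x₀` as base point; the cells of the
structure are the cells other than `x₀`. -/
abbrev BasedGCWComplex (G : Type u) [Group G] (X : Type u) [TopologicalSpace X] [MulAction G X]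
    (x₀ : MulAction.fixedPoints G X) : Type (u + 1) :=
  RelGCWComplex G X {(x₀ : X)}

namespace RelGCWComplex

variable {X : Type u} [TopologicalSpace X] [MulAction G X] {D : Set X}

/-- `c.skelLT n` is the union of `D` and the cells of dimension `< n`, that is, the
`(n - 1)`-skeleton. -/
def skelLT (c : RelGCWComplex G X D) (n : ℕ) : Set X :=
  letI := c.t2Space
  letI := c.cw
  (RelCWComplex.skeletonLT (Set.univ : Set X) n : Set X)

lemma skelLT_mono (c : RelGCWComplex G X D) (n : ℕ) : c.skelLT n ⊆ c.skelLT (n + 1) := by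
  let _ := c.t2Space
  let _ := c.cw
  exact RelCWComplex.skeletonLT_mono (by norm_cast; omega)

lemma smul_mem_skelLT (c : RelGCWComplex G X D) (n : ℕ) (g : G) {x : X} (hx : x ∈ c.skelLT n) :
    g • x ∈ c.skelLT n := by
  let _ := c.t2Space
  let _ := c.cw
  let _ := c.cellAction
  simp only [skelLT, RelCWComplex.coe_skeletonLT, Set.mem_union, Set.mem_iUnion] at hx ⊢
  obtain hx | ⟨m, hm, i, t, ht, rfl⟩ := hx
  · exact Or.inl (c.smul_base g x hx)
  · exact Or.inr ⟨m, hm, g • i, t, ht, c.map_smul g m i t ht⟩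

/-- The `H`-fixed points of `c.skelLT n`. -/
def fixedSkelLT (c : RelGCWComplex G X D) (H : Subgroup G) (n : ℕ) : Set X :=
  c.skelLT n ∩ MulAction.fixedPoints H X

lemma out_smul {X : Type u} [MulAction G X] {K : Subgroup G} {x : X}
    (hx : x ∈ MulAction.fixedPoints K X) (g : G) : (g : G ⧸ K).out • x = g • x := by
  obtain ⟨k, hk⟩ := QuotientGroup.mk_out_eq_mul K g
  rw [hk, mul_smul]
  exact congrArg _ (hx k)

/-- A representative `g` of the coset `f(H) = gK`, for a `G`-map `f : G ⧸ H → G ⧸ K`. -/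
def cosetRep {H K : OrbitCat G} (f : H ⟶ K) : G :=
  (MulActionHom.toFun f ((1 : G) : G ⧸ H.subgroup)).out

lemma map_mk {H K : OrbitCat G} (f : H ⟶ K) (g : G) :
    MulActionHom.toFun f (g : G ⧸ H.subgroup) = ((g * cosetRep f : G) : G ⧸ K.subgroup) := by
  have h := f.map_smul' g ((1 : G) : G ⧸ H.subgroup)
  have h1 : g • ((1 : G) : G ⧸ H.subgroup) = (g : G ⧸ H.subgroup) :=
    congrArg _ (mul_one g)
  rw [h1] at h
  refine h.trans ?_
  refine (congrArg (fun q : G ⧸ K.subgroup => g • q) (QuotientGroup.out_eq' _).symm).trans ?_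
  rfl

/-- If `f : G ⧸ H → G ⧸ K` is a `G`-map with `f(H) = gK`, then `x ↦ g • x` maps `K`-fixed points
to `H`-fixed points. -/
lemma cosetRep_smul_mem (c : RelGCWComplex G X D) {H K : OrbitCat G} (f : H ⟶ K) (n : ℕ) {x : X}
    (hx : x ∈ c.fixedSkelLT K.subgroup n) : cosetRep f • x ∈ c.fixedSkelLT H.subgroup n := by
  refine ⟨c.smul_mem_skelLT n _ hx.1, fun h => ?_⟩
  have h1 : ((h : G) : G ⧸ H.subgroup) = ((1 : G) : G ⧸ H.subgroup) := by
    rw [QuotientGroup.eq]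
    simp
  have h2 := congrArg (MulActionHom.toFun f) h1
  rw [map_mk, map_mk, one_mul] at h2
  change (h : G) • cosetRep f • x = cosetRep f • x
  rw [← mul_smul, ← out_smul hx.2, h2, out_smul hx.2]

/-- The filtered space of `H`-fixed points of `X`, with the filtration `(X^H) ∩ skelLT n`. -/
def fixedFiltration (c : RelGCWComplex G X D) (H : Subgroup G) : FilteredSpace.{u} where
  obj := Functor.ofSequence (X := fun n => TopCat.of (c.fixedSkelLT H n)) fun n =>
    TopCat.ofHom ⟨Set.inclusion (Set.inter_subset_inter_left _ (c.skelLT_mono n)),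
      continuous_inclusion _⟩
  property n := by
    rw [TopCat.mono_iff_injective, Functor.ofSequence_map_homOfLE_succ]
    exact Set.inclusion_injective (Set.inter_subset_inter_left _ (c.skelLT_mono n))

/-- The map `X^K → X^H`, `x ↦ g • x`, induced by a `G`-map `f : G ⧸ H → G ⧸ K` with
`f(H) = gK`. -/
def fixedMap (c : RelGCWComplex G X D) {H K : OrbitCat G} (f : H ⟶ K) :
    c.fixedFiltration K.subgroup ⟶ c.fixedFiltration H.subgroup :=
  ObjectProperty.homMk (NatTrans.ofSequence
    (fun n => TopCat.ofHom ⟨fun x => (⟨cosetRep f • (x : X), c.cosetRep_smul_mem f n x.2⟩ :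
        c.fixedSkelLT H.subgroup n),
      ((c.continuous_smul _).comp continuous_subtype_val).subtype_mk _⟩)
    (fun n => by
      simp only [fixedFiltration, Functor.ofSequence_map_homOfLE_succ]
      rfl))

/-- The contravariant functor `G ⧸ H ↦ X^H` on the orbit category, with values in filtered
spaces. -/
def fixedFunctor (c : RelGCWComplex G X D) : (OrbitCat G)ᵒᵖ ⥤ FilteredSpace.{u} where
  obj H := c.fixedFiltration H.unop.subgroup
  map f := c.fixedMap f.unop
  map_id H := by
    ext n x
    refine Subtype.ext ?_
    refine (out_smul x.2.2 1).trans ?_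
    exact one_smul G _
  map_comp {K H I} f g := by
    ext n x
    refine Subtype.ext ?_
    have h : MulActionHom.toFun (f.unop) (MulActionHom.toFun g.unop ((1 : G) : G ⧸ _)) =
        ((cosetRep g.unop * cosetRep f.unop : G) : G ⧸ K.unop.subgroup) := by
      rw [map_mk, map_mk, one_mul]
    refine Eq.trans (congrArg (fun q : G ⧸ K.unop.subgroup => q.out • (Subtype.val x : X)) h) ?_
    refine (out_smul (Subtype.property x).2 _).trans ?_
    exact mul_smul _ _ _

/-- The chain complex of coefficient systems `G ⧸ H ↦ C_*(X^H, D^H)` of cellular chain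
complexes. -/
def coeffChains (c : RelGCWComplex G X D) : ChainComplex (CoeffSystem G) ℕ where
  X n := c.fixedFunctor ⋙ cellularComplex ⋙ HomologicalComplex.eval _ _ n
  d i j :=
    { app := fun H => (cellularComplex.obj (c.fixedFunctor.obj H)).d i j
      naturality := fun H K f => (cellularComplex.map (c.fixedFunctor.map f)).comm i j }
  shape i j h := by
    ext H : 2
    exact (cellularComplex.obj (c.fixedFunctor.obj H)).shape i j h
  d_comp_d' i j k _ _ := by
    ext H : 2
    exact (cellularComplex.obj (c.fixedFunctor.obj H)).d_comp_d i j k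

/-- The chain complex of Mackey functors of a relative `G`-CW complex: the left Kan extension of its
cellular chain complex of coefficient systems. -/
def mackeyChains [Finite G] (c : RelGCWComplex G X D) : ChainComplex (MackeyFunctor G) ℕ :=
  ((coeffToMackey G).mapHomologicalComplex (ComplexShape.down ℕ)).obj c.coeffChains

end RelGCWComplex

/-- The complex `C_M(X)` of a `G`-CW complex. -/
abbrev GCWComplex.mackeyComplex {G : Type u} [Group G] [Finite G] {X : Type u}
    [TopologicalSpace X] [MulAction G X] (c : GCWComplex G X) :
    ChainComplex (MackeyFunctor G) ℕ :=
  RelGCWComplex.mackeyChains c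

/-- The reduced complex of a based `G`-CW complex: its chains in degree `n` are the relative chains
of `(X, x₀)`, in which the base point is omitted from the cells. -/
abbrev BasedGCWComplex.reducedMackeyComplex {G : Type u} [Group G] [Finite G] {X : Type u}
    [TopologicalSpace X] [MulAction G X] {x₀ : MulAction.fixedPoints G X}
    (c : BasedGCWComplex G X x₀) : ChainComplex (MackeyFunctor G) ℕ :=
  RelGCWComplex.mackeyChains c

/-! ## Products and smash products -/

section Products

variable {X Y : Type u}

/-- The product of two spaces, with the compactly generated topology. -/
def KProd (X Y : Type u) : Type u := CompactCoherentification (X × Y)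

/-- The point `(x, y)` of the product. -/
def KProd.mk (x : X) (y : Y) : KProd X Y := CompactCoherentification.mk (X × Y) (x, y)

instance [TopologicalSpace X] [TopologicalSpace Y] : TopologicalSpace (KProd X Y) :=
  inferInstanceAs (TopologicalSpace (CompactCoherentification (X × Y)))

/-- The diagonal action on the product. -/
instance [MulAction G X] [MulAction G Y] : MulAction G (KProd X Y) :=
  inferInstanceAs (MulAction G (X × Y))

variable [MulAction G X] [MulAction G Y]

/-- The subset of the product given by the union of the products of skeleta `X^p × Y^q` with
`p + q = n`. -/
def productSkeleton [TopologicalSpace X] [TopologicalSpace Y] {D : Set X} {E : Set Y} (c : RelGCWComplex G X D)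
    (d : RelGCWComplex G Y E) (n : ℕ) : Set (KProd X Y) :=
  {z | ∃ (p q : ℕ) (x : X) (y : Y), p + q = n ∧ x ∈ c.skelLT (p + 1) ∧ y ∈ d.skelLT (q + 1) ∧
    z = KProd.mk x y}

/-- `e` is the product of the `G`-CW structures `c` and `d`: the `n`-skeleton of the product is the
union of the products `X^p × Y^q` of skeleta with `p + q = n`. -/
def IsProductStructure [TopologicalSpace X] [TopologicalSpace Y] (c : GCWComplex G X)
    (d : GCWComplex G Y) (e : GCWComplex G (KProd X Y)) : Prop :=
  ∀ n : ℕ, e.skelLT (n + 1) = productSkeleton c d n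

variable (x₀ : MulAction.fixedPoints G X) (y₀ : MulAction.fixedPoints G Y)

/-- The wedge `X × {y₀} ∪ {x₀} × Y` in the product. -/
def wedge : Set (KProd X Y) :=
  {z | (∃ x : X, z = KProd.mk x (y₀ : Y)) ∨ ∃ y : Y, z = KProd.mk (x₀ : X) y}

lemma smul_mem_wedge (g : G) {z : KProd X Y} (hz : z ∈ wedge x₀ y₀) : g • z ∈ wedge x₀ y₀ := by
  obtain ⟨x, rfl⟩ | ⟨y, rfl⟩ := hz
  · exact Or.inl ⟨g • x, congrArg (KProd.mk (g • x)) (y₀.2 g)⟩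
  · exact Or.inr ⟨g • y, congrArg (fun x => KProd.mk x (g • y)) (x₀.2 g)⟩

/-- The equivalence relation that collapses the wedge to a point. -/
def wedgeSetoid : Setoid (KProd X Y) where
  r z w := z = w ∨ (z ∈ wedge x₀ y₀ ∧ w ∈ wedge x₀ y₀)
  iseqv :=
    { refl := fun _ => Or.inl rfl
      symm := by
        rintro z w (h | h)
        · exact Or.inl h.symm
        · exact Or.inr ⟨h.2, h.1⟩
      trans := by
        rintro z w v (rfl | h) (rfl | k)
        · exact Or.inl rfl
        · exact Or.inr k
        · exact Or.inr h
        · exact Or.inr ⟨h.1, k.2⟩ }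

/-- The smash product `X ∧ Y`: the quotient of the product by the wedge, with the quotient
topology. -/
def Smash : Type u := Quotient (wedgeSetoid x₀ y₀)

instance [TopologicalSpace X] [TopologicalSpace Y] : TopologicalSpace (Smash x₀ y₀) :=
  inferInstanceAs (TopologicalSpace (Quotient (wedgeSetoid x₀ y₀)))

/-- The quotient map to the smash product. -/
def Smash.proj (z : KProd X Y) : Smash x₀ y₀ := Quotient.mk (wedgeSetoid x₀ y₀) z

/-- The action on the smash product induced by the diagonal action. -/
instance : MulAction G (Smash x₀ y₀) where
  smul g := Quotient.map (sa := wedgeSetoid x₀ y₀) (sb := wedgeSetoid x₀ y₀) (fun z => g • z) (by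
    rintro z w (rfl | h)
    · exact Or.inl rfl
    · exact Or.inr ⟨smul_mem_wedge x₀ y₀ g h.1, smul_mem_wedge x₀ y₀ g h.2⟩)
  one_smul := by
    rintro ⟨z⟩
    exact congrArg (Smash.proj x₀ y₀) (one_smul G z)
  mul_smul g h := by
    rintro ⟨z⟩
    exact congrArg (Smash.proj x₀ y₀) (mul_smul g h z)

/-- The base point of the smash product, the image of the wedge. -/
def Smash.basePoint : MulAction.fixedPoints G (Smash x₀ y₀) :=
  ⟨Smash.proj x₀ y₀ (KProd.mk (x₀ : X) (y₀ : Y)), fun g =>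
    congrArg (Smash.proj x₀ y₀) (congrArg₂ KProd.mk (x₀.2 g) (y₀.2 g))⟩

variable {x₀ y₀}

/-- `e` is the smash product of the based `G`-CW structures `c` and `d`: the `n`-skeleton of the
smash product is the image of the union of the products `X^p × Y^q` of skeleta with `p + q = n`. -/
def IsSmashStructure [TopologicalSpace X] [TopologicalSpace Y] (c : BasedGCWComplex G X x₀)
    (d : BasedGCWComplex G Y y₀)
    (e : BasedGCWComplex G (Smash x₀ y₀) (Smash.basePoint x₀ y₀)) : Prop :=
  ∀ n : ℕ, e.skelLT (n + 1) = Smash.proj x₀ y₀ '' productSkeleton c d n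

end Products

end MackeyChains

end

/-!
# Cellular chains of products and smash products of `G`-CW complexes

The product and the smash product are both treated as a pairing `X × Y → Z` of relative complexes
`(X, D)` and `(Y, E)` with values in a relative complex `(Z, W)`, which collapses exactly
`D × Y ∪ X × E` to `W` (`ProductMap`). Here `D`, `E`, `W` are empty for the product and the base
points for the smash product. Products of cells are the cells of a structure on `Z`
(`ProductMap.product`). Its weak topology comes from the fact that a compact set meets finitely many
open cells, which suffices as the product carries the compactly generated topology
(`isClosed_kprod`).

The isomorphism of chain complexes has a geometric and an algebraic part.

*Geometry.* For each subgroup `H` the cross product of singular chains induces an isomorphism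
`⨁_{p + q = n} C_p(X)(G/H) ⊗ C_q(Y)(G/H) ≅ C_n(Z)(G/H)` which is natural in `G/H` and satisfies
the Leibniz rule (`ProductMap.crossMap_bijective`, `ProductMap.crossMap_d`). To obtain it,
cellular chains are represented by relative singular cycles of the fixed points of successive
skeleta (`RelGCWComplex.cellClass`). Barycentric subdivision gives excision (`RelIso.excision`),
hence the cells fixed by `H` form a basis of `C_n(X)(G/H)` for every choice of generators of
`H_n([-1, 1]ⁿ, ∂[-1, 1]ⁿ)` (`Attach.relBasis`, `RelGCWComplex.relBasis_fixed`). Since cross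
products of generators for cubes are generators (`relGen_cross`), the cross product maps the basis
of products of cells to a basis. Singular chains are realised from chains on tuples of points, on
which cones define the cross product and the subdivision by recursion.

*Algebra.* The left Kan extension `L` takes the pointwise tensor product of coefficient systems to
the box product of Mackey functors (`lanBoxIso`). One map sends `a ⊗ b` at `G/H` to the external
product of `a` and `b` restricted along the diagonal of `G/H`. Its inverse decomposes `G/H × G/K`
into orbits, on which the pullbacks of `a` and `b` along the projections are multiplied. The two are
inverse to each other since the identity of a finite `G`-set in the Burnside category is the sum
over its orbits (`sum_orbits`), and since an element that is defined orbitwise restricts as expected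
along maps of `G`-sets (`OrbSection.lanPost_contra_total`).

As `L` is additive, the decomposition of coefficient systems becomes one of Mackey functors, and the
Leibniz rule identifies the differential with that of the total complex (`totalIso`,
`ProductMap.nonempty_mackeyChains_iso`). Only the skeleta enter the definition of the cellular
chains, so the conclusion holds for every structure with the prescribed skeleta.
-/

noncomputable section

namespace MackeyChains

/-! ### Chains on tuples of points -/

section Tuples

variable {V W V' W' : Type*}

/-- The free abelian group on the `(n + 1)`-tuples of points of `V`. -/
abbrev Tup (V : Type*) (n : ℕ) : Type _ := (Fin (n + 1) → V) →₀ ℤ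

/-- A tuple as a chain. -/
abbrev tup {n : ℕ} (v : Fin (n + 1) → V) : Tup V n := Finsupp.single v 1

/-- The alternating sum of the faces of a tuple. In degree `0` it is zero, with values in degree
`0 - 1 = 0`. -/
def tupD : (n : ℕ) → Tup V n →ₗ[ℤ] Tup V (n - 1)
  | 0 => 0
  | n + 1 => Finsupp.linearCombination ℤ fun v : Fin (n + 2) → V =>
      ∑ i : Fin (n + 2), (-1 : ℤ) ^ (i : ℕ) • (tup (v ∘ i.succAbove) : Tup V n)

/-- The cone with apex `b`. -/
def tupCone (b : V) (n : ℕ) : Tup V n →ₗ[ℤ] Tup V (n + 1) :=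
  Finsupp.lmapDomain ℤ ℤ fun v : Fin (n + 1) → V => (Fin.cons b v : Fin (n + 2) → V)

/-- The map of tuple chains induced by a map of sets. -/
def tupMap (f : V → W) (n : ℕ) : Tup V n →ₗ[ℤ] Tup W n :=
  Finsupp.lmapDomain ℤ ℤ fun v => f ∘ v

lemma tupD_zero : (tupD 0 : Tup V 0 →ₗ[ℤ] Tup V 0) = 0 := rfl

lemma tupD_tup (n : ℕ) (v : Fin (n + 2) → V) :
    tupD (n + 1) (tup v) =
      ∑ i : Fin (n + 2), (-1 : ℤ) ^ (i : ℕ) • (tup (v ∘ i.succAbove) : Tup V n) := by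
  simp [tupD, tup]

lemma tupCone_tup (b : V) (n : ℕ) (v : Fin (n + 1) → V) :
    tupCone b n (tup v) = tup (Fin.cons b v : Fin (n + 2) → V) := by
  simp [tupCone, tup]

lemma tupMap_tup (f : V → W) (n : ℕ) (v : Fin (n + 1) → V) :
    tupMap f n (tup v) = tup (f ∘ v) := by
  simp [tupMap, tup]

lemma tup_hom_ext {n : ℕ} {A : Type*} [AddCommGroup A] {f g : Tup V n →ₗ[ℤ] A}
    (h : ∀ v, f (tup v) = g (tup v)) : f = g :=
  Finsupp.lhom_ext' fun v => LinearMap.ext_ring (h v)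

/-- Induction on chains with integral coefficients: sums and negatives of generators exhaust
them. -/
lemma tup_induct {n : ℕ} {p : Tup V n → Prop} (x : Tup V n) (zero : p 0) (of : ∀ v, p (tup v))
    (add : ∀ x y, p x → p y → p (x + y)) (neg : ∀ x, p x → p (-x)) : p x := by
  have key : ∀ (v) (k : ℤ), p (Finsupp.single v k) := by
    intro v k
    induction k using Int.induction_on with
    | zero => simpa using zero
    | succ k h => rw [Finsupp.single_add]; exact add _ _ h (of v)
    | pred k h => rw [Finsupp.single_sub, sub_eq_add_neg]; exact add _ _ h (neg _ (of v))
  induction x using Finsupp.induction_linear with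
  | zero => exact zero
  | add x y hx hy => exact add x y hx hy
  | single v k => exact key v k

lemma cons_comp_succAbove {n : ℕ} (b : V) (v : Fin (n + 2) → V) (i : Fin (n + 2)) :
    (Fin.cons b v : Fin (n + 3) → V) ∘ (i.succ).succAbove =
      (Fin.cons b (v ∘ i.succAbove) : Fin (n + 2) → V) := by
  funext k
  refine Fin.cases ?_ (fun k => ?_) k
  · simp
  · simp

/-- `∂ (b * x) = x - b * ∂ x` in positive degrees. -/
lemma tupD_cone (b : V) (n : ℕ) (x : Tup V (n + 1)) :
    tupD (n + 2) (tupCone b (n + 1) x) = x - tupCone b n (tupD (n + 1) x) := by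
  suffices h : (tupD (n + 2)).comp (tupCone b (n + 1)) =
      LinearMap.id - (tupCone b n).comp (tupD (n + 1)) from LinearMap.congr_fun h x
  refine tup_hom_ext fun v => ?_
  simp only [LinearMap.comp_apply, LinearMap.sub_apply, LinearMap.id_apply]
  rw [tupCone_tup, tupD_tup (n + 1), tupD_tup n, Fin.sum_univ_succ, map_sum, sub_eq_add_neg,
    ← Finset.sum_neg_distrib]
  congr 1
  · simp only [Fin.val_zero, pow_zero, one_smul]
    congr 1
  · refine Finset.sum_congr rfl fun i _ => ?_
    rw [cons_comp_succAbove, map_smul, tupCone_tup, Fin.val_succ, pow_succ, mul_neg_one, neg_smul]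

/-- The augmentation, the sum of the coefficients. -/
def tupAug (n : ℕ) : Tup V n →ₗ[ℤ] ℤ := Finsupp.linearCombination ℤ fun _ => 1

lemma tupAug_tup (n : ℕ) (v : Fin (n + 1) → V) : tupAug n (tup v) = 1 := by
  simp [tupAug, tup]

lemma tupD_one (v : Fin 2 → V) :
    tupD 1 (tup v) = (tup (fun _ => v 1) - tup (fun _ => v 0) : Tup V 0) := by
  rw [tupD_tup, Fin.sum_univ_two]
  have h0 : v ∘ (0 : Fin 2).succAbove = fun _ : Fin 1 => v 1 := by
    funext k; fin_cases k; rfl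
  have h1 : v ∘ (1 : Fin 2).succAbove = fun _ : Fin 1 => v 0 := by
    funext k; fin_cases k; rfl
  rw [h0, h1]
  simp [sub_eq_add_neg]

lemma tupAug_D (x : Tup V 1) : tupAug 0 (tupD 1 x) = 0 := by
  suffices h : (tupAug 0).comp (tupD 1) = (0 : Tup V 1 →ₗ[ℤ] ℤ) from LinearMap.congr_fun h x
  refine tup_hom_ext fun v => ?_
  rw [LinearMap.comp_apply, tupD_one]
  exact (map_sub (tupAug 0) _ _).trans (by rw [tupAug_tup, tupAug_tup]; simp)

/-- `∂ (b * x) = x - ε(x) b` in degree `0`. -/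
lemma tupD_cone_zero (b : V) (x : Tup V 0) :
    tupD 1 (tupCone b 0 x) = x - tupAug 0 x • (tup (fun _ => b) : Tup V 0) := by
  suffices h : (tupD 1).comp (tupCone b 0) =
      LinearMap.id - (tupAug 0).smulRight (tup (fun _ => b) : Tup V 0) from
    LinearMap.congr_fun h x
  refine tup_hom_ext fun v => ?_
  rw [LinearMap.comp_apply, tupCone_tup, tupD_one]
  have hv : (fun _ : Fin 1 => v 0) = v := by
    funext k; fin_cases k; rfl
  simp only [LinearMap.sub_apply, LinearMap.id_apply, LinearMap.smulRight_apply, tupAug_tup,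
    one_smul]
  congr 2

/-- Every tuple of positive degree is a cone, which reduces `∂ ∂ = 0` to the boundary formula of
cones. -/
lemma tup_eq_cone {n : ℕ} (v : Fin (n + 2) → V) :
    tup v = tupCone (v 0) n (tup (Fin.tail v)) := by
  rw [tupCone_tup, Fin.cons_self_tail]

lemma tupD_D : ∀ (n : ℕ) (x : Tup V n), tupD (n - 1) (tupD n x) = 0
  | 0, x => by simp [tupD_zero]
  | 1, x => by simp [tupD_zero]
  | n + 2, x => by
    suffices h : (tupD (n + 1)).comp (tupD (n + 2)) = (0 : Tup V (n + 2) →ₗ[ℤ] Tup V n) from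
      LinearMap.congr_fun h x
    refine tup_hom_ext fun v => ?_
    rw [LinearMap.comp_apply, tup_eq_cone, tupD_cone, map_sub]
    cases n with
    | zero =>
      rw [show tupD (0 + 1) (tupCone (v 0) 0 _) = _ from tupD_cone_zero _ _, tupAug_D]
      simp
    | succ n =>
      rw [tupD_cone]
      have := tupD_D (n + 2) (tup (Fin.tail v))
      simp only [Nat.add_one_sub_one] at this
      erw [this]
      simp

lemma tupMap_D (f : V → W) : ∀ (n : ℕ) (x : Tup V n),
    tupMap f (n - 1) (tupD n x) = tupD n (tupMap f n x)
  | 0, x => by simp [tupD_zero]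
  | n + 1, x => by
    suffices h : (tupMap f n).comp (tupD (n + 1)) = (tupD (n + 1)).comp (tupMap f (n + 1)) from
      LinearMap.congr_fun h x
    refine tup_hom_ext fun v => ?_
    rw [LinearMap.comp_apply, LinearMap.comp_apply, tupMap_tup, tupD_tup, tupD_tup, map_sum]
    refine Finset.sum_congr rfl fun i _ => ?_
    rw [map_smul, tupMap_tup]
    rfl

lemma tupMap_D_succ (f : V → W) (n : ℕ) (x : Tup V (n + 1)) :
    tupMap f n (tupD (n + 1) x) = tupD (n + 1) (tupMap f (n + 1) x) :=
  tupMap_D f (n + 1) x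

lemma tupMap_cone (f : V → W) (b : V) (n : ℕ) (x : Tup V n) :
    tupMap f (n + 1) (tupCone b n x) = tupCone (f b) n (tupMap f n x) := by
  suffices h : (tupMap f (n + 1)).comp (tupCone b n) = (tupCone (f b) n).comp (tupMap f n) from
    LinearMap.congr_fun h x
  refine tup_hom_ext fun v => ?_
  rw [LinearMap.comp_apply, LinearMap.comp_apply, tupMap_tup, tupCone_tup, tupCone_tup, tupMap_tup]
  congr 1
  funext k
  refine Fin.cases ?_ (fun k => ?_) k <;> rfl

/-- The bilinear extension of a function on pairs of generators. -/
def bilin {S T A : Type*} [AddCommGroup A] (f : S → T → A) : (S →₀ ℤ) →ₗ[ℤ] (T →₀ ℤ) →ₗ[ℤ] A :=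
  Finsupp.linearCombination ℤ fun s => Finsupp.linearCombination ℤ fun t => f s t

lemma bilin_single {S T A : Type*} [AddCommGroup A] (f : S → T → A) (s : S) (t : T) :
    bilin f (Finsupp.single s 1) (Finsupp.single t 1) = f s t := by
  simp [bilin]

lemma bilin_ext {S T A : Type*} [AddCommGroup A] {f g : (S →₀ ℤ) →ₗ[ℤ] (T →₀ ℤ) →ₗ[ℤ] A}
    (h : ∀ s t, f (Finsupp.single s 1) (Finsupp.single t 1) =
      g (Finsupp.single s 1) (Finsupp.single t 1)) : f = g :=
  Finsupp.lhom_ext' fun s => LinearMap.ext_ring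
    (Finsupp.lhom_ext' fun t => LinearMap.ext_ring (h s t))

/-- The cross product of tuple chains, with values in degree `n`. It is zero unless `n = p + q`. In
positive bidegrees `v × w` is the cone over `∂v × w ± v × ∂w` with apex `(v 0, w 0)`. -/
def tupCross : (n p q : ℕ) → Tup V p →ₗ[ℤ] Tup W q →ₗ[ℤ] Tup (V × W) n
  | n, 0, q => if h : q = n then
      bilin fun v w => tup fun i => (v 0, w (Fin.cast (congrArg (· + 1) h.symm) i)) else 0
  | n, p + 1, 0 => if h : p + 1 = n then
      bilin fun v w => tup fun i => (v (Fin.cast (congrArg (· + 1) h.symm) i), w 0) else 0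
  | 0, _ + 1, _ + 1 => 0
  | n + 1, p + 1, q + 1 => bilin fun v w => tupCone (v 0, w 0) n
      (tupCross n p (q + 1) (tupD (p + 1) (tup v)) (tup w) +
        (-1 : ℤ) ^ (p + 1) • tupCross n (p + 1) q (tup v) (tupD (q + 1) (tup w)))

lemma tupCross_zero_left (q : ℕ) (v : Fin 1 → V) (w : Fin (q + 1) → W) :
    tupCross q 0 q (tup v) (tup w) = tup fun i => (v 0, w i) := by
  simp only [tupCross, dite_true, bilin_single]
  rfl

lemma tupCross_zero_right (p : ℕ) (v : Fin (p + 1) → V) (w : Fin 1 → W) :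
    tupCross p p 0 (tup v) (tup w) = tup fun i => (v i, w 0) := by
  cases p with
  | zero =>
    rw [tupCross_zero_left]
    congr 1
    funext i
    rw [show i = 0 from Subsingleton.elim (α := Fin 1) i 0]
  | succ p =>
    simp only [tupCross, dite_true, bilin_single]
    rfl

lemma tupCross_succ (n p q : ℕ) (v : Fin (p + 2) → V) (w : Fin (q + 2) → W) :
    tupCross (n + 1) (p + 1) (q + 1) (tup v) (tup w) = tupCone (v 0, w 0) n
      (tupCross n p (q + 1) (tupD (p + 1) (tup v)) (tup w) +
        (-1 : ℤ) ^ (p + 1) • tupCross n (p + 1) q (tup v) (tupD (q + 1) (tup w))) := by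
  simp only [tupCross, bilin_single]

/-- Naturality of the cross product. -/
lemma tupMap_cross (f : V → V') (g : W → W') : ∀ (n p q : ℕ) (x : Tup V p) (y : Tup W q),
    tupMap (Prod.map f g) n (tupCross n p q x y) =
      tupCross n p q (tupMap f p x) (tupMap g q y) := by
  intro n
  induction n with
  | zero =>
    intro p q x y
    suffices h : (tupCross 0 p q).compr₂ (tupMap (Prod.map f g) 0) =
      (tupCross 0 p q).compl₁₂ (tupMap f p) (tupMap g q) from
      LinearMap.congr_fun (LinearMap.congr_fun h x) y
    refine bilin_ext fun v w => ?_
    simp only [LinearMap.compr₂_apply, LinearMap.compl₁₂_apply]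
    rw [tupMap_tup, tupMap_tup]
    rcases p with _ | p <;> rcases q with _ | q <;>
      simp [tupCross, bilin_single, tupMap_tup, Function.comp_def]
  | succ n ih =>
    intro p q x y
    suffices h : (tupCross (n + 1) p q).compr₂ (tupMap (Prod.map f g) (n + 1)) =
      (tupCross (n + 1) p q).compl₁₂ (tupMap f p) (tupMap g q) from
      LinearMap.congr_fun (LinearMap.congr_fun h x) y
    refine bilin_ext fun v w => ?_
    simp only [LinearMap.compr₂_apply, LinearMap.compl₁₂_apply]
    rw [tupMap_tup, tupMap_tup]
    rcases p with _ | p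
    · simp only [tupCross]
      split_ifs with h
      · simp [bilin_single, tupMap_tup, Function.comp_def]
      · simp
    rcases q with _ | q
    · simp only [tupCross]
      split_ifs with h
      · simp [bilin_single, tupMap_tup, Function.comp_def]
      · simp
    · rw [tupCross_succ, tupCross_succ, tupMap_cone, map_add, map_smul, ih, ih, ← tupMap_tup,
        ← tupMap_tup, tupMap_D_succ, tupMap_D_succ]
      rfl

/-- The Leibniz rule. -/
lemma tupD_cross : ∀ (n p q : ℕ), p + q = n → ∀ (x : Tup V p) (y : Tup W q),
    tupD n (tupCross n p q x y) = tupCross (n - 1) (p - 1) q (tupD p x) y +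
      (-1 : ℤ) ^ p • tupCross (n - 1) p (q - 1) x (tupD q y) := by
  intro n
  induction n with
  | zero =>
    intro p q h x y
    obtain rfl : p = 0 := by omega
    obtain rfl : q = 0 := by omega
    simp [tupD_zero]
  | succ n ih =>
    intro p q h x y
    suffices h : (tupCross (n + 1) p q).compr₂ (tupD (n + 1)) =
        (tupCross n (p - 1) q).compl₁₂ (tupD p) LinearMap.id +
        (-1 : ℤ) ^ p • (tupCross n p (q - 1)).compl₁₂ LinearMap.id (tupD q) from
      LinearMap.congr_fun (LinearMap.congr_fun h x) y
    refine bilin_ext fun v w => ?_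
    simp only [LinearMap.compr₂_apply, LinearMap.compl₁₂_apply, LinearMap.add_apply,
      LinearMap.smul_apply, LinearMap.id_apply]
    rcases p with _ | p
    · obtain rfl : q = n + 1 := by omega
      rw [tupCross_zero_left, tupD_zero]
      simp only [Nat.add_one_sub_one, LinearMap.zero_apply, map_zero, pow_zero, one_smul, zero_add]
      rw [tupD_tup, tupD_tup, map_sum]
      refine Finset.sum_congr rfl fun i _ => ?_
      rw [map_smul]
      exact congrArg _ (tupCross_zero_left n v (w ∘ i.succAbove)).symm
    rcases q with _ | q
    · obtain rfl : p = n := by omega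
      rw [tupCross_zero_right, tupD_zero]
      simp only [Nat.add_one_sub_one, LinearMap.zero_apply, map_zero, smul_zero, add_zero]
      rw [tupD_tup, tupD_tup, map_sum, LinearMap.sum_apply]
      refine Finset.sum_congr rfl fun i _ => ?_
      rw [map_smul, LinearMap.smul_apply]
      exact congrArg _ (tupCross_zero_right p (v ∘ i.succAbove) w).symm
    · obtain ⟨m, rfl⟩ : ∃ m, n = m + 1 := ⟨n - 1, by omega⟩
      have hv : tupD p (tupD (p + 1) (tup v)) = 0 := tupD_D (p + 1) (tup v)
      have hw : tupD q (tupD (q + 1) (tup w)) = 0 := tupD_D (q + 1) (tup w)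
      have h1 := ih p (q + 1) (by omega) (tupD (p + 1) (tup v)) (tup w)
      have h2 := ih (p + 1) q (by omega) (tup v) (tupD (q + 1) (tup w))
      rw [hv] at h1
      rw [hw] at h2
      simp only [Nat.add_one_sub_one, map_zero, LinearMap.zero_apply, zero_add, smul_zero,
        add_zero] at h1 h2 ⊢
      rw [tupCross_succ, tupD_cone, map_add, map_smul]
      erw [h1, h2]
      have h3 : ∀ z : Tup (V × W) m, (-1 : ℤ) ^ p • z + (-1 : ℤ) ^ (p + 1) • z = 0 := by
        intro z
        rw [pow_succ, mul_neg_one, neg_smul, add_neg_cancel]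
      -- the two mixed terms `∂v × ∂w` cancel
      erw [h3]
      simp

end Tuples

/-! ### Barycentric subdivision of tuples -/

section Subdivision

variable {V W : Type*} (β : ∀ n : ℕ, (Fin (n + 1) → V) → V)

/-- The subdivision of tuple chains determined by a choice `β` of barycentres. -/
def tupSd : (n : ℕ) → Tup V n →ₗ[ℤ] Tup V n
  | 0 => LinearMap.id
  | n + 1 => Finsupp.linearCombination ℤ fun v =>
      tupCone (β (n + 1) v) n (tupSd n (tupD (n + 1) (tup v)))

/-- The chain homotopy from the identity to the subdivision. -/
def tupSdH : (n : ℕ) → Tup V n →ₗ[ℤ] Tup V (n + 1)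
  | 0 => 0
  | n + 1 => Finsupp.linearCombination ℤ fun v => tupCone (β (n + 1) v) (n + 1)
      (tup v - tupSd β (n + 1) (tup v) - tupSdH n (tupD (n + 1) (tup v)))

lemma tupSd_tup (n : ℕ) (v : Fin (n + 2) → V) : tupSd β (n + 1) (tup v) =
    tupCone (β (n + 1) v) n (tupSd β n (tupD (n + 1) (tup v))) := by
  simp [tupSd, tup]

lemma tupSdH_tup (n : ℕ) (v : Fin (n + 2) → V) : tupSdH β (n + 1) (tup v) =
    tupCone (β (n + 1) v) (n + 1)
      (tup v - tupSd β (n + 1) (tup v) - tupSdH β n (tupD (n + 1) (tup v))) := by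
  simp [tupSdH, tup]

/-- Subdivision is a chain map. -/
lemma tupD_sd : ∀ (n : ℕ) (x : Tup V n), tupD n (tupSd β n x) = tupSd β (n - 1) (tupD n x)
  | 0, x => by simp [tupD_zero]
  | n + 1, x => by
    suffices h : (tupD (n + 1)).comp (tupSd β (n + 1)) = (tupSd β n).comp (tupD (n + 1)) from
      LinearMap.congr_fun h x
    refine tup_hom_ext fun v => ?_
    rw [LinearMap.comp_apply, LinearMap.comp_apply, tupSd_tup]
    cases n with
    | zero =>
      rw [show tupD (0 + 1) (tupCone _ 0 _) = _ from tupD_cone_zero _ _]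
      simp only [tupSd, LinearMap.id_apply]
      rw [show tupAug 0 (tupD (0 + 1) (tup v)) = 0 from tupAug_D _]
      simp
    | succ n =>
      have h := tupD_D (n + 2) (tup v)
      rw [tupD_cone, tupD_sd (n + 1)]
      simp only [Nat.add_one_sub_one] at h ⊢
      erw [h]
      simp

lemma tupD_sdH_zero (x : Tup V 0) : tupD 1 (tupSdH β 0 x) = 0 := by
  simp [tupSdH]

/-- The homotopy formula `∂ H = 1 - Sd - H ∂` in positive degrees. The chain in the definition of
`H` is a cycle by the formula in the previous degree, so that coning it off yields it back as a
boundary. -/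
lemma tupD_sdH_succ : ∀ (n : ℕ) (x : Tup V (n + 1)),
    (tupD (n + 2) (tupSdH β (n + 1) x) : Tup V (n + 1)) =
      x - tupSd β (n + 1) x - tupSdH β n (tupD (n + 1) x) := by
  intro n
  induction n with
  | zero =>
    intro x
    suffices h : (tupD 2).comp (tupSdH β 1) =
        LinearMap.id - tupSd β 1 - (tupSdH β 0).comp (tupD 1) from
      LinearMap.congr_fun h x
    refine tup_hom_ext fun v => ?_
    simp only [LinearMap.comp_apply, LinearMap.sub_apply, LinearMap.id_apply]
    have h1 : tupD 1 (tup v - tupSd β 1 (tup v) - tupSdH β 0 (tupD 1 (tup v))) = 0 := by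
      rw [map_sub, map_sub, tupD_sd β 1, tupD_sdH_zero]
      simp [tupSd]
    rw [show tupSdH β 1 (tup v) = _ from tupSdH_tup β 0 v, tupD_cone]
    erw [h1]
    simp
  | succ n ih =>
    intro x
    suffices h : (tupD (n + 3)).comp (tupSdH β (n + 2)) =
        LinearMap.id - tupSd β (n + 2) - (tupSdH β (n + 1)).comp (tupD (n + 2)) from
      LinearMap.congr_fun h x
    refine tup_hom_ext fun v => ?_
    simp only [LinearMap.comp_apply, LinearMap.sub_apply, LinearMap.id_apply]
    have h0 : tupD (n + 1) (tupD (n + 2) (tup v)) = 0 := tupD_D (n + 2) (tup v)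
    let e : Tup V (n + 2) →ₗ[ℤ] Tup V (n + 1) := tupD (n + 2)
    have hb : e (tupSd β (n + 2) (tup v)) = tupSd β (n + 1) (e (tup v)) := tupD_sd β (n + 2) _
    have hc : e (tupSdH β (n + 1) (e (tup v))) =
        e (tup v) - tupSd β (n + 1) (e (tup v)) - tupSdH β n (tupD (n + 1) (e (tup v))) :=
      ih _
    have h1 : e (tup v - tupSd β (n + 2) (tup v) - tupSdH β (n + 1) (e (tup v))) = 0 := by
      rw [map_sub, map_sub, hb, hc, show tupD (n + 1) (e (tup v)) = 0 from h0, map_zero, sub_zero,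
        sub_self]
    rw [tupSdH_tup]
    refine (tupD_cone _ _ _).trans ?_
    refine (congrArg (fun z => _ - tupCone (β (n + 2) v) (n + 1) z) h1).trans ?_
    rw [map_zero, sub_zero]

variable {β} {γ : ∀ n : ℕ, (Fin (n + 1) → W) → W}

/-- Subdivision is natural for maps that preserve the chosen barycentres. -/
lemma tupMap_sd (f : V → W) (hf : ∀ n v, f (β n v) = γ n (f ∘ v)) : ∀ (n : ℕ) (x : Tup V n),
    tupMap f n (tupSd β n x) = tupSd γ n (tupMap f n x)
  | 0, x => rfl
  | n + 1, x => by
    suffices h : (tupMap f (n + 1)).comp (tupSd β (n + 1)) =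
        (tupSd γ (n + 1)).comp (tupMap f (n + 1)) from LinearMap.congr_fun h x
    refine tup_hom_ext fun v => ?_
    simp only [LinearMap.comp_apply]
    rw [tupMap_tup, tupSd_tup, tupSd_tup, tupMap_cone, tupMap_sd f hf n, hf, ← tupMap_tup,
      ← tupMap_D]
    rfl

lemma tupMap_sdH (f : V → W) (hf : ∀ n v, f (β n v) = γ n (f ∘ v)) : ∀ (n : ℕ) (x : Tup V n),
    tupMap f (n + 1) (tupSdH β n x) = tupSdH γ n (tupMap f n x)
  | 0, x => by simp [tupSdH]
  | n + 1, x => by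
    suffices h : (tupMap f (n + 2)).comp (tupSdH β (n + 1)) =
        (tupSdH γ (n + 1)).comp (tupMap f (n + 1)) from LinearMap.congr_fun h x
    refine tup_hom_ext fun v => ?_
    simp only [LinearMap.comp_apply]
    have h := tupMap_sdH f hf n (tupD (n + 1) (tup v))
    rw [tupMap_D_succ, tupMap_tup] at h
    have h' := tupMap_sd f hf (n + 1) (tup v)
    rw [tupMap_tup] at h'
    rw [tupMap_tup, tupSdH_tup, tupSdH_tup, tupMap_cone, hf]
    refine congrArg _ ?_
    let e : Tup V (n + 1) →ₗ[ℤ] Tup V n := tupD (n + 1)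
    refine (map_sub (tupMap f (n + 1)) (tup v - tupSd β (n + 1) (tup v)) _).trans ?_
    refine congrArg₂ (· - ·) ?_ h
    rw [map_sub, h', tupMap_tup]

end Subdivision

/-! ### Singular chains -/

section Singular

/-- The topological `n`-simplex. -/
abbrev Simp (n : ℕ) : Type := stdSimplex ℝ (Fin (n + 1))

/-- The affine map of simplices with prescribed images of the vertices. -/
def bary {m n : ℕ} (u : Fin (m + 1) → Simp n) : C(Simp m, Simp n) where
  toFun t := ⟨fun j => ∑ i, t i * u i j,
    fun j => Finset.sum_nonneg fun i _ => mul_nonneg (t.2.1 i) ((u i).2.1 j), by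
      rw [Finset.sum_comm]
      simp_rw [← Finset.mul_sum]
      simp⟩
  continuous_toFun := by
    refine Continuous.subtype_mk (continuous_pi fun j => continuous_finsetSum _ fun i _ => ?_) _
    exact ((continuous_apply i).comp continuous_subtype_val).mul continuous_const

lemma bary_apply {m n : ℕ} (u : Fin (m + 1) → Simp n) (t : Simp m) (j : Fin (n + 1)) :
    bary u t j = ∑ i, t i * u i j := rfl

/-- The tuple of vertices of the simplex. -/
def verts (n : ℕ) : Fin (n + 1) → Simp n := fun i => stdSimplex.vertex i

/-- Spaces in which a tuple of points spans a singular simplex, compatibly with affine maps of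
simplices, such as simplices and their products. -/
class Bar (K : Type) [TopologicalSpace K] where
  bar : ∀ {m : ℕ}, (Fin (m + 1) → K) → C(Simp m, K)
  bar_bar : ∀ {m k : ℕ} (u : Fin (m + 1) → K) (w : Fin (k + 1) → Simp m),
    (bar u).comp (bary w) = bar fun i => bar u (w i)
  bar_verts : ∀ {m : ℕ} (u : Fin (m + 1) → K) (i : Fin (m + 1)), bar u (verts m i) = u i

open Bar (bar bar_bar bar_verts)

instance (n : ℕ) : Bar (Simp n) where
  bar := bary
  bar_bar u w := by
    ext t j
    change ∑ i, (∑ k, t k * w k i) * u i j = ∑ k, t k * ∑ i, w k i * u i j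
    simp_rw [Finset.sum_mul, Finset.mul_sum, mul_assoc]
    exact Finset.sum_comm
  bar_verts u i := by
    ext j
    change ∑ k, (Pi.single i (1 : ℝ) : Fin _ → ℝ) k * u k j = u i j
    simp [Pi.single_apply]

instance (K L : Type) [TopologicalSpace K] [TopologicalSpace L] [Bar K] [Bar L] : Bar (K × L) where
  bar u := (bar fun i => (u i).1).prodMk (bar fun i => (u i).2)
  bar_bar u w := by
    ext t
    · exact congrArg (fun f => f t) (bar_bar (fun i => (u i).1) w)
    · exact congrArg (fun f => f t) (bar_bar (fun i => (u i).2) w)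
  bar_verts u i := Prod.ext (bar_verts _ i) (bar_verts _ i)

lemma bary_verts_id (n : ℕ) : bary (verts n) = ContinuousMap.id _ := by
  ext t j
  change ∑ k, t k * (Pi.single k (1 : ℝ) : Fin _ → ℝ) j = t j
  simp [Pi.single_apply]

/-- The group of singular `n`-chains. -/
abbrev Ch (X : Type*) [TopologicalSpace X] (n : ℕ) : Type _ := C(Simp n, X) →₀ ℤ

variable {X Y Z : Type*} [TopologicalSpace X] [TopologicalSpace Y] [TopologicalSpace Z]
  {K L : Type} [TopologicalSpace K] [TopologicalSpace L] [Bar K] [Bar L]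

/-- A singular simplex as a chain. -/
abbrev sing {n : ℕ} (σ : C(Simp n, X)) : Ch X n := Finsupp.single σ 1

/-- The singular chain spanned by a chain of tuples in `K`, for a map `g : K → X`. -/
def real (g : C(K, X)) (n : ℕ) : Tup K n →ₗ[ℤ] Ch X n :=
  Finsupp.lmapDomain ℤ ℤ fun u => g.comp (bar u)

lemma real_tup (g : C(K, X)) (n : ℕ) (u : Fin (n + 1) → K) :
    real g n (tup u) = sing (g.comp (bar u)) := by
  simp [real, tup]

lemma real_verts {n : ℕ} (σ : C(Simp n, X)) : real σ n (tup (verts n)) = sing σ := by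
  rw [real_tup]
  congr 1
  exact (congrArg σ.comp (bary_verts_id n)).trans (ContinuousMap.comp_id σ)

/-- The singular chain map induced by a continuous map. -/
def chMap (f : C(X, Y)) (n : ℕ) : Ch X n →ₗ[ℤ] Ch Y n := Finsupp.lmapDomain ℤ ℤ f.comp

lemma chMap_sing (f : C(X, Y)) (n : ℕ) (σ : C(Simp n, X)) :
    chMap f n (sing σ) = sing (f.comp σ) := by
  simp [chMap]

lemma ch_hom_ext {n : ℕ} {A : Type*} [AddCommGroup A] {f g : Ch X n →ₗ[ℤ] A}
    (h : ∀ σ, f (sing σ) = g (sing σ)) : f = g :=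
  Finsupp.lhom_ext' fun v => LinearMap.ext_ring (h v)

lemma chMap_real (f : C(X, Y)) (g : C(K, X)) (n : ℕ) (x : Tup K n) :
    chMap f n (real g n x) = real (f.comp g) n x := by
  suffices h : (chMap f n).comp (real g n) = real (f.comp g) n from LinearMap.congr_fun h x
  refine tup_hom_ext fun v => ?_
  rw [LinearMap.comp_apply, real_tup, chMap_sing, real_tup, ContinuousMap.comp_assoc]

lemma chMap_id (n : ℕ) (x : Ch X n) : chMap (ContinuousMap.id X) n x = x := by
  suffices h : chMap (ContinuousMap.id X) n = LinearMap.id from LinearMap.congr_fun h x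
  refine ch_hom_ext fun σ => ?_
  rw [chMap_sing, ContinuousMap.id_comp, LinearMap.id_apply]

lemma chMap_comp (g : C(Y, Z)) (f : C(X, Y)) (n : ℕ) (x : Ch X n) :
    chMap g n (chMap f n x) = chMap (g.comp f) n x := by
  suffices h : (chMap g n).comp (chMap f n) = chMap (g.comp f) n from LinearMap.congr_fun h x
  refine ch_hom_ext fun σ => ?_
  rw [LinearMap.comp_apply, chMap_sing, chMap_sing, chMap_sing, ContinuousMap.comp_assoc]

/-- Compatibility of `real` with maps that carry spanned simplices to spanned simplices. -/
lemma real_comp (g : C(K, X)) (h : C(L, K)) (n : ℕ)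
    (hh : ∀ u : Fin (n + 1) → L, h.comp (bar u) = bar (h ∘ u)) (x : Tup L n) :
    real (g.comp h) n x = real g n (tupMap h n x) := by
  suffices e : real (g.comp h) n = (real g n).comp (tupMap h n) from LinearMap.congr_fun e x
  refine tup_hom_ext fun v => ?_
  rw [LinearMap.comp_apply, real_tup, tupMap_tup, real_tup, ContinuousMap.comp_assoc, hh]

lemma bar_comp_bar {m k : ℕ} (u : Fin (m + 1) → K) (w : Fin (k + 1) → Simp m) :
    (bar u).comp (bar w) = bar (bar u ∘ w) :=
  bar_bar u w

lemma bar_comp_verts {m : ℕ} (u : Fin (m + 1) → K) : bar u ∘ verts m = u :=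
  funext fun i => bar_verts u i

/-- The boundary of singular chains. In degree `0` it is zero, with values in degree
`0 - 1 = 0`. -/
def chD : (n : ℕ) → Ch X n →ₗ[ℤ] Ch X (n - 1)
  | 0 => 0
  | n + 1 => Finsupp.linearCombination ℤ fun σ => real σ n (tupD (n + 1) (tup (verts (n + 1))))

lemma chD_zero : (chD 0 : Ch X 0 →ₗ[ℤ] Ch X 0) = 0 := rfl

lemma chD_sing : ∀ (n : ℕ) (σ : C(Simp n, X)),
    chD n (sing σ) = real σ (n - 1) (tupD n (tup (verts n)))
  | 0, σ => by simp [chD_zero, tupD_zero]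
  | n + 1, σ => by simp [chD]

/-- Realisation is a chain map; identities of singular chains thus reduce to identities of
tuples. -/
lemma chD_real (g : C(K, X)) (n : ℕ) (x : Tup K n) :
    chD n (real g n x) = real g (n - 1) (tupD n x) := by
  suffices h : (chD n).comp (real g n) = (real g (n - 1)).comp (tupD n) from
    LinearMap.congr_fun h x
  refine tup_hom_ext fun u => ?_
  rw [LinearMap.comp_apply, LinearMap.comp_apply, real_tup, chD_sing, real_comp _ _ _
    (bar_comp_bar u), tupMap_D, tupMap_tup, bar_comp_verts]

lemma chMap_D (f : C(X, Y)) (n : ℕ) (x : Ch X n) :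
    chMap f (n - 1) (chD n x) = chD n (chMap f n x) := by
  suffices h : (chMap f (n - 1)).comp (chD n) = (chD n).comp (chMap f n) from
    LinearMap.congr_fun h x
  refine ch_hom_ext fun σ => ?_
  rw [LinearMap.comp_apply, LinearMap.comp_apply, chD_sing, chMap_real, chMap_sing, chD_sing]

lemma chD_D (n : ℕ) (x : Ch X n) : chD (n - 1) (chD n x) = 0 := by
  suffices h : (chD (n - 1)).comp (chD n) = (0 : Ch X n →ₗ[ℤ] Ch X (n - 1 - 1)) from
    LinearMap.congr_fun h x
  refine ch_hom_ext fun σ => ?_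
  rw [LinearMap.comp_apply, chD_sing, chD_real, tupD_D, map_zero, LinearMap.zero_apply]

/-! ### Chains in a subspace -/

/-- The chains of simplices contained in `A`. -/
def chSub (A : Set X) (n : ℕ) : Submodule ℤ (Ch X n) :=
  Finsupp.supported ℤ ℤ {σ : C(Simp n, X) | ∀ t, σ t ∈ A}

lemma sing_mem {A : Set X} {n : ℕ} {σ : C(Simp n, X)} (h : ∀ t, σ t ∈ A) :
    sing σ ∈ chSub A n :=
  Finsupp.single_mem_supported ℤ 1 h

/-- To contain the chains in `A`, a subgroup need only contain the simplices in `A`. -/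
lemma chSub_le {A : Set X} {n : ℕ} {M : Submodule ℤ (Ch X n)}
    (h : ∀ σ : C(Simp n, X), (∀ t, σ t ∈ A) → sing σ ∈ M) : chSub A n ≤ M := by
  rw [chSub, Finsupp.supported_eq_span_single, Submodule.span_le]
  rintro _ ⟨σ, hσ, rfl⟩
  exact h σ hσ

lemma chSub_mono {A B : Set X} (h : A ⊆ B) (n : ℕ) : chSub A n ≤ chSub B n :=
  Finsupp.supported_mono fun _ hσ t => h (hσ t)

lemma chSub_univ (n : ℕ) (x : Ch X n) : x ∈ chSub (Set.univ : Set X) n := by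
  rw [chSub, Finsupp.mem_supported]
  exact fun _ _ _ => trivial

lemma chSub_inter (A B : Set X) (n : ℕ) : chSub (A ∩ B) n = chSub A n ⊓ chSub B n := by
  rw [chSub, chSub, chSub, ← Finsupp.supported_inter]
  congr 1
  ext σ
  exact forall_and

lemma real_mem {A : Set X} {g : C(K, X)} (hg : ∀ t, g t ∈ A) (n : ℕ) (x : Tup K n) :
    real g n x ∈ chSub A n := by
  induction x using tup_induct with
  | zero => rw [map_zero]; exact zero_mem _
  | of v => rw [real_tup]; exact sing_mem fun t => hg _
  | add x y hx hy => rw [map_add]; exact add_mem hx hy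
  | neg x hx => rw [map_neg]; exact neg_mem hx

lemma chD_mem {A : Set X} {n : ℕ} {x : Ch X n} (hx : x ∈ chSub A n) :
    chD n x ∈ chSub A (n - 1) := by
  have : chSub A n ≤ (chSub A (n - 1)).comap (chD n) := chSub_le fun σ hσ => by
    rw [Submodule.mem_comap, chD_sing]
    exact real_mem hσ _ _
  exact this hx

lemma chMap_mem {A : Set X} {B : Set Y} {f : C(X, Y)} (hf : Set.MapsTo f A B) {n : ℕ} {x : Ch X n}
    (hx : x ∈ chSub A n) : chMap f n x ∈ chSub B n := by
  have : chSub A n ≤ (chSub B n).comap (chMap f n) := chSub_le fun σ hσ => by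
    rw [Submodule.mem_comap, chMap_sing]
    exact sing_mem fun t => hf (hσ t)
  exact this hx

/-! ### Cross products -/

/-- A map `X × Y → Z` that is continuous on products of compact spaces mapping to `X` and `Y`. -/
structure KMap (X Y Z : Type*) [TopologicalSpace X] [TopologicalSpace Y]
    [TopologicalSpace Z] where
  toFun : X → Y → Z
  cont : ∀ {K L : Type} [TopologicalSpace K] [TopologicalSpace L] [CompactSpace K] [CompactSpace L]
    (a : C(K, X)) (b : C(L, Y)), Continuous fun s : K × L => toFun (a s.1) (b s.2)

/-- The restriction of a `KMap` to a product of compact spaces. -/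
def KMap.comp (f : KMap X Y Z) {K L : Type} [TopologicalSpace K] [TopologicalSpace L]
    [CompactSpace K] [CompactSpace L] (a : C(K, X)) (b : C(L, Y)) : C(K × L, Z) :=
  ⟨fun s => f.toFun (a s.1) (b s.2), f.cont a b⟩

/-- A continuous map on the product. -/
def KMap.ofContinuous (f : C(X × Y, Z)) : KMap X Y Z where
  toFun x y := f (x, y)
  cont a b := by fun_prop

/-- The cross product of singular chains, with values in degree `n`. -/
def chCross (f : KMap X Y Z) (n p q : ℕ) : Ch X p →ₗ[ℤ] Ch Y q →ₗ[ℤ] Ch Z n :=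
  bilin fun σ τ => real (f.comp σ τ) n (tupCross n p q (tup (verts p)) (tup (verts q)))

lemma chCross_sing (f : KMap X Y Z) (n p q : ℕ) (σ : C(Simp p, X)) (τ : C(Simp q, Y)) :
    chCross f n p q (sing σ) (sing τ) =
      real (f.comp σ τ) n (tupCross n p q (tup (verts p)) (tup (verts q))) :=
  bilin_single _ σ τ

/-- The cross product of realised chains is the realisation of their cross product, by naturality of
the latter. -/
lemma chCross_real [CompactSpace K] [CompactSpace L] (f : KMap X Y Z) (n p q : ℕ) (σ : C(K, X))
    (τ : C(L, Y)) (x : Tup K p) (y : Tup L q) :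
    chCross f n p q (real σ p x) (real τ q y) = real (f.comp σ τ) n (tupCross n p q x y) := by
  suffices h : (chCross f n p q).compl₁₂ (real σ p) (real τ q) =
      (tupCross n p q).compr₂ (real (f.comp σ τ) n) from
    LinearMap.congr_fun (LinearMap.congr_fun h x) y
  refine bilin_ext fun u w => ?_
  simp only [LinearMap.compr₂_apply, LinearMap.compl₁₂_apply]
  have h1 : f.comp (σ.comp (bar u)) (τ.comp (bar w)) =
      (f.comp σ τ).comp ((bar u).prodMap (bar w)) := rfl
  have h2 : ∀ v : Fin (n + 1) → Simp p × Simp q, ((bar u).prodMap (bar w)).comp (bar v) =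
      bar ((bar u).prodMap (bar w) ∘ v) := by
    intro v
    ext t
    · exact congrArg (fun f => f t) (bar_bar u (fun i => (v i).1))
    · exact congrArg (fun f => f t) (bar_bar w (fun i => (v i).2))
  have h3 : (⇑((bar u).prodMap (bar w)) : Simp p × Simp q → K × L) =
    Prod.map (bar u) (bar w) := rfl
  rw [real_tup, real_tup, chCross_sing, h1, real_comp _ _ _ h2, h3, tupMap_cross, tupMap_tup,
    tupMap_tup, bar_comp_verts, bar_comp_verts]

lemma chCross_hom_ext {p q : ℕ} {A : Type*} [AddCommGroup A]
    {f g : Ch X p →ₗ[ℤ] Ch Y q →ₗ[ℤ] A}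
    (h : ∀ σ τ, f (sing σ) (sing τ) = g (sing σ) (sing τ)) : f = g :=
  bilin_ext h

/-- The Leibniz rule for the cross product of singular chains. -/
lemma chD_cross (f : KMap X Y Z) {n p q : ℕ} (h : p + q = n) (x : Ch X p) (y : Ch Y q) :
    chD n (chCross f n p q x y) = chCross f (n - 1) (p - 1) q (chD p x) y +
      (-1 : ℤ) ^ p • chCross f (n - 1) p (q - 1) x (chD q y) := by
  suffices e : (chCross f n p q).compr₂ (chD n) =
      (chCross f (n - 1) (p - 1) q).compl₁₂ (chD p) LinearMap.id +
      (-1 : ℤ) ^ p • (chCross f (n - 1) p (q - 1)).compl₁₂ LinearMap.id (chD q) from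
    LinearMap.congr_fun (LinearMap.congr_fun e x) y
  refine chCross_hom_ext fun σ τ => ?_
  simp only [LinearMap.compr₂_apply, LinearMap.compl₁₂_apply, LinearMap.add_apply,
    LinearMap.smul_apply, LinearMap.id_apply]
  rw [chCross_sing, chD_real, tupD_cross n p q h, map_add, map_smul, ← chCross_real, ← chCross_real,
    ← chD_real, ← chD_real, real_verts, real_verts]

/-- Naturality of the cross product. -/
lemma chMap_cross {X' Y' Z' : Type*} [TopologicalSpace X'] [TopologicalSpace Y']
    [TopologicalSpace Z'] {f : KMap X Y Z} {f' : KMap X' Y' Z'} {a : C(X, X')} {b : C(Y, Y')}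
    {c : C(Z, Z')} (h : ∀ x y, c (f.toFun x y) = f'.toFun (a x) (b y)) (n p q : ℕ) (x : Ch X p)
    (y : Ch Y q) :
    chMap c n (chCross f n p q x y) = chCross f' n p q (chMap a p x) (chMap b q y) := by
  suffices e : (chCross f n p q).compr₂ (chMap c n) =
      (chCross f' n p q).compl₁₂ (chMap a p) (chMap b q) from
    LinearMap.congr_fun (LinearMap.congr_fun e x) y
  refine chCross_hom_ext fun σ τ => ?_
  simp only [LinearMap.compr₂_apply, LinearMap.compl₁₂_apply]
  have e : c.comp (f.comp σ τ) = f'.comp (a.comp σ) (b.comp τ) :=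
    ContinuousMap.ext fun s => h _ _
  rw [chMap_sing, chMap_sing, chCross_sing, chCross_sing, chMap_real, e]

lemma chCross_mem {f : KMap X Y Z} {A : Set X} {B : Set Y} {C : Set Z}
    (h : ∀ x ∈ A, ∀ y ∈ B, f.toFun x y ∈ C) {n p q : ℕ} {x : Ch X p} {y : Ch Y q}
    (hx : x ∈ chSub A p) (hy : y ∈ chSub B q) : chCross f n p q x y ∈ chSub C n := by
  have h1 : ∀ σ : C(Simp p, X), (∀ t, σ t ∈ A) →
      chSub B q ≤ (chSub C n).comap (chCross f n p q (sing σ)) := fun σ hσ =>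
    chSub_le fun τ hτ => by
      rw [Submodule.mem_comap, chCross_sing]
      exact real_mem (fun t => h _ (hσ _) _ (hτ _)) _ _
  have h2 : chSub A p ≤ (chSub C n).comap ((chCross f n p q).flip y) :=
    chSub_le fun σ hσ => h1 σ hσ hy
  exact h2 hx

lemma bary_const {n m : ℕ} (s : Simp m) (t : Simp n) : bary (fun _ => s) t = s := by
  ext j
  rw [bary_apply, ← Finset.sum_mul, stdSimplex.sum_eq_one, one_mul]

lemma chCross_zero_right (f : KMap X Y Z) (p : ℕ) (σ : C(Simp p, X)) (τ : C(Simp 0, Y)) :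
    chCross f p p 0 (sing σ) (sing τ) =
      sing ⟨fun t => f.toFun (σ t) (τ (verts 0 0)),
        (f.cont σ τ).comp (continuous_id.prodMk continuous_const)⟩ := by
  rw [chCross_sing, tupCross_zero_right, real_tup]
  congr 1
  ext t
  change f.toFun (σ (bary (verts p) t)) (τ (bary (fun _ => verts 0 0) t)) = _
  rw [bary_verts_id, bary_const]
  rfl

lemma chCross_zero_left (f : KMap X Y Z) (q : ℕ) (σ : C(Simp 0, X)) (τ : C(Simp q, Y)) :
    chCross f q 0 q (sing σ) (sing τ) =
      sing ⟨fun t => f.toFun (σ (verts 0 0)) (τ t),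
        (f.cont σ τ).comp (continuous_const.prodMk continuous_id)⟩ := by
  rw [chCross_sing, tupCross_zero_left, real_tup]
  congr 1
  ext t
  change f.toFun (σ (bary (fun _ => verts 0 0) t)) (τ (bary (verts q) t)) = _
  rw [bary_verts_id, bary_const]
  rfl

/-! ### Subdivision of singular chains -/

/-- The barycentre of the simplex. -/
def centre (n : ℕ) : Simp n :=
  ⟨fun _ => 1 / ((n : ℝ) + 1), fun _ => by positivity, by
    simp only [Finset.sum_const, Finset.card_univ, Fintype.card_fin, nsmul_eq_mul]
    push_cast
    field_simp⟩

/-- The barycentre of a tuple. -/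
def barCentre (K : Type) [TopologicalSpace K] [Bar K] (n : ℕ) (v : Fin (n + 1) → K) : K :=
  bar v (centre n)

lemma bar_barCentre {m : ℕ} (u : Fin (m + 1) → K) (n : ℕ) (v : Fin (n + 1) → Simp m) :
    bar u (barCentre (Simp m) n v) = barCentre K n (bar u ∘ v) :=
  congrArg (fun f => f (centre n)) (bar_bar u v)

/-- Barycentric subdivision of singular chains. -/
def chSd (n : ℕ) : Ch X n →ₗ[ℤ] Ch X n :=
  Finsupp.linearCombination ℤ fun σ => real σ n (tupSd (barCentre (Simp n)) n (tup (verts n)))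

/-- The chain homotopy from the identity to barycentric subdivision. -/
def chSdH (n : ℕ) : Ch X n →ₗ[ℤ] Ch X (n + 1) :=
  Finsupp.linearCombination ℤ fun σ =>
    real σ (n + 1) (tupSdH (barCentre (Simp n)) n (tup (verts n)))

lemma chSd_sing (n : ℕ) (σ : C(Simp n, X)) :
    chSd n (sing σ) = real σ n (tupSd (barCentre (Simp n)) n (tup (verts n))) := by
  simp [chSd]

lemma chSdH_sing (n : ℕ) (σ : C(Simp n, X)) :
    chSdH n (sing σ) = real σ (n + 1) (tupSdH (barCentre (Simp n)) n (tup (verts n))) := by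
  simp [chSdH]

/-- Realisation commutes with subdivision, as affine maps preserve barycentres. -/
lemma chSd_real (g : C(K, X)) (n : ℕ) (x : Tup K n) :
    chSd n (real g n x) = real g n (tupSd (barCentre K) n x) := by
  suffices h : (chSd n).comp (real g n) = (real g n).comp (tupSd (barCentre K) n) from
    LinearMap.congr_fun h x
  refine tup_hom_ext fun u => ?_
  rw [LinearMap.comp_apply, LinearMap.comp_apply, real_tup, chSd_sing, real_comp _ _ _
    (bar_comp_bar u), tupMap_sd _ (bar_barCentre u), tupMap_tup, bar_comp_verts]

lemma chSdH_real (g : C(K, X)) (n : ℕ) (x : Tup K n) :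
    chSdH n (real g n x) = real g (n + 1) (tupSdH (barCentre K) n x) := by
  suffices h : (chSdH n).comp (real g n) = (real g (n + 1)).comp (tupSdH (barCentre K) n) from
    LinearMap.congr_fun h x
  refine tup_hom_ext fun u => ?_
  rw [LinearMap.comp_apply, LinearMap.comp_apply, real_tup, chSdH_sing, real_comp _ _ _
    (bar_comp_bar u), tupMap_sdH _ (bar_barCentre u), tupMap_tup, bar_comp_verts]

lemma chD_sd (n : ℕ) (x : Ch X n) : chD n (chSd n x) = chSd (n - 1) (chD n x) := by
  suffices h : (chD n).comp (chSd n) = (chSd (n - 1)).comp (chD n : Ch X n →ₗ[ℤ] _) from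
    LinearMap.congr_fun h x
  refine ch_hom_ext fun σ => ?_
  rw [LinearMap.comp_apply, LinearMap.comp_apply, chSd_sing, chD_real, tupD_sd, ← chSd_real,
    chD_sing]

lemma chD_sdH_succ (n : ℕ) (x : Ch X (n + 1)) :
    (chD (n + 2) (chSdH (n + 1) x) : Ch X (n + 1)) =
      x - chSd (n + 1) x - chSdH n (chD (n + 1) x) := by
  suffices h : (chD (n + 2)).comp (chSdH (n + 1)) =
      LinearMap.id - chSd (n + 1) - (chSdH n).comp (chD (n + 1) : Ch X (n + 1) →ₗ[ℤ] Ch X n) from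
    LinearMap.congr_fun h x
  refine ch_hom_ext fun σ => ?_
  simp only [LinearMap.comp_apply, LinearMap.sub_apply, LinearMap.id_apply]
  have h1 := tupD_sdH_succ (barCentre (Simp (n + 1))) n (tup (verts (n + 1)))
  have h2 := congrArg (real σ (n + 1)) h1
  rw [map_sub, map_sub, ← chSdH_real, real_verts] at h2
  rw [chSdH_sing, chSd_sing, chD_sing]
  exact (chD_real _ _ _).trans h2

lemma chSd_mem {A : Set X} {n : ℕ} {x : Ch X n} (hx : x ∈ chSub A n) : chSd n x ∈ chSub A n := by
  have : chSub A n ≤ (chSub A n).comap (chSd n) := chSub_le fun σ hσ => by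
    rw [Submodule.mem_comap, chSd_sing]
    exact real_mem hσ _ _
  exact this hx

lemma chSdH_mem {A : Set X} {n : ℕ} {x : Ch X n} (hx : x ∈ chSub A n) :
    chSdH n x ∈ chSub A (n + 1) := by
  have : chSub A n ≤ (chSub A (n + 1)).comap (chSdH n) := chSub_le fun σ hσ => by
    rw [Submodule.mem_comap, chSdH_sing]
    exact real_mem hσ _ _
  exact this hx

end Singular

/-! ### Relative cycles and boundaries -/

section Relative

open Bar (bar bar_bar bar_verts)

variable {X Y Z : Type*} [TopologicalSpace X] [TopologicalSpace Y] [TopologicalSpace Z]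

/-- The boundary in positive degrees, with values in the expected degree. -/
abbrev chDs (n : ℕ) : Ch X (n + 1) →ₗ[ℤ] Ch X n := chD (n + 1)

lemma chDs_mem {A : Set X} {n : ℕ} {x : Ch X (n + 1)} (hx : x ∈ chSub A (n + 1)) :
    chDs n x ∈ chSub A n :=
  chD_mem hx

lemma chMap_Ds (f : C(X, Y)) (n : ℕ) (x : Ch X (n + 1)) :
    chMap f n (chDs n x) = chDs n (chMap f (n + 1) x) :=
  chMap_D f (n + 1) x

/-- The relative `n`-cycles of `(A, A')`, as chains in the ambient space. -/
def relCyc (A A' : Set X) (n : ℕ) : Submodule ℤ (Ch X n) :=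
  chSub A n ⊓ (chSub A' (n - 1)).comap (chD n)

/-- The relative `n`-boundaries of `(A, A')`, as chains in the ambient space. -/
def relBdry (A A' : Set X) (n : ℕ) : Submodule ℤ (Ch X n) :=
  chSub A' n ⊔ (chSub A (n + 1)).map (chDs n)

lemma mem_relCyc {A A' : Set X} {n : ℕ} {z : Ch X n} :
    z ∈ relCyc A A' n ↔ z ∈ chSub A n ∧ chD n z ∈ chSub A' (n - 1) := Iff.rfl

lemma mem_relCyc_succ {A A' : Set X} {n : ℕ} {z : Ch X (n + 1)} :
    z ∈ relCyc A A' (n + 1) ↔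
      z ∈ chSub A (n + 1) ∧ chDs n z ∈ chSub A' n := Iff.rfl

lemma mem_relCyc_zero {A A' : Set X} {z : Ch X 0} : z ∈ relCyc A A' 0 ↔ z ∈ chSub A 0 :=
  ⟨fun h => h.1, fun h => ⟨h, show chD 0 z ∈ chSub A' 0 by simp [chD_zero]⟩⟩

lemma chD_D_succ (n : ℕ) (w : Ch X (n + 1)) : chD n (chDs n w) = 0 :=
  chD_D (n + 1) w

lemma mem_relBdry {A A' : Set X} {n : ℕ} {z : Ch X n} :
    z ∈ relBdry A A' n ↔ ∃ a ∈ chSub A' n, ∃ w ∈ chSub A (n + 1),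
      z = a + chDs n w := by
  rw [relBdry, Submodule.mem_sup]
  constructor
  · rintro ⟨a, ha, b, ⟨w, hw, rfl⟩, rfl⟩
    exact ⟨a, ha, w, hw, rfl⟩
  · rintro ⟨a, ha, w, hw, rfl⟩
    exact ⟨a, ha, _, ⟨w, hw, rfl⟩, rfl⟩

lemma chSub_le_relBdry (A A' : Set X) (n : ℕ) : chSub A' n ≤ relBdry A A' n := le_sup_left

lemma chD_mem_relBdry {A : Set X} (A' : Set X) {n : ℕ} {w : Ch X (n + 1)}
    (hw : w ∈ chSub A (n + 1)) : chDs n w ∈ relBdry A A' n :=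
  Submodule.mem_sup_right ⟨w, hw, rfl⟩

lemma relBdry_mono {A A' B B' : Set X} (h : A ⊆ B) (h' : A' ⊆ B') (n : ℕ) :
    relBdry A A' n ≤ relBdry B B' n :=
  sup_le_sup (chSub_mono h' n) (Submodule.map_mono (chSub_mono h _))

lemma relCyc_mono {A A' B B' : Set X} (h : A ⊆ B) (h' : A' ⊆ B') (n : ℕ) :
    relCyc A A' n ≤ relCyc B B' n :=
  inf_le_inf (chSub_mono h n) (Submodule.comap_mono (chSub_mono h' _))

lemma chMap_relCyc {f : C(X, Y)} {A A' : Set X} {B B' : Set Y} (h : Set.MapsTo f A B)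
    (h' : Set.MapsTo f A' B') {n : ℕ} {z : Ch X n} (hz : z ∈ relCyc A A' n) :
    chMap f n z ∈ relCyc B B' n := by
  refine mem_relCyc.2 ⟨chMap_mem h hz.1, ?_⟩
  rw [← chMap_D]
  exact chMap_mem h' hz.2

lemma chMap_relBdry {f : C(X, Y)} {A A' : Set X} {B B' : Set Y} (h : Set.MapsTo f A B)
    (h' : Set.MapsTo f A' B') {n : ℕ} {z : Ch X n} (hz : z ∈ relBdry A A' n) :
    chMap f n z ∈ relBdry B B' n := by
  obtain ⟨a, ha, w, hw, rfl⟩ := mem_relBdry.1 hz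
  refine mem_relBdry.2 ⟨_, chMap_mem h' ha, _, chMap_mem h hw, ?_⟩
  rw [map_add]
  exact congrArg _ (chMap_Ds f n w)

/-- `f` induces an isomorphism `H_n(A, A') → H_n(B, B')` of relative homology groups. -/
structure RelIso (f : C(X, Y)) (A A' : Set X) (B B' : Set Y) (n : ℕ) : Prop where
  mapsTo : Set.MapsTo f A B
  mapsTo' : Set.MapsTo f A' B'
  surj : ∀ z ∈ relCyc B B' n, ∃ y ∈ relCyc A A' n, z - chMap f n y ∈ relBdry B B' n
  inj : ∀ y ∈ relCyc A A' n, chMap f n y ∈ relBdry B B' n → y ∈ relBdry A A' n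

lemma RelIso.comp {f : C(X, Y)} {g : C(Y, Z)} {A A' : Set X} {B B' : Set Y} {C C' : Set Z} {n : ℕ}
    (hg : RelIso g B B' C C' n) (hf : RelIso f A A' B B' n) :
    RelIso (g.comp f) A A' C C' n where
  mapsTo := hg.mapsTo.comp hf.mapsTo
  mapsTo' := hg.mapsTo'.comp hf.mapsTo'
  surj z hz := by
    obtain ⟨y, hy, h1⟩ := hg.surj z hz
    obtain ⟨x, hx, h2⟩ := hf.surj y hy
    refine ⟨x, hx, ?_⟩
    have h3 := add_mem h1 (chMap_relBdry hg.mapsTo hg.mapsTo' h2)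
    rwa [map_sub, chMap_comp, sub_add_sub_cancel] at h3
  inj y hy h := by
    rw [← chMap_comp] at h
    exact hf.inj y hy (hg.inj _ (chMap_relCyc hf.mapsTo hf.mapsTo' hy) h)

lemma RelIso.of_comp {f : C(X, Y)} {g : C(Y, Z)} {A A' : Set X} {B B' : Set Y} {C C' : Set Z}
    {n : ℕ} (hg : RelIso g B B' C C' n) (hgf : RelIso (g.comp f) A A' C C' n)
    (h : Set.MapsTo f A B) (h' : Set.MapsTo f A' B') : RelIso f A A' B B' n where
  mapsTo := h
  mapsTo' := h'
  surj z hz := by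
    obtain ⟨y, hy, h1⟩ := hgf.surj _ (chMap_relCyc hg.mapsTo hg.mapsTo' hz)
    refine ⟨y, hy, hg.inj _ (sub_mem hz (chMap_relCyc h h' hy)) ?_⟩
    rwa [map_sub, chMap_comp]
  inj y hy hz := by
    refine hgf.inj y hy ?_
    rw [← chMap_comp]
    exact chMap_relBdry hg.mapsTo hg.mapsTo' hz

/-! ### Homotopy invariance -/

/-- The parameter `t ∈ [0, 1]` of a point of the `1`-simplex. -/
abbrev simpParam : C(Simp 1, unitInterval) := ⟨_, stdSimplexHomeomorphUnitInterval.continuous⟩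

/-- The map at time `t` of a homotopy. -/
def homAt (h : C(X × unitInterval, Y)) (t : unitInterval) : C(X, Y) :=
  h.comp ((ContinuousMap.id X).prodMk (ContinuousMap.const X t))

/-- The cross product with the fundamental class of the interval is a chain homotopy. -/
lemma homotopy_formula (h : C(X × unitInterval, Y)) {A A' : Set X} {B B' : Set Y}
    (hA : ∀ x ∈ A, ∀ t, h (x, t) ∈ B) (hA' : ∀ x ∈ A', ∀ t, h (x, t) ∈ B') {n : ℕ} {z : Ch X n}
    (hz : z ∈ relCyc A A' n) :
    chMap (homAt h 1) n z - chMap (homAt h 0) n z ∈ relBdry B B' n := by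
  let f : KMap X (Simp 1) Y := KMap.ofContinuous (h.comp ((ContinuousMap.id X).prodMap simpParam))
  -- the fundamental chain of the interval
  let ι : Ch (Simp 1) 1 := sing (ContinuousMap.id _)
  have hι : (chD 1 ι : Ch (Simp 1) 0) = sing (ContinuousMap.const _ (verts 1 1)) -
      sing (ContinuousMap.const _ (verts 1 0)) := by
    rw [chD_sing]
    erw [tupD_one]
    refine (map_sub (real (ContinuousMap.id (Simp 1)) 0) _ _).trans ?_
    rw [real_tup, real_tup]
    congr 2
    · ext t : 1
      exact bary_const _ _
    · ext t : 1
      exact bary_const _ _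
  have h1 : ∀ (i : Fin 2) (t : unitInterval) (ht : simpParam (verts 1 i) = t) (x : Ch X n),
      chCross f n n 0 x (sing (ContinuousMap.const _ (verts 1 i))) = chMap (homAt h t) n x := by
    intro i t ht x
    suffices e : (chCross f n n 0).flip (sing (ContinuousMap.const _ (verts 1 i))) =
      chMap (homAt h t) n from LinearMap.congr_fun e x
    refine ch_hom_ext fun σ => ?_
    rw [LinearMap.flip_apply, chCross_zero_right, chMap_sing, ← ht]
    rfl
  -- the Leibniz rule expresses `± (h₁ z - h₀ z)` through `∂ (z × ι)` and `∂z × ι`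
  have h2 : chD (n + 1) (chCross f (n + 1) n 1 z ι) = chCross f n (n - 1) 1 (chD n z) ι +
      (-1 : ℤ) ^ n • (chMap (homAt h 1) n z - chMap (homAt h 0) n z) := by
    refine (chD_cross f rfl z ι).trans ?_
    congr 2
    refine (congrArg (fun w => chCross f n n 0 z w) hι).trans ?_
    rw [map_sub, h1 1 1 (by exact stdSimplexHomeomorphUnitInterval_one),
      h1 0 0 (by exact stdSimplexHomeomorphUnitInterval_zero)]
  have h3 : (-1 : ℤ) ^ n • (chMap (homAt h 1) n z - chMap (homAt h 0) n z) ∈ relBdry B B' n := by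
    rw [← sub_eq_iff_eq_add'] at h2
    rw [← h2]
    refine sub_mem (chD_mem_relBdry B' ?_) (chSub_le_relBdry B B' n ?_)
    · exact chCross_mem (B := Set.univ) (fun x hx y _ => hA x hx _) hz.1 (chSub_univ _ _)
    · exact chCross_mem (B := Set.univ) (fun x hx y _ => hA' x hx _) hz.2 (chSub_univ _ _)
  have h4 := (relBdry B B' n).smul_mem ((-1 : ℤ) ^ n) h3
  rwa [smul_smul, ← mul_pow, neg_one_mul, neg_neg, one_pow, one_smul] at h4

/-- If a homotopy deforms `A` into `A'` through maps of pairs, then the relative homology of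
`(A, A')` vanishes. -/
lemma relCyc_le_relBdry_of_homotopy (h : C(X × unitInterval, X)) {A A' : Set X}
    (hA : ∀ x ∈ A, ∀ t, h (x, t) ∈ A) (hA' : ∀ x ∈ A', ∀ t, h (x, t) ∈ A')
    (h0 : ∀ x, h (x, 0) = x) (h1 : ∀ x ∈ A, h (x, 1) ∈ A') (n : ℕ) :
    relCyc A A' n ≤ relBdry A A' n := by
  intro z hz
  have e := homotopy_formula h hA hA' hz
  have e0 : homAt h 0 = ContinuousMap.id X := ContinuousMap.ext h0
  rw [e0, chMap_id] at e
  have e1 : chMap (homAt h 1) n z ∈ chSub A' n := chMap_mem (f := homAt h 1) h1 hz.1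
  have := sub_mem (chSub_le_relBdry A A' n e1) e
  rwa [sub_sub_cancel] at this

/-! ### Chains in a subspace as chains of the subspace -/

/-- The inclusion of a subspace. -/
abbrev subIncl (A : Set X) : C(A, X) := ⟨Subtype.val, continuous_subtype_val⟩

lemma chMap_injective {f : C(X, Y)} (hf : Function.Injective f) (n : ℕ) :
    Function.Injective (chMap f n) :=
  Finsupp.mapDomain_injective fun _ _ h => ContinuousMap.ext fun t =>
    hf (congrArg (fun g : C(Simp n, Y) => g t) h)

/-- Chains in the image of an embedding lift along it. -/
lemma exists_chMap_eq {f : C(X, Y)} (hf : IsEmbedding f) {A : Set X} {B : Set Y}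
    (h : ∀ y ∈ B, ∃ x ∈ A, f x = y) {n : ℕ} {z : Ch Y n} (hz : z ∈ chSub B n) :
    ∃ w ∈ chSub A n, chMap f n w = z := by
  have : chSub B n ≤ (chSub A n).map (chMap f n) := chSub_le fun σ hσ => by
    choose g hg hg' using fun t => h _ (hσ t)
    have hc : Continuous g := by
      rw [hf.continuous_iff]
      exact σ.continuous.congr fun t => (hg' t).symm
    refine ⟨sing ⟨g, hc⟩, sing_mem hg, ?_⟩
    rw [chMap_sing]
    congr 1
    exact ContinuousMap.ext hg'
  exact this hz

lemma mem_chSub_of_chMap {f : C(X, Y)} (hf : IsEmbedding f) {A : Set X} {B : Set Y}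
    (h : ∀ y ∈ B, ∃ x ∈ A, f x = y) {n : ℕ} {w : Ch X n} (hw : chMap f n w ∈ chSub B n) :
    w ∈ chSub A n := by
  obtain ⟨w', hw', e⟩ := exists_chMap_eq hf h hw
  rwa [← chMap_injective hf.injective n e]

/-- An embedding induces isomorphisms of the relative homology of pairs in its range. -/
lemma RelIso.of_isEmbedding {f : C(X, Y)} (hf : IsEmbedding f) {A A' : Set X} {B B' : Set Y}
    (h : Set.MapsTo f A B) (h' : Set.MapsTo f A' B') (hB : ∀ y ∈ B, ∃ x ∈ A, f x = y)
    (hB' : ∀ y ∈ B', ∃ x ∈ A', f x = y) (n : ℕ) : RelIso f A A' B B' n where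
  mapsTo := h
  mapsTo' := h'
  surj z hz := by
    obtain ⟨w, hw, rfl⟩ := exists_chMap_eq hf hB hz.1
    refine ⟨w, ⟨hw, ?_⟩, by rw [sub_self]; exact zero_mem _⟩
    refine mem_chSub_of_chMap hf hB' ?_
    rw [chMap_D]
    exact hz.2
  inj y hy hz := by
    obtain ⟨a, ha, w, hw, e⟩ := mem_relBdry.1 hz
    obtain ⟨a', ha', rfl⟩ := exists_chMap_eq hf hB' ha
    obtain ⟨w', hw', rfl⟩ := exists_chMap_eq hf hB hw
    refine mem_relBdry.2 ⟨a', ha', w', hw', chMap_injective hf.injective n ?_⟩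
    rw [e, ← chMap_Ds, map_add]

/-- If the relative homology of `(U, A')` vanishes, then `A'` may be replaced by `U` in the
relative homology of `(A, A')`. -/
lemma RelIso.of_acyclic {A U A' : Set X} (hU : U ⊆ A) (hA' : A' ⊆ U)
    (h : ∀ n, relCyc U A' n ≤ relBdry U A' n) (n : ℕ) :
    RelIso (ContinuousMap.id X) A A' A U n where
  mapsTo := Set.mapsTo_id _
  mapsTo' := hA'
  surj z hz := by
    simp only [chMap_id]
    cases n with
    | zero => exact ⟨z, mem_relCyc_zero.2 hz.1, by simp⟩
    | succ n =>
      -- the boundary of `z` is a relative cycle of `(U, A')`, hence `∂z = a + ∂w`, and `z - w` is a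
      -- cycle relative to `A'`
      have h1 : chDs n z ∈ relCyc U A' n :=
        mem_relCyc.2 ⟨(mem_relCyc_succ.1 hz).2, by rw [chD_D_succ]; exact zero_mem _⟩
      obtain ⟨a, ha, w, hw, e⟩ := mem_relBdry.1 (h n h1)
      refine ⟨z - w, mem_relCyc_succ.2 ⟨sub_mem hz.1 (chSub_mono hU _ hw), ?_⟩, ?_⟩
      · have e' : chDs n (z - w) = a := by
          rw [map_sub]
          exact sub_eq_of_eq_add e
        rwa [e']
      · rw [sub_sub_cancel]
        exact chSub_le_relBdry _ _ _ hw
  inj y hy hz := by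
    rw [chMap_id] at hz
    obtain ⟨u, hu, w, hw, rfl⟩ := mem_relBdry.1 hz
    have h1 : u ∈ relCyc U A' n := by
      refine ⟨hu, ?_⟩
      have h2 := (mem_relCyc.1 hy).2
      rwa [map_add, chD_D_succ, add_zero] at h2
    exact add_mem (relBdry_mono hU subset_rfl n (h n h1)) (chD_mem_relBdry A' hw)

/-! ### Small chains and excision -/

/-- A simplex lies in every closed ball around `x` that contains its vertices. -/
lemma dist_bary_le {m n : ℕ} {u : Fin (m + 1) → Simp n} {x : Simp n} {r : ℝ}
    (h : ∀ i, dist x (u i) ≤ r) (t : Simp m) : dist x (bary u t) ≤ r := by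
  have h0 : 0 ≤ r := dist_nonneg.trans (h 0)
  rw [Subtype.dist_eq, dist_pi_le_iff h0]
  intro j
  have h1 : ∀ i, |x j - u i j| ≤ r := fun i =>
    (dist_le_pi_dist (x : Fin (n + 1) → ℝ) (u i) j).trans (h i)
  have h2 : x j - bary u t j = ∑ i, t i * (x j - u i j) := by
    simp_rw [mul_sub, Finset.sum_sub_distrib, ← Finset.sum_mul]
    rw [stdSimplex.sum_eq_one, one_mul, bary_apply]
  change |x j - bary u t j| ≤ r
  rw [h2]
  calc |∑ i, t i * (x j - u i j)| ≤ ∑ i, |t i * (x j - u i j)| := Finset.abs_sum_le_sum_abs _ _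
    _ ≤ ∑ i, t i * r := Finset.sum_le_sum fun i _ => by
        rw [abs_mul, abs_of_nonneg (show 0 ≤ t i from t.2.1 i)]
        exact mul_le_mul_of_nonneg_left (h1 i) (t.2.1 i)
    _ = r := by rw [← Finset.sum_mul, stdSimplex.sum_eq_one, one_mul]

/-- The barycentre of a simplex with `m + 1` vertices is at distance at most `m / (m + 1)` times the
diameter from the vertices: the `k`-th summand of the average of `u i - u k` is zero. -/
lemma dist_centre_le {m n : ℕ} {u : Fin (m + 1) → Simp n} {r : ℝ}
    (h : ∀ i j, dist (u i) (u j) ≤ r) (k : Fin (m + 1)) :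
    dist (barCentre (Simp n) m u) (u k) ≤ m / (m + 1) * r := by
  have h0 : 0 ≤ r := dist_nonneg.trans (h 0 0)
  rw [Subtype.dist_eq, dist_pi_le_iff (by positivity)]
  intro j
  have h1 : ∀ i, |u i j - u k j| ≤ r := fun i =>
    (dist_le_pi_dist (u i : Fin (n + 1) → ℝ) (u k) j).trans (h i k)
  have h2 : barCentre (Simp n) m u j - u k j =
      ∑ i ∈ Finset.univ.erase k, 1 / ((m : ℝ) + 1) * (u i j - u k j) := by
    have h3 : barCentre (Simp n) m u j = ∑ i, 1 / ((m : ℝ) + 1) * u i j := rfl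
    have h4 : u k j = ∑ i : Fin (m + 1), 1 / ((m : ℝ) + 1) * u k j := by
      simp only [Finset.sum_const, Finset.card_univ, Fintype.card_fin, nsmul_eq_mul]
      push_cast
      field_simp
    rw [Finset.sum_erase _ (by rw [sub_self, mul_zero]), h3]
    conv_lhs => rw [h4]
    rw [← Finset.sum_sub_distrib]
    simp_rw [mul_sub]
  change |barCentre (Simp n) m u j - u k j| ≤ _
  rw [h2]
  calc |∑ i ∈ Finset.univ.erase k, 1 / ((m : ℝ) + 1) * (u i j - u k j)|
      ≤ ∑ i ∈ Finset.univ.erase k, |1 / ((m : ℝ) + 1) * (u i j - u k j)| :=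
        Finset.abs_sum_le_sum_abs _ _
    _ ≤ ∑ i ∈ Finset.univ.erase k, 1 / ((m : ℝ) + 1) * r := Finset.sum_le_sum fun i _ => by
        rw [abs_mul, abs_of_nonneg (by positivity : (0 : ℝ) ≤ 1 / ((m : ℝ) + 1))]
        exact mul_le_mul_of_nonneg_left (h1 i) (by positivity)
    _ = m / (m + 1) * r := by
        rw [Finset.sum_const, Finset.card_erase_of_mem (Finset.mem_univ k), Finset.card_univ,
          Fintype.card_fin, nsmul_eq_mul]
        simp only [Nat.add_one_sub_one]
        ring

/-- The tuples that occur in the subdivision of a tuple of diameter at most `r` have points in the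
simplex spanned by it, and diameter at most `m / (m + 1) * r`. -/
lemma tupSd_mesh {n : ℕ} : ∀ (m : ℕ) (u : Fin (m + 1) → Simp n) (r : ℝ),
    (∀ i j, dist (u i) (u j) ≤ r) → tupSd (barCentre (Simp n)) m (tup u) ∈
      Finsupp.supported ℤ ℤ {w : Fin (m + 1) → Simp n | (∀ i, w i ∈ Set.range (bary u)) ∧
        ∀ i j, dist (w i) (w j) ≤ m / (m + 1) * r} := by
  intro m
  induction m with
  | zero =>
    intro u r h
    refine Finsupp.single_mem_supported ℤ 1 ⟨fun i => ⟨verts 0 i, bar_verts u i⟩, fun i j => ?_⟩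
    rw [show i = j from Subsingleton.elim (α := Fin 1) i j, dist_self]
    simp
  | succ m ih =>
    intro u r h
    have h0 : 0 ≤ r := dist_nonneg.trans (h 0 0)
    rw [tupSd_tup, tupD_tup, map_sum, map_sum]
    refine Submodule.sum_mem _ fun i _ => ?_
    rw [map_smul, map_smul]
    refine Submodule.smul_mem _ _ ?_
    have h1 := ih (u ∘ i.succAbove) r fun j k => h _ _
    have h2 : Finsupp.supported ℤ ℤ {w : Fin (m + 1) → Simp n |
        (∀ j, w j ∈ Set.range (bary (u ∘ i.succAbove))) ∧
          ∀ j k, dist (w j) (w k) ≤ m / (m + 1) * r} ≤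
        (Finsupp.supported ℤ ℤ {w : Fin (m + 2) → Simp n | (∀ i, w i ∈ Set.range (bary u)) ∧
          ∀ i j, dist (w i) (w j) ≤ (m + 1 : ℕ) / ((m + 1 : ℕ) + 1) * r}).comap
          (tupCone (barCentre (Simp n) (m + 1) u) m) := by
      rw [Finsupp.supported_eq_span_single, Submodule.span_le]
      rintro _ ⟨w, ⟨hw, hw'⟩, rfl⟩
      rw [SetLike.mem_coe, Submodule.mem_comap]
      rw [tupCone_tup]
      have hr : ∀ j, w j ∈ Set.range (bary u) := fun j => by
        obtain ⟨t, ht⟩ := hw j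
        refine ⟨bary (verts (m + 1) ∘ i.succAbove) t, ?_⟩
        have e := congrArg (fun f => f t) (bar_bar u (verts (m + 1) ∘ i.succAbove))
        refine e.trans (Eq.trans ?_ ht)
        congr 2
        funext k
        exact bar_verts u _
      have hd : ∀ j, dist (barCentre (Simp n) (m + 1) u) (w j) ≤
          (m + 1 : ℕ) / ((m + 1 : ℕ) + 1) * r := fun j => by
        obtain ⟨t, ht⟩ := hr j
        rw [← ht]
        exact dist_bary_le (dist_centre_le h) t
      have hm : (m : ℝ) / (m + 1) * r ≤ (m + 1 : ℕ) / ((m + 1 : ℕ) + 1) * r := by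
        refine mul_le_mul_of_nonneg_right ?_ h0
        push_cast
        rw [div_le_div_iff₀ (by positivity) (by positivity)]
        nlinarith
      refine Finsupp.single_mem_supported ℤ 1 ⟨fun j => ?_, fun j k => ?_⟩
      · refine Fin.cases ⟨_, rfl⟩ (fun j => ?_) j
        exact hr j
      · refine Fin.cases ?_ (fun j => ?_) j <;> refine Fin.cases ?_ (fun k => ?_) k
        · rw [dist_self]; positivity
        · exact hd k
        · rw [dist_comm]; exact hd j
        · exact (hw' j k).trans hm
    exact h2 h1

lemma tupSd_mesh_supported {n : ℕ} (m : ℕ) (r : ℝ) :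
    Finsupp.supported ℤ ℤ {w : Fin (m + 1) → Simp n | ∀ i j, dist (w i) (w j) ≤ r} ≤
      (Finsupp.supported ℤ ℤ {w : Fin (m + 1) → Simp n |
        ∀ i j, dist (w i) (w j) ≤ m / (m + 1) * r}).comap (tupSd (barCentre (Simp n)) m) := by
  rw [Finsupp.supported_eq_span_single, Submodule.span_le]
  rintro _ ⟨w, hw, rfl⟩
  exact Finsupp.supported_mono (fun v hv => hv.2) (tupSd_mesh m w r hw)

lemma tupSd_iterate_mesh (n N : ℕ) : (tupSd (barCentre (Simp n)) n)^[N] (tup (verts n)) ∈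
    Finsupp.supported ℤ ℤ {w : Fin (n + 1) → Simp n |
      ∀ i j, dist (w i) (w j) ≤ (n / (n + 1) : ℝ) ^ N} := by
  induction N with
  | zero =>
    refine Finsupp.single_mem_supported ℤ 1 fun i j => ?_
    rw [pow_zero]
    exact (Metric.dist_le_diam_of_mem (bounded_stdSimplex _) (verts n i).2 (verts n j).2).trans
      diam_stdSimplex_le
  | succ N ih =>
    rw [Function.iterate_succ_apply', pow_succ']
    exact tupSd_mesh_supported n _ ih

lemma chSd_iterate_real {K : Type} [TopologicalSpace K] [Bar K] (g : C(K, X)) (n N : ℕ)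
    (x : Tup K n) :
    (chSd n)^[N] (real g n x) = real g n ((tupSd (barCentre K) n)^[N] x) := by
  induction N with
  | zero => rfl
  | succ N ih => rw [Function.iterate_succ_apply', Function.iterate_succ_apply', ih, chSd_real]

lemma chSd_iterate_mem {A : Set X} {n : ℕ} {x : Ch X n} (hx : x ∈ chSub A n) (N : ℕ) :
    (chSd n)^[N] x ∈ chSub A n := by
  induction N with
  | zero => exact hx
  | succ N ih => rw [Function.iterate_succ_apply']; exact chSd_mem ih

lemma chMap_sd (f : C(X, Y)) (n : ℕ) (x : Ch X n) :
    chMap f n (chSd n x) = chSd n (chMap f n x) := by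
  suffices h : (chMap f n).comp (chSd n) = (chSd n).comp (chMap f n) from LinearMap.congr_fun h x
  refine ch_hom_ext fun σ => ?_
  rw [LinearMap.comp_apply, LinearMap.comp_apply, chSd_sing, chMap_real, chMap_sing, chSd_sing]

lemma chMap_sd_iterate (f : C(X, Y)) (n N : ℕ) (x : Ch X n) :
    chMap f n ((chSd n)^[N] x) = (chSd n)^[N] (chMap f n x) := by
  induction N with
  | zero => rfl
  | succ N ih => rw [Function.iterate_succ_apply', Function.iterate_succ_apply', chMap_sd, ih]

lemma chD_sd_iterate (n N : ℕ) (x : Ch X n) :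
    chD n ((chSd n)^[N] x) = (chSd (n - 1))^[N] (chD n x) := by
  induction N with
  | zero => rfl
  | succ N ih => rw [Function.iterate_succ_apply', Function.iterate_succ_apply', chD_sd, ih]

/-- By the Lebesgue number lemma, a singular simplex becomes small with respect to an open cover
after iterated subdivision. -/
lemma exists_small_sing {U V : Set X} (hU : IsOpen U) (hV : IsOpen V) (h : U ∪ V = Set.univ) {n : ℕ}
    (σ : C(Simp n, X)) : ∃ N, (chSd n)^[N] (sing σ) ∈ chSub U n ⊔ chSub V n := by
  obtain ⟨δ, hδ, hL⟩ := lebesgue_number_lemma_of_metric (s := (Set.univ : Set (Simp n)))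
    (c := fun b : Bool => σ ⁻¹' (bif b then U else V)) isCompact_univ
    (fun b => by cases b; exacts [hV.preimage σ.continuous, hU.preimage σ.continuous])
    (fun t _ => by
      have : σ t ∈ U ∪ V := h ▸ Set.mem_univ _
      rcases this with h | h
      · exact Set.mem_iUnion.2 ⟨true, h⟩
      · exact Set.mem_iUnion.2 ⟨false, h⟩)
  have hn : (n / (n + 1) : ℝ) < 1 := by
    rw [div_lt_one (by positivity)]
    linarith
  obtain ⟨N, hN⟩ := exists_pow_lt_of_lt_one hδ hn
  refine ⟨N, ?_⟩
  rw [← real_verts, chSd_iterate_real]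
  have h1 : Finsupp.supported ℤ ℤ {w : Fin (n + 1) → Simp n |
      ∀ i j, dist (w i) (w j) ≤ (n / (n + 1) : ℝ) ^ N} ≤
      (chSub U n ⊔ chSub V n).comap (real σ n) := by
    rw [Finsupp.supported_eq_span_single, Submodule.span_le]
    rintro _ ⟨w, hw, rfl⟩
    rw [SetLike.mem_coe, Submodule.mem_comap]
    rw [real_tup]
    obtain ⟨b, hb⟩ := hL (w 0) trivial
    have h2 : ∀ t, bary w t ∈ Metric.ball (w 0) δ := fun t => by
      rw [Metric.mem_ball, dist_comm]
      exact (dist_bary_le (hw 0) t).trans_lt hN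
    cases b
    · exact Submodule.mem_sup_right (sing_mem fun t => hb (h2 t))
    · exact Submodule.mem_sup_left (sing_mem fun t => hb (h2 t))
  exact h1 (tupSd_iterate_mesh n N)

lemma small_iterate {U V : Set X} {n : ℕ} {x : Ch X n} (hx : x ∈ chSub U n ⊔ chSub V n) (N : ℕ) :
    (chSd n)^[N] x ∈ chSub U n ⊔ chSub V n := by
  induction N with
  | zero => exact hx
  | succ N ih =>
    rw [Function.iterate_succ_apply']
    obtain ⟨a, ha, b, hb, e⟩ := Submodule.mem_sup.1 ih
    rw [← e, map_add]
    exact Submodule.add_mem_sup (chSd_mem ha) (chSd_mem hb)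

lemma chSd_iterate_add (n N : ℕ) (x y : Ch X n) :
    (chSd n)^[N] (x + y) = (chSd n)^[N] x + (chSd n)^[N] y := by
  induction N with
  | zero => rfl
  | succ N ih => simp only [Function.iterate_succ_apply', ih, map_add]

lemma chSd_iterate_neg (n N : ℕ) (x : Ch X n) : (chSd n)^[N] (-x) = -(chSd n)^[N] x := by
  induction N with
  | zero => rfl
  | succ N ih => simp only [Function.iterate_succ_apply', ih, map_neg]

/-- Every singular chain becomes small with respect to an open cover after iterated subdivision. -/
lemma exists_small {U V : Set X} (hU : IsOpen U) (hV : IsOpen V) (h : U ∪ V = Set.univ) {n : ℕ}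
    (x : Ch X n) : ∃ N, ∀ M, N ≤ M → (chSd n)^[M] x ∈ chSub U n ⊔ chSub V n := by
  suffices h : ∃ N, (chSd n)^[N] x ∈ chSub U n ⊔ chSub V n by
    obtain ⟨N, hN⟩ := h
    refine ⟨N, fun M hM => ?_⟩
    obtain ⟨k, rfl⟩ := Nat.exists_eq_add_of_le' hM
    rw [Function.iterate_add_apply]
    exact small_iterate hN k
  -- a common number of subdivisions for a sum is the sum of those for its terms
  have key : ∀ x y : Ch X n, (∃ N, (chSd n)^[N] x ∈ chSub U n ⊔ chSub V n) →
      (∃ N, (chSd n)^[N] y ∈ chSub U n ⊔ chSub V n) →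
      ∃ N, (chSd n)^[N] (x + y) ∈ chSub U n ⊔ chSub V n := by
    rintro x y ⟨N, hN⟩ ⟨M, hM⟩
    refine ⟨N + M, ?_⟩
    rw [chSd_iterate_add]
    refine add_mem ?_ ?_
    · refine (congrArg (· ∈ _) ?_).mpr (small_iterate hN M)
      rw [← Function.iterate_add_apply, Nat.add_comm M N]
    · rw [Function.iterate_add_apply]
      exact small_iterate hM N
  have hneg : ∀ x : Ch X n, (∃ N, (chSd n)^[N] x ∈ chSub U n ⊔ chSub V n) →
      ∃ N, (chSd n)^[N] (-x) ∈ chSub U n ⊔ chSub V n := by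
    rintro x ⟨N, hN⟩
    exact ⟨N, by rw [chSd_iterate_neg]; exact neg_mem hN⟩
  have hmul : ∀ (σ : C(Simp n, X)) (k : ℤ),
      ∃ N, (chSd n)^[N] (Finsupp.single σ k) ∈ chSub U n ⊔ chSub V n := by
    intro σ k
    induction k using Int.induction_on with
    | zero => exact ⟨0, by simp⟩
    | succ k ih =>
      rw [Finsupp.single_add]
      exact key _ _ ih (exists_small_sing hU hV h σ)
    | pred k ih =>
      rw [Finsupp.single_sub, sub_eq_add_neg]
      exact key _ _ ih (hneg _ (exists_small_sing hU hV h σ))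
  induction x using Finsupp.induction_linear with
  | zero => exact ⟨0, zero_mem _⟩
  | add x y hx hy => exact key x y hx hy
  | single σ k => exact hmul σ k

lemma sd_mem_relCyc {A A' : Set X} {n : ℕ} {z : Ch X n} (hz : z ∈ relCyc A A' n) :
    chSd n z ∈ relCyc A A' n := by
  refine mem_relCyc.2 ⟨chSd_mem hz.1, ?_⟩
  rw [chD_sd]
  exact chSd_mem hz.2

/-- A relative cycle is homologous to its subdivision. -/
lemma sub_sd_mem_relBdry {A A' : Set X} {n : ℕ} {z : Ch X n} (hz : z ∈ relCyc A A' n) :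
    z - chSd n z ∈ relBdry A A' n := by
  cases n with
  | zero =>
    have : chSd 0 z = z := by
      suffices h : (chSd 0 : Ch X 0 →ₗ[ℤ] Ch X 0) = LinearMap.id from LinearMap.congr_fun h z
      refine ch_hom_ext fun σ => ?_
      rw [chSd_sing]
      exact real_verts σ
    rw [this, sub_self]
    exact zero_mem _
  | succ n =>
    refine mem_relBdry.2 ⟨chSdH n (chDs n z), chSdH_mem (mem_relCyc_succ.1 hz).2,
      chSdH (n + 1) z, chSdH_mem hz.1, ?_⟩
    have e : chDs (n + 1) (chSdH (n + 1) z) = z - chSd (n + 1) z - chSdH n (chDs n z) :=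
      chD_sdH_succ n z
    rw [e]
    abel

lemma sub_sd_iterate_mem_relBdry {A A' : Set X} {n : ℕ} {z : Ch X n} (hz : z ∈ relCyc A A' n)
    (N : ℕ) : (chSd n)^[N] z ∈ relCyc A A' n ∧ z - (chSd n)^[N] z ∈ relBdry A A' n := by
  induction N with
  | zero => exact ⟨hz, by simp⟩
  | succ N ih =>
    rw [Function.iterate_succ_apply']
    refine ⟨sd_mem_relCyc ih.1, ?_⟩
    have := add_mem ih.2 (sub_sd_mem_relBdry ih.1)
    rwa [sub_add_sub_cancel] at this

/-- Excision: if `U` and `V` form an open cover of `Y`, and `f` restricts to a homeomorphism over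
`V` with inverse `g`, then `f` induces an isomorphism of the homology of the spaces relative to `U`
and its preimage. -/
lemma RelIso.excision {f : C(X, Y)} {U V : Set Y} (hU : IsOpen U) (hV : IsOpen V)
    (h : U ∪ V = Set.univ) (g : C(V, X)) (hfg : ∀ v, f (g v) = v)
    (hgf : ∀ x (hx : f x ∈ V), g ⟨f x, hx⟩ = x) (n : ℕ) :
    RelIso f Set.univ (f ⁻¹' U) Set.univ U n := by
  -- the lift along `f` of chains in `V`
  have hlift : ∀ {m : ℕ} {v : Ch Y m}, v ∈ chSub V m → ∃ w : Ch V m, chMap (subIncl V) m w = v :=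
    fun hv => by
      obtain ⟨w, _, e⟩ := exists_chMap_eq (f := subIncl V) (A := Set.univ)
        IsEmbedding.subtypeVal (fun y hy => ⟨⟨y, hy⟩, trivial, rfl⟩) hv
      exact ⟨w, e⟩
  have hfg' : f.comp g = subIncl V := ContinuousMap.ext hfg
  have hgU : Set.MapsTo g (Subtype.val ⁻¹' U) (f ⁻¹' U) := fun v hv => by
    rw [Set.mem_preimage, hfg]
    exact hv
  have hUV : ∀ {m : ℕ} {w : Ch V m}, chMap (subIncl V) m w ∈ chSub U m →
      chMap g m w ∈ chSub (f ⁻¹' U) m := fun {m w} hw => by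
    refine chMap_mem hgU (mem_chSub_of_chMap (f := subIncl V) (B := U ∩ V) IsEmbedding.subtypeVal
      (fun y hy => ⟨⟨y, hy.2⟩, hy.1, rfl⟩) ?_)
    rw [chSub_inter]
    exact ⟨hw, chMap_mem (fun v _ => v.2) (chSub_univ m w)⟩
  refine ⟨Set.mapsTo_univ _ _, fun x hx => hx, fun z hz => ?_, fun y hy hfy => ?_⟩
  -- surjectivity: write a subdivision of `z` as `a + b` with `a` in `U`, `b` in `V`, and lift `b`
  · obtain ⟨N, hN⟩ := exists_small hU hV h z
    obtain ⟨hc, hb⟩ := sub_sd_iterate_mem_relBdry hz N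
    obtain ⟨a, ha, b, hb', e⟩ := Submodule.mem_sup.1 (hN N le_rfl)
    obtain ⟨w, rfl⟩ := hlift hb'
    refine ⟨chMap g n w, mem_relCyc.2 ⟨chSub_univ _ _, ?_⟩, ?_⟩
    · rw [← chMap_D]
      refine hUV ?_
      rw [chMap_D, ← add_sub_cancel_left a (chMap (subIncl V) n w), e, map_sub]
      exact sub_mem hc.2 (chD_mem ha)
    · rw [chMap_comp, hfg']
      have h2 := add_mem hb (chSub_le_relBdry Set.univ U n ha)
      rwa [← e, ← sub_sub, sub_right_comm, sub_add_cancel] at h2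
  -- injectivity: subdivide both `y` and the chain `w` bounded by its image
  · obtain ⟨u, hu, w, -, e⟩ := mem_relBdry.1 hfy
    obtain ⟨N₁, hN₁⟩ := exists_small (hU.preimage f.continuous) (hV.preimage f.continuous)
      (by rw [← Set.preimage_union, h, Set.preimage_univ]) y
    obtain ⟨N₂, hN₂⟩ := exists_small hU hV h w
    let N := max N₁ N₂
    obtain ⟨a, ha, b, hb, e1⟩ := Submodule.mem_sup.1 (hN₁ N (le_max_left _ _))
    obtain ⟨a', ha', b', hb', e2⟩ := Submodule.mem_sup.1 (hN₂ N (le_max_right _ _))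
    obtain ⟨hc, hy'⟩ := sub_sd_iterate_mem_relBdry hy N
    -- the part of the subdivided cycle over `V`, as a chain of `V`
    obtain ⟨s, hs⟩ := hlift (chMap_mem (f := f) (fun x hx => hx) hb)
    obtain ⟨w', hw'⟩ := hlift hb'
    have hgs : chMap g n s = b := by
      have hi : ∀ {m : ℕ} {c : Ch X m}, c ∈ chSub (f ⁻¹' V) m → ∀ s : Ch V m,
          chMap (subIncl V) m s = chMap f m c → chMap g m s = c := by
        intro m c hc s hs
        obtain ⟨c', -, rfl⟩ := exists_chMap_eq (f := subIncl (f ⁻¹' V)) (A := Set.univ)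
          IsEmbedding.subtypeVal (fun y hy => ⟨⟨y, hy⟩, trivial, rfl⟩) hc
        let r : C(f ⁻¹' V, V) := ⟨fun x => ⟨f x, x.2⟩, by fun_prop⟩
        have h1 : (subIncl V).comp r = f.comp (subIncl _) := rfl
        rw [chMap_comp, ← h1, ← chMap_comp] at hs
        rw [chMap_injective (f := subIncl V) Subtype.val_injective m hs, chMap_comp]
        congr 2
        ext x
        exact hgf _ x.2
      exact hi hb s hs
    have key : chMap g n (s - chDs n w') ∈ chSub (f ⁻¹' U) n := by
      refine hUV ?_
      have e3 := congrArg (chSd n)^[N] e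
      rw [chSd_iterate_add, ← chMap_sd_iterate, ← e1, map_add,
        show (chSd n)^[N] (chDs n w) = chDs n ((chSd (n + 1))^[N] w) from
          (chD_sd_iterate (n + 1) N w).symm, ← e2, map_add, ← hs, ← hw'] at e3
      have e4 : chMap (subIncl V) n (chDs n w') =
        chDs n (chMap (subIncl V) (n + 1) w') := chMap_Ds _ n w'
      have e5 : chMap (subIncl V) n (s - chDs n w') =
          (chSd n)^[N] u + chDs n a' - chMap f n a := by
        rw [map_sub, e4]
        have e6 : ∀ (A S U' D B : Ch Y n), A + S = U' + (D + B) → S - B = U' + D - A := by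
          intro A S U' D B h
          rw [eq_sub_iff_add_eq, ← sub_eq_iff_eq_add.2 (h.trans (add_assoc _ _ _).symm)]
          abel
        exact e6 _ _ _ _ _ e3
      rw [e5]
      exact sub_mem (add_mem (chSd_iterate_mem hu N) (chDs_mem ha'))
        (chMap_mem (fun x hx => hx) ha)
    have h3 : (chSd n)^[N] y ∈ relBdry Set.univ (f ⁻¹' U) n := by
      rw [← e1, ← hgs]
      rw [map_sub] at key
      have h4 := add_mem (chSub_le_relBdry Set.univ _ n (add_mem ha key))
        (chD_mem_relBdry (A := Set.univ) (f ⁻¹' U) (chSub_univ (n + 1) (chMap g (n + 1) w')))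
      have e7 : chMap g n (chDs n w') = chDs n (chMap g (n + 1) w') :=
        chMap_Ds g n w'
      rw [e7] at h4
      have e8 : ∀ A B C : Ch X n, A + (B - C) + C = A + B := fun A B C => by abel
      rwa [e8] at h4
    have := add_mem hy' h3
    rwa [sub_add_cancel] at this

end Relative

/-! ### Cross products of relative classes -/

section RelCross

variable {X Y Z : Type*} [TopologicalSpace X] [TopologicalSpace Y] [TopologicalSpace Z]
  {f : KMap X Y Z} {A A' : Set X} {B B' : Set Y} {C C' : Set Z}

lemma chCross_relCyc (hA' : ∀ x ∈ A', ∀ y ∈ B, f.toFun x y ∈ C')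
    (hB' : ∀ x ∈ A, ∀ y ∈ B', f.toFun x y ∈ C') (h : ∀ x ∈ A, ∀ y ∈ B, f.toFun x y ∈ C)
    {n p q : ℕ} (hn : p + q = n) {x : Ch X p} {y : Ch Y q} (hx : x ∈ relCyc A A' p)
    (hy : y ∈ relCyc B B' q) : chCross f n p q x y ∈ relCyc C C' n := by
  refine mem_relCyc.2 ⟨chCross_mem h hx.1 hy.1, ?_⟩
  rw [chD_cross f hn]
  exact add_mem (chCross_mem hA' hx.2 hy.1)
    (Submodule.smul_mem _ _ (chCross_mem hB' hx.1 hy.2))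

/-- The cross product of a relative boundary and a relative cycle is a relative boundary, by the
Leibniz rule for the chain that is bounded. -/
lemma chCross_relBdry_left (hA' : ∀ x ∈ A', ∀ y ∈ B, f.toFun x y ∈ C')
    (hB' : ∀ x ∈ A, ∀ y ∈ B', f.toFun x y ∈ C') (h : ∀ x ∈ A, ∀ y ∈ B, f.toFun x y ∈ C)
    {n p q : ℕ} (hn : p + q = n) {x : Ch X p} {y : Ch Y q} (hx : x ∈ relBdry A A' p)
    (hy : y ∈ relCyc B B' q) : chCross f n p q x y ∈ relBdry C C' n := by
  obtain ⟨a, ha, w, hw, rfl⟩ := mem_relBdry.1 hx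
  rw [map_add, LinearMap.add_apply]
  refine add_mem (chSub_le_relBdry _ _ _ (chCross_mem hA' ha hy.1)) ?_
  have e : chDs n (chCross f (n + 1) (p + 1) q w y) = chCross f n p q (chDs p w) y +
      (-1 : ℤ) ^ (p + 1) • chCross f n (p + 1) (q - 1) w (chD q y) :=
    chD_cross f (by omega) w y
  rw [← sub_eq_iff_eq_add] at e
  rw [← e]
  exact sub_mem (chD_mem_relBdry C' (chCross_mem h hw hy.1)) (Submodule.smul_mem _ _
    (chSub_le_relBdry _ _ _ (chCross_mem hB' hw hy.2)))

lemma chCross_relBdry_right (hA' : ∀ x ∈ A', ∀ y ∈ B, f.toFun x y ∈ C')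
    (hB' : ∀ x ∈ A, ∀ y ∈ B', f.toFun x y ∈ C') (h : ∀ x ∈ A, ∀ y ∈ B, f.toFun x y ∈ C)
    {n p q : ℕ} (hn : p + q = n) {x : Ch X p} {y : Ch Y q} (hx : x ∈ relCyc A A' p)
    (hy : y ∈ relBdry B B' q) : chCross f n p q x y ∈ relBdry C C' n := by
  obtain ⟨b, hb, w, hw, rfl⟩ := mem_relBdry.1 hy
  rw [map_add]
  refine add_mem (chSub_le_relBdry _ _ _ (chCross_mem hB' hx.1 hb)) ?_
  have e : chDs n (chCross f (n + 1) p (q + 1) x w) =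
      chCross f n (p - 1) (q + 1) (chD p x) w + (-1 : ℤ) ^ p • chCross f n p q x (chDs q w) :=
    chD_cross f (by omega) x w
  rw [← sub_eq_iff_eq_add'] at e
  have h1 : (-1 : ℤ) ^ p • chCross f n p q x (chDs q w) ∈ relBdry C C' n := by
    rw [← e]
    exact sub_mem (chD_mem_relBdry C' (chCross_mem h hx.1 hw))
      (chSub_le_relBdry _ _ _ (chCross_mem hA' hx.2 hw))
  have h2 := (relBdry C C' n).smul_mem ((-1 : ℤ) ^ p) h1
  rwa [smul_smul, ← mul_pow, neg_one_mul, neg_neg, one_pow, one_smul] at h2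

end RelCross

/-! ### Bases of relative homology groups -/

section Bases

variable {X Y : Type*} [TopologicalSpace X] [TopologicalSpace Y] {J : Type*}

/-- The classes of the relative cycles `b j` form a basis of `H_n(A, A')`. -/
structure RelBasis (A A' : Set X) (n : ℕ) (b : J → Ch X n) : Prop where
  mem : ∀ j, b j ∈ relCyc A A' n
  span : ∀ z ∈ relCyc A A' n, ∃ c : J →₀ ℤ, z - Finsupp.linearCombination ℤ b c ∈ relBdry A A' n
  indep : ∀ c : J →₀ ℤ, Finsupp.linearCombination ℤ b c ∈ relBdry A A' n → c = 0

/-- `H_n(A, A')` is infinite cyclic, generated by the class of the relative cycle `g`. -/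
structure RelGen (A A' : Set X) (n : ℕ) (g : Ch X n) : Prop where
  mem : g ∈ relCyc A A' n
  span : ∀ z ∈ relCyc A A' n, ∃ k : ℤ, z - k • g ∈ relBdry A A' n
  indep : ∀ k : ℤ, k • g ∈ relBdry A A' n → k = 0

lemma chMap_linearCombination (f : C(X, Y)) {n : ℕ} (b : J → Ch X n) (c : J →₀ ℤ) :
    chMap f n (Finsupp.linearCombination ℤ b c) =
      Finsupp.linearCombination ℤ (fun j => chMap f n (b j)) c := by
  rw [Finsupp.linearCombination_apply, Finsupp.linearCombination_apply, Finsupp.sum, Finsupp.sum,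
    map_sum]
  simp_rw [map_smul]

lemma linearCombination_mem {M : Type*} [AddCommGroup M] {S : Submodule ℤ M} {b : J → M}
    (h : ∀ j, b j ∈ S) (c : J →₀ ℤ) : Finsupp.linearCombination ℤ b c ∈ S := by
  rw [Finsupp.linearCombination_apply, Finsupp.sum]
  exact Submodule.sum_mem _ fun j _ => S.smul_mem _ (h j)

lemma RelBasis.map {f : C(X, Y)} {A A' : Set X} {B B' : Set Y} {n : ℕ} {b : J → Ch X n}
    (hb : RelBasis A A' n b) (hf : RelIso f A A' B B' n) :
    RelBasis B B' n fun j => chMap f n (b j) where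
  mem j := chMap_relCyc hf.mapsTo hf.mapsTo' (hb.mem j)
  span z hz := by
    obtain ⟨y, hy, h⟩ := hf.surj z hz
    obtain ⟨c, hc⟩ := hb.span y hy
    refine ⟨c, ?_⟩
    have := add_mem h (chMap_relBdry hf.mapsTo hf.mapsTo' hc)
    rwa [map_sub, sub_add_sub_cancel, chMap_linearCombination] at this
  indep c hc := by
    rw [← chMap_linearCombination] at hc
    exact hb.indep c (hf.inj _ (linearCombination_mem hb.mem c) hc)

lemma RelBasis.relGen [Unique J] {A A' : Set X} {n : ℕ} {b : J → Ch X n} (h : RelBasis A A' n b) :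
    RelGen A A' n (b default) where
  mem := h.mem _
  span z hz := by
    obtain ⟨c, hc⟩ := h.span z hz
    rw [Finsupp.unique_single c, Finsupp.linearCombination_single] at hc
    exact ⟨_, hc⟩
  indep k hk := by
    have := h.indep (Finsupp.single default k) (by rwa [Finsupp.linearCombination_single])
    rwa [Finsupp.single_eq_zero] at this

variable [TopologicalSpace J] [DiscreteTopology J]

/-- The inclusion of a component of the product with a discrete space. -/
def slice (X : Type*) [TopologicalSpace X] (j : J) : C(X, J × X) :=
  ⟨fun x => (j, x), by fun_prop⟩

open Classical in
/-- The part of a chain of `J × X` in the component with index `j`. -/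
def chComp (j : J) (n : ℕ) : Ch (J × X) n →ₗ[ℤ] Ch X n :=
  Finsupp.linearCombination ℤ fun σ =>
    if (σ (verts n 0)).1 = j then sing (ContinuousMap.snd.comp σ) else 0

/-- A singular simplex of `J × X` lies in a single component. -/
lemma fst_simp_eq {n : ℕ} (σ : C(Simp n, J × X)) (s t : Simp n) : (σ s).1 = (σ t).1 :=
  PreconnectedSpace.constant inferInstance (continuous_fst.comp σ.continuous)

open Classical in
lemma chComp_sing (j : J) (n : ℕ) (σ : C(Simp n, J × X)) (s : Simp n) : chComp j n (sing σ) =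
    if (σ s).1 = j then sing (ContinuousMap.snd.comp σ) else (0 : Ch X n) := by
  rw [fst_simp_eq σ s (verts n 0)]
  simp [chComp]

open Classical in
lemma chComp_real (j : J) (m n : ℕ) (σ : C(Simp m, J × X)) (x : Tup (Simp m) n) (s : Simp m) :
    chComp j n (real σ n x) =
      if (σ s).1 = j then real (ContinuousMap.snd.comp σ) n x else (0 : Ch X n) := by
  have h : (chComp j n).comp (real σ n) =
      if (σ s).1 = j then real (ContinuousMap.snd.comp σ) n else
        (0 : Tup (Simp m) n →ₗ[ℤ] Ch X n) := by
    refine tup_hom_ext fun u => ?_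
    rw [LinearMap.comp_apply, real_tup, chComp_sing j n _ (verts n 0), ContinuousMap.comp_apply,
      fst_simp_eq σ _ s]
    split_ifs
    · rw [real_tup, ContinuousMap.comp_assoc]
    · rfl
  have := LinearMap.congr_fun h x
  rw [LinearMap.comp_apply] at this
  rw [this]
  split_ifs <;> rfl

lemma chComp_D (j : J) (n : ℕ) (x : Ch (J × X) n) :
    chComp j (n - 1) (chD n x) = chD n (chComp j n x) := by
  classical
  suffices h : (chComp j (n - 1)).comp (chD n) = (chD n).comp (chComp j n) from
    LinearMap.congr_fun h x
  refine ch_hom_ext fun σ => ?_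
  rw [LinearMap.comp_apply, LinearMap.comp_apply, chD_sing, chComp_real j _ _ _ _ (verts n 0),
    chComp_sing j n σ (verts n 0)]
  split_ifs
  · rw [chD_sing]
  · rw [map_zero]

lemma chComp_mem (j : J) {n : ℕ} {A : Set X} {x : Ch (J × X) n}
    (hx : x ∈ chSub (Prod.snd ⁻¹' A : Set (J × X)) n) : chComp j n x ∈ chSub A n := by
  classical
  have : chSub (Prod.snd ⁻¹' A : Set (J × X)) n ≤ (chSub A n).comap (chComp j n) :=
    chSub_le fun σ hσ => by
      rw [Submodule.mem_comap, chComp_sing j n σ (verts n 0)]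
      split_ifs
      · exact sing_mem fun t => hσ t
      · exact zero_mem _
  exact this hx

lemma chComp_slice (i j : J) (n : ℕ) (x : Ch X n) [Decidable (i = j)] :
    chComp j n (chMap (slice X i) n x) = if i = j then x else 0 := by
  have h : (chComp j n).comp (chMap (slice X i) n) = if i = j then LinearMap.id else 0 := by
    refine ch_hom_ext fun σ => ?_
    rw [LinearMap.comp_apply, chMap_sing, chComp_sing j n _ (verts n 0)]
    by_cases e : i = j
    · rw [if_pos e, if_pos (by exact e)]
      rfl
    · rw [if_neg e, if_neg (by exact e)]
      rfl
  have := LinearMap.congr_fun h x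
  rw [LinearMap.comp_apply] at this
  rw [this]
  split_ifs <;> rfl

/-- A chain of `J × X` is the sum of its components. -/
lemma exists_sum_chComp (n : ℕ) (x : Ch (J × X) n) : ∃ s : Finset J, ∀ s', s ⊆ s' →
    x = ∑ j ∈ s', chMap (slice X j) n (chComp j n x) := by
  classical
  induction x using Finsupp.induction_linear with
  | zero => exact ⟨∅, fun s' _ => by simp⟩
  | add x y hx hy =>
    obtain ⟨s, hs⟩ := hx
    obtain ⟨t, ht⟩ := hy
    refine ⟨s ∪ t, fun s' h => ?_⟩
    simp_rw [map_add, Finset.sum_add_distrib]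
    rw [← hs s' (Finset.subset_union_left.trans h), ← ht s' (Finset.subset_union_right.trans h)]
  | single σ k =>
    refine ⟨{(σ (verts n 0)).1}, fun s' h => ?_⟩
    have e : (Finsupp.single σ k : Ch (J × X) n) = k • sing σ := by simp
    rw [e]
    simp_rw [map_smul, ← Finset.smul_sum]
    congr 1
    rw [Finset.sum_eq_single (σ (verts n 0)).1]
    · rw [chComp_sing _ n σ (verts n 0), if_pos rfl, chMap_sing]
      congr 1
      ext t : 1
      exact Prod.ext (fst_simp_eq σ _ _) rfl
    · intro j _ hj
      rw [chComp_sing _ n σ (verts n 0), if_neg hj.symm, map_zero]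
    · intro hj
      exact absurd (h (Finset.mem_singleton_self _)) hj

/-- The relative homology of a product with a discrete space is a direct sum. -/
lemma RelGen.relBasis_slice {A' : Set X} {n : ℕ} {g : J → Ch X n}
    (h : ∀ j, RelGen Set.univ A' n (g j)) :
    RelBasis Set.univ (Prod.snd ⁻¹' A' : Set (J × X)) n fun j => chMap (slice X j) n (g j) := by
  classical
  have hs : ∀ j : J, Set.MapsTo (slice X j) A' (Prod.snd ⁻¹' A') := fun j x hx => hx
  refine ⟨fun j => chMap_relCyc (Set.mapsTo_univ _ _) (hs j) (h j).mem,
    fun z hz => ?_, fun c hc => ?_⟩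
  · obtain ⟨s, e⟩ := exists_sum_chComp n z
    have hz' : ∀ j, chComp j n z ∈ relCyc Set.univ A' n := fun j =>
      mem_relCyc.2 ⟨chSub_univ _ _, by rw [← chComp_D]; exact chComp_mem j hz.2⟩
    choose k hk using fun j => (h j).span _ (hz' j)
    refine ⟨∑ j ∈ s, Finsupp.single j (k j), ?_⟩
    rw [map_sum]
    nth_rw 1 [e s subset_rfl]
    rw [← Finset.sum_sub_distrib]
    refine Submodule.sum_mem _ fun j _ => ?_
    rw [Finsupp.linearCombination_single, ← map_smul, ← map_sub]
    exact chMap_relBdry (Set.mapsTo_univ _ _) (hs j) (hk j)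
  · ext j
    refine (h j).indep _ ?_
    obtain ⟨a, ha, w, -, e⟩ := mem_relBdry.1 hc
    have e1 : chComp j n (Finsupp.linearCombination ℤ (fun j => chMap (slice X j) n (g j)) c) =
        c j • g j := by
      rw [Finsupp.linearCombination_apply, Finsupp.sum, map_sum]
      simp_rw [map_smul, chComp_slice]
      by_cases hj : j ∈ c.support
      · rw [Finset.sum_eq_single j (fun i _ hi => by rw [if_neg hi, smul_zero])
          (fun h => absurd hj h), if_pos rfl]
      · rw [Finsupp.notMem_support_iff.1 hj, zero_smul]
        refine Finset.sum_eq_zero fun i hi => ?_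
        rw [if_neg (fun h' : i = j => hj (h' ▸ hi)), smul_zero]
    rw [← e1, e, map_add]
    refine mem_relBdry.2 ⟨_, chComp_mem j ha, _, chSub_univ _ (chComp j (n + 1) w), ?_⟩
    congr 1
    exact chComp_D j (n + 1) w

end Bases

/-! ### Spaces obtained by attaching cells -/

/-- The cube `[-1, 1]ⁿ`. -/
abbrev Cube (n : ℕ) : Type := Fin n → Set.Icc (-1 : ℝ) 1

section CubeGeometry

variable {n : ℕ}

/-- The boundary of the cube. -/
def cubeBd (n : ℕ) : Set (Cube n) := {x | ∃ i, |(x i : ℝ)| = 1}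

/-- The supremum norm on the cube. -/
def cubeNorm (x : Cube n) : ℝ := ‖fun i => (x i : ℝ)‖

/-- The centre of the cube. -/
def cubeZero (n : ℕ) : Cube n := fun _ => ⟨0, by norm_num⟩

lemma continuous_cubeNorm : Continuous (cubeNorm (n := n)) := by
  unfold cubeNorm
  fun_prop

lemma abs_le_cubeNorm (x : Cube n) (i : Fin n) : |(x i : ℝ)| ≤ cubeNorm x :=
  norm_le_pi_norm (fun i => (x i : ℝ)) i

lemma cubeNorm_nonneg (x : Cube n) : 0 ≤ cubeNorm x := norm_nonneg _

lemma cubeNorm_le_one (x : Cube n) : cubeNorm x ≤ 1 :=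
  (pi_norm_le_iff_of_nonneg zero_le_one).2 fun i => abs_le.2 ⟨(x i).2.1, (x i).2.2⟩

lemma exists_abs_eq_cubeNorm {x : Cube n} (h : cubeNorm x ≠ 0) : ∃ i, |(x i : ℝ)| = cubeNorm x := by
  by_contra! hc
  have hp : 0 < cubeNorm x := (cubeNorm_nonneg x).lt_of_ne' h
  have : cubeNorm x < cubeNorm x :=
    (pi_norm_lt_iff hp).2 fun i => (abs_le_cubeNorm x i).lt_of_ne (hc i)
  exact lt_irrefl _ this

lemma mem_cubeBd_iff {x : Cube n} : x ∈ cubeBd n ↔ cubeNorm x = 1 := by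
  constructor
  · rintro ⟨i, hi⟩
    exact le_antisymm (cubeNorm_le_one x) (hi ▸ abs_le_cubeNorm x i)
  · intro h
    obtain ⟨i, hi⟩ := exists_abs_eq_cubeNorm (x := x) (by rw [h]; exact one_ne_zero)
    exact ⟨i, hi.trans h⟩

lemma isClosed_cubeBd : IsClosed (cubeBd n) := by
  have : cubeBd n = cubeNorm ⁻¹' {1} := Set.ext fun x => mem_cubeBd_iff
  rw [this]
  exact isClosed_singleton.preimage continuous_cubeNorm

lemma cubeNorm_eq_zero {x : Cube n} : cubeNorm x = 0 ↔ x = cubeZero n := by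
  rw [cubeNorm, norm_eq_zero]
  constructor
  · intro h
    funext i
    exact Subtype.ext (congrFun h i)
  · rintro rfl
    rfl

lemma cubeZero_notMem_cubeBd : cubeZero n ∉ cubeBd n := by
  rw [mem_cubeBd_iff, cubeNorm_eq_zero.2 rfl]
  exact zero_ne_one

lemma radial_factor_le {x : Cube n} {t : ℝ} (h0 : 0 ≤ t) (h1 : t ≤ 1) (i : Fin n) :
    |(x i : ℝ) * (1 - t + t / cubeNorm x)| ≤ 1 := by
  have hN := cubeNorm_nonneg x
  have hs : 0 ≤ 1 - t + t / cubeNorm x := add_nonneg (sub_nonneg.2 h1) (div_nonneg h0 hN)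
  rw [abs_mul, abs_of_nonneg hs]
  refine (mul_le_mul_of_nonneg_right (abs_le_cubeNorm x i) hs).trans ?_
  rcases eq_or_ne (cubeNorm x) 0 with h | h
  · rw [h, zero_mul]; exact zero_le_one
  · have e : cubeNorm x * (1 - t + t / cubeNorm x) = cubeNorm x * (1 - t) + t := by field_simp
    rw [e]
    nlinarith [cubeNorm_le_one x]

/-- The radial deformation of the punctured cube to its boundary. At the centre, the division by
zero makes the path constant. -/
def radial (x : Cube n) (t : unitInterval) : Cube n := fun i =>
  ⟨(x i : ℝ) * (1 - t + t / cubeNorm x), abs_le.1 (radial_factor_le t.2.1 t.2.2 i)⟩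

lemma radial_zero (x : Cube n) : radial x 0 = x := by
  funext i
  refine Subtype.ext ?_
  simp [radial]

lemma radial_of_bd {x : Cube n} (hx : x ∈ cubeBd n) (t : unitInterval) : radial x t = x := by
  funext i
  refine Subtype.ext ?_
  simp [radial, mem_cubeBd_iff.1 hx]

lemma radial_one {x : Cube n} (hx : x ≠ cubeZero n) : radial x 1 ∈ cubeBd n := by
  have h : cubeNorm x ≠ 0 := fun h => hx (cubeNorm_eq_zero.1 h)
  obtain ⟨i, hi⟩ := exists_abs_eq_cubeNorm h
  refine ⟨i, ?_⟩
  simp [radial, abs_mul, hi, abs_of_nonneg (cubeNorm_nonneg x), h]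

lemma radial_ne {x : Cube n} (hx : x ≠ cubeZero n) (t : unitInterval) :
    radial x t ≠ cubeZero n := by
  have h : cubeNorm x ≠ 0 := fun h => hx (cubeNorm_eq_zero.1 h)
  have hp : 0 < cubeNorm x := (cubeNorm_nonneg x).lt_of_ne' h
  obtain ⟨i, hi⟩ := exists_abs_eq_cubeNorm h
  intro e
  have e1 : (x i : ℝ) * (1 - t + t / cubeNorm x) = 0 := congrArg Subtype.val (congrFun e i)
  have h2 : 0 < 1 - (t : ℝ) + t / cubeNorm x := by
    have h3 : (t : ℝ) ≤ t / cubeNorm x := by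
      rw [le_div_iff₀ hp]
      exact mul_le_of_le_one_right t.2.1 (cubeNorm_le_one x)
    linarith
  rcases mul_eq_zero.1 e1 with h3 | h3
  · rw [h3, abs_zero] at hi
    exact h hi.symm
  · exact h2.ne' h3

lemma continuous_radial (x : Cube n) : Continuous (radial x) := by
  unfold radial
  fun_prop

lemma continuousOn_radial :
    ContinuousOn (fun s : Cube n × unitInterval => radial s.1 s.2) {s | s.1 ≠ cubeZero n} := by
  refine continuousOn_pi.2 fun i => ?_
  rw [Topology.IsInducing.subtypeVal.continuousOn_iff]
  have h1 : ContinuousOn (fun s : Cube n × unitInterval => (s.2 : ℝ) / cubeNorm s.1)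
      {s | s.1 ≠ cubeZero n} :=
    ContinuousOn.div (by fun_prop) ((continuous_cubeNorm.comp continuous_fst).continuousOn)
      fun s hs h => hs (cubeNorm_eq_zero.1 h)
  have h2 : Continuous fun s : Cube n × unitInterval => ((s.1 i : ℝ)) := by fun_prop
  have h3 : Continuous fun s : Cube n × unitInterval => 1 - (s.2 : ℝ) := by fun_prop
  exact h2.continuousOn.mul (h3.continuousOn.add h1)

end CubeGeometry

/-- The space `Q` arises from its closed subspace `A` by attaching `n`-cells with characteristic
maps `φ j`. -/
structure Attach {Q : Type*} [TopologicalSpace Q] (A : Set Q) (n : ℕ) {J : Type*}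
    (φ : J → C(Cube n, Q)) : Prop where
  isClosed : IsClosed A
  bd : ∀ j, ∀ x ∈ cubeBd n, φ j x ∈ A
  int : ∀ j, ∀ x ∉ cubeBd n, φ j x ∉ A
  inj : ∀ i j x y, x ∉ cubeBd n → φ i x = φ j y → i = j ∧ x = y
  cover : ∀ q ∉ A, ∃ j x, φ j x = q
  closed : ∀ C : Set Q, IsClosed (C ∩ A) → (∀ j, IsClosed (φ j ⁻¹' C)) → IsClosed C

namespace Attach

variable {Q : Type*} [TopologicalSpace Q] {A : Set Q} {n : ℕ} {J : Type*} {φ : J → C(Cube n, Q)}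
  (h : Attach A n φ)

include h

/-- The complement of the centres of the cells. -/
def punctured (_ : Attach A n φ) : Set Q := (Set.range fun j => φ j (cubeZero n))ᶜ

lemma subset_punctured : A ⊆ h.punctured := by
  rintro q hq ⟨j, rfl⟩
  exact h.int j _ cubeZero_notMem_cubeBd hq

lemma mem_punctured {j : J} {x : Cube n} : φ j x ∈ h.punctured ↔ x ≠ cubeZero n := by
  constructor
  · rintro hx rfl
    exact hx ⟨j, rfl⟩
  · rintro hx ⟨i, hi⟩
    exact hx (h.inj i j _ _ cubeZero_notMem_cubeBd hi).2.symm

lemma isOpen_punctured : IsOpen h.punctured := by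
  refine isClosed_compl_iff.1 (h.closed _ ?_ fun j => ?_)
  · have : h.puncturedᶜ ∩ A = ∅ := by
      ext q
      exact ⟨fun hq => hq.1 (h.subset_punctured hq.2), fun hq => hq.elim⟩
    rw [this]
    exact isClosed_empty
  · have : φ j ⁻¹' h.puncturedᶜ = {cubeZero n} := by
      ext x
      rw [Set.mem_preimage, Set.mem_compl_iff, h.mem_punctured, not_not, Set.mem_singleton_iff]
    rw [this]
    exact isClosed_singleton

open Classical in
/-- The path of the radial deformation that starts at a given point. -/
def path (h : Attach A n φ) (q : Q) : C(unitInterval, Q) :=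
  if hq : q ∈ A then ContinuousMap.const _ q else
    (φ (h.cover q hq).choose).comp ⟨radial (h.cover q hq).choose_spec.choose, continuous_radial _⟩

lemma path_of_mem {q : Q} (hq : q ∈ A) (t : unitInterval) : h.path q t = q := by
  rw [path, dif_pos hq]
  rfl

lemma path_cell (j : J) (x : Cube n) (t : unitInterval) :
    h.path (φ j x) t = φ j (radial x t) := by
  by_cases hx : x ∈ cubeBd n
  · rw [h.path_of_mem (h.bd j x hx), radial_of_bd hx]
  · have hq := h.int j x hx
    have e := (h.cover _ hq).choose_spec.choose_spec
    obtain ⟨e1, e2⟩ := h.inj j _ x _ hx e.symm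
    have key : ∀ i y, j = i → x = y → φ i (radial y t) = φ j (radial x t) := by
      rintro _ _ rfl rfl
      rfl
    rw [path, dif_neg hq]
    exact key _ _ e1 e2

lemma path_zero (q : Q) : h.path q 0 = q := by
  by_cases hq : q ∈ A
  · exact h.path_of_mem hq 0
  · obtain ⟨j, x, rfl⟩ := h.cover q hq
    rw [path_cell, radial_zero]

lemma path_one {q : Q} (hq : q ∈ h.punctured) : h.path q 1 ∈ A := by
  by_cases hA : q ∈ A
  · rwa [h.path_of_mem hA]
  · obtain ⟨j, x, rfl⟩ := h.cover q hA
    rw [path_cell]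
    exact h.bd j _ (radial_one (h.mem_punctured.1 hq))

lemma path_mem {q : Q} (hq : q ∈ h.punctured) (t : unitInterval) : h.path q t ∈ h.punctured := by
  by_cases hA : q ∈ A
  · rwa [h.path_of_mem hA]
  · obtain ⟨j, x, rfl⟩ := h.cover q hA
    rw [path_cell]
    exact h.mem_punctured.2 (radial_ne (h.mem_punctured.1 hq) t)

/-- The deformation of the complement of the centres is continuous. It is treated as a map into the
path space, since continuity on `Q` can be tested on `A` and the cells, while for the product of `Q`
with the interval this is not immediate. -/
lemma continuous_path : Continuous fun u : h.punctured => h.path u := by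
  refine continuous_iff_isClosed.2 fun D hD => ?_
  have hC : IsClosed (h.path ⁻¹' D ∪ h.puncturedᶜ) := by
    refine h.closed _ ?_ fun j => ?_
    · have e : (h.path ⁻¹' D ∪ h.puncturedᶜ) ∩ A =
          (ContinuousMap.const unitInterval ⁻¹' D : Set Q) ∩ A := by
        ext q
        constructor
        · rintro ⟨h1 | h1, hq⟩
          · refine ⟨?_, hq⟩
            rw [Set.mem_preimage, path, dif_pos hq] at h1
            exact h1
          · exact absurd (h.subset_punctured hq) h1
        · rintro ⟨h1, hq⟩
          refine ⟨Or.inl ?_, hq⟩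
          rw [Set.mem_preimage, path, dif_pos hq]
          exact h1
      rw [e]
      exact (hD.preimage ContinuousMap.continuous_const').inter h.isClosed
    · rw [← isOpen_compl_iff]
      -- the complement is an open subset of the punctured cube
      let W : Set (Cube n) := {x | x ≠ cubeZero n}
      have hW : IsOpen W := isOpen_compl_singleton
      have h1 : Continuous fun x : W => h.path (φ j x) := by
        have h2 : Continuous fun s : W × unitInterval => φ j (radial s.1 s.2) := by
          refine (φ j).continuous.comp ?_
          have h3 := continuousOn_radial (n := n)
          exact h3.comp_continuous (f := fun s : W × unitInterval => ((s.1 : Cube n), s.2))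
            (by fun_prop) fun s => s.1.2
        have h4 : (fun x : W => h.path (φ j x)) = ContinuousMap.curry ⟨_, h2⟩ := by
          funext x
          ext t
          exact h.path_cell j x t
        rw [h4]
        exact ContinuousMap.continuous _
      have h5 : (φ j ⁻¹' (h.path ⁻¹' D ∪ h.puncturedᶜ))ᶜ =
          Subtype.val '' ((fun x : W => h.path (φ j x)) ⁻¹' Dᶜ) := by
        ext x
        constructor
        · intro hx
          rw [Set.mem_compl_iff, Set.mem_preimage, Set.mem_union, not_or, Set.mem_compl_iff,
            not_not, h.mem_punctured] at hx
          exact ⟨⟨x, hx.2⟩, hx.1, rfl⟩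
        · rintro ⟨⟨x, hx⟩, hx', rfl⟩ (h6 | h6)
          · exact hx' h6
          · exact h6 (h.mem_punctured.2 hx)
      rw [h5]
      exact hW.isOpenMap_subtype_val _ (hD.isOpen_compl.preimage h1)
  have e : (fun u : h.punctured => h.path u) ⁻¹' D =
      Subtype.val ⁻¹' (h.path ⁻¹' D ∪ h.puncturedᶜ) := by
    ext u
    constructor
    · exact fun hu => Or.inl hu
    · rintro (hu | hu)
      · exact hu
      · exact absurd u.2 hu
  rw [e]
  exact hC.preimage continuous_subtype_val

/-- The complement of the centres deforms into `A`. -/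
lemma acyclic_punctured (m : ℕ) : relCyc h.punctured A m ≤ relBdry h.punctured A m := by
  let F : C(h.punctured, C(unitInterval, Q)) := ⟨_, h.continuous_path⟩
  let H : C(h.punctured × unitInterval, h.punctured) :=
    ⟨fun s => ⟨h.path s.1 s.2, h.path_mem s.1.2 s.2⟩, by
      refine Continuous.subtype_mk ?_ _
      exact F.uncurry.continuous⟩
  have key := relCyc_le_relBdry_of_homotopy H (A := Set.univ) (A' := Subtype.val ⁻¹' A)
    (fun _ _ _ => trivial) (fun x hx t => by
      change h.path x t ∈ A
      rwa [h.path_of_mem hx]) (fun x => Subtype.ext (h.path_zero x))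
    (fun x _ => h.path_one x.2) m
  have iso : RelIso (subIncl h.punctured) Set.univ (Subtype.val ⁻¹' A) h.punctured A m :=
    RelIso.of_isEmbedding IsEmbedding.subtypeVal (fun x _ => x.2) (fun x hx => hx)
      (fun y hy => ⟨⟨y, hy⟩, Set.mem_univ _, rfl⟩)
      (fun y hy => ⟨⟨y, h.subset_punctured hy⟩, hy, rfl⟩) m
  intro z hz
  obtain ⟨y, hy, h1⟩ := iso.surj z hz
  have h2 := add_mem h1 (chMap_relBdry iso.mapsTo iso.mapsTo' (key hy))
  rwa [sub_add_cancel] at h2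

variable [TopologicalSpace J] [DiscreteTopology J]

/-- The characteristic maps, as one map. -/
def charMap (_ : Attach A n φ) : C(J × Cube n, Q) where
  toFun s := φ s.1 s.2
  continuous_toFun := continuous_prod_of_discrete_left.2 fun j => (φ j).continuous

omit h in
/-- The disjoint union of cells arises from their boundaries by attaching the cells. -/
lemma sigma : Attach (Prod.snd ⁻¹' cubeBd n : Set (J × Cube n)) n (fun j => slice (Cube n) j) where
  isClosed := isClosed_cubeBd.preimage continuous_snd
  bd j x hx := hx
  int j x hx := hx
  inj i j x y _ e := ⟨congrArg Prod.fst e, congrArg Prod.snd e⟩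
  cover q _ := ⟨q.1, q.2, rfl⟩
  closed C _ hC := by
    rw [← isOpen_compl_iff, isOpen_iff_continuous_mem]
    exact continuous_prod_of_discrete_left.2 fun j =>
      isOpen_iff_continuous_mem.1 (hC j).isOpen_compl

/-- The inverse of the characteristic maps on the open cells. -/
def inv (h : Attach A n φ) : C((Aᶜ : Set Q), J × Cube n) where
  toFun v := ((h.cover v v.2).choose, (h.cover v v.2).choose_spec.choose)
  continuous_toFun := by
    refine continuous_iff_isClosed.2 fun D hD => ?_
    have hs : ∀ v : (Aᶜ : Set Q), φ (h.cover v v.2).choose (h.cover v v.2).choose_spec.choose = v :=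
      fun v => (h.cover v v.2).choose_spec.choose_spec
    have hC : IsClosed (h.charMap '' D ∪ A) := by
      refine h.closed _ ?_ fun j => ?_
      · rw [Set.inter_eq_self_of_subset_right Set.subset_union_right]
        exact h.isClosed
      · have e : φ j ⁻¹' (h.charMap '' D ∪ A) = slice (Cube n) j ⁻¹' D ∪ cubeBd n := by
          ext x
          by_cases hx : x ∈ cubeBd n
          · exact ⟨fun _ => Or.inr hx, fun _ => Or.inr (h.bd j x hx)⟩
          · constructor
            · rintro (⟨⟨i, y⟩, hy, e⟩ | h1)
              · obtain ⟨rfl, rfl⟩ := h.inj j i x y hx e.symm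
                exact Or.inl hy
              · exact absurd h1 (h.int j x hx)
            · rintro (h1 | h1)
              · exact Or.inl ⟨(j, x), h1, rfl⟩
              · exact absurd h1 hx
        rw [e]
        exact (hD.preimage (ContinuousMap.continuous _)).union isClosed_cubeBd
    convert hC.preimage (continuous_subtype_val (p := (· ∈ Aᶜ))) using 1
    ext v
    constructor
    · exact fun hv => Or.inl ⟨_, hv, hs v⟩
    · rintro (⟨⟨i, y⟩, hy, e⟩ | h1)
      · have hy' : y ∉ cubeBd n := fun hc => v.2 (e ▸ h.bd i y hc)
        obtain ⟨e1, e2⟩ := h.inj i _ y _ hy' (e.trans (hs v).symm)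
        exact (congrArg (· ∈ D) (Prod.ext e1 e2 :
          (i, y) = ((h.cover v v.2).choose, (h.cover v v.2).choose_spec.choose))).mp hy
      · exact absurd h1 v.2

lemma charMap_inv (v : (Aᶜ : Set Q)) : h.charMap (h.inv v) = v :=
  (h.cover v v.2).choose_spec.choose_spec

lemma inv_charMap (s : J × Cube n) (hs : h.charMap s ∈ Aᶜ) : h.inv ⟨h.charMap s, hs⟩ = s := by
  have hy : s.2 ∉ cubeBd n := fun hc => hs (h.bd s.1 s.2 hc)
  obtain ⟨e1, e2⟩ := h.inj s.1 _ s.2 _ hy (h.charMap_inv ⟨_, hs⟩).symm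
  exact Prod.ext e1.symm e2.symm

/-- The characteristic maps identify the relative homology of `(Q, A)` with that of the disjoint
union of the cells relative to their boundaries: both subspaces may be replaced by the complement
of the centres of the cells, and then excision applies. -/
theorem relIso (m : ℕ) : RelIso h.charMap Set.univ (Prod.snd ⁻¹' cubeBd n) Set.univ A m := by
  have h1 : RelIso (ContinuousMap.id Q) Set.univ A Set.univ h.punctured m :=
    RelIso.of_acyclic (Set.subset_univ _) h.subset_punctured h.acyclic_punctured m
  have h' := Attach.sigma (n := n) (J := J)
  have h2 : RelIso (ContinuousMap.id _) Set.univ (Prod.snd ⁻¹' cubeBd n) Set.univ h'.punctured m :=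
    RelIso.of_acyclic (Set.subset_univ _) h'.subset_punctured h'.acyclic_punctured m
  have h3 : RelIso h.charMap Set.univ (h.charMap ⁻¹' h.punctured) Set.univ h.punctured m := by
    refine RelIso.excision h.isOpen_punctured h.isClosed.isOpen_compl ?_ h.inv h.charMap_inv
      h.inv_charMap m
    rw [Set.eq_univ_iff_forall]
    intro q
    by_cases hq : q ∈ A
    · exact Or.inl (h.subset_punctured hq)
    · exact Or.inr hq
  have e : h.charMap ⁻¹' h.punctured = h'.punctured := by
    ext s
    exact (h.mem_punctured (j := s.1)).trans (h'.mem_punctured (j := s.1)).symm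
  rw [e] at h3
  exact RelIso.of_comp h1 (h3.comp h2) (Set.mapsTo_univ _ _) fun s hs => h.bd s.1 s.2 hs

omit [TopologicalSpace J] [DiscreteTopology J] in
/-- The cells form a basis of the relative homology. -/
theorem relBasis {m : ℕ} {g : J → Ch (Cube n) m}
    (hg : ∀ j, RelGen Set.univ (cubeBd n) m (g j)) :
    RelBasis Set.univ A m fun j => chMap (φ j) m (g j) := by
  let _ : TopologicalSpace J := ⊥
  have : DiscreteTopology J := ⟨rfl⟩
  have := (RelGen.relBasis_slice hg).map (h.relIso m)
  simp_rw [chMap_comp] at this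
  exact this

end Attach

/-! ### Fundamental classes of cubes -/

section CubeClass

variable {n : ℕ}

/-- The face of the cube on which the first coordinate is `1`. -/
def face (n : ℕ) : C(Cube n, Cube (n + 1)) where
  toFun x := Fin.cons ⟨1, by norm_num⟩ x
  continuous_toFun := continuous_pi fun i => by
    refine Fin.cases ?_ (fun i => ?_) i
    · exact continuous_const
    · exact continuous_apply i

/-- The union of the faces of the cube other than the one on which the first coordinate is `1`. -/
def horn (n : ℕ) : Set (Cube (n + 1)) := {x | (x 0 : ℝ) = -1 ∨ Fin.tail x ∈ cubeBd n}

lemma mem_cubeBd_succ {x : Cube (n + 1)} :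
    x ∈ cubeBd (n + 1) ↔ |(x 0 : ℝ)| = 1 ∨ Fin.tail x ∈ cubeBd n :=
  Fin.exists_fin_succ

lemma horn_subset : horn n ⊆ cubeBd (n + 1) := by
  rintro x (hx | hx)
  · exact mem_cubeBd_succ.2 (Or.inl (by rw [hx]; norm_num))
  · exact mem_cubeBd_succ.2 (Or.inr hx)

lemma isClosed_horn : IsClosed (horn n) := by
  refine IsClosed.union ?_ ?_
  · exact isClosed_eq (by fun_prop) continuous_const
  · have h : Continuous fun (x : Cube (n + 1)) (i : Fin n) => x i.succ := by fun_prop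
    exact isClosed_cubeBd.preimage h

/-- The cube can be pushed into the horn. -/
lemma acyclic_horn (m : ℕ) :
    relCyc Set.univ (horn n) m ≤ relBdry Set.univ (horn n) m := by
  have hm : ∀ (a t : ℝ), -1 ≤ a → a ≤ 1 → 0 ≤ t → t ≤ 1 →
      (1 - t) * a - t ∈ Set.Icc (-1 : ℝ) 1 := fun a t h1 h2 h3 h4 =>
    ⟨by nlinarith, by nlinarith⟩
  let h : C(Cube (n + 1) × unitInterval, Cube (n + 1)) :=
    { toFun := fun s => Fin.cons ⟨(1 - s.2) * (s.1 0 : ℝ) - s.2,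
        hm _ _ (s.1 0).2.1 (s.1 0).2.2 s.2.2.1 s.2.2.2⟩ (Fin.tail s.1)
      continuous_toFun := continuous_pi fun i => by
        refine Fin.cases ?_ (fun i => ?_) i
        · exact Continuous.subtype_mk (by fun_prop) _
        · exact ((continuous_apply i.succ).comp continuous_fst :
            Continuous fun s : Cube (n + 1) × unitInterval => s.1 i.succ) }
  refine relCyc_le_relBdry_of_homotopy h (fun _ _ _ => Set.mem_univ _) ?_ ?_ ?_ m
  · rintro x (hx | hx) t
    · refine Or.inl ?_
      change (1 - (t : ℝ)) * (x 0 : ℝ) - t = -1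
      rw [hx]
      ring
    · exact Or.inr hx
  · intro x
    funext i
    refine Fin.cases ?_ (fun i => rfl) i
    refine Subtype.ext ?_
    change (1 - (0 : ℝ)) * (x 0 : ℝ) - 0 = x 0
    ring
  · intro x _
    refine Or.inl ?_
    change (1 - (1 : ℝ)) * (x 0 : ℝ) - 1 = -1
    ring

lemma face_mem_cubeBd (x : Cube n) : face n x ∈ cubeBd (n + 1) :=
  mem_cubeBd_succ.2 (Or.inl (by change |(1 : ℝ)| = 1; norm_num))

lemma face_injective : Function.Injective (face n) := fun _ _ e =>
  funext fun i => congrFun e i.succ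

lemma face_mem_horn {x : Cube n} : face n x ∈ horn n ↔ x ∈ cubeBd n := by
  constructor
  · rintro (h | h)
    · change (1 : ℝ) = -1 at h
      norm_num at h
    · exact h
  · exact Or.inr

/-- The boundary of the cube arises from the horn by attaching the remaining face. -/
lemma attach_face : Attach (Subtype.val ⁻¹' horn n : Set (cubeBd (n + 1))) n
    (fun _ : Unit => ⟨fun x => ⟨face n x, face_mem_cubeBd x⟩, by fun_prop⟩) where
  isClosed := isClosed_horn.preimage continuous_subtype_val
  bd _ _ hx := face_mem_horn.2 hx
  int _ _ hx h := hx (face_mem_horn.1 h)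
  inj _ _ _ _ _ e := ⟨rfl, face_injective (congrArg Subtype.val e)⟩
  cover q hq := by
    refine ⟨(), Fin.tail q.1, Subtype.ext ?_⟩
    have h0 : (q.1 0 : ℝ) = 1 := by
      rcases mem_cubeBd_succ.1 q.2 with h | h
      · rcases eq_or_eq_neg_of_abs_eq h with h | h
        · exact h
        · exact absurd (Or.inl h) hq
      · exact absurd (Or.inr h) hq
    funext i
    refine Fin.cases ?_ (fun i => rfl) i
    exact Subtype.ext h0.symm
  closed C h1 h2 := by
    have e : C = C ∩ Subtype.val ⁻¹' horn n ∪
        (fun x => (⟨face n x, face_mem_cubeBd x⟩ : cubeBd (n + 1))) ''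
          ((fun x => (⟨face n x, face_mem_cubeBd x⟩ : cubeBd (n + 1))) ⁻¹' C) := by
      ext q
      constructor
      · intro hq
        by_cases hh : q ∈ Subtype.val ⁻¹' horn n
        · exact Or.inl ⟨hq, hh⟩
        · have h0 : (q.1 0 : ℝ) = 1 := by
            rcases mem_cubeBd_succ.1 q.2 with h | h
            · rcases eq_or_eq_neg_of_abs_eq h with h | h
              · exact h
              · exact absurd (Or.inl h) hh
            · exact absurd (Or.inr h) hh
          have e : (⟨face n (Fin.tail q.1), face_mem_cubeBd _⟩ : cubeBd (n + 1)) = q := by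
            refine Subtype.ext (funext fun i => ?_)
            refine Fin.cases ?_ (fun i => rfl) i
            exact Subtype.ext h0.symm
          refine Or.inr ⟨Fin.tail q.1, ?_, e⟩
          rw [Set.mem_preimage, e]
          exact hq
      · rintro (hq | ⟨x, hx, rfl⟩)
        · exact hq.1
        · exact hx
    rw [e]
    exact h1.union ((h2 ()).isCompact.image (by fun_prop)).isClosed

/-- The relative homology of the boundary of the cube modulo the horn is that of the remaining face
relative to its boundary. -/
lemma RelGen.chMap_face {m : ℕ} {g : Ch (Cube n) m} (h : RelGen Set.univ (cubeBd n) m g) :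
    RelGen (cubeBd (n + 1)) (horn n) m (chMap (face n) m g) := by
  have h1 := attach_face.relBasis fun _ => h
  have h2 : RelIso (subIncl (cubeBd (n + 1))) Set.univ (Subtype.val ⁻¹' horn n)
      (cubeBd (n + 1)) (horn n) m :=
    RelIso.of_isEmbedding IsEmbedding.subtypeVal (fun x _ => x.2) (fun x hx => hx)
      (fun y hy => ⟨⟨y, hy⟩, Set.mem_univ _, rfl⟩) (fun y hy => ⟨⟨y, horn_subset hy⟩, hy, rfl⟩) m
  have h3 := (h1.map h2).relGen
  rwa [chMap_comp] at h3

/-- A relative cycle of the cube is a generator if its boundary represents, modulo the horn, the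
image of a generator on the remaining face. -/
lemma RelGen.of_boundary {g : Ch (Cube n) n} (h : RelGen Set.univ (cubeBd n) n g)
    {z : Ch (Cube (n + 1)) (n + 1)} (hz : z ∈ relCyc Set.univ (cubeBd (n + 1)) (n + 1))
    (e : chDs n z - chMap (face n) n g ∈ relBdry (cubeBd (n + 1)) (horn n) n) :
    RelGen Set.univ (cubeBd (n + 1)) (n + 1) z where
  mem := hz
  span y hy := by
    have h1 : chDs n y ∈ relCyc (cubeBd (n + 1)) (horn n) n :=
      mem_relCyc.2 ⟨(mem_relCyc_succ.1 hy).2, by rw [chD_D_succ]; exact zero_mem _⟩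
    obtain ⟨k, hk⟩ := h.chMap_face.span _ h1
    refine ⟨k, ?_⟩
    have h2 : chDs n (y - k • z) ∈ relBdry (cubeBd (n + 1)) (horn n) n := by
      have := sub_mem hk (Submodule.smul_mem _ k e)
      rwa [smul_sub, sub_sub_sub_cancel_right, ← map_smul, ← map_sub] at this
    obtain ⟨a, ha, w, hw, e2⟩ := mem_relBdry.1 h2
    have h3 : y - k • z - w ∈ relCyc Set.univ (horn n) (n + 1) := by
      refine mem_relCyc_succ.2 ⟨chSub_univ _ _, ?_⟩
      rw [map_sub, e2, add_sub_cancel_right]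
      exact ha
    have h4 := relBdry_mono subset_rfl horn_subset _ (acyclic_horn _ h3)
    have h5 := add_mem h4 (chSub_le_relBdry Set.univ _ _ hw)
    rwa [sub_add_cancel] at h5
  indep k hk := by
    obtain ⟨a, ha, w, -, e2⟩ := mem_relBdry.1 hk
    refine h.chMap_face.indep k ?_
    have e3 : k • chDs n z = chDs n a := by
      rw [← map_smul, e2, map_add]
      have : chDs n (chDs (n + 1) w) = 0 := chD_D_succ (n + 1) w
      rw [this, add_zero]
    have := sub_mem (chD_mem_relBdry (horn n) ha) (Submodule.smul_mem _ k e)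
    rwa [smul_sub, e3, sub_sub_cancel] at this

/-- Since the cube is acyclic relative to the horn, the class of the remaining face bounds modulo
the horn. -/
lemma RelGen.exists_succ {g : Ch (Cube n) n} (h : RelGen Set.univ (cubeBd n) n g) :
    ∃ z ∈ relCyc Set.univ (cubeBd (n + 1)) (n + 1),
      chDs n z - chMap (face n) n g ∈ relBdry (cubeBd (n + 1)) (horn n) n := by
  have h1 := h.chMap_face.mem
  have h2 := acyclic_horn n (relCyc_mono (Set.subset_univ _) subset_rfl _ h1)
  obtain ⟨a, ha, w, hw, e⟩ := mem_relBdry.1 h2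
  refine ⟨w, mem_relCyc_succ.2 ⟨hw, ?_⟩, ?_⟩
  · rw [← sub_eq_iff_eq_add'.2 e]
    exact sub_mem h1.1 (chSub_mono horn_subset _ ha)
  · rw [e, sub_add_cancel_right]
    exact neg_mem (chSub_le_relBdry _ _ _ ha)

/-- The singular simplex at the point of the cube of dimension `0`. -/
def cubePt : C(Simp 0, Cube 0) := ContinuousMap.const _ (cubeZero 0)

/-- In degree `0` the relative homology of the one-point cube is free on its point. -/
lemma relGen_cubePt : RelGen Set.univ (cubeBd 0) 0 (sing cubePt) where
  mem := mem_relCyc_zero.2 (chSub_univ _ _)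
  span z _ := by
    refine ⟨Finsupp.linearCombination ℤ (fun _ => (1 : ℤ)) z, ?_⟩
    have : z = Finsupp.linearCombination ℤ (fun _ => (1 : ℤ)) z • sing cubePt := by
      suffices h : LinearMap.id = (LinearMap.toSpanSingleton ℤ (Ch (Cube 0) 0) (sing cubePt)).comp
          (Finsupp.linearCombination ℤ fun _ => (1 : ℤ)) from LinearMap.congr_fun h z
      refine ch_hom_ext fun σ => ?_
      have hσ : σ = cubePt := ContinuousMap.ext fun t => Subsingleton.elim _ _
      simp [hσ]
    rw [← this, sub_self]
    exact zero_mem _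
  indep k hk := by
    obtain ⟨a, ha, w, -, e⟩ := mem_relBdry.1 hk
    have ha0 : a = 0 := by
      have : chSub (cubeBd 0) 0 ≤ ⊥ := chSub_le fun σ hσ => by
        obtain ⟨i, -⟩ := hσ (verts 0 0)
        exact i.elim0
      exact (Submodule.mem_bot ℤ).1 (this ha)
    have hw : ∀ w : Ch (Cube 0) 1, chDs 0 w = 0 := fun w => by
      suffices h : (chDs 0 : Ch (Cube 0) 1 →ₗ[ℤ] Ch (Cube 0) 0) = 0 from LinearMap.congr_fun h w
      refine ch_hom_ext fun σ => ?_
      change chD 1 (sing σ) = 0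
      rw [chD_sing]
      erw [tupD_one]
      refine (map_sub (real σ 0) _ _).trans ?_
      rw [real_tup, real_tup, sub_eq_zero]
      congr 1
      exact ContinuousMap.ext fun t => Subsingleton.elim _ _
    rw [ha0, hw, add_zero, Finsupp.smul_single, smul_eq_mul, mul_one, Finsupp.single_eq_zero] at e
    exact e

/-- The inductively chosen fundamental classes of the cubes. -/
def cubeGenAux : (n : ℕ) → {g : Ch (Cube n) n // RelGen Set.univ (cubeBd n) n g}
  | 0 => ⟨sing cubePt, relGen_cubePt⟩
  | n + 1 => ⟨(cubeGenAux n).2.exists_succ.choose,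
      (cubeGenAux n).2.of_boundary (cubeGenAux n).2.exists_succ.choose_spec.1
        (cubeGenAux n).2.exists_succ.choose_spec.2⟩

/-- A relative cycle that represents a generator of `H_n([-1, 1]ⁿ, ∂[-1, 1]ⁿ)`. -/
def cubeGen (n : ℕ) : Ch (Cube n) n := (cubeGenAux n).1

lemma cubeGen_relGen (n : ℕ) : RelGen Set.univ (cubeBd n) n (cubeGen n) := (cubeGenAux n).2

lemma cubeGen_boundary (n : ℕ) : chDs n (cubeGen (n + 1)) - chMap (face n) n (cubeGen n) ∈
    relBdry (cubeBd (n + 1)) (horn n) n :=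
  (cubeGenAux n).2.exists_succ.choose_spec.2

/-! ### Products of cubes -/

/-- The identification of a product of cubes with a cube. -/
def cubeAppend {p q n : ℕ} (h : p + q = n) (x : Cube p) (y : Cube q) : Cube n := fun i =>
  if hi : (i : ℕ) < p then x ⟨i, hi⟩ else y ⟨i - p, by omega⟩

lemma continuous_cubeAppend {p q n : ℕ} (h : p + q = n) :
    Continuous fun s : Cube p × Cube q => cubeAppend h s.1 s.2 := by
  refine continuous_pi fun i => ?_
  unfold cubeAppend
  split_ifs <;> fun_prop

/-- The first factor of a point of a cube. -/
def cubeFst {p q n : ℕ} (h : p + q = n) (z : Cube n) : Cube p := fun i => z ⟨i, by omega⟩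

/-- The second factor of a point of a cube. -/
def cubeSnd {p q n : ℕ} (h : p + q = n) (z : Cube n) : Cube q := fun i => z ⟨p + i, by omega⟩

lemma cubeFst_append {p q n : ℕ} (h : p + q = n) (x : Cube p) (y : Cube q) :
    cubeFst h (cubeAppend h x y) = x := by
  funext i
  simp [cubeFst, cubeAppend]

lemma cubeSnd_append {p q n : ℕ} (h : p + q = n) (x : Cube p) (y : Cube q) :
    cubeSnd h (cubeAppend h x y) = y := by
  funext i
  simp [cubeSnd, cubeAppend]

lemma cubeAppend_fst_snd {p q n : ℕ} (h : p + q = n) (z : Cube n) :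
    cubeAppend h (cubeFst h z) (cubeSnd h z) = z := by
  funext i
  simp only [cubeAppend, cubeFst, cubeSnd]
  split_ifs with hi
  · rfl
  · congr 1
    exact Fin.ext (by simp; omega)

lemma cubeAppend_mem_bd {p q n : ℕ} (h : p + q = n) {x : Cube p} {y : Cube q} :
    cubeAppend h x y ∈ cubeBd n ↔ x ∈ cubeBd p ∨ y ∈ cubeBd q := by
  constructor
  · rintro ⟨i, hi⟩
    simp only [cubeAppend] at hi
    split_ifs at hi with hp
    · exact Or.inl ⟨_, hi⟩
    · exact Or.inr ⟨_, hi⟩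
  · rintro (⟨i, hi⟩ | ⟨i, hi⟩)
    · refine ⟨⟨i, by omega⟩, ?_⟩
      simpa [cubeAppend] using hi
    · refine ⟨⟨p + i, by omega⟩, ?_⟩
      simpa [cubeAppend] using hi

lemma cubeAppend_cons {p q n : ℕ} (h : p + q = n) (h' : p + 1 + q = n + 1) (x : Cube (p + 1))
    (y : Cube q) : cubeAppend h' x y = Fin.cons (x 0) (cubeAppend h (Fin.tail x) y) := by
  funext i
  refine Fin.cases ?_ (fun i => ?_) i
  · simp [cubeAppend]
  · simp only [cubeAppend, Fin.cons_succ, Fin.val_succ, Nat.add_lt_add_iff_right]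
    split_ifs with hi
    · rfl
    · congr 1
      exact Fin.ext (by simp)

/-- The product of cubes as a pairing. -/
abbrev cubePair {p q n : ℕ} (h : p + q = n) : KMap (Cube p) (Cube q) (Cube n) :=
  KMap.ofContinuous ⟨_, continuous_cubeAppend h⟩

/-- Cross products of fundamental classes of cubes are fundamental classes. -/
theorem relGen_cross {p q n : ℕ} (h : p + q = n) : RelGen Set.univ (cubeBd n) n
    (chCross (cubePair h) n p q (cubeGen p) (cubeGen q)) := by
  induction p generalizing n with
  | zero =>
    obtain rfl : q = n := by omega
    have e : chCross (cubePair h) q 0 q (cubeGen 0) (cubeGen q) = cubeGen q := by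
      suffices e : chCross (cubePair h) q 0 q (sing cubePt) = LinearMap.id from
        LinearMap.congr_fun e (cubeGen q)
      refine ch_hom_ext fun σ => ?_
      rw [chCross_zero_left]
      refine congrArg sing (ContinuousMap.ext fun t => ?_)
      funext i
      change cubeAppend h (cubeZero 0) (σ t) i = σ t i
      simp [cubeAppend]
    rw [e]
    exact cubeGen_relGen q
  | succ p ih =>
    obtain ⟨n, rfl⟩ : ∃ m, n = m + 1 := ⟨p + q, by omega⟩
    have h' : p + q = n := by omega
    -- modulo the horn, the boundary of the product is the product of the face of the first factor
    -- with the second factor: the other term `g × ∂g` of the Leibniz rule lies in the horn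
    refine (ih h').of_boundary ?_ ?_
    · refine chCross_relCyc (A := Set.univ) (B := Set.univ) ?_ ?_ (fun _ _ _ _ => Set.mem_univ _) h
        (cubeGen_relGen _).mem (cubeGen_relGen _).mem
      · exact fun x hx y _ => (cubeAppend_mem_bd h).2 (Or.inl hx)
      · exact fun x _ y hy => (cubeAppend_mem_bd h).2 (Or.inr hy)
    · have e1 : chDs n (chCross (cubePair h) (n + 1) (p + 1) q (cubeGen (p + 1)) (cubeGen q)) =
          chCross (cubePair h) n p q (chDs p (cubeGen (p + 1))) (cubeGen q) +
          (-1 : ℤ) ^ (p + 1) • chCross (cubePair h) n (p + 1) (q - 1) (cubeGen (p + 1))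
            (chD q (cubeGen q)) := chD_cross (cubePair h) h _ _
      have e2 : chMap (face n) n (chCross (cubePair h') n p q (cubeGen p) (cubeGen q)) =
          chCross (cubePair h) n p q (chMap (face p) p (cubeGen p))
            (chMap (ContinuousMap.id _) q (cubeGen q)) :=
        chMap_cross (fun x y => (cubeAppend_cons h' h (face p x) y).symm) n p q _ _
      rw [chMap_id] at e2
      rw [e1, e2, add_sub_right_comm, ← LinearMap.sub_apply, ← map_sub]
      refine add_mem ?_ (Submodule.smul_mem _ _ (chSub_le_relBdry _ _ _ ?_))
      · refine chCross_relBdry_left (A := cubeBd (p + 1)) (A' := horn p) (B := Set.univ)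
          (B' := cubeBd q) ?_ ?_ ?_ h' (cubeGen_boundary p) (cubeGen_relGen q).mem
        · rintro x (hx | hx) y _
          · refine Or.inl ?_
            change ((cubeAppend h x y 0 : Set.Icc (-1 : ℝ) 1) : ℝ) = -1
            rw [cubeAppend_cons h' h]
            exact hx
          · refine Or.inr ?_
            change Fin.tail (cubeAppend h x y) ∈ _
            rw [cubeAppend_cons h' h, Fin.tail_cons]
            exact (cubeAppend_mem_bd h').2 (Or.inl hx)
        · intro x _ y hy
          refine Or.inr ?_
          change Fin.tail (cubeAppend h x y) ∈ _
          rw [cubeAppend_cons h' h, Fin.tail_cons]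
          exact (cubeAppend_mem_bd h').2 (Or.inr hy)
        · exact fun x hx y _ => (cubeAppend_mem_bd h).2 (Or.inl hx)
      · refine chCross_mem (A := Set.univ) (B := cubeBd q) ?_ (chSub_univ _ _)
          (cubeGen_relGen q).mem.2
        intro x _ y hy
        refine Or.inr ?_
        change Fin.tail (cubeAppend h x y) ∈ _
        rw [cubeAppend_cons h' h, Fin.tail_cons]
        exact (cubeAppend_mem_bd h').2 (Or.inr hy)

end CubeClass

/-! ### The cells of the fixed point sets -/

namespace RelGCWComplex

variable {G : Type u} [Group G] {X : Type u} [TopologicalSpace X] [MulAction G X] {D : Set X}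
  (c : RelGCWComplex G X D)

/-- The `n`-cells of a relative `G`-CW complex. -/
abbrev Cell (n : ℕ) : Type u := c.cw.cell n

instance (n : ℕ) : MulAction G (c.Cell n) := c.cellAction n

lemma cube_mem_closedBall {n : ℕ} (x : Cube n) :
    (fun i => (x i : ℝ)) ∈ Metric.closedBall (0 : Fin n → ℝ) 1 :=
  mem_closedBall_zero_iff.2 (cubeNorm_le_one x)

lemma cube_mem_sphere {n : ℕ} {x : Cube n} :
    (fun i => (x i : ℝ)) ∈ Metric.sphere (0 : Fin n → ℝ) 1 ↔ x ∈ cubeBd n := by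
  rw [mem_sphere_zero_iff_norm, mem_cubeBd_iff]
  rfl

lemma cube_mem_ball {n : ℕ} {x : Cube n} :
    (fun i => (x i : ℝ)) ∈ Metric.ball (0 : Fin n → ℝ) 1 ↔ x ∉ cubeBd n := by
  rw [mem_ball_zero_iff, mem_cubeBd_iff]
  exact (cubeNorm_le_one x).lt_iff_ne

lemma exists_cube {n : ℕ} {t : Fin n → ℝ} (ht : t ∈ Metric.closedBall (0 : Fin n → ℝ) 1) :
    ∃ x : Cube n, (fun i => (x i : ℝ)) = t :=
  ⟨fun i => ⟨t i, abs_le.1 ((norm_le_pi_norm t i).trans (mem_closedBall_zero_iff.1 ht))⟩, rfl⟩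

/-- The characteristic map of a cell. -/
def char (n : ℕ) (i : c.Cell n) : C(Cube n, X) where
  toFun x := c.cw.map n i fun k => (x k : ℝ)
  continuous_toFun := (c.cw.continuousOn n i).comp_continuous (by fun_prop) cube_mem_closedBall

lemma char_smul (g : G) (n : ℕ) (i : c.Cell n) (x : Cube n) :
    c.char n (g • i) x = g • c.char n i x :=
  c.map_smul g n i _ (cube_mem_closedBall x)

lemma range_char (n : ℕ) (i : c.Cell n) :
    Set.range (c.char n i) = c.cw.map n i '' Metric.closedBall 0 1 := by
  ext z
  constructor
  · rintro ⟨x, rfl⟩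
    exact ⟨_, cube_mem_closedBall x, rfl⟩
  · rintro ⟨t, ht, rfl⟩
    obtain ⟨x, rfl⟩ := exists_cube ht
    exact ⟨x, rfl⟩

lemma mem_skelLT {n : ℕ} {z : X} :
    z ∈ c.skelLT n ↔ z ∈ D ∨ ∃ m < n, ∃ (i : c.Cell m) (x : Cube m), c.char m i x = z := by
  let _ := c.t2Space
  let _ := c.cw
  have e : c.skelLT n = RelCWComplex.skeletonLT (Set.univ : Set X) n := rfl
  rw [e, RelCWComplex.coe_skeletonLT]
  simp only [Set.mem_union, Set.mem_iUnion, ENat.natCast_lt_natCast, exists_prop]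
  refine or_congr Iff.rfl (exists_congr fun m => and_congr Iff.rfl (exists_congr fun i => ?_))
  exact (Set.ext_iff.1 (c.range_char m i) z).symm

lemma mem_skelLT_open {n : ℕ} {z : X} :
    z ∈ c.skelLT n ↔
      z ∈ D ∨ ∃ m < n, ∃ (i : c.Cell m) (x : Cube m), x ∉ cubeBd m ∧ c.char m i x = z := by
  let _ := c.t2Space
  let _ := c.cw
  have e : c.skelLT n = RelCWComplex.skeletonLT (Set.univ : Set X) n := rfl
  rw [e, SetLike.mem_coe, RelCWComplex.mem_skeletonLT_iff]
  simp only [ENat.natCast_lt_natCast, exists_prop]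
  refine or_congr Iff.rfl (exists_congr fun m => and_congr Iff.rfl (exists_congr fun i => ?_))
  constructor
  · rintro ⟨t, ht, rfl⟩
    obtain ⟨x, rfl⟩ := exists_cube (Metric.ball_subset_closedBall ht)
    exact ⟨x, cube_mem_ball.1 ht, rfl⟩
  · rintro ⟨x, hx, rfl⟩
    exact ⟨_, cube_mem_ball.2 hx, rfl⟩

lemma exists_open (z : X) (hz : z ∉ D) :
    ∃ (m : ℕ) (i : c.Cell m) (x : Cube m), x ∉ cubeBd m ∧ c.char m i x = z := by
  let _ := c.t2Space
  let _ := c.cw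
  have h : z ∈ ⋃ n : ℕ, (RelCWComplex.skeletonLT (Set.univ : Set X) n : Set X) := by
    rw [RelCWComplex.iUnion_skeletonLT_eq_complex]
    trivial
  obtain ⟨n, hn⟩ := Set.mem_iUnion.1 h
  obtain h | ⟨m, -, h⟩ := c.mem_skelLT_open.1 hn
  · exact absurd h hz
  · exact ⟨m, h⟩

lemma char_open_injective {m n : ℕ} {i : c.Cell m} {j : c.Cell n} {x : Cube m} {y : Cube n}
    (hx : x ∉ cubeBd m) (hy : y ∉ cubeBd n) (h : c.char m i x = c.char n j y) :
    (⟨m, i, x⟩ : Σ m, c.Cell m × Cube m) = ⟨n, j, y⟩ := by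
  let _ := c.t2Space
  let _ := c.cw
  have h1 : (⟨m, i⟩ : Σ m, c.Cell m) = ⟨n, j⟩ := by
    refine RelCWComplex.eq_of_not_disjoint_openCell (C := Set.univ) ?_
    exact Set.not_disjoint_iff.2 ⟨_, ⟨_, cube_mem_ball.2 hx, rfl⟩, ⟨_, cube_mem_ball.2 hy, h.symm⟩⟩
  obtain ⟨rfl, h1⟩ := Sigma.mk.inj_iff.1 h1
  obtain rfl := eq_of_heq h1
  have h2 := (c.cw.map m i).injOn ((c.cw.source_eq m i).symm ▸ cube_mem_ball.2 hx)
    ((c.cw.source_eq m i).symm ▸ cube_mem_ball.2 hy) h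
  have : x = y := funext fun k => Subtype.ext (congrFun h2 k)
  rw [this]

lemma char_notMem_base {n : ℕ} {i : c.Cell n} {x : Cube n} (hx : x ∉ cubeBd n) :
    c.char n i x ∉ D := fun h =>
  Set.disjoint_left.1 (c.cw.disjointBase' n i) ⟨_, cube_mem_ball.2 hx, rfl⟩ h

lemma char_mem_skelLT_succ {n : ℕ} (i : c.Cell n) (x : Cube n) :
    c.char n i x ∈ c.skelLT (n + 1) :=
  c.mem_skelLT.2 (Or.inr ⟨n, n.lt_succ_self, i, x, rfl⟩)

lemma char_mem_skelLT_of_bd {n : ℕ} (i : c.Cell n) {x : Cube n} (hx : x ∈ cubeBd n) :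
    c.char n i x ∈ c.skelLT n := by
  let _ := c.t2Space
  let _ := c.cw
  exact RelCWComplex.cellFrontier_subset_skeletonLT n i ⟨_, cube_mem_sphere.2 hx, rfl⟩

lemma char_notMem_skelLT {n k : ℕ} (h : k ≤ n) (i : c.Cell n) {x : Cube n} (hx : x ∉ cubeBd n) :
    c.char n i x ∉ c.skelLT k := by
  intro hz
  obtain hz | ⟨m, hm, j, y, hy, e⟩ := c.mem_skelLT_open.1 hz
  · exact c.char_notMem_base hx hz
  · have := congrArg Sigma.fst (c.char_open_injective hy hx e)
    simp only at this
    omega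

lemma isClosed_skelLT (n : ℕ) : IsClosed (c.skelLT n) := by
  let _ := c.t2Space
  let _ := c.cw
  exact (RelCWComplex.skeletonLT (Set.univ : Set X) n).closed

lemma isClosed_fixedSkelLT (H : Subgroup G) (n : ℕ) : IsClosed (c.fixedSkelLT H n) := by
  let _ := c.t2Space
  refine (c.isClosed_skelLT n).inter ?_
  have : MulAction.fixedPoints H X = ⋂ h : H, {x | h • x = x} := by
    ext x
    simp [MulAction.mem_fixedPoints]
  rw [this]
  exact isClosed_iInter fun h => isClosed_eq (c.continuous_smul h) continuous_id

lemma fixedSkelLT_mono (H : Subgroup G) (n : ℕ) : c.fixedSkelLT H n ⊆ c.fixedSkelLT H (n + 1) :=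
  Set.inter_subset_inter_left _ (c.skelLT_mono n)

/-- The `n`-cells fixed by `H`. -/
abbrev FixedCell (H : Subgroup G) (n : ℕ) : Type u := MulAction.fixedPoints H (c.Cell n)

lemma char_fixed {H : Subgroup G} {n : ℕ} (i : c.FixedCell H n) (x : Cube n) :
    c.char n i x ∈ c.fixedSkelLT H (n + 1) := by
  refine ⟨c.char_mem_skelLT_succ _ x, fun h => ?_⟩
  refine (c.char_smul h n i x).symm.trans ?_
  rw [show (h : G) • (i : c.Cell n) = i from i.2 h]

lemma cell_fixed {H : Subgroup G} {n : ℕ} {i : c.Cell n} {x : Cube n} (hx : x ∉ cubeBd n)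
    (h : c.char n i x ∈ MulAction.fixedPoints H X) : i ∈ MulAction.fixedPoints H (c.Cell n) := by
  intro g
  have e : c.char n ((g : G) • i) x = c.char n i x := (c.char_smul g n i x).trans (h g)
  have e1 := c.char_open_injective hx hx e
  simp only [Sigma.mk.injEq, heq_eq_eq, Prod.mk.injEq, true_and, and_true] at e1
  exact e1

/-- The `H`-fixed points of the skeleta arise from each other by attaching the cells that are fixed
by `H`. -/
lemma attach_fixed (H : Subgroup G) (n : ℕ) :
    Attach (Subtype.val ⁻¹' c.fixedSkelLT H n : Set (c.fixedSkelLT H (n + 1))) n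
      (fun i : c.FixedCell H n => ⟨fun x => ⟨c.char n i x, c.char_fixed i x⟩, by fun_prop⟩) where
  isClosed := (c.isClosed_fixedSkelLT H n).preimage continuous_subtype_val
  bd i x hx := ⟨c.char_mem_skelLT_of_bd _ hx, (c.char_fixed i x).2⟩
  int i x hx h := c.char_notMem_skelLT le_rfl _ hx h.1
  inj i j x y hx e := by
    have e' : c.char n i x = c.char n j y := congrArg Subtype.val e
    have hy : y ∉ cubeBd n := fun hy =>
      c.char_notMem_skelLT le_rfl _ hx (e' ▸ c.char_mem_skelLT_of_bd _ hy)
    have e1 := c.char_open_injective hx hy e'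
    simp only [Sigma.mk.injEq, heq_eq_eq, Prod.mk.injEq, true_and] at e1
    exact ⟨Subtype.ext e1.1, e1.2⟩
  cover q hq := by
    obtain h | ⟨m, hm, i, x, hx, e⟩ := c.mem_skelLT_open.1 q.2.1
    · exact absurd ⟨c.mem_skelLT.2 (Or.inl h), q.2.2⟩ hq
    · rcases (Nat.lt_succ_iff.1 hm).lt_or_eq with hm | rfl
      · exact absurd ⟨c.mem_skelLT.2 (Or.inr ⟨m, hm, i, x, e⟩), q.2.2⟩ hq
      · exact ⟨⟨i, c.cell_fixed hx (e ▸ q.2.2)⟩, x, Subtype.ext e⟩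
  closed C hC hC' := by
    let _ := c.t2Space
    let _ := c.cw
    -- closedness may be tested on the closed cells, and only on those whose open cell meets `C`
    suffices h : IsClosed (Subtype.val '' C) by
      have := h.preimage (continuous_subtype_val (p := (· ∈ c.fixedSkelLT H (n + 1))))
      rwa [Set.preimage_image_eq _ Subtype.val_injective] at this
    have h1 : IsClosed (Subtype.val '' C ∩ c.skelLT n) := by
      have e : Subtype.val '' C ∩ c.skelLT n =
          Subtype.val '' (C ∩ Subtype.val ⁻¹' c.fixedSkelLT H n) := by
        ext z
        constructor
        · rintro ⟨⟨q, hq, rfl⟩, hz⟩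
          exact ⟨q, ⟨hq, hz, q.2.2⟩, rfl⟩
        · rintro ⟨q, ⟨hq, hz⟩, rfl⟩
          exact ⟨⟨q, hq, rfl⟩, hz.1⟩
      rw [e]
      exact (c.isClosed_fixedSkelLT H (n + 1)).isClosedMap_subtype_val _ hC
    have h2 : ∀ S : Set X, IsClosed S → S ⊆ c.skelLT n → IsClosed (Subtype.val '' C ∩ S) := by
      intro S hS hS'
      have e : Subtype.val '' C ∩ S = (Subtype.val '' C ∩ c.skelLT n) ∩ S := by
        rw [Set.inter_assoc, Set.inter_eq_self_of_subset_right hS']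
      rw [e]
      exact h1.inter hS
    refine RelCWComplex.isClosed_of_disjoint_openCell_or_isClosed_inter_closedCell
      (C := Set.univ) (D := D) (Set.subset_univ _)
      (h2 D c.cw.isClosedBase fun z hz => c.mem_skelLT.2 (Or.inl hz)) fun m _ j => ?_
    rcases lt_trichotomy m n with hm | rfl | hm
    · refine Or.inr (h2 _ RelCWComplex.isClosed_closedCell ?_)
      rintro z hz
      rw [RelCWComplex.closedCell, ← range_char] at hz
      obtain ⟨x, hx⟩ := hz
      exact c.mem_skelLT.2 (Or.inr ⟨m, hm, j, x, hx⟩)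
    · by_cases hj : j ∈ MulAction.fixedPoints H (c.Cell m)
      · refine Or.inr ?_
        have h3 := ((hC' ⟨j, hj⟩).isCompact.image (c.char m j).continuous).isClosed
        have e : Subtype.val '' C ∩ RelCWComplex.closedCell m j = c.char m j ''
            {x | (⟨c.char m j x, c.char_fixed ⟨j, hj⟩ x⟩ : c.fixedSkelLT H (m + 1)) ∈ C} := by
          rw [RelCWComplex.closedCell, ← range_char]
          ext z
          constructor
          · rintro ⟨⟨q, hq, hq'⟩, ⟨x, rfl⟩⟩
            refine ⟨x, ?_, rfl⟩
            obtain rfl : q = ⟨c.char m j x, c.char_fixed ⟨j, hj⟩ x⟩ := Subtype.ext hq'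
            exact hq
          · rintro ⟨x, hx, rfl⟩
            exact ⟨⟨_, hx, rfl⟩, ⟨x, rfl⟩⟩
        rw [e]
        exact h3
      · refine Or.inl (Set.disjoint_left.2 ?_)
        rintro _ ⟨q, -, rfl⟩ ⟨t, ht, e⟩
        obtain ⟨x, rfl⟩ := exists_cube (Metric.ball_subset_closedBall ht)
        exact hj (c.cell_fixed (cube_mem_ball.1 ht)
          ((show c.char m j x = q from e) ▸ q.2.2))
    · refine Or.inl (Set.disjoint_left.2 ?_)
      rintro _ ⟨q, -, rfl⟩ ⟨t, ht, e⟩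
      obtain ⟨x, rfl⟩ := exists_cube (Metric.ball_subset_closedBall ht)
      exact c.char_notMem_skelLT hm j (cube_mem_ball.1 ht) ((show c.char m j x = q from e) ▸ q.2.1)

/-- The cells fixed by `H` form a basis of the relative homology of the fixed points of adjacent
skeleta. -/
theorem relBasis_fixed (H : Subgroup G) {n : ℕ} {g : c.FixedCell H n → Ch (Cube n) n}
    (hg : ∀ i, RelGen Set.univ (cubeBd n) n (g i)) :
    RelBasis (c.fixedSkelLT H (n + 1)) (c.fixedSkelLT H n) n
      fun i : c.FixedCell H n => chMap (c.char n i) n (g i) := by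
  have h : RelIso (subIncl (c.fixedSkelLT H (n + 1))) Set.univ
      (Subtype.val ⁻¹' c.fixedSkelLT H n) (c.fixedSkelLT H (n + 1)) (c.fixedSkelLT H n) n :=
    RelIso.of_isEmbedding IsEmbedding.subtypeVal (fun x _ => x.2) (fun x hx => hx)
      (fun y hy => ⟨⟨y, hy⟩, Set.mem_univ _, rfl⟩)
      (fun y hy => ⟨⟨y, c.fixedSkelLT_mono H n hy⟩, hy, rfl⟩) n
  have := ((c.attach_fixed H n).relBasis hg).map h
  simp_rw [chMap_comp] at this
  exact this

end RelGCWComplex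

/-! ### Construction of relative CW structures from cubes -/

section CubeCW

variable {Z : Type u} [TopologicalSpace Z] [T2Space Z] {W : Set Z}

/-- The nearest point of the cube. -/
def clamp {n : ℕ} (t : Fin n → ℝ) : Cube n := fun i => Set.projIcc (-1) 1 (by norm_num) (t i)

lemma continuous_clamp {n : ℕ} : Continuous (clamp (n := n)) :=
  continuous_pi fun i => continuous_projIcc.comp (continuous_apply i)

lemma clamp_coe {n : ℕ} (x : Cube n) : clamp (fun i => (x i : ℝ)) = x :=
  funext fun i => Set.projIcc_val _ (x i)

lemma coe_clamp {n : ℕ} {t : Fin n → ℝ} (ht : t ∈ Metric.closedBall (0 : Fin n → ℝ) 1) :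
    (fun i => (clamp t i : ℝ)) = t := by
  obtain ⟨x, rfl⟩ := RelGCWComplex.exists_cube ht
  rw [clamp_coe]

lemma clamp_notMem_bd {n : ℕ} {t : Fin n → ℝ} (ht : t ∈ Metric.ball (0 : Fin n → ℝ) 1) :
    clamp t ∉ cubeBd n := by
  rw [← RelGCWComplex.cube_mem_ball, coe_clamp (Metric.ball_subset_closedBall ht)]
  exact ht

lemma clamp_mem_bd {n : ℕ} {t : Fin n → ℝ} (ht : t ∈ Metric.sphere (0 : Fin n → ℝ) 1) :
    clamp t ∈ cubeBd n := by
  rw [← RelGCWComplex.cube_mem_sphere, coe_clamp (Metric.sphere_subset_closedBall ht)]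
  exact ht

/-- A relative CW structure from characteristic maps that are defined on cubes. -/
@[reducible] def relCWOfCubes (cell : ℕ → Type u) (χ : ∀ n, cell n → C(Cube n, Z))
    (hW : IsClosed W)
    (inj : ∀ {m n : ℕ} {i : cell m} {j : cell n} {x : Cube m} {y : Cube n}, x ∉ cubeBd m →
      y ∉ cubeBd n → χ m i x = χ n j y → (⟨m, i, x⟩ : Σ m, cell m × Cube m) = ⟨n, j, y⟩)
    (bd : ∀ {n : ℕ} {i : cell n} {x y : Cube n}, χ n i x = χ n i y → y ∉ cubeBd n → x ∉ cubeBd n)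
    (frontier : ∀ (n : ℕ) (i : cell n), ∃ I : ∀ m, Finset (cell m), ∀ x ∈ cubeBd n,
      χ n i x ∈ W ∨ ∃ m < n, ∃ j ∈ I m, ∃ y, χ m j y = χ n i x)
    (base : ∀ {n : ℕ} {i : cell n} {x : Cube n}, x ∉ cubeBd n → χ n i x ∉ W)
    (cover : ∀ z ∉ W, ∃ (n : ℕ) (i : cell n) (x : Cube n), χ n i x = z)
    (closed : ∀ C : Set Z, IsClosed (C ∩ W) → (∀ n i, IsClosed (χ n i ⁻¹' C)) → IsClosed C) :
    RelCWComplex (Set.univ : Set Z) W :=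
  have hinj : ∀ (n : ℕ) (i : cell n),
      Set.InjOn (fun t : Fin n → ℝ => χ n i (clamp t)) (Metric.ball 0 1) :=
    fun n i t ht s hs e => by
    have e1 := inj (clamp_notMem_bd ht) (clamp_notMem_bd hs) e
    simp only [Sigma.mk.injEq, heq_eq_eq, Prod.mk.injEq, true_and] at e1
    rw [← coe_clamp (Metric.ball_subset_closedBall ht), e1,
      coe_clamp (Metric.ball_subset_closedBall hs)]
  have hcont : ∀ (n : ℕ) (i : cell n), Continuous fun t : Fin n → ℝ => χ n i (clamp t) :=
    fun n i => (χ n i).continuous.comp continuous_clamp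
  { cell := cell
    map := fun n i => (hinj n i).toPartialEquiv _ _
    source_eq := fun n i => rfl
    continuousOn := fun n i => (hcont n i).continuousOn
    continuousOn_symm := fun n i => by
      set P := (hinj n i).toPartialEquiv (fun t : Fin n → ℝ => χ n i (clamp t))
        (Metric.ball 0 1)
      refine continuousOn_iff_isClosed.2 fun T hT => ?_
      refine ⟨(fun t : Fin n → ℝ => χ n i (clamp t)) '' (T ∩ Metric.closedBall 0 1),
        (((isCompact_closedBall 0 1).inter_left hT).image (hcont n i)).isClosed, ?_⟩
      ext z
      constructor
      · rintro ⟨h1, h2⟩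
        refine ⟨⟨P.symm z, ⟨h1, Metric.ball_subset_closedBall (P.map_target h2)⟩,
          P.right_inv h2⟩, h2⟩
      · rintro ⟨⟨t, ⟨h1, h2⟩, rfl⟩, ⟨s, hs, e⟩⟩
        have ht : t ∈ Metric.ball (0 : Fin n → ℝ) 1 := by
          rw [← coe_clamp h2, RelGCWComplex.cube_mem_ball]
          exact bd e.symm (clamp_notMem_bd hs)
        refine ⟨?_, ⟨s, hs, e⟩⟩
        rw [Set.mem_preimage]
        have : P.symm (P t) = t := P.left_inv ht
        exact this.symm ▸ h1
    pairwiseDisjoint' := by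
      rintro ⟨m, i⟩ - ⟨n, j⟩ - hne
      refine Set.disjoint_left.2 ?_
      rintro _ ⟨t, ht, rfl⟩ ⟨s, hs, e⟩
      have e1 := inj (clamp_notMem_bd ht) (clamp_notMem_bd hs) e.symm
      exact hne (congrArg (fun s : Σ m, cell m × Cube m => (⟨s.1, s.2.1⟩ : Σ m, cell m)) e1)
    disjointBase' := fun n i => by
      refine Set.disjoint_left.2 ?_
      rintro _ ⟨t, ht, rfl⟩
      exact base (clamp_notMem_bd ht)
    mapsTo := fun n i => by
      obtain ⟨I, hI⟩ := frontier n i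
      refine ⟨I, fun t ht => ?_⟩
      obtain h | ⟨m, hm, j, hj, y, e⟩ := hI _ (clamp_mem_bd ht)
      · exact Or.inl h
      · refine Or.inr ?_
        simp only [Set.mem_iUnion]
        refine ⟨m, hm, j, hj, _, RelGCWComplex.cube_mem_closedBall y, ?_⟩
        refine Eq.trans ?_ e
        exact congrArg (χ m j) (clamp_coe y)
    closed' := fun C _ h => by
      refine closed C h.2 fun n i => ?_
      have h1 := (h.1 n i).preimage (χ n i).continuous
      have e : χ n i ⁻¹' (C ∩ ((fun t : Fin n → ℝ => χ n i (clamp t)) '' Metric.closedBall 0 1)) =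
          χ n i ⁻¹' C := by
        ext x
        refine ⟨fun hx => hx.1, fun hx => ⟨hx, _, RelGCWComplex.cube_mem_closedBall x, ?_⟩⟩
        exact congrArg (χ n i) (clamp_coe x)
      exact e ▸ h1
    isClosedBase := hW
    union' := by
      rw [Set.eq_univ_iff_forall]
      intro z
      by_cases hz : z ∈ W
      · exact Or.inl hz
      · obtain ⟨n, i, x, rfl⟩ := cover z hz
        refine Or.inr ?_
        simp only [Set.mem_iUnion]
        exact ⟨n, i, _, RelGCWComplex.cube_mem_closedBall x, congrArg (χ n i) (clamp_coe x)⟩ }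

end CubeCW

/-! ### Products of relative `G`-CW complexes -/

section ProductCW

variable {G : Type u} [Group G] {X Y : Type u} [TopologicalSpace X] [TopologicalSpace Y]
  [MulAction G X] [MulAction G Y] {D : Set X} {E : Set Y}

/-- A pairing `X × Y → Z` that exhibits the relative complex `(Z, W)` as a product of the relative
complexes `(X, D)` and `(Y, E)`: it collapses `D × Y ∪ X × E` to `W`, and `Z` has the weak topology
with respect to `W` and the products of cells. -/
structure ProductMap (c : RelGCWComplex G X D) (d : RelGCWComplex G Y E) {Z : Type u}
    [TopologicalSpace Z] [MulAction G Z] (W : Set Z) where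
  map : KMap X Y Z
  t2Space : T2Space Z
  continuous_smul : ∀ g : G, Continuous fun z : Z => g • z
  smul_base : ∀ (g : G) (z : Z), z ∈ W → g • z ∈ W
  isClosed_base : IsClosed W
  map_smul : ∀ (g : G) x y, map.toFun (g • x) (g • y) = g • map.toFun x y
  mem_base : ∀ x y, map.toFun x y ∈ W ↔ x ∈ D ∨ y ∈ E
  inj : ∀ x y x' y', x ∉ D → y ∉ E → map.toFun x y = map.toFun x' y' → x = x' ∧ y = y'
  surj : ∀ z ∉ W, ∃ x y, map.toFun x y = z
  closed : ∀ C : Set Z, IsClosed (C ∩ W) → (∀ p q (i : c.Cell p) (j : d.Cell q),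
    IsClosed {s : Cube p × Cube q | map.toFun (c.char p i s.1) (d.char q j s.2) ∈ C}) → IsClosed C

namespace ProductMap

variable {c : RelGCWComplex G X D} {d : RelGCWComplex G Y E} {Z : Type u} [TopologicalSpace Z]
  [MulAction G Z] {W : Set Z} (m : ProductMap c d W)

/-- The `n`-cells of the product. -/
def PCell (c : RelGCWComplex G X D) (d : RelGCWComplex G Y E) (n : ℕ) : Type u :=
  Σ s : Finset.HasAntidiagonal.antidiagonal n, c.Cell s.1.1 × d.Cell s.1.2

lemma antidiagonal_eq {n : ℕ} (s : Finset.HasAntidiagonal.antidiagonal n) : s.1.1 + s.1.2 = n :=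
  Finset.HasAntidiagonal.mem_antidiagonal.1 s.2

/-- The characteristic map of a cell of the product. -/
def pchar (n : ℕ) (k : PCell c d n) : C(Cube n, Z) where
  toFun x := m.map.toFun (c.char _ k.2.1 (cubeFst (antidiagonal_eq k.1) x))
    (d.char _ k.2.2 (cubeSnd (antidiagonal_eq k.1) x))
  continuous_toFun := by
    refine (m.map.cont (c.char _ k.2.1) (d.char _ k.2.2)).comp (Continuous.prodMk ?_ ?_)
    · exact continuous_pi fun i => continuous_apply _
    · exact continuous_pi fun i => continuous_apply _

lemma mem_cubeBd_split {p q n : ℕ} (h : p + q = n) {x : Cube n} :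
    x ∈ cubeBd n ↔ cubeFst h x ∈ cubeBd p ∨ cubeSnd h x ∈ cubeBd q := by
  conv_lhs => rw [← cubeAppend_fst_snd h x]
  exact cubeAppend_mem_bd h

/-- The characteristic maps of the product are jointly injective on the interiors of the cubes. -/
lemma pchar_inj {a b : ℕ} {k : PCell c d a} {l : PCell c d b} {x : Cube a} {y : Cube b}
    (hx : x ∉ cubeBd a) (hy : y ∉ cubeBd b) (e : m.pchar a k x = m.pchar b l y) :
    (⟨a, k, x⟩ : Σ a, PCell c d a × Cube a) = ⟨b, l, y⟩ := by
  obtain ⟨⟨⟨p, q⟩, h⟩, i, j⟩ := k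
  obtain ⟨⟨⟨p', q'⟩, h'⟩, i', j'⟩ := l
  have h0 := Finset.HasAntidiagonal.mem_antidiagonal.1 h
  have h0' := Finset.HasAntidiagonal.mem_antidiagonal.1 h'
  simp only at h0 h0'
  rw [mem_cubeBd_split h0, not_or] at hx
  rw [mem_cubeBd_split h0', not_or] at hy
  obtain ⟨e1, e2⟩ := m.inj _ _ _ _ (c.char_notMem_base hx.1) (d.char_notMem_base hx.2) e
  have e3 := c.char_open_injective hx.1 hy.1 e1
  have e4 := d.char_open_injective hx.2 hy.2 e2
  obtain ⟨rfl, e3⟩ := Sigma.mk.inj_iff.1 e3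
  obtain ⟨rfl, e4⟩ := Sigma.mk.inj_iff.1 e4
  obtain ⟨rfl, e5⟩ := Prod.mk.inj (eq_of_heq e3)
  obtain ⟨rfl, e6⟩ := Prod.mk.inj (eq_of_heq e4)
  obtain rfl : a = b := h0.symm.trans h0'
  have : x = y := by
    rw [← cubeAppend_fst_snd h0 x, e5, e6]
    exact cubeAppend_fst_snd h0 y
  rw [this]

lemma pchar_bd {n : ℕ} {k : PCell c d n} {x y : Cube n} (e : m.pchar n k x = m.pchar n k y)
    (hy : y ∉ cubeBd n) : x ∉ cubeBd n := by
  have h := antidiagonal_eq k.1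
  rw [mem_cubeBd_split h, not_or] at hy ⊢
  obtain ⟨e1, e2⟩ := m.inj _ _ _ _ (c.char_notMem_base hy.1) (d.char_notMem_base hy.2) e.symm
  exact ⟨fun hx => c.char_notMem_skelLT le_rfl _ hy.1 (e1 ▸ c.char_mem_skelLT_of_bd _ hx),
    fun hx => d.char_notMem_skelLT le_rfl _ hy.2 (e2 ▸ d.char_mem_skelLT_of_bd _ hx)⟩

/-- Every closed cell is covered by the base and finitely many closed cells, which have lower
dimension on the boundary. -/
lemma exists_finite_cells (c : RelGCWComplex G X D) {n : ℕ} (i : c.Cell n) :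
    ∃ I : ∀ m, Finset (c.Cell m), i ∈ I n ∧ ∀ x ∈ cubeBd n,
      c.char n i x ∈ D ∨ ∃ m < n, ∃ j ∈ I m, ∃ y, c.char m j y = c.char n i x := by
  classical
  obtain ⟨I, hI⟩ := c.cw.mapsTo n i
  refine ⟨Function.update I n {i}, by simp, fun x hx => ?_⟩
  obtain h | h := hI (RelGCWComplex.cube_mem_sphere.2 hx)
  · exact Or.inl h
  · simp only [Set.mem_iUnion] at h
    obtain ⟨m, hm, j, hj, t, ht, e⟩ := h
    obtain ⟨y, rfl⟩ := RelGCWComplex.exists_cube ht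
    exact Or.inr ⟨m, hm, j, by rwa [Function.update_of_ne hm.ne], y, e⟩

/-- The cell of the product given by two cells. -/
def prodCell {p q n : ℕ} (h : p + q = n) (i : c.Cell p) (j : d.Cell q) : PCell c d n :=
  ⟨⟨(p, q), Finset.HasAntidiagonal.mem_antidiagonal.2 h⟩, i, j⟩

lemma pchar_append {p q n : ℕ} (h : p + q = n) (i : c.Cell p) (j : d.Cell q) (x : Cube p)
    (y : Cube q) :
    m.pchar n (prodCell h i j) (cubeAppend h x y) =
      m.map.toFun (c.char p i x) (d.char q j y) := by
  change m.map.toFun (c.char p i (cubeFst h (cubeAppend h x y)))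
    (d.char q j (cubeSnd h (cubeAppend h x y))) = _
  rw [cubeFst_append, cubeSnd_append]

/-- The boundary of a product of cells is covered by products in which one factor is replaced by a
cell of its boundary. -/
lemma pchar_frontier (n : ℕ) (k : PCell c d n) : ∃ I : ∀ m, Finset (PCell c d m), ∀ x ∈ cubeBd n,
    m.pchar n k x ∈ W ∨ ∃ a < n, ∃ l ∈ I a, ∃ y, m.pchar a l y = m.pchar n k x := by
  obtain ⟨⟨⟨p, q⟩, h⟩, i, j⟩ := k
  have h0 := Finset.HasAntidiagonal.mem_antidiagonal.1 h
  simp only at h0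
  obtain ⟨I, hi, hI⟩ := exists_finite_cells c i
  obtain ⟨J, hj, hJ⟩ := exists_finite_cells d j
  refine ⟨fun a => Finset.univ.sigma fun s => I s.1.1 ×ˢ J s.1.2, fun x hx => ?_⟩
  change m.map.toFun (c.char p i (cubeFst h0 x)) (d.char q j (cubeSnd h0 x)) ∈ W ∨ ∃ a < n,
    ∃ l ∈ Finset.univ.sigma fun s : Finset.HasAntidiagonal.antidiagonal a => I s.1.1 ×ˢ J s.1.2,
      ∃ y, m.pchar a l y = m.map.toFun (c.char p i (cubeFst h0 x)) (d.char q j (cubeSnd h0 x))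
  rcases (mem_cubeBd_split h0).1 hx with hx | hx
  · obtain hw | ⟨p', (hp : p' < p), i', hi', y, e⟩ := hI _ hx
    · exact Or.inl ((m.mem_base _ _).2 (Or.inl hw))
    · refine Or.inr ⟨p' + q, by omega, prodCell rfl i' j, ?_,
        cubeAppend rfl y (cubeSnd h0 x), ?_⟩
      · simp [prodCell, hi', hj]
      · rw [pchar_append, e]
  · obtain hw | ⟨q', (hq : q' < q), j', hj', y, e⟩ := hJ _ hx
    · exact Or.inl ((m.mem_base _ _).2 (Or.inr hw))
    · refine Or.inr ⟨p + q', by omega, prodCell rfl i j', ?_,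
        cubeAppend rfl (cubeFst h0 x) y, ?_⟩
      · simp [prodCell, hi, hj']
      · rw [pchar_append, e]

instance (n : ℕ) : MulAction G (PCell c d n) where
  smul g k := ⟨k.1, g • k.2.1, g • k.2.2⟩
  one_smul k := by
    change (⟨k.1, (1 : G) • k.2.1, (1 : G) • k.2.2⟩ : PCell c d n) = k
    rw [one_smul, one_smul]
    rfl
  mul_smul g h k := by
    change (⟨k.1, (g * h) • k.2.1, (g * h) • k.2.2⟩ : PCell c d n) =
      ⟨k.1, g • h • k.2.1, g • h • k.2.2⟩
    rw [mul_smul, mul_smul]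

/-- The product structure. -/
def product : RelGCWComplex G Z W :=
  letI := m.t2Space
  { t2Space := m.t2Space
    continuous_smul := m.continuous_smul
    smul_base := m.smul_base
    cw := relCWOfCubes (PCell c d) m.pchar m.isClosed_base m.pchar_inj m.pchar_bd m.pchar_frontier
      (fun {n k x} hx hw => by
        rw [mem_cubeBd_split (antidiagonal_eq k.1), not_or] at hx
        rcases (m.mem_base _ _).1 hw with h | h
        · exact c.char_notMem_base hx.1 h
        · exact d.char_notMem_base hx.2 h)
      (fun z hz => by
        obtain ⟨x, y, rfl⟩ := m.surj z hz
        rw [m.mem_base, not_or] at hz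
        obtain ⟨p, i, x, -, rfl⟩ := c.exists_open x hz.1
        obtain ⟨q, j, y, -, rfl⟩ := d.exists_open y hz.2
        exact ⟨p + q, _, _, m.pchar_append rfl i j x y⟩)
      (fun C hC h => by
        refine m.closed C hC fun p q i j => ?_
        have := (h (p + q) (prodCell rfl i j)).preimage
          (continuous_cubeAppend (p := p) (q := q) rfl)
        convert this using 1
        ext s
        rw [Set.mem_preimage, Set.mem_preimage, pchar_append]
        rfl)
    cellAction := fun n => (inferInstance : MulAction G (PCell c d n))
    map_smul := fun g n k t _ => by
      change m.map.toFun (c.char _ (g • k.2.1) _) (d.char _ (g • k.2.2) _) = g • m.map.toFun _ _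
      rw [c.char_smul, d.char_smul, m.map_smul] }

lemma product_char (n : ℕ) (k : PCell c d n) (x : Cube n) :
    m.product.char n k x = m.pchar n k x :=
  congrArg (m.pchar n k) (clamp_coe x)

lemma skelLT_mono' (c : RelGCWComplex G X D) {m n : ℕ} (h : m ≤ n) : c.skelLT m ⊆ c.skelLT n :=
  monotone_nat_of_le_succ c.skelLT_mono h

/-- The skeleta of the product are the unions of the products of skeleta, together with the base. -/
lemma mem_product_skelLT {n : ℕ} {z : Z} : z ∈ m.product.skelLT (n + 1) ↔ z ∈ W ∨
    ∃ (p q : ℕ) (x : X) (y : Y), p + q = n ∧ x ∈ c.skelLT (p + 1) ∧ y ∈ d.skelLT (q + 1) ∧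
      z = m.map.toFun x y := by
  rw [RelGCWComplex.mem_skelLT]
  constructor
  · rintro (h | ⟨a, ha, k, x, rfl⟩)
    · exact Or.inl h
    · have h := antidiagonal_eq k.1
      refine Or.inr ⟨k.1.1.1, n - k.1.1.1, _, _, by omega, c.char_mem_skelLT_succ k.2.1 _,
        skelLT_mono' d (by omega) (d.char_mem_skelLT_succ k.2.2 _), m.product_char a k x⟩
  · rintro (h | ⟨p, q, x, y, h, hx, hy, rfl⟩)
    · exact Or.inl h
    · obtain hx | ⟨p', hp, i, x, rfl⟩ := c.mem_skelLT.1 hx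
      · exact Or.inl ((m.mem_base _ _).2 (Or.inl hx))
      · obtain hy | ⟨q', hq, j, y, rfl⟩ := d.mem_skelLT.1 hy
        · exact Or.inl ((m.mem_base _ _).2 (Or.inr hy))
        · refine Or.inr ⟨p' + q', by omega, prodCell rfl i j, cubeAppend rfl x y, ?_⟩
          rw [product_char, pchar_append]

end ProductMap

end ProductCW

/-! ### Products and smash products as relative complexes -/

section Spaces

variable {G : Type u} [Group G] {X Y : Type u} [TopologicalSpace X] [TopologicalSpace Y]
  [MulAction G X] [MulAction G Y] {D : Set X} {E : Set Y}

/-- The closed cells are covered by the base and finitely many open cells. -/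
lemma RelGCWComplex.exists_finite_open (c : RelGCWComplex G X D) {n : ℕ} (i : c.Cell n) :
    ∃ I : Set (Σ m, c.Cell m), I.Finite ∧ ∀ x, c.char n i x ∈ D ∨
      ∃ k ∈ I, ∃ y ∉ cubeBd k.1, c.char k.1 k.2 y = c.char n i x := by
  let _ := c.t2Space
  let _ := c.cw
  obtain ⟨I, hI⟩ := RelCWComplex.cellFrontier_subset_finite_openCell n i
  refine ⟨{⟨n, i⟩} ∪ ⋃ m ∈ Finset.range n, Sigma.mk m '' (I m : Set (c.Cell m)), ?_, fun x => ?_⟩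
  · exact (Set.finite_singleton _).union
      (Set.Finite.biUnion (Finset.finite_toSet _) fun m _ => (Finset.finite_toSet _).image _)
  · by_cases hx : x ∈ cubeBd n
    · obtain h | h := hI ⟨_, cube_mem_sphere.2 hx, rfl⟩
      · exact Or.inl h
      · simp only [Set.mem_iUnion] at h
        obtain ⟨m, hm, j, hj, t, ht, e⟩ := h
        obtain ⟨y, rfl⟩ := exists_cube (Metric.ball_subset_closedBall ht)
        refine Or.inr ⟨⟨m, j⟩, Or.inr ?_, y, cube_mem_ball.1 ht, e⟩
        simp only [Set.mem_iUnion]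
        exact ⟨m, Finset.mem_range.2 hm, j, hj, rfl⟩
    · exact Or.inr ⟨⟨n, i⟩, Or.inl rfl, x, hx, rfl⟩

/-- A compact subset meets only finitely many open cells. -/
lemma RelGCWComplex.exists_finite_of_isCompact (c : RelGCWComplex G X D) {K : Set X}
    (hK : IsCompact K) : ∃ I : Set (Σ m, c.Cell m), I.Finite ∧ ∀ z ∈ K, z ∈ D ∨
      ∃ k ∈ I, ∃ y, c.char k.1 k.2 y = z := by
  let _ := c.t2Space
  let _ := c.cw
  let I : Set (Σ m, c.Cell m) := {k | ∃ y ∉ cubeBd k.1, c.char k.1 k.2 y ∈ K}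
  refine ⟨I, ?_, fun z hz => ?_⟩
  swap
  · by_cases h : z ∈ D
    · exact Or.inl h
    · obtain ⟨m, i, x, hx, rfl⟩ := c.exists_open z h
      exact Or.inr ⟨⟨m, i⟩, ⟨x, hx, hz⟩, x, rfl⟩
  -- one point in each open cell that meets `K`
  choose y hy hyK using fun k : I => k.2
  let a : I → X := fun k => c.char k.1.1 k.1.2 (y k)
  have ha : Function.Injective a := fun k l e => by
    have := c.char_open_injective (hy k) (hy l) e
    exact Subtype.ext (congrArg (fun s : Σ m, c.Cell m × Cube m =>
      (⟨s.1, s.2.1⟩ : Σ m, c.Cell m)) this)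
  have hcl : ∀ T : Set I, IsClosed (a '' T) := fun T => by
    refine c.cw.closed' _ (Set.subset_univ _) ⟨fun n i => ?_, ?_⟩
    · obtain ⟨F, hF, h⟩ := c.exists_finite_open i
      refine Set.Finite.isClosed (Set.Finite.subset
        ((hF.preimage Subtype.val_injective.injOn).image a) ?_)
      rw [← c.range_char]
      rintro _ ⟨⟨k, -, rfl⟩, ⟨x, hx⟩⟩
      obtain hD | ⟨l, hl, z, hz, e⟩ := h x
      · exact absurd (hx ▸ hD) (c.char_notMem_base (hy k))
      · have := c.char_open_injective hz (hy k) (e.trans hx)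
        have e' : l = k.1 := congrArg (fun s : Σ m, c.Cell m × Cube m =>
          (⟨s.1, s.2.1⟩ : Σ m, c.Cell m)) this
        exact ⟨k, by rw [Set.mem_preimage, ← e']; exact hl, rfl⟩
    · have : a '' T ∩ D = ∅ := by
        ext z
        constructor
        · rintro ⟨⟨k, -, rfl⟩, h⟩
          exact c.char_notMem_base (hy k) h
        · exact fun h => h.elim
      rw [this]
      exact isClosed_empty
  have hc : IsCompact (Set.range a) := hK.of_isClosed_subset
    (Set.image_univ ▸ hcl Set.univ) (by rintro _ ⟨k, rfl⟩; exact hyK k)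
  have hd : DiscreteTopology (Set.range a) := by
    refine discreteTopology_iff_forall_isClosed.2 fun T => ?_
    have h1 := (hcl (a ⁻¹' (Subtype.val '' T))).preimage
      (continuous_subtype_val (p := (· ∈ Set.range a)))
    convert h1 using 1
    ext ⟨_, k, rfl⟩
    constructor
    · exact fun h => ⟨k, ⟨_, h, rfl⟩, rfl⟩
    · rintro ⟨l, ⟨q, hq, e⟩, e'⟩
      have : q = ⟨a k, k, rfl⟩ := Subtype.ext (e.trans e')
      exact this ▸ hq
  have : CompactSpace (Set.range a) := isCompact_iff_compactSpace.1 hc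
  have hf : Finite (Set.range a) := finite_of_compact_of_discrete
  exact Set.finite_coe_iff.1 (Finite.of_injective (Set.rangeFactorization a)
    fun k l e => ha (congrArg Subtype.val e))

/-- The pairing of two spaces with values in their product. -/
def kprodMap (X Y : Type u) [TopologicalSpace X] [TopologicalSpace Y] : KMap X Y (KProd X Y) where
  toFun := KProd.mk
  cont a b := CompactCoherentification.continuous_mk_comp_iff_of_compactSpace.2
    ((a.continuous.comp continuous_fst).prodMk (b.continuous.comp continuous_snd))

lemma continuous_kprod_smul (hX : ∀ g : G, Continuous fun x : X => g • x)
    (hY : ∀ g : G, Continuous fun y : Y => g • y) (g : G) :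
    Continuous fun z : KProd X Y => g • z :=
  CompactCoherentification.continuous_map_of_continuous ((hX g).prodMap (hY g))

/-- The product has the weak topology with respect to the products of cells, relative to the union
of the products with the bases: compact subsets of the factors meet finitely many open cells. -/
lemma isClosed_kprod (c : RelGCWComplex G X D) (d : RelGCWComplex G Y E) {S : Set (KProd X Y)}
    (h : IsClosed (S ∩ {z | ∃ x y, z = KProd.mk x y ∧ (x ∈ D ∨ y ∈ E)}))
    (h' : ∀ p q (i : c.Cell p) (j : d.Cell q),
      IsClosed {s : Cube p × Cube q | KProd.mk (c.char p i s.1) (d.char q j s.2) ∈ S}) :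
    IsClosed S := by
  let _ := c.t2Space
  let _ := d.t2Space
  refine CompactCoherentification.isClosed_iff.2 fun K hK => ?_
  obtain ⟨I, hI, hI'⟩ := c.exists_finite_of_isCompact (hK.image continuous_fst)
  obtain ⟨J, hJ, hJ'⟩ := d.exists_finite_of_isCompact (hK.image continuous_snd)
  let B : Set (KProd X Y) := {z | ∃ x y, z = KProd.mk x y ∧ (x ∈ D ∨ y ∈ E)}
  let P : (Σ m, c.Cell m) → (Σ m, d.Cell m) → Set (X × Y) := fun k l =>
    (fun s : Cube k.1 × Cube l.1 => (c.char k.1 k.2 s.1, d.char l.1 l.2 s.2)) ''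
      {s | KProd.mk (c.char k.1 k.2 s.1) (d.char l.1 l.2 s.2) ∈ S}
  have hP : ∀ k l, IsClosed (P k l) := fun k l =>
    ((h' _ _ k.2 l.2).isCompact.image (by fun_prop)).isClosed
  have h1 : IsClosed (⋃ k ∈ I, ⋃ l ∈ J, P k l) :=
    hI.isClosed_biUnion fun k _ => hJ.isClosed_biUnion fun l _ => hP k l
  have h2 := (CompactCoherentification.isClosed_iff.1 h K hK).union
    (h1.preimage (continuous_subtype_val (p := (· ∈ K))))
  convert h2 using 1
  ext ⟨⟨x, y⟩, hz⟩
  constructor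
  · intro hs
    by_cases hB : x ∈ D ∨ y ∈ E
    · exact Or.inl ⟨hs, x, y, rfl, hB⟩
    · rw [not_or] at hB
      obtain hx | ⟨k, hk, s, rfl⟩ := hI' x ⟨_, hz, rfl⟩
      · exact absurd hx hB.1
      obtain hy | ⟨l, hl, t, rfl⟩ := hJ' y ⟨_, hz, rfl⟩
      · exact absurd hy hB.2
      refine Or.inr ?_
      simp only [Set.mem_preimage, Set.mem_iUnion]
      exact ⟨k, hk, l, hl, (s, t), hs, rfl⟩
  · rintro (hs | hs)
    · exact hs.1
    · simp only [Set.mem_preimage, Set.mem_iUnion] at hs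
      obtain ⟨k, -, l, -, s, hs, e⟩ := hs
      exact (congrArg (fun z : X × Y => KProd.mk z.1 z.2 ∈ S) e).mp hs

/-- The product of two `G`-CW complexes. -/
def kprodProduct (c : GCWComplex G X) (d : GCWComplex G Y) :
    ProductMap c d (∅ : Set (KProd X Y)) where
  map := kprodMap X Y
  t2Space := by
    let _ := c.t2Space
    let _ := d.t2Space
    exact CompactCoherentification.t2space
  continuous_smul := continuous_kprod_smul c.continuous_smul d.continuous_smul
  smul_base _ _ h := h.elim
  isClosed_base := isClosed_empty
  map_smul _ _ _ := rfl
  mem_base _ _ := ⟨fun h => h.elim, fun h => h.elim (fun h => h.elim) fun h => h.elim⟩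
  inj _ _ _ _ _ _ e := Prod.mk.inj e
  surj z _ := ⟨z.1, z.2, rfl⟩
  closed C _ h := by
    refine isClosed_kprod c d ?_ h
    have : {z : KProd X Y | ∃ x y, z = KProd.mk x y ∧ (x ∈ (∅ : Set X) ∨ y ∈ (∅ : Set Y))} = ∅ := by
      ext z
      simp
    rw [this, Set.inter_empty]
    exact isClosed_empty

lemma kprodProduct_isProductStructure (c : GCWComplex G X) (d : GCWComplex G Y) :
    IsProductStructure c d (kprodProduct c d).product := fun n => by
  ext z
  rw [ProductMap.mem_product_skelLT]
  exact ⟨fun h => h.elim (fun h => h.elim) id, Or.inr⟩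

section SmashCW

variable {x₀ : MulAction.fixedPoints G X} {y₀ : MulAction.fixedPoints G Y}

/-- The pairing of two based spaces with values in their smash product. -/
def smashMap (x₀ : MulAction.fixedPoints G X) (y₀ : MulAction.fixedPoints G Y) :
    KMap X Y (Smash x₀ y₀) where
  toFun x y := Smash.proj x₀ y₀ (KProd.mk x y)
  cont a b := continuous_quotient_mk'.comp ((kprodMap X Y).cont a b)

lemma mem_wedge {x : X} {y : Y} :
    KProd.mk x y ∈ wedge x₀ y₀ ↔ x ∈ ({(x₀ : X)} : Set X) ∨ y ∈ ({(y₀ : Y)} : Set Y) := by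
  constructor
  · rintro (⟨x', e⟩ | ⟨y', e⟩)
    · exact Or.inr (congrArg Prod.snd e)
    · exact Or.inl (congrArg Prod.fst e)
  · rintro (rfl | rfl)
    · exact Or.inr ⟨y, rfl⟩
    · exact Or.inl ⟨x, rfl⟩

lemma proj_eq_iff {z w : KProd X Y} : Smash.proj x₀ y₀ z = Smash.proj x₀ y₀ w ↔
    z = w ∨ (z ∈ wedge x₀ y₀ ∧ w ∈ wedge x₀ y₀) :=
  Quotient.eq (r := wedgeSetoid x₀ y₀)

lemma proj_eq_base_iff {z : KProd X Y} :
    Smash.proj x₀ y₀ z ∈ ({(Smash.basePoint x₀ y₀ : Smash x₀ y₀)} : Set (Smash x₀ y₀)) ↔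
      z ∈ wedge x₀ y₀ := by
  refine proj_eq_iff.trans ?_
  have h : KProd.mk (x₀ : X) (y₀ : Y) ∈ wedge x₀ y₀ := mem_wedge.2 (Or.inl rfl)
  constructor
  · rintro (rfl | h')
    · exact h
    · exact h'.1
  · exact fun h' => Or.inr ⟨h', h⟩

lemma isClosed_smash_iff {C : Set (Smash x₀ y₀)} :
    IsClosed C ↔ IsClosed (Smash.proj x₀ y₀ ⁻¹' C) :=
  (isQuotientMap_quotient_mk' (s := wedgeSetoid x₀ y₀)).isClosed_preimage.symm

lemma isOpen_smash_iff {C : Set (Smash x₀ y₀)} :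
    IsOpen C ↔ IsOpen (Smash.proj x₀ y₀ ⁻¹' C) :=
  (isQuotientMap_quotient_mk' (s := wedgeSetoid x₀ y₀)).isOpen_preimage.symm

/-- The open set of points of the product with prescribed open sets of coordinates. -/
lemma isOpen_kprod {U : Set (X × Y)} (hU : IsOpen U) :
    IsOpen ((CompactCoherentification.mk (X × Y)).symm ⁻¹' U : Set (KProd X Y)) :=
  hU.preimage CompactCoherentification.continuous_mk_symm

/-- Points and the wedge are separated in the product by open sets given by coordinates. -/
lemma t2Space_smash [T2Space X] [T2Space Y] : T2Space (Smash x₀ y₀) := by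
  have hx : ∀ {x : X} {y : Y}, KProd.mk x y ∉ wedge x₀ y₀ → x ≠ x₀ ∧ y ≠ y₀ := fun h => by
    rw [mem_wedge, not_or] at h
    exact h
  -- open sets of the product that contain the wedge or are disjoint from it give open sets
  have hW : IsClosed (wedge x₀ y₀ : Set (KProd X Y)) := by
    have : (wedge x₀ y₀ : Set (KProd X Y)) = (CompactCoherentification.mk (X × Y)).symm ⁻¹'
        {s | s.1 = x₀ ∨ s.2 = y₀} := by
      ext ⟨x, y⟩
      exact mem_wedge
    rw [this]
    exact ((isClosed_eq continuous_fst continuous_const).union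
      (isClosed_eq continuous_snd continuous_const)).preimage
        CompactCoherentification.continuous_mk_symm
  have h1 : ∀ U : Set (KProd X Y), IsOpen U → Disjoint U (wedge x₀ y₀) →
      IsOpen (Smash.proj x₀ y₀ '' U) := fun U hU hd => by
    rw [isOpen_smash_iff]
    convert hU using 1
    ext z
    constructor
    · rintro ⟨w, hw, e⟩
      obtain rfl | h := proj_eq_iff.1 e
      · exact hw
      · exact absurd h.1 (Set.disjoint_left.1 hd hw)
    · exact fun hz => ⟨z, hz, rfl⟩
  have h2 : ∀ U : Set (KProd X Y), IsOpen U → wedge x₀ y₀ ⊆ U →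
      IsOpen (Smash.proj x₀ y₀ '' U) := fun U hU hd => by
    rw [isOpen_smash_iff]
    convert hU using 1
    ext z
    constructor
    · rintro ⟨w, hw, e⟩
      obtain rfl | h := proj_eq_iff.1 e
      · exact hw
      · exact hd h.2
    · exact fun hz => ⟨z, hz, rfl⟩
  -- a point outside of the wedge has a neighbourhood that is disjoint from one of the wedge
  have h3 : ∀ {z w : KProd X Y}, z ∉ wedge x₀ y₀ → w ∈ wedge x₀ y₀ → ∃ U V : Set (Smash x₀ y₀),
      IsOpen U ∧ IsOpen V ∧ Smash.proj x₀ y₀ z ∈ U ∧ Smash.proj x₀ y₀ w ∈ V ∧ Disjoint U V := by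
    intro z w hz hw
    obtain ⟨x, y⟩ := z
    obtain ⟨h4, h5⟩ := hx hz
    obtain ⟨A, A', hA, hA', xA, xA', hAA⟩ := t2_separation h4
    obtain ⟨B, B', hB, hB', yB, yB', hBB⟩ := t2_separation h5
    let U : Set (KProd X Y) := (CompactCoherentification.mk (X × Y)).symm ⁻¹' (A ×ˢ B)
    let V : Set (KProd X Y) := (CompactCoherentification.mk (X × Y)).symm ⁻¹'
      (A' ×ˢ Set.univ ∪ Set.univ ×ˢ B')
    have hV : wedge x₀ y₀ ⊆ V := by
      rintro ⟨a, b⟩ h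
      rcases mem_wedge.1 h with rfl | rfl
      · exact Or.inl ⟨xA', trivial⟩
      · exact Or.inr ⟨trivial, yB'⟩
    have hUV : Disjoint U V := by
      refine Set.disjoint_left.2 ?_
      rintro ⟨a, b⟩ h (h' | h')
      · exact Set.disjoint_left.1 hAA h.1 h'.1
      · exact Set.disjoint_left.1 hBB h.2 h'.2
    refine ⟨_, _, h1 U (isOpen_kprod (hA.prod hB)) (hUV.mono_right hV), h2 V (isOpen_kprod
      ((hA'.prod isOpen_univ).union (isOpen_univ.prod hB'))) hV, ⟨KProd.mk x y, ⟨xA, yB⟩, rfl⟩,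
      ⟨_, hV hw, rfl⟩, ?_⟩
    refine Set.disjoint_left.2 ?_
    rintro _ ⟨a, ha, rfl⟩ ⟨b, hb, e⟩
    obtain rfl | h := proj_eq_iff.1 e
    · exact Set.disjoint_left.1 hUV ha hb
    · exact Set.disjoint_left.1 hUV ha (hV h.2)
  refine ⟨fun z w hzw => ?_⟩
  obtain ⟨z, rfl⟩ := Quotient.exists_rep z
  obtain ⟨w, rfl⟩ := Quotient.exists_rep w
  by_cases hz : z ∈ wedge x₀ y₀ <;> by_cases hw : w ∈ wedge x₀ y₀
  · exact absurd (proj_eq_iff.2 (Or.inr ⟨hz, hw⟩)) hzw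
  · obtain ⟨U, V, hU, hV, zU, wV, h⟩ := h3 hw hz
    exact ⟨V, U, hV, hU, wV, zU, h.symm⟩
  · exact h3 hz hw
  · have hne : z ≠ w := fun h => hzw (congrArg _ h)
    have : T2Space (KProd X Y) := CompactCoherentification.t2space
    obtain ⟨A, B, hA, hB, zA, wB, h⟩ := t2_separation hne
    refine ⟨_, _, h1 (A \ wedge x₀ y₀) (hA.sdiff hW) Set.disjoint_sdiff_left,
      h1 (B \ wedge x₀ y₀) (hB.sdiff hW) Set.disjoint_sdiff_left, ⟨z, ⟨zA, hz⟩, rfl⟩,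
      ⟨w, ⟨wB, hw⟩, rfl⟩, ?_⟩
    refine Set.disjoint_left.2 ?_
    rintro _ ⟨a, ha, rfl⟩ ⟨b, hb, e⟩
    obtain rfl | h' := proj_eq_iff.1 e
    · exact Set.disjoint_left.1 h ha.1 hb.1
    · exact ha.2 h'.2

/-- The smash product of two based `G`-CW complexes. -/
def smashProduct (c : BasedGCWComplex G X x₀) (d : BasedGCWComplex G Y y₀) :
    ProductMap c d ({(Smash.basePoint x₀ y₀ : Smash x₀ y₀)} : Set (Smash x₀ y₀)) where
  map := smashMap x₀ y₀
  t2Space := by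
    let _ := c.t2Space
    let _ := d.t2Space
    exact t2Space_smash
  continuous_smul g := by
    refine (isQuotientMap_quotient_mk' (s := wedgeSetoid x₀ y₀)).continuous_iff.2 ?_
    exact continuous_quotient_mk'.comp
      (continuous_kprod_smul c.continuous_smul d.continuous_smul g)
  smul_base g z h := by
    rw [Set.mem_singleton_iff] at h
    rw [h]
    exact (Smash.basePoint x₀ y₀).2 g
  isClosed_base := by
    let _ := c.t2Space
    let _ := d.t2Space
    have : T2Space (Smash x₀ y₀) := t2Space_smash
    exact isClosed_singleton
  map_smul _ _ _ := rfl
  mem_base x y := proj_eq_base_iff.trans mem_wedge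
  inj x y x' y' hx hy e := by
    obtain h | h := proj_eq_iff.1 e
    · exact Prod.mk.inj h
    · exact absurd (mem_wedge.1 h.1) (not_or.2 ⟨hx, hy⟩)
  surj z _ := by
    obtain ⟨⟨x, y⟩, rfl⟩ := Quotient.exists_rep z
    exact ⟨x, y, rfl⟩
  closed C hC h := by
    rw [isClosed_smash_iff] at hC ⊢
    refine isClosed_kprod c d ?_ h
    convert hC using 1
    ext ⟨x, y⟩
    refine and_congr Iff.rfl (Iff.trans ?_ (proj_eq_base_iff.trans mem_wedge).symm)
    constructor
    · rintro ⟨x', y', e, h⟩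
      obtain ⟨rfl, rfl⟩ := Prod.mk.inj e
      exact h
    · exact fun h => ⟨x, y, rfl, h⟩

lemma smashProduct_isSmashStructure (c : BasedGCWComplex G X x₀) (d : BasedGCWComplex G Y y₀) :
    IsSmashStructure c d (smashProduct c d).product := fun n => by
  ext z
  rw [ProductMap.mem_product_skelLT]
  constructor
  · rintro (rfl | ⟨p, q, x, y, h, hx, hy, rfl⟩)
    · exact ⟨_, ⟨0, n, x₀, y₀, zero_add n, c.mem_skelLT.2 (Or.inl rfl), d.mem_skelLT.2 (Or.inl rfl),
        rfl⟩, rfl⟩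
    · exact ⟨_, ⟨p, q, x, y, h, hx, hy, rfl⟩, rfl⟩
  · rintro ⟨_, ⟨p, q, x, y, h, hx, hy, rfl⟩, rfl⟩
    exact Or.inr ⟨p, q, x, y, h, hx, hy, rfl⟩

end SmashCW

end Spaces

/-! ### Comparison with the singular chain complex functor -/

section Compare

open Opposite

/-- A singular simplex as an element of the singular simplicial set. -/
def toSimplex (X : TopCat.{u}) {n : ℕ} (σ : C(Simp n, X)) :
    (TopCat.toSSet.obj X).obj (op (SimplexCategory.mk n)) :=
  (X.toSSetObjEquiv (op (SimplexCategory.mk n))).symm σ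

/-- The generator of the group of singular chains with a given coefficient. -/
def simplexHom (X : TopCat.{u}) {n : ℕ} (σ : C(Simp n, X)) :
    AddCommGrpCat.of (ULift.{u + 1} ℤ) ⟶ (singularChains.obj X).X n :=
  (TopCat.toSSet.obj X).ιChainComplex (toSimplex X σ)

/-- The comparison of finitely supported functions on the singular simplices with the coproduct
over the singular simplices. -/
def chTo (X : TopCat.{u}) (n : ℕ) : Ch X n →+ (singularChains.obj X).X n :=
  Finsupp.liftAddHom fun σ => (simplexHom X σ).hom.comp AddEquiv.ulift.symm.toAddMonoidHom

lemma chTo_single (X : TopCat.{u}) (n : ℕ) (σ : C(Simp n, X)) (k : ℤ) :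
    chTo X n (Finsupp.single σ k) = simplexHom X σ ⟨k⟩ := by
  rw [chTo, Finsupp.liftAddHom_apply_single]
  rfl

/-- The inverse of `chTo`. -/
def chFrom (X : TopCat.{u}) (n : ℕ) :
    (singularChains.obj X).X n ⟶ AddCommGrpCat.of (ULift.{u + 1} (Ch X n)) :=
  ((TopCat.toSSet.obj X).isColimitChainComplexXCofan (AddCommGrpCat.of (ULift.{u + 1} ℤ)) n).desc
    (Cofan.mk _ fun x => AddCommGrpCat.ofHom
      ((AddEquiv.ulift.symm.toAddMonoidHom.comp
        (Finsupp.singleAddHom (X.toSSetObjEquiv (op (SimplexCategory.mk n)) x))).comp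
          AddEquiv.ulift.toAddMonoidHom))

lemma chFrom_simplexHom (X : TopCat.{u}) (n : ℕ) (σ : C(Simp n, X)) (k : ULift.{u + 1} ℤ) :
    chFrom X n (simplexHom X σ k) = ⟨Finsupp.single σ k.down⟩ := by
  have h : simplexHom X σ ≫ chFrom X n = _ :=
    ((TopCat.toSSet.obj X).isColimitChainComplexXCofan (AddCommGrpCat.of (ULift.{u + 1} ℤ)) n).fac _
      ⟨toSimplex X σ⟩
  exact congrArg (fun f => f.hom k) h

lemma chFrom_chTo (X : TopCat.{u}) (n : ℕ) (z : Ch X n) : chFrom X n (chTo X n z) = ⟨z⟩ := by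
  have : (chFrom X n).hom.comp (chTo X n) = AddEquiv.ulift.symm.toAddMonoidHom := by
    refine Finsupp.addHom_ext fun σ k => ?_
    rw [AddMonoidHom.comp_apply, chTo_single]
    exact chFrom_simplexHom X n σ ⟨k⟩
  exact DFunLike.congr_fun this z

lemma chTo_chFrom (X : TopCat.{u}) (n : ℕ) (z : (singularChains.obj X).X n) :
    chTo X n (chFrom X n z).down = z := by
  have : chFrom X n ≫ AddCommGrpCat.ofHom ((chTo X n).comp AddEquiv.ulift.toAddMonoidHom) =
      𝟙 _ := by
    refine SSet.chainComplex_hom_ext fun x => ?_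
    ext k
    have h := chFrom_simplexHom X n (X.toSSetObjEquiv (op (SimplexCategory.mk n)) x) k
    refine (congrArg (fun w : ULift.{u + 1} (Ch X n) => chTo X n w.down) h).trans ?_
    exact chTo_single X n _ _
  exact congrArg (fun f => f.hom z) this

lemma chTo_bijective (X : TopCat.{u}) (n : ℕ) : Function.Bijective (chTo X n) :=
  ⟨fun z w h => congrArg ULift.down ((chFrom_chTo X n z).symm.trans
    ((congrArg (chFrom X n) h).trans (chFrom_chTo X n w))), fun z => ⟨_, chTo_chFrom X n z⟩⟩

lemma chTo_map {X Y : TopCat.{u}} (f : X ⟶ Y) (n : ℕ) (z : Ch X n) :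
    (singularChains.map f).f n (chTo X n z) = chTo Y n (chMap f.hom n z) := by
  have : ((singularChains.map f).f n).hom.comp (chTo X n) =
      (chTo Y n).comp (chMap f.hom n).toAddMonoidHom := by
    refine Finsupp.addHom_ext fun σ k => ?_
    rw [AddMonoidHom.comp_apply, AddMonoidHom.comp_apply, chTo_single]
    have h : simplexHom X σ ≫ (singularChains.map f).f n = simplexHom Y (f.hom.comp σ) :=
      SSet.ι_chainComplexMap_f (TopCat.toSSet.obj X) (TopCat.toSSet.obj Y) (TopCat.toSSet.map f) _ _
    refine (congrArg (fun g => g.hom ⟨k⟩) h).trans ?_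
    refine (chTo_single Y n _ k).symm.trans ?_
    congr 1
    exact (Finsupp.mapDomain_single).symm
  exact DFunLike.congr_fun this z

/-- Evaluation at an element, as a homomorphism. -/
def homEval (M N : AddCommGrpCat.{w₁}) (x : M) : (M ⟶ N) →+ N where
  toFun f := f.hom x
  map_zero' := rfl
  map_add' _ _ := rfl

lemma stdSimplex_map_succAbove {n : ℕ} (i : Fin (n + 2)) :
    (⟨stdSimplex.map i.succAbove, by continuity⟩ : C(Simp n, Simp (n + 1))) =
      bary (verts (n + 1) ∘ i.succAbove) := by
  ext t j
  change FunOnFinite.linearMap ℝ ℝ i.succAbove t j =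
    ∑ k, t k * (Pi.single (i.succAbove k) (1 : ℝ) : Fin (n + 2) → ℝ) j
  rw [FunOnFinite.linearMap_apply_apply, Finset.sum_filter]
  refine Finset.sum_congr rfl fun k _ => ?_
  rw [Pi.single_apply]
  by_cases h : i.succAbove k = j
  · rw [if_pos h, if_pos h.symm, mul_one]
  · rw [if_neg h, if_neg (Ne.symm h), mul_zero]

/-- The boundary of singular chains agrees with the alternating face map differential. -/
lemma chTo_d_succ (X : TopCat.{u}) (n : ℕ) (z : Ch X (n + 1)) :
    (singularChains.obj X).d (n + 1) n (chTo X (n + 1) z) = chTo X n (chDs n z) := by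
  have : ((singularChains.obj X).d (n + 1) n).hom.comp (chTo X (n + 1)) =
      (chTo X n).comp (chDs n).toAddMonoidHom := by
    refine Finsupp.addHom_ext' fun σ => AddMonoidHom.ext_int ?_
    rw [AddMonoidHom.comp_apply, AddMonoidHom.comp_apply, AddMonoidHom.comp_apply,
      AddMonoidHom.comp_apply]
    change (singularChains.obj X).d (n + 1) n (chTo X (n + 1) (sing σ)) =
      chTo X n (chD (n + 1) (sing σ))
    rw [chTo_single, chD_sing, tupD_tup]
    have h : simplexHom X σ ≫ (singularChains.obj X).d (n + 1) n = _ :=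
      SSet.ιChainComplex_d _ _ _
    refine (congrArg (fun g => g.hom ⟨1⟩) h).trans ?_
    refine (map_sum (homEval (AddCommGrpCat.of (ULift.{u + 1} ℤ))
      ((singularChains.obj X).X n) ⟨1⟩) _ _).trans ?_
    refine Eq.trans ?_ (congrArg (chTo X n) (map_sum (real σ n) _ _)).symm
    refine Eq.trans ?_ (map_sum (chTo X n) _ _).symm
    refine Finset.sum_congr rfl fun i _ => ?_
    rw [map_smul, real_tup, map_zsmul, chTo_single]
    refine (map_zsmul (homEval (AddCommGrpCat.of (ULift.{u + 1} ℤ))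
      ((singularChains.obj X).X n) ⟨1⟩) _ _).trans (congrArg _ ?_)
    exact congrArg (fun f => (simplexHom X (σ.comp f)).hom (⟨1⟩ : ULift.{u + 1} ℤ))
      (stdSimplex_map_succAbove i)
  exact DFunLike.congr_fun this z

lemma chTo_d (X : TopCat.{u}) : ∀ (n : ℕ) (z : Ch X n),
    (singularChains.obj X).d n (n - 1) (chTo X n z) = chTo X (n - 1) (chD n z)
  | 0, z => by
    rw [(singularChains.obj X).shape 0 (0 - 1) (by simp), chD_zero]
    exact (map_zero _).symm
  | n + 1, z => chTo_d_succ X n z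

end Compare

/-! ### Relative homology classes -/

section RelClass

open HomologicalComplex hiding eval

variable (S T : ShortComplex (ChainComplex AddCommGrpCat.{u} ℕ))

/-- The elements of the middle complex whose boundary vanishes in the quotient. -/
def relKer (n : ℕ) : AddSubgroup (S.X₂.X n) :=
  (S.X₂.d n (n - 1) ≫ S.g.f (n - 1)).hom.ker

variable {S T} in
lemma mem_relKer {n : ℕ} {x : S.X₂.X n} :
    x ∈ relKer S n ↔ S.g.f (n - 1) (S.X₂.d n (n - 1) x) = 0 := Iff.rfl

lemma down_next (n : ℕ) : (ComplexShape.down ℕ).next n = n - 1 := by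
  cases n with
  | zero => exact ChainComplex.next_nat_zero
  | succ n => exact ChainComplex.next_nat_succ n

/-- The cycle in the quotient represented by an element whose boundary vanishes there. -/
def relCycle (n : ℕ) : AddCommGrpCat.of (relKer S n) ⟶ S.X₃.cycles n :=
  S.X₃.liftCycles (AddCommGrpCat.ofHom (relKer S n).subtype ≫ S.g.f n) (n - 1) (down_next n)
    (by
      ext x
      rw [Category.assoc, S.g.comm]
      exact x.2)

lemma relCycle_i (n : ℕ) : relCycle S n ≫ S.X₃.iCycles n =
    AddCommGrpCat.ofHom (relKer S n).subtype ≫ S.g.f n :=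
  S.X₃.liftCycles_i _ _ _ _

variable {S} in
lemma iCycles_relCycle {n : ℕ} (x : relKer S n) :
    S.X₃.iCycles n (relCycle S n x) = S.g.f n x.1 :=
  congrArg (fun q => q.hom x) (relCycle_i S n)

/-- The homology class in the quotient of an element whose boundary vanishes there. -/
def relClass (n : ℕ) : AddCommGrpCat.of (relKer S n) ⟶ S.X₃.homology n :=
  relCycle S n ≫ S.X₃.homologyπ n

variable {S T} in
/-- Naturality of the class. It is verified for morphisms out of the integers that represent the
elements, where the universal properties apply. -/
lemma relClass_map (φ : S ⟶ T) (n : ℕ) (x : relKer S n) (y : relKer T n)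
    (h : φ.τ₂.f n x.1 = y.1) :
    homologyMap φ.τ₃ n (relClass S n x) = relClass T n y := by
  let k : AddCommGrpCat.of (ULift.{u} ℤ) ⟶ AddCommGrpCat.of (relKer S n) :=
    AddCommGrpCat.ofHom ((zmultiplesHom _ x).comp AddEquiv.ulift.toAddMonoidHom)
  let l : AddCommGrpCat.of (ULift.{u} ℤ) ⟶ AddCommGrpCat.of (relKer T n) :=
    AddCommGrpCat.ofHom ((zmultiplesHom _ y).comp AddEquiv.ulift.toAddMonoidHom)
  have hk : k ⟨1⟩ = x := one_zsmul x
  have hl : l ⟨1⟩ = y := one_zsmul y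
  have h1 : k ≫ relClass S n ≫ homologyMap φ.τ₃ n = l ≫ relClass T n := by
    rw [relClass, relClass, Category.assoc, homologyπ_naturality, ← Category.assoc,
      ← Category.assoc, ← Category.assoc]
    congr 1
    rw [← cancel_mono (T.X₃.iCycles n)]
    simp only [Category.assoc, cyclesMap_i, relCycle_i, reassoc_of% relCycle_i]
    have h2 : S.g.f n ≫ φ.τ₃.f n = φ.τ₂.f n ≫ T.g.f n :=
      congrArg (fun q => q.f n) φ.comm₂₃.symm
    rw [h2]
    ext t
    have h3 : φ.τ₂.f n (k t).1 = (l t).1 := by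
      change φ.τ₂.f n (t.down • x.1) = t.down • y.1
      rw [map_zsmul, h]
    exact congrArg (T.g.f n) h3
  have := congrArg (fun q => q.hom ⟨1⟩) h1
  change homologyMap φ.τ₃ n (relClass S n (k ⟨1⟩)) = relClass T n (l ⟨1⟩) at this
  rwa [hk, hl] at this

variable {S T}

lemma relClass_surjective (hS : S.ShortExact) (n : ℕ) : Function.Surjective (relClass S n) := by
  intro y
  have := hS.epi_g
  obtain ⟨z, rfl⟩ := (AddCommGrpCat.epi_iff_surjective (S.X₃.homologyπ n)).1 inferInstance y
  have hg : Function.Surjective (S.g.f n) :=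
    (AddCommGrpCat.epi_iff_surjective (S.g.f n)).1
      (inferInstanceAs (Epi ((HomologicalComplex.eval AddCommGrpCat _ n).map S.g)))
  obtain ⟨x, hx⟩ := hg (S.X₃.iCycles n z)
  have hx' : x ∈ relKer S n := by
    rw [mem_relKer]
    have h1 := congrArg (fun q => q.hom x) (S.g.comm n (n - 1))
    refine h1.symm.trans ?_
    change S.X₃.d n (n - 1) (S.g.f n x) = 0
    rw [hx]
    exact congrArg (fun q => q.hom z) (S.X₃.iCycles_d n (n - 1))
  refine ⟨⟨x, hx'⟩, ?_⟩
  refine congrArg (S.X₃.homologyπ n) ?_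
  refine (AddCommGrpCat.mono_iff_injective (S.X₃.iCycles n)).1 inferInstance ?_
  exact (iCycles_relCycle _).trans hx

/-- An element represents zero in the homology of the quotient if it is a boundary up to an element
of the subcomplex. -/
lemma relClass_eq_zero (hS : S.ShortExact) (n : ℕ) (x : relKer S n) :
    relClass S n x = 0 ↔ ∃ (a : S.X₁.X n) (w : S.X₂.X (n + 1)),
      x.1 = S.f.f n a + S.X₂.d (n + 1) n w := by
  have := hS.epi_g
  have hg (m : ℕ) : Function.Surjective (S.g.f m) :=
    (AddCommGrpCat.epi_iff_surjective (S.g.f m)).1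
      (inferInstanceAs (Epi ((HomologicalComplex.eval AddCommGrpCat _ m).map S.g)))
  have hprev : (ComplexShape.down ℕ).prev n = n + 1 := ChainComplex.prev ℕ n
  have hex : (S.map (HomologicalComplex.eval _ _ n)).Exact :=
    (hS.map_of_exact (HomologicalComplex.eval _ _ n)).exact
  rw [ShortComplex.ab_exact_iff] at hex
  have hex2 : (ShortComplex.mk (S.X₃.toCycles (n + 1) n) (S.X₃.homologyπ n)
      (S.X₃.toCycles_comp_homologyπ _ _)).Exact :=
    ShortComplex.exact_of_g_is_cokernel _ (S.X₃.homologyIsCokernel (n + 1) n hprev)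
  rw [ShortComplex.ab_exact_iff] at hex2
  constructor
  · intro h
    obtain ⟨v, hv⟩ := hex2 (relCycle S n x) h
    replace hv : S.X₃.toCycles (n + 1) n v = relCycle S n x := hv
    obtain ⟨w, hw⟩ := hg (n + 1) v
    have h1 : S.X₃.d (n + 1) n v = S.g.f n x.1 := by
      rw [← iCycles_relCycle, ← hv]
      exact (congrArg (fun q => q.hom v) (S.X₃.toCycles_i (n + 1) n)).symm
    have h2 : S.g.f n (S.X₂.d (n + 1) n w) = S.X₃.d (n + 1) n v := by
      rw [← hw]
      exact (congrArg (fun q => q.hom w) (S.g.comm (n + 1) n)).symm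
    obtain ⟨a, ha⟩ := hex (x.1 - S.X₂.d (n + 1) n w) (by
      change S.g.f n _ = 0
      rw [map_sub, h2, h1, sub_self])
    refine ⟨a, w, ?_⟩
    have ha' : S.f.f n a = x.1 - S.X₂.d (n + 1) n w := ha
    rw [ha', sub_add_cancel]
  · rintro ⟨a, w, h⟩
    have h3 : relCycle S n x = S.X₃.toCycles (n + 1) n (S.g.f (n + 1) w) := by
      refine (AddCommGrpCat.mono_iff_injective (S.X₃.iCycles n)).1 inferInstance ?_
      refine (iCycles_relCycle x).trans ?_
      have h5 : S.X₃.iCycles n (S.X₃.toCycles (n + 1) n (S.g.f (n + 1) w)) =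
        S.X₃.d (n + 1) n (S.g.f (n + 1) w) :=
        congrArg (fun q => q.hom (S.g.f (n + 1) w)) (S.X₃.toCycles_i (n + 1) n)
      rw [h5, h, map_add]
      have h4 : S.g.f n (S.f.f n a) = 0 :=
        congrArg (fun q => (q.f n).hom a) S.zero
      rw [h4, zero_add]
      exact (congrArg (fun q => q.hom w) (S.g.comm (n + 1) n)).symm
    refine (congrArg (S.X₃.homologyπ n) h3).trans ?_
    exact congrArg (fun q => q.hom (S.g.f (n + 1) w)) (S.X₃.toCycles_comp_homologyπ (n + 1) n)

/-- The boundary map of a triple, on classes. The subcomplex of `S` is the middle complex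
of `T`. -/
lemma relClass_boundary {K₁ K₂ K₃ K₄ K₅ : ChainComplex AddCommGrpCat.{u} ℕ}
    {f : K₁ ⟶ K₂} {g : K₂ ⟶ K₃} {w : f ≫ g = 0} (hS : (ShortComplex.mk f g w).ShortExact)
    {f' : K₄ ⟶ K₁} {g' : K₁ ⟶ K₅} {w' : f' ≫ g' = 0} (n : ℕ)
    (x : relKer (ShortComplex.mk f g w) (n + 1)) (y : relKer (ShortComplex.mk f' g' w') n)
    (h : f.f n y.1 = K₂.d (n + 1) n x.1) :
    homologyMap g' n (hS.δ (n + 1) n (ComplexShape.down_mk (n + 1) n rfl)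
      (relClass _ (n + 1) x)) = relClass _ n y := by
  let Z := AddCommGrpCat.of (ULift.{u} ℤ)
  let k : Z ⟶ AddCommGrpCat.of (relKer (ShortComplex.mk f g w) (n + 1)) :=
    AddCommGrpCat.ofHom ((zmultiplesHom _ x).comp AddEquiv.ulift.toAddMonoidHom)
  let l : Z ⟶ AddCommGrpCat.of (relKer (ShortComplex.mk f' g' w') n) :=
    AddCommGrpCat.ofHom ((zmultiplesHom _ y).comp AddEquiv.ulift.toAddMonoidHom)
  have hk : k ⟨1⟩ = x := one_zsmul x
  have hl : l ⟨1⟩ = y := one_zsmul y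
  have hf : Function.Injective (f.f (n - 1)) := by
    have : Mono f := hS.mono_f
    exact (AddCommGrpCat.mono_iff_injective (f.f (n - 1))).1
      (inferInstanceAs (Mono ((HomologicalComplex.eval AddCommGrpCat _ (n - 1)).map f)))
  have hy0 : K₁.d n (n - 1) y.1 = 0 := by
    apply hf
    rw [map_zero]
    have h1 : f.f (n - 1) (K₁.d n (n - 1) y.1) = K₂.d n (n - 1) (f.f n y.1) :=
      (congrArg (fun q => q.hom y.1) (f.comm n (n - 1))).symm
    rw [h1, h]
    exact congrArg (fun q => q.hom x.1) (K₂.d_comp_d (n + 1) n (n - 1))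
  let x₂ : Z ⟶ K₂.X (n + 1) := k ≫ AddCommGrpCat.ofHom (AddSubgroup.subtype _)
  let x₁ : Z ⟶ K₁.X n := l ≫ AddCommGrpCat.ofHom (AddSubgroup.subtype _)
  have e₁ : x₁ ≫ f.f n = x₂ ≫ K₂.d (n + 1) n := by
    ext t
    change f.f n (t.down • y.1) = K₂.d (n + 1) n (t.down • x.1)
    rw [map_zsmul, map_zsmul, h]
  have e₀ : x₁ ≫ K₁.d n (n - 1) = 0 := by
    ext t
    change K₁.d n (n - 1) (t.down • y.1) = 0
    rw [map_zsmul, hy0, smul_zero]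
  have key := hS.δ_eq (n + 1) n (ComplexShape.down_mk (n + 1) n rfl) (A := Z)
    (x₂ ≫ g.f (n + 1)) (by
      rw [Category.assoc, g.comm]
      ext t
      exact (k t).2) x₂ rfl x₁ e₁ (n - 1) (down_next n)
  have h1 : k ≫ relClass _ (n + 1) ≫ hS.δ (n + 1) n (ComplexShape.down_mk (n + 1) n rfl) ≫
      homologyMap g' n = l ≫ relClass (ShortComplex.mk f' g' w') n := by
    have h2 : k ≫ relClass (ShortComplex.mk f g w) (n + 1) =
        K₃.liftCycles (x₂ ≫ g.f (n + 1)) n (down_next (n + 1)) (by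
      rw [Category.assoc, g.comm]
      ext t
      exact (k t).2) ≫ K₃.homologyπ (n + 1) := by
      rw [relClass, ← Category.assoc]
      congr 1
      rw [← cancel_mono (K₃.iCycles (n + 1)), liftCycles_i]
      erw [Category.assoc, relCycle_i]
      rfl
    rw [← Category.assoc, h2, ← Category.assoc]
    erw [key]
    rw [Category.assoc, homologyπ_naturality, relClass, ← Category.assoc, ← Category.assoc]
    congr 1
    rw [← cancel_mono (K₅.iCycles n)]
    erw [Category.assoc, Category.assoc, cyclesMap_i, liftCycles_i_assoc, relCycle_i]
    rfl
  have := congrArg (fun q => q.hom ⟨1⟩) h1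
  change homologyMap g' n (hS.δ _ _ _ (relClass _ (n + 1) (k ⟨1⟩))) = relClass _ n (l ⟨1⟩) at this
  rwa [hk, hl] at this

end RelClass

/-! ### Cellular chains as relative singular cycles -/

section Lift

variable {X : Type*} [TopologicalSpace X]

lemma chMap_subIncl_mem (A : Set X) (n : ℕ) (w : Ch A n) :
    chMap (subIncl A) n w ∈ chSub A n :=
  chMap_mem (fun x _ => x.2) (chSub_univ n w)

/-- The singular chains of a subspace are the chains with support in it. -/
def chLift (A : Set X) (n : ℕ) : chSub A n ≃ₗ[ℤ] Ch A n :=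
  (LinearEquiv.ofBijective ((chMap (subIncl A) n).codRestrict _ (chMap_subIncl_mem A n))
    ⟨fun z w h => chMap_injective Subtype.val_injective n (congrArg Subtype.val h), fun z => by
      obtain ⟨w, -, h⟩ := exists_chMap_eq (f := subIncl A) (A := Set.univ) (B := A)
        IsEmbedding.subtypeVal (fun y hy => ⟨⟨y, hy⟩, Set.mem_univ _, rfl⟩) z.2
      exact ⟨w, Subtype.ext h⟩⟩).symm

lemma chMap_chLift {A : Set X} {n : ℕ} (z : chSub A n) :
    chMap (subIncl A) n (chLift A n z) = z.1 :=
  congrArg Subtype.val ((chLift A n).symm_apply_apply z)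

lemma chLift_eq {A : Set X} {n : ℕ} {z : chSub A n} {w : Ch A n}
    (h : chMap (subIncl A) n w = z.1) : chLift A n z = w :=
  chMap_injective Subtype.val_injective n ((chMap_chLift z).trans h.symm)

end Lift

namespace RelGCWComplex

open Opposite

variable {G : Type u} [Group G] {X : Type u} [TopologicalSpace X] [MulAction G X] {D : Set X}
  (c : RelGCWComplex G X D)

/-- The inclusion of the fixed points of successive skeleta. -/
abbrev fixedIncl (H : Subgroup G) (n : ℕ) : C(c.fixedSkelLT H n, c.fixedSkelLT H (n + 1)) :=
  ⟨Set.inclusion (Set.inter_subset_inter_left _ (c.skelLT_mono n)), continuous_inclusion _⟩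

/-- `chTo` with values in the total term of the sequence of a pair of skeleta. -/
def pairTo (H : Subgroup G) (n m : ℕ) :
    Ch (c.fixedSkelLT H (n + 1)) m →+ (pairSequence (c.fixedFiltration H) n).X₂.X m :=
  chTo (TopCat.of (c.fixedSkelLT H (n + 1))) m

/-- `chTo` with values in the subcomplex of the sequence of a pair of skeleta. -/
def pairFrom (H : Subgroup G) (n m : ℕ) :
    Ch (c.fixedSkelLT H n) m →+ (pairSequence (c.fixedFiltration H) n).X₁.X m :=
  chTo (TopCat.of (c.fixedSkelLT H n)) m

lemma pairTo_bijective (H : Subgroup G) (n m : ℕ) : Function.Bijective (c.pairTo H n m) :=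
  chTo_bijective _ m

lemma pairFrom_bijective (H : Subgroup G) (n m : ℕ) : Function.Bijective (c.pairFrom H n m) :=
  chTo_bijective _ m

lemma pairTo_d (H : Subgroup G) (n m : ℕ) (w : Ch (c.fixedSkelLT H (n + 1)) m) :
    (pairSequence (c.fixedFiltration H) n).X₂.d m (m - 1) (c.pairTo H n m w) =
      c.pairTo H n (m - 1) (chD m w) :=
  chTo_d (TopCat.of (c.fixedSkelLT H (n + 1))) m w

lemma pairTo_ds (H : Subgroup G) (n m : ℕ) (w : Ch (c.fixedSkelLT H (n + 1)) (m + 1)) :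
    (pairSequence (c.fixedFiltration H) n).X₂.d (m + 1) m (c.pairTo H n (m + 1) w) =
      c.pairTo H n m (chDs m w) :=
  chTo_d (TopCat.of (c.fixedSkelLT H (n + 1))) (m + 1) w

lemma pairSequence_f_pairFrom (H : Subgroup G) (n m : ℕ) (v : Ch (c.fixedSkelLT H n) m) :
    (pairSequence (c.fixedFiltration H) n).f.f m (c.pairFrom H n m v) =
      c.pairTo H n m (chMap (c.fixedIncl H n) m v) := by
  have h : (c.fixedFiltration H).obj.map (homOfLE (Nat.le_succ n)) =
      TopCat.ofHom (c.fixedIncl H n) := Functor.ofSequence_map_homOfLE_succ _ n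
  have h2 : (pairSequence (c.fixedFiltration H) n).f =
    singularChains.map (TopCat.ofHom (c.fixedIncl H n)) := congrArg singularChains.map h
  rw [h2]
  exact chTo_map _ _ _

/-- The boundary of a chain vanishes in the quotient exactly if the chain is a relative cycle. -/
lemma pairTo_mem_relKer_iff {H : Subgroup G} {n : ℕ} {w : Ch (c.fixedSkelLT H (n + 1)) n} :
    c.pairTo H n n w ∈ relKer (pairSequence (c.fixedFiltration H) n) n ↔
      chMap (subIncl _) n w ∈ relCyc (c.fixedSkelLT H (n + 1)) (c.fixedSkelLT H n) n := by
  rw [mem_relKer, mem_relCyc, pairTo_d, ← chMap_D]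
  constructor
  · intro hx
    refine ⟨chMap_subIncl_mem _ _ _, ?_⟩
    have hex : ((pairSequence (c.fixedFiltration H) n).map
        (HomologicalComplex.eval _ _ (n - 1))).Exact :=
      ((pairSequence_shortExact (c.fixedFiltration H) n).map_of_exact
        (HomologicalComplex.eval _ _ (n - 1))).exact
    rw [ShortComplex.ab_exact_iff] at hex
    obtain ⟨v, hv⟩ := hex _ hx
    obtain ⟨v, rfl⟩ := (c.pairFrom_bijective H n (n - 1)).2 v
    rw [← (c.pairTo_bijective H n (n - 1)).1
      ((c.pairSequence_f_pairFrom H n (n - 1) v).symm.trans hv), chMap_comp]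
    exact chMap_subIncl_mem _ _ v
  · rintro ⟨-, h⟩
    have h3 : chD n w = chMap (c.fixedIncl H n) (n - 1) (chLift _ _ ⟨_, h⟩) := by
      refine chMap_injective (f := subIncl (c.fixedSkelLT H (n + 1))) Subtype.val_injective _ ?_
      rw [chMap_comp]
      exact (chMap_chLift ⟨_, h⟩).symm
    rw [h3, ← pairSequence_f_pairFrom]
    exact congrArg (fun q => (q.f (n - 1)).hom (c.pairFrom H n (n - 1) (chLift _ _ ⟨_, h⟩)))
      (pairSequence (c.fixedFiltration H) n).zero

/-- A relative cycle as an element of the relative chains. -/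
def cycTo (H : Subgroup G) (n : ℕ) :
    relCyc (c.fixedSkelLT H (n + 1)) (c.fixedSkelLT H n) n →+
      (pairSequence (c.fixedFiltration H) n).X₂.X n :=
  (c.pairTo H n n).comp ((chLift _ n).toLinearMap.comp
    (Submodule.inclusion inf_le_left)).toAddMonoidHom

lemma cycTo_mem (H : Subgroup G) (n : ℕ)
    (z : relCyc (c.fixedSkelLT H (n + 1)) (c.fixedSkelLT H n) n) :
    c.cycTo H n z ∈ relKer (pairSequence (c.fixedFiltration H) n) n := by
  refine c.pairTo_mem_relKer_iff.2 ?_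
  have := chMap_chLift (⟨z.1, z.2.1⟩ : chSub (c.fixedSkelLT H (n + 1)) n)
  exact (congrArg (· ∈ relCyc (c.fixedSkelLT H (n + 1)) (c.fixedSkelLT H n) n) this).mpr z.2

/-- The class of a relative cycle in the group of cellular chains. -/
def cellClass (H : OrbitCat G) (n : ℕ) :
    relCyc (c.fixedSkelLT H.subgroup (n + 1)) (c.fixedSkelLT H.subgroup n) n →+
      (c.coeffChains.X n).obj (op H) :=
  (relClass (pairSequence (c.fixedFiltration H.subgroup) n) n).hom.comp
    ((c.cycTo H.subgroup n).codRestrict _ (c.cycTo_mem H.subgroup n))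

variable {c} in
lemma cellClass_eq {H : OrbitCat G} {n : ℕ}
    {z : relCyc (c.fixedSkelLT H.subgroup (n + 1)) (c.fixedSkelLT H.subgroup n) n}
    {w : Ch (c.fixedSkelLT H.subgroup (n + 1)) n} (h : chMap (subIncl _) n w = z.1) :
    c.cellClass H n z = relClass (pairSequence (c.fixedFiltration H.subgroup) n) n
      ⟨c.pairTo H.subgroup n n w, c.pairTo_mem_relKer_iff.2 (by rw [h]; exact z.2)⟩ := by
  have := chLift_eq (z := ⟨z.1, z.2.1⟩) h
  subst this
  rfl

lemma cellClass_surjective (H : OrbitCat G) (n : ℕ) : Function.Surjective (c.cellClass H n) := by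
  intro y
  obtain ⟨⟨x, hx⟩, rfl⟩ :=
    relClass_surjective (pairSequence_shortExact (c.fixedFiltration H.subgroup) n) n y
  obtain ⟨w, rfl⟩ := (c.pairTo_bijective H.subgroup n n).2 x
  exact ⟨⟨_, c.pairTo_mem_relKer_iff.1 hx⟩, cellClass_eq rfl⟩

/-- The kernel of the class consists of the relative boundaries. -/
lemma cellClass_eq_zero {H : OrbitCat G} {n : ℕ}
    {z : relCyc (c.fixedSkelLT H.subgroup (n + 1)) (c.fixedSkelLT H.subgroup n) n} :
    c.cellClass H n z = 0 ↔
      z.1 ∈ relBdry (c.fixedSkelLT H.subgroup (n + 1)) (c.fixedSkelLT H.subgroup n) n := by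
  obtain ⟨z, hz⟩ := z
  obtain ⟨w', rfl⟩ : ∃ w, chMap (subIncl _) n w = z := ⟨_, chMap_chLift ⟨z, hz.1⟩⟩
  rw [cellClass_eq (w := w') rfl]
  refine (relClass_eq_zero (pairSequence_shortExact (c.fixedFiltration H.subgroup) n) n _).trans ?_
  rw [mem_relBdry]
  constructor
  · rintro ⟨a, w, h⟩
    obtain ⟨a, rfl⟩ := (c.pairFrom_bijective H.subgroup n n).2 a
    obtain ⟨w, rfl⟩ := (c.pairTo_bijective H.subgroup n (n + 1)).2 w
    refine ⟨_, chMap_subIncl_mem _ _ a, _, chMap_subIncl_mem _ _ w, ?_⟩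
    rw [pairSequence_f_pairFrom, pairTo_ds, ← map_add] at h
    have h1 := congrArg (chMap (subIncl _) n) ((c.pairTo_bijective H.subgroup n n).1 h)
    rwa [map_add, chMap_comp, chMap_Ds] at h1
  · rintro ⟨a, ha, w, hw, h⟩
    refine ⟨c.pairFrom H.subgroup n n (chLift _ n ⟨a, ha⟩),
      c.pairTo H.subgroup n (n + 1) (chLift _ (n + 1) ⟨w, hw⟩), ?_⟩
    rw [pairSequence_f_pairFrom, pairTo_ds, ← map_add]
    refine congrArg (c.pairTo _ n n) ?_
    refine chMap_injective (f := subIncl (c.fixedSkelLT H.subgroup (n + 1)))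
      Subtype.val_injective _ (h.trans ?_)
    rw [map_add, chMap_comp, chMap_Ds, chMap_chLift]
    exact congrArg (· + chDs n w) (chMap_chLift (⟨a, ha⟩ : chSub _ n)).symm

lemma chDs_relCyc {A A' A'' : Set X} {n : ℕ} {z : Ch X (n + 1)} (hz : z ∈ relCyc A A' (n + 1)) :
    chDs n z ∈ relCyc A' A'' n :=
  ⟨(mem_relCyc_succ.1 hz).2, by
    change chD n (chDs n z) ∈ chSub A'' (n - 1)
    rw [chD_D_succ]
    exact zero_mem _⟩

/-- The boundary of the triple of skeleta is the singular boundary of representing cycles. -/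
lemma cellClass_d (H : OrbitCat G) (n : ℕ)
    (z : relCyc (c.fixedSkelLT H.subgroup (n + 1 + 1)) (c.fixedSkelLT H.subgroup (n + 1)) (n + 1)) :
    (c.coeffChains.d (n + 1) n).app (op H) (c.cellClass H (n + 1) z) =
      c.cellClass H n ⟨chDs n z.1, chDs_relCyc z.2⟩ := by
  have hd : (c.coeffChains.d (n + 1) n).app (op H) =
      cellBoundary (c.fixedFiltration H.subgroup) n := ChainComplex.of_d _ _ n
  rw [hd, cellClass_eq (chMap_chLift ⟨z.1, z.2.1⟩),
    cellClass_eq (z := ⟨chDs n z.1, _⟩) (chMap_chLift ⟨_, (mem_relCyc_succ.1 z.2).2⟩)]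
  refine relClass_boundary (pairSequence_shortExact (c.fixedFiltration H.subgroup) (n + 1)) n _ _ ?_
  refine (c.pairSequence_f_pairFrom H.subgroup (n + 1) n _).trans ?_
  refine Eq.trans ?_ (c.pairTo_ds H.subgroup (n + 1) n _).symm
  refine congrArg (c.pairTo _ (n + 1) n) ?_
  refine chMap_injective (f := subIncl (c.fixedSkelLT H.subgroup (n + 1 + 1))) Subtype.val_injective
    _ ?_
  rw [chMap_comp, chMap_Ds, chMap_chLift]
  exact chMap_chLift (⟨_, (mem_relCyc_succ.1 z.2).2⟩ : chSub _ n)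

/-- The action of a group element as a continuous map. -/
abbrev smulMap (g : G) : C(X, X) := ⟨fun x => g • x, c.continuous_smul g⟩

lemma smulMap_relCyc {H K : OrbitCat G} (f : H ⟶ K) {n : ℕ} {z : Ch X n}
    (hz : z ∈ relCyc (c.fixedSkelLT K.subgroup (n + 1)) (c.fixedSkelLT K.subgroup n) n) :
    chMap (c.smulMap (cosetRep f)) n z ∈
      relCyc (c.fixedSkelLT H.subgroup (n + 1)) (c.fixedSkelLT H.subgroup n) n :=
  chMap_relCyc (fun _ hx => c.cosetRep_smul_mem f _ hx) (fun _ hx => c.cosetRep_smul_mem f _ hx) hz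

/-- A map `G/H → G/K` acts on representing cycles through the group element that determines it. -/
lemma cellClass_map {H K : OrbitCat G} (f : H ⟶ K) (n : ℕ)
    (z : relCyc (c.fixedSkelLT K.subgroup (n + 1)) (c.fixedSkelLT K.subgroup n) n) :
    (c.coeffChains.X n).map f.op (c.cellClass K n z) =
      c.cellClass H n ⟨chMap (c.smulMap (cosetRep f)) n z.1, c.smulMap_relCyc f z.2⟩ := by
  let F : C(c.fixedSkelLT K.subgroup (n + 1), c.fixedSkelLT H.subgroup (n + 1)) :=
    ⟨fun x => ⟨cosetRep f • x.1, c.cosetRep_smul_mem f _ x.2⟩,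
      ((c.continuous_smul _).comp continuous_subtype_val).subtype_mk _⟩
  rw [cellClass_eq (chMap_chLift ⟨z.1, z.2.1⟩),
    cellClass_eq (z := ⟨chMap (c.smulMap (cosetRep f)) n z.1, _⟩)
      (w := chMap F n (chLift _ n ⟨z.1, z.2.1⟩))]
  swap
  · rw [chMap_comp]
    have : (subIncl (c.fixedSkelLT H.subgroup (n + 1))).comp F =
      (c.smulMap (cosetRep f)).comp (subIncl _) := rfl
    rw [this, ← chMap_comp, chMap_chLift]
  have hm : (c.coeffChains.X n).map f.op = cellGroupMap (c.fixedMap f) n := rfl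
  rw [hm]
  exact relClass_map (pairMap (c.fixedMap f) n) n _ _ (chTo_map (TopCat.ofHom F) n _)

end RelGCWComplex

/-! ### Spans of finite `G`-sets -/

section Spans

open Algebra (GrothendieckAddGroup)

variable {G : Type u} [Group G] {S T U V W : FinGSet G}

/-- The class of a span as a morphism of the Burnside category. -/
abbrev spanHom (A : GSpan S T) : Burnside.of S ⟶ Burnside.of T := A.toHom

/-- The covariant morphism of the Burnside category defined by a `G`-map. -/
abbrev cov (f : S →[G] T) : Burnside.of S ⟶ Burnside.of T :=
  spanHom ⟨S, MulActionHom.id G, f⟩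

/-- The contravariant morphism of the Burnside category defined by a `G`-map. -/
abbrev contra (f : S →[G] T) : Burnside.of T ⟶ Burnside.of S :=
  spanHom ⟨S, f, MulActionHom.id G⟩

lemma spanHom_eq {A B : GSpan S T} (h : A.Iso B) : spanHom A = spanHom B :=
  congrArg GrothendieckAddGroup.of (Quotient.sound h)

lemma spanHom_comp (A : GSpan S T) (B : GSpan T U) :
    spanHom A ≫ spanHom B = spanHom (A.comp B) :=
  grothLift₂_of _ _ _

lemma spanHom_empty : spanHom (GSpan.empty S T) = 0 :=
  map_zero (GrothendieckAddGroup.of : SpanClass S T →+ _)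

lemma spanHom_prod (A : GSpan S T) (B : GSpan U V) :
    (burnsideProd G).map (X := (Burnside.of S, Burnside.of U)) (Y := (Burnside.of T, Burnside.of V))
      (spanHom A, spanHom B) = spanHom (A.prod B) :=
  grothLift₂_of _ _ _

lemma burnsideProd_add_left {S T U V : Burnside G} (f f' : S ⟶ T) (g : U ⟶ V) :
    (burnsideProd G).map (X := (S, U)) (Y := (T, V)) (f + f', g) =
      (burnsideProd G).map (X := (S, U)) (Y := (T, V)) (f, g) +
        (burnsideProd G).map (X := (S, U)) (Y := (T, V)) (f', g) := by
  exact congrArg (fun h : BurnsideHom U.toFinGSet V.toFinGSet →+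
    BurnsideHom (S.toFinGSet.prod U.toFinGSet) (T.toFinGSet.prod V.toFinGSet) => h g)
    (map_add (grothLift₂ (SpanClass.prod S.toFinGSet T.toFinGSet U.toFinGSet V.toFinGSet)) f f')

lemma burnsideProd_add_right {S T U V : Burnside G} (f : S ⟶ T) (g g' : U ⟶ V) :
    (burnsideProd G).map (X := (S, U)) (Y := (T, V)) (f, g + g') =
      (burnsideProd G).map (X := (S, U)) (Y := (T, V)) (f, g) +
        (burnsideProd G).map (X := (S, U)) (Y := (T, V)) (f, g') :=
  map_add _ _ _

lemma contra_comp (f : S →[G] T) (g : U →[G] S) : contra f ≫ contra g = contra (f.comp g) := by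
  rw [spanHom_comp]
  refine spanHom_eq ⟨⟨fun x => x.1.2, fun x => ⟨(g x, x), rfl⟩, ?_, fun _ => rfl⟩,
    fun _ _ => rfl, ?_, fun _ => rfl⟩
  · rintro ⟨⟨x, y⟩, h⟩
    exact Subtype.ext (Prod.ext (Eq.symm h) rfl)
  · rintro ⟨⟨x, y⟩, h⟩
    exact congrArg f (Eq.symm h)

lemma contra_comp_cov (f : S →[G] T) (g : S →[G] U) : contra f ≫ cov g = spanHom ⟨S, f, g⟩ := by
  rw [spanHom_comp]
  refine spanHom_eq ⟨⟨fun x => x.1.1, fun x => ⟨(x, x), rfl⟩, ?_, fun _ => rfl⟩,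
    fun _ _ => rfl, fun _ => rfl, ?_⟩
  · rintro ⟨⟨x, y⟩, h⟩
    exact Subtype.ext (Prod.ext rfl h)
  · rintro ⟨⟨x, y⟩, h⟩
    exact congrArg g h

/-- The product of two `G`-maps. -/
abbrev prodMapHom (f : S →[G] T) (g : U →[G] V) :
    (S.prod U : FinGSet G) →[G] (T.prod V : FinGSet G) where
  toFun x := (f x.1, g x.2)
  map_smul' r x := Prod.ext (map_smul f r x.1) (map_smul g r x.2)

/-- The `G`-map to a product with given components. -/
abbrev pairHom (f : S →[G] T) (g : S →[G] V) : S →[G] (T.prod V : FinGSet G) where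
  toFun x := (f x, g x)
  map_smul' r x := Prod.ext (map_smul f r x) (map_smul g r x)

lemma contra_prod (f : S →[G] T) (g : U →[G] V) :
    (burnsideProd G).map (X := (Burnside.of T, Burnside.of V)) (Y := (Burnside.of S, Burnside.of U))
      (contra f, contra g) = contra (prodMapHom f g) :=
  spanHom_prod _ _

/-- Base change along an injective map through which the other map factors. -/
lemma cov_comp_contra {c : S →[G] U} (hc : Function.Injective c) (y : T →[G] S) :
    cov c ≫ contra (c.comp y) = contra y := by
  rw [spanHom_comp]
  refine spanHom_eq ⟨⟨fun x => x.1.2, fun x => ⟨(y x, x), rfl⟩, ?_, fun _ => rfl⟩,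
    fun _ _ => rfl, ?_, fun _ => rfl⟩
  · rintro ⟨⟨x, z⟩, h⟩
    exact Subtype.ext (Prod.ext (hc (Eq.symm h)) rfl)
  · rintro ⟨⟨x, z⟩, h⟩
    exact hc (Eq.symm h)

/-- Base change of maps with disjoint images. -/
lemma cov_comp_contra_eq_zero {c : S →[G] U} {x : T →[G] U} (h : ∀ s t, c s ≠ x t) :
    cov c ≫ contra x = 0 := by
  rw [spanHom_comp, ← spanHom_empty]
  exact spanHom_eq ⟨⟨fun z => (h _ _ z.2).elim, fun z => z.elim, fun z => (h _ _ z.2).elim,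
    fun z => z.elim⟩, fun _ z => (h _ _ z.2).elim, fun z => (h _ _ z.2).elim,
    fun z => (h _ _ z.2).elim⟩

instance sigmaAction {ι : Type u} (A : ι → FinGSet G) : MulAction G (Σ i, A i) where
  smul g x := ⟨x.1, g • x.2⟩
  one_smul x := Sigma.ext rfl (heq_of_eq (one_smul G x.2))
  mul_smul g h x := Sigma.ext rfl (heq_of_eq (mul_smul g h x.2))

/-- The disjoint union of a finite family of spans. -/
abbrev GSpan.sigma {ι : Type u} [Finite ι] (A : ι → GSpan S T) : GSpan S T where
  apex := ⟨Σ i, (A i).apex⟩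
  left := { toFun := fun x => (A x.1).left x.2
            map_smul' := fun g x => map_smul (A x.1).left g x.2 }
  right := { toFun := fun x => (A x.1).right x.2
             map_smul' := fun g x => map_smul (A x.1).right g x.2 }

/-- A finite sum of spans is their disjoint union. -/
lemma sum_spanHom {ι : Type u} [Fintype ι] (A : ι → GSpan S T) :
    ∑ i, spanHom (A i) = spanHom (GSpan.sigma A) := by
  revert A
  refine Fintype.induction_empty_option (P := fun ι _ => ∀ A : ι → GSpan S T,
    ∑ i, spanHom (A i) = spanHom (GSpan.sigma A)) ?_ ?_ ?_ ι
  · intro α β _ e h A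
    have : Fintype α := Fintype.ofEquiv β e.symm
    rw [← e.sum_comp]
    refine Eq.trans ?_ ((h fun i => A (e i)).trans (spanHom_eq
      ⟨Equiv.sigmaCongrLeft (β := fun i => (A i).apex) e, fun _ _ => rfl, fun _ => rfl,
        fun _ => rfl⟩))
    exact Finset.sum_congr (by ext; simp) fun _ _ => rfl
  · intro A
    rw [Finset.univ_eq_empty, Finset.sum_empty, ← spanHom_empty]
    exact spanHom_eq ⟨⟨fun x => x.elim, fun x => x.1.elim, fun x => x.elim, fun x => x.1.elim⟩,
      fun _ x => x.elim, fun x => x.elim, fun x => x.elim⟩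
  · intro α _ h A
    rw [Fintype.sum_option, h]
    refine (map_add (GrothendieckAddGroup.of : SpanClass S T →+ _) _ _).symm.trans
      (spanHom_eq (A := (A none).sum (GSpan.sigma fun i => A (some i))) ⟨⟨fun x => match x with
        | Sum.inl y => ⟨none, y⟩
        | Sum.inr y => ⟨some y.1, y.2⟩, fun x => match x with
        | ⟨none, y⟩ => Sum.inl y
        | ⟨some i, y⟩ => Sum.inr ⟨i, y⟩, ?_, ?_⟩, ?_, ?_, ?_⟩)
    · rintro (x | x) <;> rfl
    · rintro ⟨(_ | i), x⟩ <;> rfl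
    · rintro g (x | x) <;> rfl
    · rintro (x | x) <;> rfl
    · rintro (x | x) <;> rfl

end Spans

section Orbits

variable {G : Type u} [Group G] [Finite G] (U : FinGSet G)

/-- The set of orbits of a finite `G`-set. -/
abbrev Orbits : Type u := MulAction.orbitRel.Quotient G U

instance : Fintype (Orbits U) := Fintype.ofFinite _

variable {U}

/-- A `G`-orbit, as an object of the orbit category. -/
abbrev orbitObj (o : Orbits U) : OrbitCat G := OrbitCat.of (MulAction.stabilizer G o.out)

/-- The inclusion of an orbit. -/
def orbitIncl (o : Orbits U) : orbit (orbitObj o) →[G] U where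
  toFun := MulAction.ofQuotientStabilizer G o.out
  map_smul' g x := MulAction.ofQuotientStabilizer_smul G o.out g x

lemma orbitIncl_injective (o : Orbits U) : Function.Injective (orbitIncl o) :=
  MulAction.injective_ofQuotientStabilizer G o.out

lemma mk_orbitIncl (o : Orbits U) (x : orbit (orbitObj o)) :
    (Quotient.mk'' (orbitIncl o x) : Orbits U) = o := by
  induction x using QuotientGroup.induction_on with | _ g
  refine Eq.trans ?_ (Quotient.out_eq' o)
  exact Quotient.sound' ⟨g, rfl⟩

lemma exists_orbitIncl (u : U) :
    ∃ x : orbit (orbitObj (Quotient.mk'' u : Orbits U)), orbitIncl _ x = u := by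
  obtain ⟨g, hg⟩ := Quotient.exact' (Quotient.out_eq' (Quotient.mk'' u : Orbits U)).symm
  exact ⟨(g : G ⧸ _), hg⟩

/-- A finite `G`-set is the disjoint union of its orbits. -/
lemma sum_orbits :
    ∑ o : Orbits U, contra (orbitIncl o) ≫ cov (orbitIncl o) = 𝟙 (Burnside.of U) := by
  simp only [contra_comp_cov]
  rw [sum_spanHom]
  refine spanHom_eq (B := GSpan.id U) ⟨Equiv.ofBijective (fun x => orbitIncl x.1 x.2) ⟨?_, ?_⟩,
    fun g x => map_smul (orbitIncl x.1) g x.2, fun _ => rfl, fun _ => rfl⟩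
  · rintro ⟨o, x⟩ ⟨o', x'⟩ h
    obtain rfl : o = o' := by rw [← mk_orbitIncl o x, ← mk_orbitIncl o' x']; exact congrArg _ h
    exact congrArg (Sigma.mk o) (orbitIncl_injective o h)
  · intro u
    obtain ⟨x, hx⟩ := exists_orbitIncl u
    exact ⟨⟨_, x⟩, hx⟩

/-- A map from an orbit factors through the inclusion of an orbit. -/
lemma exists_factor {I : OrbitCat G} (x : orbit I →[G] U) (o : Orbits U)
    (ho : Quotient.mk'' (x ((1 : G) : G ⧸ I.subgroup)) = o) :
    ∃ y : orbit I →[G] orbit (orbitObj o), (orbitIncl o).comp y = x := by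
  subst ho
  have h (t : orbit I) :
      ∃ s, orbitIncl (Quotient.mk'' (x ((1 : G) : G ⧸ I.subgroup)) : Orbits U) s = x t := by
    induction t using QuotientGroup.induction_on with | _ g
    obtain ⟨s, hs⟩ := exists_orbitIncl (x ((1 : G) : G ⧸ I.subgroup))
    refine ⟨g • s, ?_⟩
    rw [map_smul, hs, ← map_smul]
    exact congrArg x (congrArg _ (mul_one g))
  choose y hy using h
  refine ⟨⟨y, fun g t => orbitIncl_injective _ ?_⟩, MulActionHom.ext hy⟩
  rw [hy, map_smul, map_smul, hy]
  rfl

/-- A map from an orbit to `U` meets only the orbit of the image of the trivial coset. -/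
lemma orbitIncl_ne {I : OrbitCat G} (x : orbit I →[G] U) (o : Orbits U)
    (ho : Quotient.mk'' (x ((1 : G) : G ⧸ I.subgroup)) ≠ o) (s : orbit (orbitObj o)) (t : orbit I) :
    orbitIncl o s ≠ x t := by
  rintro h
  refine ho ?_
  induction t using QuotientGroup.induction_on with | _ g
  rw [← mk_orbitIncl o s, h]
  refine Quotient.sound' ⟨g⁻¹, ?_⟩
  change g⁻¹ • x _ = _
  rw [← map_smul]
  exact congrArg x (congrArg _ (inv_mul_cancel g))

end Orbits

/-! ### The Kan extension of a pointwise tensor product -/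

section BoxLan

open Opposite

variable {G : Type u} [Group G] [Finite G]

section Transfer

variable (C : CoeffSystem G)

/-- The value of the Mackey functor `L C` at a finite `G`-set. -/
abbrev LanVal (S : Burnside G) : Type (u + 1) := LanGroup (orbitToBurnside G) C S

variable {C}

lemma lanPost_comp_apply {S T U : Burnside G} (f : S ⟶ T) (g : T ⟶ U) (z : LanVal C S) :
    lanPost C (f ≫ g) z = lanPost C g (lanPost C f z) :=
  ConcreteCategory.congr_hom ((lanFunctor (orbitToBurnside G) C).map_comp f g) z

lemma lanPost_id_apply {S : Burnside G} (z : LanVal C S) : lanPost C (𝟙 S) z = z :=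
  ConcreteCategory.congr_hom ((lanFunctor (orbitToBurnside G) C).map_id S) z

lemma lanPost_add_apply {S T : Burnside G} (f g : S ⟶ T) (z : LanVal C S) :
    lanPost C (f + g) z = lanPost C f z + lanPost C g z :=
  ConcreteCategory.congr_hom ((lanFunctor (orbitToBurnside G) C).map_add (f := f) (g := g)) z

lemma lanPost_zero_apply {S T : Burnside G} (z : LanVal C S) :
    lanPost C (0 : S ⟶ T) z = 0 :=
  ConcreteCategory.congr_hom ((lanFunctor (orbitToBurnside G) C).map_zero S T) z

lemma lanPost_sum_apply {ι : Type*} (s : Finset ι) {S T : Burnside G} (f : ι → (S ⟶ T))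
    (z : LanVal C S) : lanPost C (∑ i ∈ s, f i) z = ∑ i ∈ s, lanPost C (f i) z := by
  classical
  induction s using Finset.induction_on with
  | empty => rw [Finset.sum_empty, Finset.sum_empty, lanPost_zero_apply]
  | insert i s hi h => rw [Finset.sum_insert hi, Finset.sum_insert hi, lanPost_add_apply, h]

/-- The element `1 ⊗ x` of `L C` at an orbit. -/
def lanOne {I : OrbitCat G} (x : C.obj (op I)) : LanVal C (Burnside.of (orbit I)) :=
  lanMk (orbitToBurnside G) C (𝟙 ((orbitToBurnside G).obj (op I))) x

lemma lanOne_add {I : OrbitCat G} (x y : C.obj (op I)) :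
    lanOne (x + y) = lanOne x + lanOne y :=
  lanMk_add_right _ _ _

lemma lanPost_lanOne {I : OrbitCat G} {S : Burnside G} (f : Burnside.of (orbit I) ⟶ S)
    (x : C.obj (op I)) : lanPost C f (lanOne x) = lanMk (orbitToBurnside G) C (a := op I) f x := by
  refine (lanPost_mk f _ x).trans ?_
  exact congrArg (fun k => lanMk (orbitToBurnside G) C (a := op I) k x) (Category.id_comp _)

lemma lanPost_contra_lanOne {I K : OrbitCat G} (y : I ⟶ K) (x : C.obj (op K)) :
    lanPost C (contra (S := orbit I) (T := orbit K) y) (lanOne x) = lanOne (C.map y.op x) := by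
  rw [lanPost_lanOne]
  refine Eq.trans ?_ (lanMk_map (F := C) y.op (𝟙 ((orbitToBurnside G).obj (op I))) x).symm
  exact congrArg (fun k => lanMk (orbitToBurnside G) C (a := op K) k x) (Category.comp_id _).symm

/-- A compatible family of elements indexed by the maps from orbits to a finite `G`-set `U`, that
is, a section over `U` of the extension of `C` to finite `G`-sets. -/
@[ext]
structure OrbSection (C : CoeffSystem G) (U : FinGSet G) where
  val : ∀ I : OrbitCat G, (orbit I →[G] U) → C.obj (op I)
  map : ∀ {I K : OrbitCat G} (y : I ⟶ K) (x : orbit K →[G] U),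
    val I (x.comp y) = C.map y.op (val K x)

/-- The restriction of a section. -/
abbrev OrbSection.restrict {U V : FinGSet G} (s : OrbSection C U) (f : V →[G] U) :
    OrbSection C V where
  val I x := s.val I (f.comp x)
  map y x := s.map y (f.comp x)

/-- The element of `L C` at `U` defined by a section over `U`: the sum over the orbits of `U`. -/
def OrbSection.total {U : FinGSet G} (s : OrbSection C U) : LanVal C (Burnside.of U) :=
  ∑ o : Orbits U, lanPost C (cov (orbitIncl o)) (lanOne (s.val _ (orbitIncl o)))

/-- A section is recovered from its total: only the summand of the orbit that contains the image of
`x` is not annihilated by the restriction along `x`. -/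
lemma OrbSection.lanPost_total {U : FinGSet G} (s : OrbSection C U) {I : OrbitCat G}
    (x : orbit I →[G] U) : lanPost C (contra x) s.total = lanOne (s.val I x) := by
  rw [OrbSection.total, map_sum]
  simp only [← lanPost_comp_apply]
  obtain ⟨o, ho⟩ : ∃ o : Orbits U, Quotient.mk'' (x ((1 : G) : G ⧸ I.subgroup)) = o := ⟨_, rfl⟩
  rw [Finset.sum_eq_single o]
  · obtain ⟨y, rfl⟩ := exists_factor x o ho
    rw [cov_comp_contra (orbitIncl_injective _) y]
    refine Eq.trans ?_ (congrArg lanOne (s.map (K := orbitObj _) y (orbitIncl o)).symm)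
    exact lanPost_contra_lanOne (K := orbitObj _) y _
  · intro o' _ h
    rw [cov_comp_contra_eq_zero (orbitIncl_ne x o' (ho.trans_ne h.symm)), lanPost_zero_apply]
  · intro h
    exact absurd (Finset.mem_univ _) h

/-- Totals are compatible with restriction. -/
lemma OrbSection.lanPost_contra_total {U V : FinGSet G} (s : OrbSection C U) (f : V →[G] U) :
    lanPost C (contra f) s.total = (s.restrict f).total := by
  rw [← lanPost_id_apply (lanPost C (contra f) s.total), ← sum_orbits, lanPost_sum_apply]
  refine Finset.sum_congr rfl fun o _ => ?_
  rw [← lanPost_comp_apply, ← Category.assoc, contra_comp, lanPost_comp_apply, s.lanPost_total]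

end Transfer

variable (A B : CoeffSystem G)

/-- The pointwise tensor product of coefficient systems. -/
def pointTensor : CoeffSystem G where
  obj H := AddCommGrpCat.of (A.obj H ⊗[ℤ] B.obj H)
  map f := AddCommGrpCat.ofHom (tensorHom (A.map f).hom (B.map f).hom)
  map_id S := by
    ext : 1
    exact tensor_hom_ext fun x y => congrArg₂ (fun a b => a ⊗ₜ[ℤ] b)
      (ConcreteCategory.congr_hom (A.map_id S) x) (ConcreteCategory.congr_hom (B.map_id S) y)
  map_comp f g := by
    ext : 1
    exact tensor_hom_ext fun x y => congrArg₂ (fun a b => a ⊗ₜ[ℤ] b)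
      (ConcreteCategory.congr_hom (A.map_comp f g) x)
      (ConcreteCategory.congr_hom (B.map_comp f g) y)

/-- The map of pointwise tensor products induced by maps of coefficient systems. -/
def pointTensorMap {A A' B B' : CoeffSystem G} (α : A ⟶ A') (β : B ⟶ B') :
    pointTensor A B ⟶ pointTensor A' B' where
  app H := AddCommGrpCat.ofHom (tensorHom (α.app H).hom (β.app H).hom)
  naturality H K f := by
    ext : 1
    exact tensor_hom_ext fun x y => congrArg₂ (fun a b => a ⊗ₜ[ℤ] b)
      (NatTrans.naturality_apply α f x) (NatTrans.naturality_apply β f y)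

variable {A B}

/-- The first projection of a product of finite `G`-sets. -/
abbrev fstHom (S T : FinGSet G) : (S.prod T : FinGSet G) →[G] S := ⟨Prod.fst, fun _ _ => rfl⟩

/-- The second projection of a product of finite `G`-sets. -/
abbrev sndHom (S T : FinGSet G) : (S.prod T : FinGSet G) →[G] T := ⟨Prod.snd, fun _ _ => rfl⟩

/-- The external product of `a` and `b`, as a section over the product of two orbits. -/
def prodSection {H K : OrbitCat G} (a : A.obj (op H)) (b : B.obj (op K)) :
    OrbSection (pointTensor A B) ((orbit H).prod (orbit K)) where
  val I x := A.map (Quiver.Hom.op (X := I) (Y := H) ((fstHom (orbit H) (orbit K)).comp x)) a ⊗ₜ[ℤ]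
    B.map (Quiver.Hom.op (X := I) (Y := K) ((sndHom (orbit H) (orbit K)).comp x)) b
  map {I L} y x := by
    refine Eq.trans ?_ (tensorHom_tmul _ _ _ _).symm
    refine congrArg₂ (fun a b => a ⊗ₜ[ℤ] b) ?_ ?_
    · exact ConcreteCategory.congr_hom (A.map_comp (Quiver.Hom.op (X := L) (Y := H)
        ((fstHom (orbit H) (orbit K)).comp x)) y.op) a
    · exact ConcreteCategory.congr_hom (B.map_comp (Quiver.Hom.op (X := L) (Y := K)
        ((sndHom (orbit H) (orbit K)).comp x)) y.op) b

/-- The external product of `a` and `b` in the Kan extension of the pointwise tensor product. -/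
def extProd {H K : OrbitCat G} (a : A.obj (op H)) (b : B.obj (op K)) :
    LanVal (pointTensor A B) (Burnside.of ((orbit H).prod (orbit K))) :=
  (prodSection a b).total

lemma extProd_add_left {H K : OrbitCat G} (a a' : A.obj (op H)) (b : B.obj (op K)) :
    extProd (a + a') b = extProd a b + extProd a' b := by
  simp only [extProd, OrbSection.total]
  rw [← Finset.sum_add_distrib]
  refine Finset.sum_congr rfl fun o _ => ?_
  rw [← map_add, ← lanOne_add]
  refine congrArg _ (congrArg lanOne ?_)
  refine (congrArg (fun z => z ⊗ₜ[ℤ] _) (map_add _ a a')).trans ?_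
  exact TensorProduct.add_tmul _ _ _

lemma extProd_add_right {H K : OrbitCat G} (a : A.obj (op H)) (b b' : B.obj (op K)) :
    extProd a (b + b') = extProd a b + extProd a b' := by
  simp only [extProd, OrbSection.total]
  rw [← Finset.sum_add_distrib]
  refine Finset.sum_congr rfl fun o _ => ?_
  rw [← map_add, ← lanOne_add]
  refine congrArg _ (congrArg lanOne ?_)
  refine (congrArg (fun z => _ ⊗ₜ[ℤ] z) (map_add _ b b')).trans ?_
  exact TensorProduct.tmul_add _ _ _

lemma extProd_map {H H' K K' : OrbitCat G} (v : H' ⟶ H) (w : K' ⟶ K) (a : A.obj (op H))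
    (b : B.obj (op K)) :
    extProd (A.map v.op a) (B.map w.op b) = lanPost _ (contra (prodMapHom (S := orbit H')
      (T := orbit H) (U := orbit K') (V := orbit K) v w)) (extProd a b) := by
  rw [extProd, extProd, OrbSection.lanPost_contra_total]
  refine congrArg OrbSection.total ?_
  ext I x
  refine congrArg₂ (fun a b => a ⊗ₜ[ℤ] b) ?_ ?_
  · exact (ConcreteCategory.congr_hom (A.map_comp v.op (Quiver.Hom.op (X := I) (Y := H')
      ((fstHom (orbit H') (orbit K')).comp x))) a).symm
  · exact (ConcreteCategory.congr_hom (B.map_comp w.op (Quiver.Hom.op (X := I) (Y := K')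
      ((sndHom (orbit H') (orbit K')).comp x))) b).symm

/-- The diagonal of an orbit. -/
abbrev diagHom (S : FinGSet G) : S →[G] (S.prod S : FinGSet G) :=
  pairHom (MulActionHom.id G) (MulActionHom.id G)

lemma lanPost_diag_extProd {H : OrbitCat G} (a : A.obj (op H)) (b : B.obj (op H)) :
    lanPost _ (contra (diagHom (orbit H))) (extProd a b) =
      lanOne (C := pointTensor A B) (I := H) (a ⊗ₜ[ℤ] b) := by
  rw [extProd, OrbSection.lanPost_total]
  refine congrArg lanOne (congrArg₂ (fun a b => a ⊗ₜ[ℤ] b) ?_ ?_)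
  · exact ConcreteCategory.congr_hom (A.map_id (op H)) a
  · exact ConcreteCategory.congr_hom (B.map_id (op H)) b

end BoxLan

/-! ### The box product of Kan extensions -/

section BoxIso

open Opposite

variable {G : Type u} [Group G] [Finite G] {A B : CoeffSystem G}

/-- The biadditive map on a tensor product of abelian groups. -/
def tensorLift {M N L : Type*} [AddCommGroup M] [AddCommGroup N] [AddCommGroup L]
    (P : M →+ N →+ L) : M ⊗[ℤ] N →+ L :=
  TensorProduct.liftAddHom P fun r x y => by
    rw [map_zsmul, map_zsmul, AddMonoidHom.smul_apply]

/-- The external product of `f ⊗ a` and `g ⊗ b` in the Kan extension of the pointwise tensor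
product. -/
def pairMk {S T : Burnside G} {H K : OrbitCat G} (f : Burnside.of (orbit H) ⟶ S)
    (a : A.obj (op H)) (g : Burnside.of (orbit K) ⟶ T) (b : B.obj (op K)) :
    LanVal (pointTensor A B) ((burnsideProd G).obj (S, T)) :=
  lanPost (pointTensor A B) ((burnsideProd G).map
    (X := (Burnside.of (orbit H), Burnside.of (orbit K))) (Y := (S, T)) (f, g)) (extProd a b)

section PairMk

variable {S T : Burnside G} {H K : OrbitCat G} (f f' : Burnside.of (orbit H) ⟶ S)
    (a a' : A.obj (op H)) (g g' : Burnside.of (orbit K) ⟶ T) (b b' : B.obj (op K))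

lemma pairMk_add_left : pairMk f (a + a') g b = pairMk f a g b + pairMk f a' g b :=
  (congrArg _ (extProd_add_left a a' b)).trans (map_add _ _ _)

lemma pairMk_add_right : pairMk f a g (b + b') = pairMk f a g b + pairMk f a g b' :=
  (congrArg _ (extProd_add_right a b b')).trans (map_add _ _ _)

lemma pairMk_add_fst : pairMk (f + f') a g b = pairMk f a g b + pairMk f' a g b :=
  (congrArg (fun k => lanPost (pointTensor A B) k _) (burnsideProd_add_left f f' g)).trans
    (lanPost_add_apply _ _ _)

lemma pairMk_add_snd : pairMk f a (g + g') b = pairMk f a g b + pairMk f a g' b :=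
  (congrArg (fun k => lanPost (pointTensor A B) k _) (burnsideProd_add_right f g g')).trans
    (lanPost_add_apply _ _ _)

lemma pairMk_post {S' T' : Burnside G} (k : S ⟶ S') (l : T ⟶ T') :
    pairMk (f ≫ k) a (g ≫ l) b =
      lanPost _ ((burnsideProd G).map (X := (S, T)) (Y := (S', T')) (k, l)) (pairMk f a g b) :=
  (congrArg (fun k => lanPost (pointTensor A B) k _) ((burnsideProd G).map_comp
      (X := (Burnside.of (orbit H), Burnside.of (orbit K))) (Y := (S, T))
      (Z := (S', T')) (f, g) (k, l))).trans (lanPost_comp_apply _ _ _)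

lemma pairMk_map {H' K' : OrbitCat G} (v : H ⟶ H') (w : K ⟶ K') (a : A.obj (op H'))
    (b : B.obj (op K')) :
    pairMk f (A.map v.op a) g (B.map w.op b) =
      pairMk (contra (S := orbit H) (T := orbit H') v ≫ f) a
        (contra (S := orbit K) (T := orbit K') w ≫ g) b := by
  refine (congrArg _ (extProd_map v w a b)).trans ?_
  rw [← contra_prod]
  refine (lanPost_comp_apply _ _ _).symm.trans ?_
  exact congrArg (fun k => lanPost (pointTensor A B) k _) ((burnsideProd G).map_comp
    (X := (Burnside.of (orbit H'), Burnside.of (orbit K')))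
    (Y := (Burnside.of (orbit H), Burnside.of (orbit K))) (Z := (S, T)) _ _).symm

lemma pairMk_map_left {H' : OrbitCat G} (v : H ⟶ H') (a : A.obj (op H')) :
    pairMk f (A.map v.op a) g b =
      pairMk (contra (S := orbit H) (T := orbit H') v ≫ f) a g b := by
  have h := pairMk_map (A := A) (B := B) f g v (𝟙 K) a b
  have hb : B.map (𝟙 K : K ⟶ K).op b = b := ConcreteCategory.congr_hom (B.map_id (op K)) b
  rw [hb] at h
  exact h.trans (congrArg (fun k => pairMk _ a k b) (Category.id_comp g))

lemma pairMk_map_right {K' : OrbitCat G} (w : K ⟶ K') (b : B.obj (op K')) :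
    pairMk f a g (B.map w.op b) =
      pairMk f a (contra (S := orbit K) (T := orbit K') w ≫ g) b := by
  have h := pairMk_map (A := A) (B := B) f g (𝟙 H) w a b
  have ha : A.map (𝟙 H : H ⟶ H).op a = a := ConcreteCategory.congr_hom (A.map_id (op H)) a
  rw [ha] at h
  exact h.trans (congrArg (fun k => pairMk k a _ b) (Category.id_comp f))

lemma pairMk_id : pairMk (𝟙 (Burnside.of (orbit H))) a (𝟙 (Burnside.of (orbit K))) b =
    extProd a b :=
  (congrArg (fun k => lanPost (pointTensor A B) k _) ((burnsideProd G).map_id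
    (Burnside.of (orbit H), Burnside.of (orbit K)))).trans (lanPost_id_apply _)

end PairMk

/-- The pairing `L A (S) × L B (T) → L (A ⊗ B) (S × T)` for a fixed generator `f ⊗ a` of the first
factor. -/
def lanPairRight {S : Burnside G} (H : (OrbitCat G)ᵒᵖ) (f : (orbitToBurnside G).obj H ⟶ S)
    (a : A.obj H) (T : Burnside G) :
    LanVal B T →+ LanVal (pointTensor A B) ((burnsideProd G).obj (S, T)) :=
  lanDesc (fun K => AddMonoidHom.mk' (fun g => AddMonoidHom.mk'
      (fun b => pairMk (H := H.unop) (K := K.unop) f a g b)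
      (pairMk_add_right (H := H.unop) (K := K.unop) f a g))
      fun g g' => AddMonoidHom.ext fun b =>
        pairMk_add_snd (H := H.unop) (K := K.unop) f a g g' b)
    fun _ K' w g b => pairMk_map_right (H := H.unop) (K := K'.unop) f a g w.unop b

lemma lanPairRight_mk {S T : Burnside G} {H K : (OrbitCat G)ᵒᵖ}
    (f : (orbitToBurnside G).obj H ⟶ S) (a : A.obj H) (g : (orbitToBurnside G).obj K ⟶ T)
    (b : B.obj K) :
    lanPairRight (B := B) H f a T (lanMk (orbitToBurnside G) B g b) =
      pairMk (H := H.unop) (K := K.unop) f a g b :=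
  lanDesc_mk _ _ K g b

variable (A B) in
/-- The pairing `L A (S) × L B (T) → L (A ⊗ B) (S × T)`. -/
def lanPair (S T : Burnside G) :
    LanVal A S →+ LanVal B T →+ LanVal (pointTensor A B) ((burnsideProd G).obj (S, T)) :=
  lanDesc (fun H => AddMonoidHom.mk' (fun f => AddMonoidHom.mk' (fun a => lanPairRight H f a T)
      fun a a' => lan_hom_ext fun K g b => by
        rw [AddMonoidHom.add_apply, lanPairRight_mk, lanPairRight_mk, lanPairRight_mk]
        exact pairMk_add_left (H := H.unop) (K := K.unop) f a a' g b)
      fun f f' => AddMonoidHom.ext fun a => lan_hom_ext fun K g b => by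
        change lanPairRight _ _ _ _ _ = lanPairRight _ _ _ _ _ + lanPairRight _ _ _ _ _
        rw [lanPairRight_mk, lanPairRight_mk, lanPairRight_mk]
        exact pairMk_add_fst (H := H.unop) (K := K.unop) f f' a g b)
    fun H H' v f a => lan_hom_ext fun K g b => by
      change lanPairRight _ _ _ _ _ = lanPairRight _ _ _ _ _
      rw [lanPairRight_mk, lanPairRight_mk]
      exact pairMk_map_left (H := H'.unop) (K := K.unop) f g b v.unop a

lemma lanPair_mk {S T : Burnside G} {H K : (OrbitCat G)ᵒᵖ}
    (f : (orbitToBurnside G).obj H ⟶ S) (a : A.obj H) (g : (orbitToBurnside G).obj K ⟶ T)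
    (b : B.obj K) :
    lanPair A B S T (lanMk (orbitToBurnside G) A f a) (lanMk (orbitToBurnside G) B g b) =
      pairMk (H := H.unop) (K := K.unop) f a g b :=
  (DFunLike.congr_fun (lanDesc_mk _ _ H f a) _).trans (lanPairRight_mk f a g b)

lemma lanPair_lanOne {H K : OrbitCat G} (a : A.obj (op H)) (b : B.obj (op K)) :
    lanPair A B (Burnside.of (orbit H)) (Burnside.of (orbit K)) (lanOne a) (lanOne b) =
      extProd a b :=
  (lanPair_mk (H := op H) (K := op K) (𝟙 _) a (𝟙 _) b).trans (pairMk_id a b)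

lemma lanPair_natural {S S' T T' : Burnside G} (k : S ⟶ S') (l : T ⟶ T') (x : LanVal A S)
    (y : LanVal B T) :
    lanPair A B S' T' (lanPost A k x) (lanPost B l y) =
      lanPost _ ((burnsideProd G).map (X := (S, T)) (Y := (S', T')) (k, l))
        (lanPair A B S T x y) := by
  have h : (AddMonoidHom.compHom.flip (lanPost B l)).comp
      ((lanPair A B S' T').comp (lanPost A k)) =
      (AddMonoidHom.compHom (lanPost (pointTensor A B)
        ((burnsideProd G).map (X := (S, T)) (Y := (S', T')) (k, l)))).comp (lanPair A B S T) := by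
    refine lan_hom_ext fun H f a => lan_hom_ext fun K g b => ?_
    change lanPair A B S' T' (lanPost A k (lanMk _ A f a)) (lanPost B l (lanMk _ B g b)) =
      lanPost _ _ (lanPair A B S T (lanMk _ A f a) (lanMk _ B g b))
    rw [lanPost_mk, lanPost_mk, lanPair_mk, lanPair_mk]
    exact pairMk_post (H := H.unop) (K := K.unop) f a g b k l
  exact DFunLike.congr_fun (DFunLike.congr_fun h x) y

/-- The value of the box product of Kan extensions at a finite `G`-set. -/
abbrev BoxVal (A B : CoeffSystem G) (U : Burnside G) : Type (u + 1) :=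
  LanGroup (burnsideProd G) (externalTensor ((coeffToMackey G).obj A) ((coeffToMackey G).obj B)) U

/-- The generator `h ⊗ (x ⊗ y)` of the box product. -/
def boxMk {S T U : Burnside G} (h : (burnsideProd G).obj (S, T) ⟶ U) (x : LanVal A S)
    (y : LanVal B T) : BoxVal A B U :=
  lanMk (burnsideProd G) (externalTensor ((coeffToMackey G).obj A) ((coeffToMackey G).obj B))
    (a := (S, T)) h (x ⊗ₜ[ℤ] y)

lemma boxMk_add_left {S T U : Burnside G} (h : (burnsideProd G).obj (S, T) ⟶ U) (x x' : LanVal A S)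
    (y : LanVal B T) : boxMk h (x + x') y = boxMk h x y + boxMk h x' y :=
  (congrArg _ (TensorProduct.add_tmul x x' y)).trans (lanMk_add_right _ _ _)

lemma boxMk_add_right {S T U : Burnside G} (h : (burnsideProd G).obj (S, T) ⟶ U) (x : LanVal A S)
    (y y' : LanVal B T) : boxMk h x (y + y') = boxMk h x y + boxMk h x y' :=
  (congrArg _ (TensorProduct.tmul_add x y y')).trans (lanMk_add_right _ _ _)

lemma boxMk_add {S T U : Burnside G} (h h' : (burnsideProd G).obj (S, T) ⟶ U) (x : LanVal A S)
    (y : LanVal B T) : boxMk (h + h') x y = boxMk h x y + boxMk h' x y :=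
  lanMk_add_left _ _ _

lemma boxMk_post {S T S' T' U : Burnside G} (k : S ⟶ S') (l : T ⟶ T')
    (h : (burnsideProd G).obj (S', T') ⟶ U) (x : LanVal A S) (y : LanVal B T) :
    boxMk h (lanPost A k x) (lanPost B l y) =
      boxMk ((burnsideProd G).map (X := (S, T)) (Y := (S', T')) (k, l) ≫ h) x y :=
  lanMk_map (J := burnsideProd G) (F := externalTensor ((coeffToMackey G).obj A)
    ((coeffToMackey G).obj B)) (a := (S, T)) (a' := (S', T')) (k, l) h (x ⊗ₜ[ℤ] y)

lemma boxMk_gen {S T U : Burnside G} {H K : (OrbitCat G)ᵒᵖ} (h : (burnsideProd G).obj (S, T) ⟶ U)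
    (f : (orbitToBurnside G).obj H ⟶ S) (a : A.obj H) (g : (orbitToBurnside G).obj K ⟶ T)
    (b : B.obj K) :
    boxMk h (lanMk (orbitToBurnside G) A f a) (lanMk (orbitToBurnside G) B g b) =
      boxMk ((burnsideProd G).map (X := ((orbitToBurnside G).obj H, (orbitToBurnside G).obj K))
        (Y := (S, T)) (f, g) ≫ h) (lanOne (I := H.unop) a) (lanOne (I := K.unop) b) :=
  (congrArg₂ (boxMk h) (lanPost_lanOne (C := A) (I := H.unop) f a)
    (lanPost_lanOne (C := B) (I := K.unop) g b)).symm.trans (boxMk_post _ _ _ _ _)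

/-- The additive extension of `x ⊗ y ↦ boxMk h x y`. -/
def boxMkHom {S T U : Burnside G} (h : (burnsideProd G).obj (S, T) ⟶ U) :
    (externalTensor ((coeffToMackey G).obj A) ((coeffToMackey G).obj B)).obj (S, T) →+
      BoxVal A B U :=
  AddMonoidHom.mk' (fun z => lanMk (burnsideProd G) (externalTensor ((coeffToMackey G).obj A)
    ((coeffToMackey G).obj B)) (a := (S, T)) h z) (lanMk_add_right h)

/-- The generator `h ⊗ ((1 ⊗ a) ⊗ (1 ⊗ b))` of the box product. -/
def boxOrb {H K : OrbitCat G} {U : Burnside G} (h : Burnside.of ((orbit H).prod (orbit K)) ⟶ U)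
    (a : A.obj (op H)) (b : B.obj (op K)) : BoxVal A B U :=
  boxMk (S := Burnside.of (orbit H)) (T := Burnside.of (orbit K)) h (lanOne a) (lanOne b)

section BoxOrb

variable {H K : OrbitCat G} {U : Burnside G} (h h' : Burnside.of ((orbit H).prod (orbit K)) ⟶ U)

lemma boxOrb_add_left (a a' : A.obj (op H)) (b : B.obj (op K)) :
    boxOrb h (a + a') b = boxOrb h a b + boxOrb h a' b :=
  (congrArg (fun k => boxMk (S := Burnside.of (orbit H)) (T := Burnside.of (orbit K)) h k
    (lanOne b)) (lanOne_add a a')).trans (boxMk_add_left _ _ _ _)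

lemma boxOrb_add_right (a : A.obj (op H)) (b b' : B.obj (op K)) :
    boxOrb h a (b + b') = boxOrb h a b + boxOrb h a b' :=
  (congrArg (fun k => boxMk (S := Burnside.of (orbit H)) (T := Burnside.of (orbit K)) h
    (lanOne a) k) (lanOne_add b b')).trans (boxMk_add_right _ _ _ _)

lemma boxOrb_add (a : A.obj (op H)) (b : B.obj (op K)) :
    boxOrb (h + h') a b = boxOrb h a b + boxOrb h' a b :=
  boxMk_add _ _ _ _

lemma boxOrb_sum {ι : Type*} (s : Finset ι)
    (h : ι → (Burnside.of ((orbit H).prod (orbit K)) ⟶ U)) (a : A.obj (op H))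
    (b : B.obj (op K)) : boxOrb (∑ i ∈ s, h i) a b = ∑ i ∈ s, boxOrb (h i) a b :=
  map_sum (AddMonoidHom.mk' (fun h => boxOrb h a b) fun h h' => boxOrb_add h h' a b) h s

lemma boxOrb_map {H' K' : OrbitCat G} (v : H ⟶ H') (w : K ⟶ K') (a : A.obj (op H'))
    (b : B.obj (op K')) :
    boxOrb h (A.map v.op a) (B.map w.op b) =
      boxOrb (contra (prodMapHom (S := orbit H) (T := orbit H') (U := orbit K) (V := orbit K') v w)
        ≫ h) a b := by
  rw [← contra_prod]
  exact (congrArg₂ (boxMk (S := Burnside.of (orbit H)) (T := Burnside.of (orbit K)) h)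
    (lanPost_contra_lanOne v a) (lanPost_contra_lanOne w b)).symm.trans (boxMk_post _ _ _ _ _)

lemma lanPost_boxOrb {V : Burnside G} (k : U ⟶ V) (a : A.obj (op H)) (b : B.obj (op K)) :
    lanPost _ k (boxOrb h a b) = boxOrb (h ≫ k) a b :=
  lanPost_mk _ _ _

end BoxOrb

/-- The box product of Kan extensions is generated by the elements `h ⊗ ((1 ⊗ a) ⊗ (1 ⊗ b))`. -/
lemma box_hom_ext {U : Burnside G} {M : Type*} [AddCommGroup M] {p q : BoxVal A B U →+ M}
    (hpq : ∀ (H K : OrbitCat G) (h : Burnside.of ((orbit H).prod (orbit K)) ⟶ U)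
      (a : A.obj (op H)) (b : B.obj (op K)),
      p (boxOrb h a b) = q (boxOrb h a b)) : p = q := by
  refine lan_hom_ext fun ⟨S, T⟩ h z => ?_
  revert z
  let P : LanVal A S →+ LanVal B T →+ M := AddMonoidHom.mk' (fun x => AddMonoidHom.mk'
    (fun y => p (boxMk h x y)) fun y y' => by rw [boxMk_add_right, map_add])
    fun x x' => AddMonoidHom.ext fun y =>
      (congrArg p (boxMk_add_left h x x' y)).trans (map_add p _ _)
  let Q : LanVal A S →+ LanVal B T →+ M := AddMonoidHom.mk' (fun x => AddMonoidHom.mk'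
    (fun y => q (boxMk h x y)) fun y y' => by rw [boxMk_add_right, map_add])
    fun x x' => AddMonoidHom.ext fun y =>
      (congrArg q (boxMk_add_left h x x' y)).trans (map_add q _ _)
  have hPQ : P = Q := by
    refine lan_hom_ext fun H f a => lan_hom_ext fun K g b => ?_
    change p (boxMk h _ _) = q (boxMk h _ _)
    refine (congrArg p (boxMk_gen h f a g b)).trans ?_
    exact (hpq H.unop K.unop _ a b).trans (congrArg q (boxMk_gen h f a g b)).symm
  exact fun z => DFunLike.congr_fun (tensor_hom_ext (f := p.comp (boxMkHom h))
    (g := q.comp (boxMkHom h)) fun x y => DFunLike.congr_fun (DFunLike.congr_fun hPQ x) y) z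

variable (A B) in
/-- The additive extension of `lanPair` to the external product. -/
def lanPairHom (S : Burnside G × Burnside G) :
    (externalTensor ((coeffToMackey G).obj A) ((coeffToMackey G).obj B)).obj S →+
      LanVal (pointTensor A B) ((burnsideProd G).obj S) :=
  tensorLift (lanPair A B S.1 S.2)

lemma lanPairHom_map {S T : Burnside G × Burnside G} (f : S ⟶ T)
    (z : (externalTensor ((coeffToMackey G).obj A) ((coeffToMackey G).obj B)).obj S) :
    lanPairHom A B T ((externalTensor ((coeffToMackey G).obj A)
      ((coeffToMackey G).obj B)).map f z) =
      lanPost _ ((burnsideProd G).map f) (lanPairHom A B S z) :=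
  DFunLike.congr_fun (tensor_hom_ext (f := (lanPairHom A B T).comp
    ((externalTensor ((coeffToMackey G).obj A) ((coeffToMackey G).obj B)).map f).hom)
    (g := AddMonoidHom.comp (lanPost _ ((burnsideProd G).map f)) (lanPairHom A B S)) fun x y =>
      lanPair_natural f.1 f.2 x y) z

variable (A B) in
/-- The biadditive maps which define `boxToLan`. -/
def boxToLanAux (U : Burnside G) (S : Burnside G × Burnside G) :
    ((burnsideProd G).obj S ⟶ U) →+ (externalTensor ((coeffToMackey G).obj A)
      ((coeffToMackey G).obj B)).obj S →+ LanVal (pointTensor A B) U :=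
  AddMonoidHom.mk' (fun h => (lanPost (pointTensor A B) h).comp (lanPairHom A B S))
    fun _ _ => AddMonoidHom.ext fun _ => lanPost_add_apply _ _ _

variable (A B) in
/-- The comparison map from the box product of Kan extensions to the Kan extension of the pointwise
tensor product. -/
def boxToLan (U : Burnside G) : BoxVal A B U →+ LanVal (pointTensor A B) U :=
  lanDesc (boxToLanAux A B U) fun _ _ f h z =>
    (congrArg (lanPost _ h) (lanPairHom_map f z)).trans (lanPost_comp_apply _ _ _).symm

lemma boxToLan_mk {S T U : Burnside G} (h : (burnsideProd G).obj (S, T) ⟶ U) (x : LanVal A S)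
    (y : LanVal B T) :
    boxToLan A B U (boxMk h x y) = lanPost _ h (lanPair A B S T x y) := by
  rw [boxToLan, boxMk]
  refine (lanDesc_mk (boxToLanAux A B U) _ (S, T) h _).trans ?_
  rfl

lemma boxToLan_orb {H K : OrbitCat G} {U : Burnside G}
    (h : Burnside.of ((orbit H).prod (orbit K)) ⟶ U) (a : A.obj (op H)) (b : B.obj (op K)) :
    boxToLan A B U (boxOrb h a b) = lanPost _ h (extProd a b) :=
  (boxToLan_mk _ _ _).trans (congrArg (lanPost _ h) (lanPair_lanOne a b))

/-- The generator `h ⊗ (a ⊗ b)` of the Kan extension of the pointwise tensor product. -/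
def lanTens {H : OrbitCat G} {U : Burnside G} (h : Burnside.of (orbit H) ⟶ U) (a : A.obj (op H))
    (b : B.obj (op H)) : LanVal (pointTensor A B) U :=
  lanMk (orbitToBurnside G) (pointTensor A B) (a := op H) h (a ⊗ₜ[ℤ] b)

lemma lanPost_lanTens {H : OrbitCat G} {U V : Burnside G} (h : Burnside.of (orbit H) ⟶ U)
    (k : U ⟶ V) (a : A.obj (op H)) (b : B.obj (op H)) :
    lanPost _ k (lanTens h a b) = lanTens (h ≫ k) a b :=
  lanPost_mk _ _ _

lemma lanTens_hom_ext {U : Burnside G} {M : Type*} [AddCommGroup M]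
    {p q : LanVal (pointTensor A B) U →+ M}
    (hpq : ∀ (H : OrbitCat G) (h : Burnside.of (orbit H) ⟶ U) (a : A.obj (op H))
      (b : B.obj (op H)), p (lanTens h a b) = q (lanTens h a b)) : p = q := by
  refine lan_hom_ext fun H h z => ?_
  let e : (pointTensor A B).obj H →+ LanVal (pointTensor A B) U :=
    AddMonoidHom.mk' (fun z => lanMk (orbitToBurnside G) (pointTensor A B) h z) (lanMk_add_right h)
  exact DFunLike.congr_fun (tensor_hom_ext (A := A.obj H) (B := B.obj H) (f := p.comp e)
    (g := q.comp e) fun a b => hpq H.unop h a b) z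

/-- The map `a ⊗ b ↦ (h ∘ Δ^*) ⊗ (a ⊗ b)` for the diagonal `Δ` of an orbit. -/
def boxDiag {U : Burnside G} (H : OrbitCat G) (h : Burnside.of (orbit H) ⟶ U) :
    A.obj (op H) ⊗[ℤ] B.obj (op H) →+ BoxVal A B U :=
  tensorLift (AddMonoidHom.mk'
      (fun a => AddMonoidHom.mk' (fun b => boxOrb (contra (diagHom (orbit H)) ≫ h) a b)
        fun b b' => boxOrb_add_right _ a b b')
      fun a a' => AddMonoidHom.ext fun b => boxOrb_add_left _ a a' b)

lemma boxDiag_tmul {U : Burnside G} (H : OrbitCat G) (h : Burnside.of (orbit H) ⟶ U)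
    (a : A.obj (op H)) (b : B.obj (op H)) :
    boxDiag H h (a ⊗ₜ[ℤ] b) = boxOrb (contra (diagHom (orbit H)) ≫ h) a b := rfl

lemma boxDiag_add {U : Burnside G} (H : OrbitCat G) (h h' : Burnside.of (orbit H) ⟶ U) :
    boxDiag (A := A) (B := B) H (h + h') = boxDiag H h + boxDiag H h' :=
  tensor_hom_ext fun a b => by
    rw [AddMonoidHom.add_apply, boxDiag_tmul, boxDiag_tmul, boxDiag_tmul, Preadditive.comp_add,
      boxOrb_add]

lemma boxDiag_map {U : Burnside G} {H K : OrbitCat G} (v : H ⟶ K)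
    (h : Burnside.of (orbit H) ⟶ U) (z : A.obj (op K) ⊗[ℤ] B.obj (op K)) :
    boxDiag H h (tensorHom (A.map v.op).hom (B.map v.op).hom z) =
      boxDiag K (contra (S := orbit H) (T := orbit K) v ≫ h) z :=
  DFunLike.congr_fun (tensor_hom_ext
    (f := (boxDiag H h).comp (tensorHom (A.map v.op).hom (B.map v.op).hom))
    (g := boxDiag K (contra (S := orbit H) (T := orbit K) v ≫ h)) fun a b => by
      refine (boxOrb_map (A := A) (B := B) _ v v a b).trans ?_
      rw [boxDiag_tmul, ← Category.assoc, ← Category.assoc, contra_comp, contra_comp]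
      rfl) z

variable (A B) in
/-- The biadditive maps which define `lanToBox`. -/
def lanToBoxAux (U : Burnside G) (H : (OrbitCat G)ᵒᵖ) :
    ((orbitToBurnside G).obj H ⟶ U) →+ (pointTensor A B).obj H →+ BoxVal A B U :=
  AddMonoidHom.mk' (fun h => boxDiag H.unop h) fun h h' => boxDiag_add H.unop h h'

variable (A B) in
/-- The inverse of `boxToLan`, induced by the diagonals of orbits. -/
def lanToBox (U : Burnside G) : LanVal (pointTensor A B) U →+ BoxVal A B U :=
  lanDesc (lanToBoxAux A B U) fun _ _ v h z => boxDiag_map v.unop h z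

lemma lanToBox_lanTens {U : Burnside G} {H : OrbitCat G} (h : Burnside.of (orbit H) ⟶ U)
    (a : A.obj (op H)) (b : B.obj (op H)) :
    lanToBox A B U (lanTens h a b) = boxOrb (contra (diagHom (orbit H)) ≫ h) a b := by
  rw [lanToBox, lanTens]
  refine (lanDesc_mk (lanToBoxAux A B U) _ (op H) h _).trans ?_
  rfl

lemma boxToLan_lanToBox (U : Burnside G) (z : LanVal (pointTensor A B) U) :
    boxToLan A B U (lanToBox A B U z) = z := by
  refine DFunLike.congr_fun (f := (boxToLan A B U).comp (lanToBox A B U))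
    (g := AddMonoidHom.id _) (lanTens_hom_ext fun H h a b => ?_) z
  rw [AddMonoidHom.comp_apply, lanToBox_lanTens, boxToLan_orb, lanPost_comp_apply,
    lanPost_diag_extProd]
  exact lanPost_lanOne (C := pointTensor A B) h (a ⊗ₜ[ℤ] b)

lemma lanToBox_post {U V : Burnside G} (k : U ⟶ V) (z : LanVal (pointTensor A B) U) :
    lanToBox A B V (lanPost _ k z) = lanPost _ k (lanToBox A B U z) := by
  refine DFunLike.congr_fun (f := (lanToBox A B V).comp (lanPost _ k))
    (g := AddMonoidHom.comp (lanPost _ k) (lanToBox A B U)) (lanTens_hom_ext fun H h a b => ?_) z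
  rw [AddMonoidHom.comp_apply, AddMonoidHom.comp_apply, lanPost_lanTens, lanToBox_lanTens,
    lanToBox_lanTens, lanPost_boxOrb, Category.assoc]

/-- Since `G/H × G/K` is the disjoint union of its orbits, the unit of the product is the sum of the
restrictions to orbits, and each of them is a diagonal followed by a product of `G`-maps. -/
lemma lanToBox_extProd {H K : OrbitCat G} (a : A.obj (op H)) (b : B.obj (op K)) :
    lanToBox A B _ (extProd a b) = boxOrb (𝟙 (Burnside.of ((orbit H).prod (orbit K)))) a b := by
  rw [extProd, OrbSection.total, map_sum, ← sum_orbits, boxOrb_sum]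
  refine Finset.sum_congr rfl fun o _ => ?_
  rw [lanPost_lanOne]
  refine (lanToBox_lanTens (cov (orbitIncl o)) _ _).trans ?_
  refine (boxOrb_map (A := A) (B := B) (H := orbitObj o) (K := orbitObj o) (H' := H) (K' := K) _
    ((fstHom (orbit H) (orbit K)).comp (orbitIncl o))
    ((sndHom (orbit H) (orbit K)).comp (orbitIncl o)) a b).trans ?_
  rw [← Category.assoc, contra_comp]
  rfl

lemma lanToBox_boxToLan (U : Burnside G) (z : BoxVal A B U) :
    lanToBox A B U (boxToLan A B U z) = z := by
  refine DFunLike.congr_fun (f := (lanToBox A B U).comp (boxToLan A B U))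
    (g := AddMonoidHom.id _) (box_hom_ext fun H K h a b => ?_) z
  rw [AddMonoidHom.comp_apply, boxToLan_orb, lanToBox_post, lanToBox_extProd, lanPost_boxOrb,
    Category.id_comp]
  rfl

variable (A B) in
/-- The Kan extension takes the pointwise tensor product of coefficient systems to the box
product of Mackey functors. -/
def lanBoxIso : (coeffToMackey G).obj (pointTensor A B) ≅
    ((box G).obj ((coeffToMackey G).obj A)).obj ((coeffToMackey G).obj B) where
  hom := ObjectProperty.homMk
    { app := fun U => AddCommGrpCat.ofHom (lanToBox A B U)
      naturality := fun U V k => by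
        ext : 1
        exact AddMonoidHom.ext fun z => lanToBox_post k z }
  inv := ObjectProperty.homMk
    { app := fun U => AddCommGrpCat.ofHom (boxToLan A B U)
      naturality := fun U V k => by
        ext : 1
        refine AddMonoidHom.ext fun z => ?_
        obtain ⟨z, rfl⟩ : ∃ w, lanToBox A B U w = z := ⟨_, lanToBox_boxToLan U z⟩
        refine (congrArg (boxToLan A B V) (lanToBox_post k z).symm).trans ?_
        refine (boxToLan_lanToBox V _).trans ?_
        exact (congrArg (lanPost _ k) (boxToLan_lanToBox U z)).symm }
  hom_inv_id := by
    ext U : 4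
    exact AddMonoidHom.ext fun z => boxToLan_lanToBox U z
  inv_hom_id := by
    ext U : 4
    exact AddMonoidHom.ext fun z => lanToBox_boxToLan U z

/-- Naturality of `lanBoxIso` in both coefficient systems. -/
lemma lanBoxIso_natural {A' B' : CoeffSystem G} (α : A ⟶ A') (β : B ⟶ B') :
    (coeffToMackey G).map (pointTensorMap α β) ≫ (lanBoxIso A' B').hom =
      (lanBoxIso A B).hom ≫ ((box G).map ((coeffToMackey G).map α)).app _ ≫
        ((box G).obj _).map ((coeffToMackey G).map β) := by
  ext U : 4
  refine lanTens_hom_ext fun H h a b => ?_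
  have h1 : lanNat (orbitToBurnside G) (pointTensorMap α β) U (lanTens h a b) =
      lanTens h (α.app _ a) (β.app _ b) := lanNat_mk (pointTensorMap α β) _ _
  have h2 (a : A.obj (op H)) (b : B.obj (op H)) : lanNat (burnsideProd G) (externalTensorMap
      ((coeffToMackey G).map α) (𝟙 ((coeffToMackey G).obj B))) U
      (boxOrb (contra (diagHom (orbit H)) ≫ h) a b) =
      boxOrb (contra (diagHom (orbit H)) ≫ h) (α.app _ a) b :=
    (lanNat_mk _ _ _).trans (congrArg (fun k => boxMk (S := Burnside.of (orbit H))
      (T := Burnside.of (orbit H)) _ k (lanOne b)) (lanNat_mk α _ a))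
  have h3 (a : A'.obj (op H)) (b : B.obj (op H)) : lanNat (burnsideProd G) (externalTensorMap
      (𝟙 ((coeffToMackey G).obj A')) ((coeffToMackey G).map β)) U
      (boxOrb (contra (diagHom (orbit H)) ≫ h) a b) =
      boxOrb (contra (diagHom (orbit H)) ≫ h) a (β.app _ b) :=
    (lanNat_mk _ _ _).trans (congrArg (fun k => boxMk (S := Burnside.of (orbit H))
      (T := Burnside.of (orbit H)) _ (lanOne a) k) (lanNat_mk β _ b))
  refine (congrArg (lanToBox A' B' U) h1).trans ?_
  refine (lanToBox_lanTens h _ _).trans ?_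
  refine Eq.trans ?_ (congrArg (lanNat (burnsideProd G) (externalTensorMap
      (𝟙 ((coeffToMackey G).obj A')) ((coeffToMackey G).map β)) U)
    ((congrArg (lanNat (burnsideProd G) (externalTensorMap
      ((coeffToMackey G).map α) (𝟙 ((coeffToMackey G).obj B))) U)
      (lanToBox_lanTens h a b)).trans (h2 a b))).symm
  exact (h3 _ b).symm

end BoxIso

/-! ### Cross products of cellular chains -/

section BiLift

variable {M N A B L : Type*} [AddCommGroup M] [AddCommGroup N] [AddCommGroup A] [AddCommGroup B]
  [AddCommGroup L] {f : M →+ A} {g : N →+ B}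

/-- The biadditive map on quotients of `M` and `N` that is induced by `P`. -/
def biLift (hf : Function.Surjective f) (hg : Function.Surjective g) (P : M →+ N →+ L)
    (hP : ∀ x y, f x = 0 → P x y = 0) (hP' : ∀ x y, g y = 0 → P x y = 0) : A →+ B →+ L :=
  f.liftOfSurjective hf ⟨AddMonoidHom.mk'
    (fun x => g.liftOfSurjective hg ⟨P x, fun y hy => hP' x y hy⟩) fun x x' => by
      ext b
      obtain ⟨y, rfl⟩ := hg b
      rw [AddMonoidHom.add_apply]
      refine (AddMonoidHom.liftOfRightInverse_comp_apply _ _ _ ⟨P (x + x'), _⟩ y).trans ?_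
      refine Eq.trans ?_ (congrArg₂ (· + ·)
        (AddMonoidHom.liftOfRightInverse_comp_apply _ _ _ ⟨P x, _⟩ y)
        (AddMonoidHom.liftOfRightInverse_comp_apply _ _ _ ⟨P x', _⟩ y)).symm
      exact DFunLike.congr_fun (map_add P x x') y, fun x hx => by
    rw [AddMonoidHom.mem_ker]
    ext b
    obtain ⟨y, rfl⟩ := hg b
    exact (AddMonoidHom.liftOfRightInverse_comp_apply _ _ _ ⟨P x, _⟩ y).trans (hP x y hx)⟩

lemma biLift_apply (hf : Function.Surjective f) (hg : Function.Surjective g) (P : M →+ N →+ L)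
    (hP : ∀ x y, f x = 0 → P x y = 0) (hP' : ∀ x y, g y = 0 → P x y = 0) (x : M) (y : N) :
    biLift hf hg P hP hP' (f x) (g y) = P x y := by
  refine (DFunLike.congr_fun (AddMonoidHom.liftOfRightInverse_comp_apply f _ _
    ⟨AddMonoidHom.mk' (fun x => g.liftOfSurjective hg ⟨P x, fun y hy => hP' x y hy⟩) _, _⟩ x)
    (g y)).trans ?_
  exact AddMonoidHom.liftOfRightInverse_comp_apply _ _ _ ⟨P x, _⟩ y

/-- The restriction of a bilinear map to submodules. -/
def biRestrict {M N L : Type*} [AddCommGroup M] [AddCommGroup N] [AddCommGroup L]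
    (P : M →ₗ[ℤ] N →ₗ[ℤ] L) {S : Submodule ℤ M} {T : Submodule ℤ N} {U : Submodule ℤ L}
    (h : ∀ x ∈ S, ∀ y ∈ T, P x y ∈ U) : S →+ T →+ U :=
  AddMonoidHom.mk' (fun x => AddMonoidHom.mk' (fun y => ⟨P x.1 y.1, h _ x.2 _ y.2⟩)
    fun _ _ => Subtype.ext (map_add _ _ _))
    fun _ _ => AddMonoidHom.ext fun _ => Subtype.ext (LinearMap.congr_fun (map_add _ _ _) _)

end BiLift

namespace ProductMap

open Opposite

variable {G : Type u} [Group G] {X Y Z : Type u} [TopologicalSpace X] [TopologicalSpace Y]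
  [TopologicalSpace Z] [MulAction G X] [MulAction G Y] [MulAction G Z] {D : Set X} {E : Set Y}
  {W : Set Z} {c : RelGCWComplex G X D} {d : RelGCWComplex G Y E} (m : ProductMap c d W)
  {e : RelGCWComplex G Z W} (he : ∀ n, e.skelLT n = m.product.skelLT n)

/-- The pairing is filtered. The index `a` of `skelLT` is a strict bound for dimensions, which is
the reason for the shift by one. -/
lemma map_mem_skelLT {a b n : ℕ} (h : a + b ≤ n + 1) {x : X} {y : Y} (hx : x ∈ c.skelLT a)
    (hy : y ∈ d.skelLT b) : m.map.toFun x y ∈ m.product.skelLT n := by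
  have hW : ∀ {z}, z ∈ W → z ∈ m.product.skelLT n := fun hz =>
    (RelGCWComplex.mem_skelLT _).2 (Or.inl hz)
  rcases a with - | a
  · refine hW ((m.mem_base _ _).2 (Or.inl ?_))
    obtain h | ⟨a, ha, -⟩ := (RelGCWComplex.mem_skelLT _).1 hx
    · exact h
    · exact absurd ha (Nat.not_lt_zero _)
  rcases b with - | b
  · refine hW ((m.mem_base _ _).2 (Or.inr ?_))
    obtain h | ⟨a, ha, -⟩ := (RelGCWComplex.mem_skelLT _).1 hy
    · exact h
    · exact absurd ha (Nat.not_lt_zero _)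
  obtain ⟨n, rfl⟩ : ∃ k, n = k + 1 := ⟨n - 1, by omega⟩
  exact m.mem_product_skelLT.2 (Or.inr ⟨a, n - a, x, y, by omega, hx,
    skelLT_mono' d (by omega) hy, rfl⟩)

include he in
lemma map_mem_fixedSkelLT (H : Subgroup G) {a b n : ℕ} (h : a + b ≤ n + 1) :
    ∀ x ∈ c.fixedSkelLT H a, ∀ y ∈ d.fixedSkelLT H b, m.map.toFun x y ∈ e.fixedSkelLT H n :=
  fun x hx y hy => ⟨(he n).symm ▸ m.map_mem_skelLT h hx.1 hy.1, fun g =>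
    (m.map_smul (g : G) x y).symm.trans (congrArg₂ m.map.toFun (hx.2 g) (hy.2 g))⟩

include he in
lemma chCross_mem_relCyc (H : Subgroup G) {n p q : ℕ} (h : p + q = n) {z : Ch X p} {w : Ch Y q}
    (hz : z ∈ relCyc (c.fixedSkelLT H (p + 1)) (c.fixedSkelLT H p) p)
    (hw : w ∈ relCyc (d.fixedSkelLT H (q + 1)) (d.fixedSkelLT H q) q) :
    chCross m.map n p q z w ∈ relCyc (e.fixedSkelLT H (n + 1)) (e.fixedSkelLT H n) n :=
  chCross_relCyc (m.map_mem_fixedSkelLT he H (by omega)) (m.map_mem_fixedSkelLT he H (by omega))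
    (m.map_mem_fixedSkelLT he H (by omega)) h hz hw

/-- The class of the cross product of two relative cycles. -/
def cycCross {n p q : ℕ} (h : p + q = n) (H : OrbitCat G) :
    relCyc (c.fixedSkelLT H.subgroup (p + 1)) (c.fixedSkelLT H.subgroup p) p →+
      relCyc (d.fixedSkelLT H.subgroup (q + 1)) (d.fixedSkelLT H.subgroup q) q →+
      (e.coeffChains.X n).obj (op H) :=
  (AddMonoidHom.compHom (e.cellClass H n)).comp (biRestrict (chCross m.map n p q) fun _ hz _ hw =>
    m.chCross_mem_relCyc he H.subgroup h hz hw)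

lemma cycCross_eq_zero_left {n p q : ℕ} (h : p + q = n) (H : OrbitCat G)
    (z : relCyc (c.fixedSkelLT H.subgroup (p + 1)) (c.fixedSkelLT H.subgroup p) p)
    (w : relCyc (d.fixedSkelLT H.subgroup (q + 1)) (d.fixedSkelLT H.subgroup q) q)
    (hz : c.cellClass H p z = 0) : m.cycCross he h H z w = 0 :=
  (e.cellClass_eq_zero (H := H) (n := n) (z := ⟨_, _⟩)).2 (chCross_relBdry_left
    (m.map_mem_fixedSkelLT he _ (by omega)) (m.map_mem_fixedSkelLT he _ (by omega))
    (m.map_mem_fixedSkelLT he _ (by omega)) h (c.cellClass_eq_zero.1 hz) w.2)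

lemma cycCross_eq_zero_right {n p q : ℕ} (h : p + q = n) (H : OrbitCat G)
    (z : relCyc (c.fixedSkelLT H.subgroup (p + 1)) (c.fixedSkelLT H.subgroup p) p)
    (w : relCyc (d.fixedSkelLT H.subgroup (q + 1)) (d.fixedSkelLT H.subgroup q) q)
    (hw : d.cellClass H q w = 0) : m.cycCross he h H z w = 0 :=
  (e.cellClass_eq_zero (H := H) (n := n) (z := ⟨_, _⟩)).2 (chCross_relBdry_right
    (m.map_mem_fixedSkelLT he _ (by omega)) (m.map_mem_fixedSkelLT he _ (by omega))
    (m.map_mem_fixedSkelLT he _ (by omega)) h z.2 (d.cellClass_eq_zero.1 hw))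

/-- The cross product of cellular chains on the fixed points. -/
def cellCross {n p q : ℕ} (h : p + q = n) (H : OrbitCat G) :
    (c.coeffChains.X p).obj (op H) →+ (d.coeffChains.X q).obj (op H) →+
      (e.coeffChains.X n).obj (op H) :=
  biLift (c.cellClass_surjective H p) (d.cellClass_surjective H q) (m.cycCross he h H)
    (m.cycCross_eq_zero_left he h H) (m.cycCross_eq_zero_right he h H)

lemma cellCross_class {n p q : ℕ} (h : p + q = n) (H : OrbitCat G)
    (z : relCyc (c.fixedSkelLT H.subgroup (p + 1)) (c.fixedSkelLT H.subgroup p) p)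
    (w : relCyc (d.fixedSkelLT H.subgroup (q + 1)) (d.fixedSkelLT H.subgroup q) q) :
    m.cellCross he h H (c.cellClass H p z) (d.cellClass H q w) =
      e.cellClass H n ⟨chCross m.map n p q z.1 w.1,
        m.chCross_mem_relCyc he H.subgroup h z.2 w.2⟩ :=
  biLift_apply _ _ _ _ _ z w

lemma cellCross_map {n p q : ℕ} (h : p + q = n) {H K : OrbitCat G} (f : H ⟶ K)
    (a : (c.coeffChains.X p).obj (op K)) (b : (d.coeffChains.X q).obj (op K)) :
    m.cellCross he h H ((c.coeffChains.X p).map f.op a) ((d.coeffChains.X q).map f.op b) =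
      (e.coeffChains.X n).map f.op (m.cellCross he h K a b) := by
  obtain ⟨z, rfl⟩ := c.cellClass_surjective K p a
  obtain ⟨w, rfl⟩ := d.cellClass_surjective K q b
  rw [c.cellClass_map, d.cellClass_map, cellCross_class, cellCross_class, e.cellClass_map]
  refine congrArg (e.cellClass H n) (Subtype.ext ?_)
  exact (chMap_cross (fun x y => (m.map_smul _ x y).symm) n p q z.1 w.1).symm

/-- The cross product of cellular chains as a map of coefficient systems. -/
def crossMap {n p q : ℕ} (h : p + q = n) :
    pointTensor (c.coeffChains.X p) (d.coeffChains.X q) ⟶ e.coeffChains.X n where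
  app H := AddCommGrpCat.ofHom (tensorLift (m.cellCross he h H.unop))
  naturality H K f := by
    ext : 1
    exact tensor_hom_ext fun a b => m.cellCross_map he h f.unop a b

/-- The Leibniz rule for cellular chains in positive bidegrees. As the cellular complexes have no
differential in degree `0`, the other bidegrees are treated separately. -/
lemma cellCross_d {n p q : ℕ} (h : p + 1 + (q + 1) = n + 1) (H : OrbitCat G)
    (a : (c.coeffChains.X (p + 1)).obj (op H)) (b : (d.coeffChains.X (q + 1)).obj (op H)) :
    (e.coeffChains.d (n + 1) n).app (op H) (m.cellCross he h H a b) =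
    m.cellCross he (by omega) H ((c.coeffChains.d (p + 1) p).app (op H) a) b +
    (-1 : ℤ) ^ (p + 1) •
      m.cellCross he (by omega) H a ((d.coeffChains.d (q + 1) q).app (op H) b) := by
  obtain ⟨z, rfl⟩ := c.cellClass_surjective H _ a
  obtain ⟨w, rfl⟩ := d.cellClass_surjective H _ b
  rw [c.cellClass_d, d.cellClass_d, cellCross_class, cellCross_class, cellCross_class]
  refine (e.cellClass_d H n _).trans ?_
  refine Eq.trans ?_ (congrArg (_ + ·) (map_zsmul (e.cellClass H n) _ _))
  refine Eq.trans ?_ (map_add (e.cellClass H n) _ _)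
  refine congrArg (e.cellClass H n) (Subtype.ext ?_)
  exact chD_cross m.map h z.1 w.1

lemma cellCross_d_zero_right {n p : ℕ} (h : p + 1 + 0 = n + 1) (H : OrbitCat G)
    (a : (c.coeffChains.X (p + 1)).obj (op H)) (b : (d.coeffChains.X 0).obj (op H)) :
    (e.coeffChains.d (n + 1) n).app (op H) (m.cellCross he h H a b) =
    m.cellCross he (by omega) H ((c.coeffChains.d (p + 1) p).app (op H) a) b := by
  obtain ⟨z, rfl⟩ := c.cellClass_surjective H _ a
  obtain ⟨w, rfl⟩ := d.cellClass_surjective H _ b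
  rw [cellCross_class, c.cellClass_d, e.cellClass_d, cellCross_class]
  refine congrArg (e.cellClass H n) (Subtype.ext ((chD_cross m.map h z.1 w.1).trans ?_))
  rw [chD_zero, LinearMap.zero_apply, map_zero, smul_zero, add_zero]
  rfl

lemma cellCross_d_zero_left {n q : ℕ} (h : 0 + (q + 1) = n + 1) (H : OrbitCat G)
    (a : (c.coeffChains.X 0).obj (op H)) (b : (d.coeffChains.X (q + 1)).obj (op H)) :
    (e.coeffChains.d (n + 1) n).app (op H) (m.cellCross he h H a b) =
    m.cellCross he (by omega) H a ((d.coeffChains.d (q + 1) q).app (op H) b) := by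
  obtain ⟨z, rfl⟩ := c.cellClass_surjective H _ a
  obtain ⟨w, rfl⟩ := d.cellClass_surjective H _ b
  rw [cellCross_class, d.cellClass_d, e.cellClass_d, cellCross_class]
  refine congrArg (e.cellClass H n) (Subtype.ext ((chD_cross m.map h z.1 w.1).trans ?_))
  rw [chD_zero, LinearMap.zero_apply, map_zero, LinearMap.zero_apply, pow_zero, one_smul, zero_add]
  rfl

lemma crossMap_d {n p q : ℕ} (h : p + 1 + (q + 1) = n + 1) :
    m.crossMap he h ≫ e.coeffChains.d (n + 1) n =
      pointTensorMap (c.coeffChains.d (p + 1) p) (𝟙 _) ≫ m.crossMap he (by omega) +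
      (-1 : ℤ) ^ (p + 1) • (pointTensorMap (𝟙 _) (d.coeffChains.d (q + 1) q) ≫
        m.crossMap he (by omega)) := by
  ext H : 2
  ext : 1
  exact tensor_hom_ext fun a b => m.cellCross_d he h H.unop a b

lemma crossMap_d_zero_right {n p : ℕ} (h : p + 1 + 0 = n + 1) :
    m.crossMap he h ≫ e.coeffChains.d (n + 1) n =
      pointTensorMap (c.coeffChains.d (p + 1) p) (𝟙 _) ≫ m.crossMap he (by omega) := by
  ext H : 2
  ext : 1
  exact tensor_hom_ext fun a b => m.cellCross_d_zero_right he h H.unop a b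

lemma crossMap_d_zero_left {n q : ℕ} (h : 0 + (q + 1) = n + 1) :
    m.crossMap he h ≫ e.coeffChains.d (n + 1) n =
      pointTensorMap (𝟙 _) (d.coeffChains.d (q + 1) q) ≫ m.crossMap he (by omega) := by
  ext H : 2
  ext : 1
  exact tensor_hom_ext fun a b => m.cellCross_d_zero_left he h H.unop a b

end ProductMap

/-! ### Cells and bases of cellular chains -/

section RelBasisClass

variable {X : Type*} [TopologicalSpace X] {A A' : Set X} {n : ℕ} {ι : Type*} {b : ι → Ch X n}
  {C : Type*} [AddCommGroup C] {f : relCyc A A' n →+ C}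

/-- The basis of the relative homology group that consists of the classes of the cycles `b`. -/
def RelBasis.basis (hb : RelBasis A A' n b) (hf : Function.Surjective f)
    (h0 : ∀ z, f z = 0 ↔ z.1 ∈ relBdry A A' n) : Module.Basis ι ℤ C :=
  have hl : ∀ l : ι →₀ ℤ, ∃ z : relCyc A A' n, z.1 = Finsupp.linearCombination ℤ b l ∧
      f z = Finsupp.linearCombination ℤ (fun i => f ⟨b i, hb.mem i⟩) l := fun l =>
    ⟨Finsupp.linearCombination ℤ (fun i => (⟨b i, hb.mem i⟩ : relCyc A A' n)) l,
      Finsupp.apply_linearCombination ℤ (relCyc A A' n).subtype _ l,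
      Finsupp.apply_linearCombination ℤ (⟨⟨f, map_add f⟩, fun r x => map_zsmul f r x⟩ :
        relCyc A A' n →ₗ[ℤ] C) _ l⟩
  Module.Basis.mk (v := fun i => f ⟨b i, hb.mem i⟩)
    (linearIndependent_iff.2 fun l hl' => by
      obtain ⟨z, hz, e⟩ := hl l
      exact hb.indep l (hz ▸ (h0 z).1 (e.trans hl')))
    (fun x _ => by
      obtain ⟨z, rfl⟩ := hf x
      obtain ⟨l, h⟩ := hb.span z.1 z.2
      obtain ⟨w, hw, e⟩ := hl l
      have : f z = f w := by
        rw [← hw] at h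
        rw [← sub_eq_zero, ← map_sub, h0]
        exact h
      rw [this, e]
      exact Finsupp.mem_span_range_iff_exists_finsupp.2 ⟨l, rfl⟩)

lemma RelBasis.basis_apply (hb : RelBasis A A' n b) (hf : Function.Surjective f)
    (h0 : ∀ z, f z = 0 ↔ z.1 ∈ relBdry A A' n) (i : ι) :
    hb.basis hf h0 i = f ⟨b i, hb.mem i⟩ := by
  rw [RelBasis.basis, Module.Basis.mk_apply]

end RelBasisClass

namespace RelGCWComplex

open Opposite

variable {G : Type u} [Group G] {X : Type u} [TopologicalSpace X] [MulAction G X] {D : Set X}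
  (c : RelGCWComplex G X D)

/-- The basis of the cellular chains of the fixed points that is given by the fixed cells. -/
def cellBasis (H : OrbitCat G) (n : ℕ) :
    Module.Basis (c.FixedCell H.subgroup n) ℤ ((c.coeffChains.X n).obj (op H)) :=
  (c.relBasis_fixed H.subgroup fun _ => cubeGen_relGen n).basis (c.cellClass_surjective H n)
    fun _ => c.cellClass_eq_zero

lemma cellBasis_apply (H : OrbitCat G) (n : ℕ) (i : c.FixedCell H.subgroup n) :
    c.cellBasis H n i = c.cellClass H n ⟨chMap (c.char n i) n (cubeGen n),
      (c.relBasis_fixed H.subgroup fun _ => cubeGen_relGen n).mem i⟩ :=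
  RelBasis.basis_apply _ _ _ i

end RelGCWComplex

namespace ProductMap

open Opposite

variable {G : Type u} [Group G] {X Y Z : Type u} [TopologicalSpace X] [TopologicalSpace Y]
  [TopologicalSpace Z] [MulAction G X] [MulAction G Y] [MulAction G Z] {D : Set X} {E : Set Y}
  {W : Set Z} {c : RelGCWComplex G X D} {d : RelGCWComplex G Y E} (m : ProductMap c d W)
  {e : RelGCWComplex G Z W} (he : ∀ n, e.skelLT n = m.product.skelLT n)

/-- The fixed cells of the product are the products of fixed cells. -/
def fixedCellEquiv (H : Subgroup G) (n : ℕ) :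
    (Σ s : Finset.HasAntidiagonal.antidiagonal n, c.FixedCell H s.1.1 × d.FixedCell H s.1.2) ≃
      m.product.FixedCell H n where
  toFun k := ⟨(⟨k.1, k.2.1.1, k.2.2.1⟩ : PCell c d n), fun h =>
    congrArg (Sigma.mk k.1) (Prod.ext (k.2.1.2 h) (k.2.2.2 h))⟩
  invFun k := ⟨Sigma.fst (k.1 : PCell c d n),
    ⟨(Sigma.snd (k.1 : PCell c d n)).1, fun h => congrArg Prod.fst
      (eq_of_heq (Sigma.mk.inj_iff.1 (k.2 h : (⟨_, _⟩ : PCell c d n) = ⟨_, _⟩)).2)⟩,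
    ⟨(Sigma.snd (k.1 : PCell c d n)).2, fun h => congrArg Prod.snd
      (eq_of_heq (Sigma.mk.inj_iff.1 (k.2 h : (⟨_, _⟩ : PCell c d n) = ⟨_, _⟩)).2)⟩⟩
  left_inv _ := rfl
  right_inv _ := rfl

/-- The cross product of the fundamental classes of the factors of a product cell. -/
def prodGen (n : ℕ) (k : PCell c d n) : Ch (Cube n) n :=
  chCross (cubePair (antidiagonal_eq k.1)) n k.1.1.1 k.1.1.2 (cubeGen _) (cubeGen _)

lemma chMap_prodGen (n : ℕ) (k : PCell c d n) :
    chMap (m.product.char n k) n (prodGen n k) = chCross m.map n k.1.1.1 k.1.1.2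
      (chMap (c.char _ k.2.1) _ (cubeGen _)) (chMap (d.char _ k.2.2) _ (cubeGen _)) :=
  chMap_cross (f := cubePair (antidiagonal_eq k.1)) (a := c.char _ k.2.1) (b := d.char _ k.2.2)
    (c := m.product.char n k) (fun x y => (m.product_char n k _).trans
    (m.pchar_append (antidiagonal_eq k.1) k.2.1 k.2.2 x y)) n _ _ _ _

include he in
/-- The cross products of fundamental classes of cells form a basis, as cross products of generators
of the homology of cubes are generators. -/
lemma relBasis_prodGen (H : Subgroup G) (n : ℕ) :
    RelBasis (e.fixedSkelLT H (n + 1)) (e.fixedSkelLT H n) n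
      fun k : m.product.FixedCell H n => chMap (m.product.char n k) n (prodGen n k.1) := by
  have h := m.product.relBasis_fixed H (n := n)
    (g := fun k => prodGen n k.1) fun k => relGen_cross _
  have he' : ∀ n, e.fixedSkelLT H n = m.product.fixedSkelLT H n := fun n =>
    congrArg (· ∩ _) (he n)
  rwa [he', he']

/-- The basis of the cellular chains of the product that is given by the products of cells. -/
def prodBasis (H : OrbitCat G) (n : ℕ) :
    Module.Basis (m.product.FixedCell H.subgroup n) ℤ ((e.coeffChains.X n).obj (op H)) :=
  (m.relBasis_prodGen he H.subgroup n).basis (e.cellClass_surjective H n)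
    fun _ => e.cellClass_eq_zero

lemma prodBasis_apply (H : OrbitCat G) (n : ℕ) (s : Finset.HasAntidiagonal.antidiagonal n)
    (i : c.FixedCell H.subgroup s.1.1) (j : d.FixedCell H.subgroup s.1.2) :
    m.prodBasis he H n (m.fixedCellEquiv H.subgroup n ⟨s, i, j⟩) =
      m.cellCross he (antidiagonal_eq s) H (c.cellBasis H _ i) (d.cellBasis H _ j) := by
  rw [prodBasis, RelBasis.basis_apply, c.cellBasis_apply, d.cellBasis_apply, cellCross_class]
  exact congrArg (e.cellClass H n) (Subtype.ext (m.chMap_prodGen n ⟨s, i, j⟩))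

/-- The cellular chains of the product on the fixed points are the direct sum of the tensor
products of cellular chains of the factors. -/
theorem crossMap_bijective (H : OrbitCat G) (n : ℕ) : Function.Bijective
    fun t : ∀ s : Finset.HasAntidiagonal.antidiagonal n,
      (c.coeffChains.X s.1.1).obj (op H) ⊗[ℤ] (d.coeffChains.X s.1.2).obj (op H) =>
    ∑ s, tensorLift (m.cellCross he (antidiagonal_eq s) H) (t s) := by
  let T := fun s : Finset.HasAntidiagonal.antidiagonal n =>
    (c.coeffChains.X s.1.1).obj (op H) ⊗[ℤ] (d.coeffChains.X s.1.2).obj (op H)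
  let b := Pi.basis fun s : Finset.HasAntidiagonal.antidiagonal n =>
    (c.cellBasis H s.1.1).tensorProduct (d.cellBasis H s.1.2)
  let F : (∀ s : Finset.HasAntidiagonal.antidiagonal n, (c.coeffChains.X s.1.1).obj (op H) ⊗[ℤ]
      (d.coeffChains.X s.1.2).obj (op H)) →ₗ[ℤ] (e.coeffChains.X n).obj (op H) :=
    ∑ s, (tensorLift (m.cellCross he (antidiagonal_eq s) H)).toIntLinearMap ∘ₗ LinearMap.proj s
  have h : F = (b.equiv (m.prodBasis he H n) (m.fixedCellEquiv H.subgroup n)).toLinearMap := by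
    refine b.ext fun k => ?_
    obtain ⟨s, i, j⟩ := k
    refine Eq.trans ?_ (b.equiv_apply (b' := m.prodBasis he H n) ⟨s, i, j⟩
      (m.fixedCellEquiv H.subgroup n)).symm
    have hb : b ⟨s, i, j⟩ = Pi.single (M := T) s (c.cellBasis H s.1.1 i ⊗ₜ[ℤ]
        d.cellBasis H s.1.2 j) :=
      (Pi.basis_apply _ _).trans (congrArg (Pi.single (M := T) s)
        (Module.Basis.tensorProduct_apply _ _ i j))
    rw [prodBasis_apply, LinearMap.sum_apply, Finset.sum_eq_single s, hb]
    · exact congrArg (tensorLift (m.cellCross he (antidiagonal_eq s) H))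
        (Pi.single_eq_same (M := T) _ _)
    · intro s' _ hs
      rw [hb]
      refine (congrArg (tensorLift (m.cellCross he (antidiagonal_eq s') H))
        (Pi.single_eq_of_ne (M := T) hs _)).trans (map_zero _)
    · intro h
      exact absurd (Finset.mem_univ s) h
  have h2 : ∀ t, F t = ∑ s, tensorLift (m.cellCross he (antidiagonal_eq s) H) (t s) := fun t =>
    LinearMap.sum_apply _ _ _
  simp_rw [← h2, h]
  exact LinearEquiv.bijective _

end ProductMap

/-! ### The total complex -/

section TotalIso

variable {C C' : Type*} [Category* C] [Category* C'] [Preadditive C] [Preadditive C']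
  {F : C ⥤ C ⥤ C'} [F.PreservesZeroMorphisms] [∀ A, (F.obj A).PreservesZeroMorphisms]
  {K L : ChainComplex C ℕ} [HomologicalComplex.HasMapBifunctor K L F (ComplexShape.down ℕ)]
  {M : ChainComplex C' ℕ}

/-- A family of pairings `F(K_p, L_q) → M_{p+q}` which satisfy the Leibniz rule and exhibit `M_n` as
the direct sum of the `F(K_p, L_q)` identifies `M` with the total complex. -/
def totalIso (ν : ∀ {p q n : ℕ}, p + q = n → ((F.obj (K.X p)).obj (L.X q) ⟶ M.X n))
    (ρ : ∀ (n : ℕ) (s : Finset.HasAntidiagonal.antidiagonal n),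
      M.X n ⟶ (F.obj (K.X s.1.1)).obj (L.X s.1.2))
    (h_total : ∀ n, ∑ s, ρ n s ≫ ν (ProductMap.antidiagonal_eq s) = 𝟙 (M.X n))
    (h_same : ∀ n s, ν (ProductMap.antidiagonal_eq s) ≫ ρ n s = 𝟙 _)
    (h_ne : ∀ n s t, s ≠ t → ν (ProductMap.antidiagonal_eq s) ≫ ρ n t = 0)
    (hd : ∀ {p q n : ℕ} (h : p + 1 + (q + 1) = n + 1), ν h ≫ M.d (n + 1) n =
      (F.map (K.d (p + 1) p)).app (L.X (q + 1)) ≫ ν (by omega) +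
        (-1 : ℤ) ^ (p + 1) • ((F.obj (K.X (p + 1))).map (L.d (q + 1) q) ≫ ν (by omega)))
    (hd_right : ∀ {p n : ℕ} (h : p + 1 + 0 = n + 1), ν h ≫ M.d (n + 1) n =
      (F.map (K.d (p + 1) p)).app (L.X 0) ≫ ν (by omega))
    (hd_left : ∀ {q n : ℕ} (h : 0 + (q + 1) = n + 1), ν h ≫ M.d (n + 1) n =
      (F.obj (K.X 0)).map (L.d (q + 1) q) ≫ ν (by omega)) :
    HomologicalComplex.mapBifunctor K L F (ComplexShape.down ℕ) ≅ M :=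
  HomologicalComplex.Hom.isoOfComponents (fun n =>
    { hom := HomologicalComplex.mapBifunctorDesc fun p q h => ν h
      inv := ∑ s, ρ n s ≫ HomologicalComplex.ιMapBifunctor K L F (ComplexShape.down ℕ) s.1.1 s.1.2 n
        (ProductMap.antidiagonal_eq s)
      hom_inv_id := by
        refine HomologicalComplex.mapBifunctor.hom_ext fun p q h => ?_
        rw [HomologicalComplex.ι_mapBifunctorDesc_assoc, Preadditive.comp_sum, Category.comp_id]
        have hpq : p + q = n := h
        let s : Finset.HasAntidiagonal.antidiagonal n :=
          ⟨(p, q), Finset.HasAntidiagonal.mem_antidiagonal.2 hpq⟩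
        rw [Finset.sum_eq_single s]
        · exact (Category.assoc _ _ _).symm.trans ((congrArg (· ≫ _) (h_same n s)).trans
            (Category.id_comp _))
        · intro t _ ht
          exact (Category.assoc _ _ _).symm.trans ((congrArg (· ≫ _) (h_ne n s t ht.symm)).trans
            zero_comp)
        · intro hs
          exact absurd (Finset.mem_univ s) hs
      inv_hom_id := by
        rw [Preadditive.sum_comp]
        refine Eq.trans (Finset.sum_congr rfl fun s _ => ?_) (h_total n)
        rw [Category.assoc, HomologicalComplex.ι_mapBifunctorDesc] })
    fun i n hn => by
      obtain rfl : n + 1 = i := hn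
      refine HomologicalComplex.mapBifunctor.hom_ext fun p q h => ?_
      have hpq : p + q = n + 1 := h
      dsimp only
      rw [HomologicalComplex.ι_mapBifunctorDesc_assoc, HomologicalComplex.mapBifunctor.d_eq,
        Preadditive.add_comp, Preadditive.comp_add, HomologicalComplex.mapBifunctor.ι_D₁_assoc,
        HomologicalComplex.mapBifunctor.ι_D₂_assoc]
      have h1 : ∀ (p : ℕ) (h : p + 1 + q = n + 1),
          HomologicalComplex.mapBifunctor.d₁ K L F (ComplexShape.down ℕ) (p + 1) q n ≫
            HomologicalComplex.mapBifunctorDesc (fun p q h => ν h) =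
          (F.map (K.d (p + 1) p)).app (L.X q) ≫ ν (show p + q = n by omega) := fun p h => by
        rw [HomologicalComplex.mapBifunctor.d₁_eq K L F (ComplexShape.down ℕ) (i₁ := p + 1)
          (i₁' := p) rfl q n (show p + q = n by omega)]
        refine (congrArg (· ≫ _) (one_smul ℤˣ _)).trans ?_
        rw [Category.assoc, HomologicalComplex.ι_mapBifunctorDesc]
      have h2 : ∀ (q : ℕ) (h : p + (q + 1) = n + 1),
          HomologicalComplex.mapBifunctor.d₂ K L F (ComplexShape.down ℕ) p (q + 1) n ≫
            HomologicalComplex.mapBifunctorDesc (fun p q h => ν h) =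
          (-1 : ℤ) ^ p • ((F.obj (K.X p)).map (L.d (q + 1) q) ≫
            ν (show p + q = n by omega)) := fun q h => by
        rw [HomologicalComplex.mapBifunctor.d₂_eq K L F (ComplexShape.down ℕ) p (i₂ := q + 1)
          (i₂' := q) rfl n (show p + q = n by omega)]
        have he : ComplexShape.ε₂ (ComplexShape.down ℕ) (ComplexShape.down ℕ)
          (ComplexShape.down ℕ) (p, q + 1) = (-1 : ℤˣ) ^ p := rfl
        rw [he, Linear.units_smul_comp, Category.assoc, HomologicalComplex.ι_mapBifunctorDesc,
          Units.smul_def]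
        push_cast
        rfl
      have h1' : p = 0 → HomologicalComplex.mapBifunctor.d₁ K L F (ComplexShape.down ℕ) p q n = 0 :=
        fun hp => HomologicalComplex.mapBifunctor.d₁_eq_zero K L F (ComplexShape.down ℕ) p q n
          fun (h : _ + 1 = p) => by omega
      have h2' : q = 0 → HomologicalComplex.mapBifunctor.d₂ K L F (ComplexShape.down ℕ) p q n = 0 :=
        fun hp => HomologicalComplex.mapBifunctor.d₂_eq_zero K L F (ComplexShape.down ℕ) p q n
          fun (h : _ + 1 = q) => by omega
      rcases p with - | p
      · rcases q with - | q
        · omega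
        · rw [h1' rfl, zero_comp, zero_add, h2 q hpq, hd_left hpq, pow_zero, one_smul]
      · rcases q with - | q
        · rw [h2' rfl, zero_comp, add_zero, h1 p hpq, hd_right hpq]
        · rw [h1 p hpq, h2 q hpq, hd hpq]

end TotalIso

/-! ### The isomorphism of chain complexes -/

section Splitting

variable {C : Type*} [Category* C] {ι : Type*} [Fintype ι] {T : ι → C ⥤ AddCommGrpCat.{w₁}}
  {E : C ⥤ AddCommGrpCat.{w₁}}

/-- A pointwise direct sum decomposition of a functor has natural projections. -/
lemma exists_projections (μ : ∀ s, T s ⟶ E) (hμ : ∀ H, Function.Bijective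
    fun t : ∀ s, (T s).obj H => ∑ s, (μ s).app H (t s)) :
    ∃ r : ∀ s, E ⟶ T s, ∑ s, r s ≫ μ s = 𝟙 E ∧ (∀ s, μ s ≫ r s = 𝟙 _) ∧
      ∀ s t, s ≠ t → μ s ≫ r t = 0 := by
  classical
  let F (H : C) : (∀ s, (T s).obj H) →+ E.obj H :=
    AddMonoidHom.mk' (fun t => ∑ s, (μ s).app H (t s)) fun t t' => by
      rw [← Finset.sum_add_distrib]
      exact Finset.sum_congr rfl fun s _ => map_add _ _ _
  let e (H : C) : (∀ s, (T s).obj H) ≃+ E.obj H := AddEquiv.ofBijective (F H) (hμ H)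
  have hmap : ∀ {H K : C} (f : H ⟶ K) (t : ∀ s, (T s).obj H),
      E.map f (e H t) = e K fun s => (T s).map f (t s) := fun f t =>
    (map_sum _ _ _).trans (Finset.sum_congr rfl fun s _ =>
      (NatTrans.naturality_apply (μ s) f (t s)).symm)
  have hsing : ∀ (H : C) (s : ι) (x : (T s).obj H), e H (Pi.single s x) = (μ s).app H x := by
    intro H s x
    refine (Finset.sum_eq_single s (fun s' _ hs => ?_)
      fun h => absurd (Finset.mem_univ s) h).trans ?_
    · exact (congrArg _ (Pi.single_eq_of_ne (M := fun s => (T s).obj H) hs x)).trans (map_zero _)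
    · exact congrArg _ (Pi.single_eq_same (M := fun s => (T s).obj H) s x)
  refine ⟨fun s =>
    { app := fun H => AddCommGrpCat.ofHom ((Pi.evalAddMonoidHom _ s).comp (e H).symm.toAddMonoidHom)
      naturality := fun H K f => by
        ext x
        obtain ⟨t, rfl⟩ := (e H).surjective x
        change (e K).symm (E.map f (e H t)) s = (T s).map f ((e H).symm (e H t) s)
        rw [hmap, AddEquiv.symm_apply_apply, AddEquiv.symm_apply_apply] }, ?_, fun s => ?_,
      fun s t hst => ?_⟩
  · ext H x
    refine (map_sum (AddMonoidHom.mk' (fun φ : E ⟶ E => φ.app H x) fun _ _ => rfl) _ _).trans ?_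
    exact (e H).apply_symm_apply x
  · ext H x
    change (e H).symm ((μ s).app H x) s = x
    rw [← hsing, AddEquiv.symm_apply_apply]
    exact Pi.single_eq_same (M := fun s => (T s).obj H) s x
  · ext H x
    change (e H).symm ((μ s).app H x) t = 0
    rw [← hsing, AddEquiv.symm_apply_apply]
    exact Pi.single_eq_of_ne (M := fun s => (T s).obj H) hst.symm x

end Splitting

section LanBoxNatural

variable {G : Type u} [Group G] [Finite G] {A A' B B' C C' : CoeffSystem G}

/-- The map from a box product of Kan extensions that is defined by a map from the pointwise tensor
product. -/
def boxDesc (μ : pointTensor A B ⟶ C) :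
    ((box G).obj ((coeffToMackey G).obj A)).obj ((coeffToMackey G).obj B) ⟶
      (coeffToMackey G).obj C :=
  (lanBoxIso A B).inv ≫ (coeffToMackey G).map μ

lemma boxDesc_comp (μ : pointTensor A B ⟶ C) (f : C ⟶ C') :
    boxDesc μ ≫ (coeffToMackey G).map f = boxDesc (μ ≫ f) := by
  rw [boxDesc, boxDesc, Functor.map_comp, Category.assoc]

lemma boxDesc_add (μ ν : pointTensor A B ⟶ C) : boxDesc (μ + ν) = boxDesc μ + boxDesc ν := by
  rw [boxDesc, Functor.map_add, Preadditive.comp_add]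
  rfl

lemma boxDesc_zsmul (k : ℤ) (μ : pointTensor A B ⟶ C) : boxDesc (k • μ) = k • boxDesc μ := by
  rw [boxDesc, Functor.map_zsmul, Preadditive.comp_zsmul]
  rfl

lemma boxDesc_left (α : A ⟶ A') (μ : pointTensor A' B ⟶ C) :
    boxDesc (pointTensorMap α (𝟙 B) ≫ μ) =
      ((box G).map ((coeffToMackey G).map α)).app ((coeffToMackey G).obj B) ≫ boxDesc μ := by
  have h : ((box G).map ((coeffToMackey G).map α)).app ((coeffToMackey G).obj B) ≫
      (lanBoxIso A' B).inv =
      (lanBoxIso A B).inv ≫ (coeffToMackey G).map (pointTensorMap α (𝟙 B)) := by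
    rw [Iso.comp_inv_eq, Category.assoc, lanBoxIso_natural, Iso.inv_hom_id_assoc,
      (coeffToMackey G).map_id, CategoryTheory.Functor.map_id, Category.comp_id]
  rw [boxDesc, boxDesc, Functor.map_comp, ← Category.assoc, ← h, Category.assoc]

lemma boxDesc_right (β : B ⟶ B') (μ : pointTensor A B' ⟶ C) :
    boxDesc (pointTensorMap (𝟙 A) β ≫ μ) =
      ((box G).obj ((coeffToMackey G).obj A)).map ((coeffToMackey G).map β) ≫ boxDesc μ := by
  have h : ((box G).obj ((coeffToMackey G).obj A)).map ((coeffToMackey G).map β) ≫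
      (lanBoxIso A B').inv =
      (lanBoxIso A B).inv ≫ (coeffToMackey G).map (pointTensorMap (𝟙 A) β) := by
    rw [Iso.comp_inv_eq, Category.assoc, lanBoxIso_natural, Iso.inv_hom_id_assoc,
      (coeffToMackey G).map_id, CategoryTheory.Functor.map_id, NatTrans.id_app, Category.id_comp]
  rw [boxDesc, boxDesc, Functor.map_comp, ← Category.assoc, ← h, Category.assoc]

lemma comp_boxDesc (ρ : C' ⟶ pointTensor A B) (μ : pointTensor A B ⟶ C) :
    ((coeffToMackey G).map ρ ≫ (lanBoxIso A B).hom) ≫ boxDesc μ =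
      (coeffToMackey G).map (ρ ≫ μ) := by
  rw [boxDesc, Category.assoc, Iso.hom_inv_id_assoc, Functor.map_comp]

lemma boxDesc_comp_lanBoxIso (μ : pointTensor A B ⟶ C) (ρ : C ⟶ pointTensor A' B') :
    boxDesc μ ≫ (coeffToMackey G).map ρ ≫ (lanBoxIso A' B').hom =
      (lanBoxIso A B).inv ≫ (coeffToMackey G).map (μ ≫ ρ) ≫ (lanBoxIso A' B').hom := by
  rw [boxDesc, Functor.map_comp, Category.assoc, Category.assoc]

end LanBoxNatural

namespace ProductMap

open Opposite

variable {G : Type u} [Group G] [Finite G] {X Y Z : Type u} [TopologicalSpace X]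
  [TopologicalSpace Y] [TopologicalSpace Z] [MulAction G X] [MulAction G Y] [MulAction G Z]
  {D : Set X} {E : Set Y} {W : Set Z} {c : RelGCWComplex G X D} {d : RelGCWComplex G Y E}
  (m : ProductMap c d W) {e : RelGCWComplex G Z W} (he : ∀ n, e.skelLT n = m.product.skelLT n)

include he in
/-- The cellular chain complex of Mackey functors of a product is the box product of those of the
factors. -/
theorem nonempty_mackeyChains_iso :
    Nonempty (e.mackeyChains ≅ boxComplex c.mackeyChains d.mackeyChains) := by
  choose r hr1 hr2 hr3 using fun n => exists_projections
    (fun s : Finset.HasAntidiagonal.antidiagonal n => m.crossMap he (antidiagonal_eq s))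
    fun H => m.crossMap_bijective he H.unop n
  refine ⟨(totalIso (F := box G) (K := c.mackeyChains) (L := d.mackeyChains) (M := e.mackeyChains)
    (fun h => boxDesc (m.crossMap he h))
    (fun n s => (coeffToMackey G).map (r n s) ≫ (lanBoxIso _ _).hom) (fun n => ?_) (fun n s => ?_)
    (fun n s t hst => ?_) (fun h => ?_) (fun h => ?_) fun h => ?_).symm⟩
  · refine Eq.trans (Finset.sum_congr rfl fun s _ => comp_boxDesc _ _) ?_
    exact ((coeffToMackey G).map_sum (f := fun s => r n s ≫ m.crossMap he (antidiagonal_eq s))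
      (s := Finset.univ)).symm.trans ((congrArg _ (hr1 n)).trans ((coeffToMackey G).map_id _))
  · refine (boxDesc_comp_lanBoxIso _ _).trans ?_
    rw [hr2, CategoryTheory.Functor.map_id, Category.id_comp]
    exact Iso.inv_hom_id _
  · refine (boxDesc_comp_lanBoxIso _ _).trans ?_
    rw [hr3 n s t hst, Functor.map_zero, zero_comp, comp_zero]
    rfl
  · exact (boxDesc_comp _ _).trans ((congrArg boxDesc (m.crossMap_d he h)).trans
      ((boxDesc_add _ _).trans (congrArg₂ (· + ·) (boxDesc_left _ _)
        ((boxDesc_zsmul _ _).trans (congrArg _ (boxDesc_right _ _))))))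
  · exact (boxDesc_comp _ _).trans ((congrArg boxDesc (m.crossMap_d_zero_right he h)).trans
      (boxDesc_left _ _))
  · exact (boxDesc_comp _ _).trans ((congrArg boxDesc (m.crossMap_d_zero_left he h)).trans
      (boxDesc_right _ _))

end ProductMap

section MainResult

variable {G : Type u} [Group G] {X : Type u} [TopologicalSpace X] [MulAction G X] {D : Set X}

lemma RelGCWComplex.skelLT_zero (c : RelGCWComplex G X D) : c.skelLT 0 = D := by
  ext x
  rw [c.mem_skelLT]
  exact ⟨fun h => h.elim id fun ⟨_, h, _⟩ => absurd h (Nat.not_lt_zero _), Or.inl⟩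

lemma RelGCWComplex.skelLT_eq {c d : RelGCWComplex G X D}
    (h : ∀ n, c.skelLT (n + 1) = d.skelLT (n + 1)) : ∀ n, c.skelLT n = d.skelLT n
  | 0 => c.skelLT_zero.trans d.skelLT_zero.symm
  | n + 1 => h n

end MainResult

end MackeyChains

end

theorem mainTheorem7 {G : Type u} [Group G] [Finite G] {X Y : Type u} [TopologicalSpace X]
    [TopologicalSpace Y] [MulAction G X] [MulAction G Y] :
    (∀ (c : MackeyChains.GCWComplex G X) (d : MackeyChains.GCWComplex G Y),
      (∃ e : MackeyChains.GCWComplex G (MackeyChains.KProd X Y),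
        MackeyChains.IsProductStructure c d e) ∧
      ∀ e : MackeyChains.GCWComplex G (MackeyChains.KProd X Y),
        MackeyChains.IsProductStructure c d e →
        Nonempty (MackeyChains.GCWComplex.mackeyComplex e ≅
          MackeyChains.boxComplex (MackeyChains.GCWComplex.mackeyComplex c)
            (MackeyChains.GCWComplex.mackeyComplex d))) ∧
    (∀ (x₀ : MulAction.fixedPoints G X) (y₀ : MulAction.fixedPoints G Y)
      (c : MackeyChains.BasedGCWComplex G X x₀) (d : MackeyChains.BasedGCWComplex G Y y₀),
      (∃ e : MackeyChains.BasedGCWComplex G (MackeyChains.Smash x₀ y₀)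
          (MackeyChains.Smash.basePoint x₀ y₀),
        MackeyChains.IsSmashStructure c d e) ∧
      ∀ e : MackeyChains.BasedGCWComplex G (MackeyChains.Smash x₀ y₀)
          (MackeyChains.Smash.basePoint x₀ y₀),
        MackeyChains.IsSmashStructure c d e →
        Nonempty (MackeyChains.BasedGCWComplex.reducedMackeyComplex e ≅
          MackeyChains.boxComplex (MackeyChains.BasedGCWComplex.reducedMackeyComplex c)
            (MackeyChains.BasedGCWComplex.reducedMackeyComplex d))) := by
  refine ⟨fun c d => ⟨⟨_, MackeyChains.kprodProduct_isProductStructure c d⟩, fun e he => ?_⟩,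
    fun x₀ y₀ c d => ⟨⟨_, MackeyChains.smashProduct_isSmashStructure c d⟩, fun e he => ?_⟩⟩
  · exact (MackeyChains.kprodProduct c d).nonempty_mackeyChains_iso
      (MackeyChains.RelGCWComplex.skelLT_eq fun n =>
        (he n).trans (MackeyChains.kprodProduct_isProductStructure c d n).symm)
  · exact (MackeyChains.smashProduct c d).nonempty_mackeyChains_iso
      (MackeyChains.RelGCWComplex.skelLT_eq fun n =>
        (he n).trans (MackeyChains.smashProduct_isSmashStructure c d n).symm)
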